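/- Let $1\le d\le 5$, $d':=\max(3,d)$, let $S:=(\mathbb R/\mathbb Z)^{d-1}\times\mathbb R$ with points $x=(x',z)$, and $G(s):=\frac{(1-s^2)^2}{4}$. For $a\in\mathbb R$ let $v_a(x',z):=\tanh\big(\frac{z-a}{\sqrt2}\big)$. For $w:S\to\mathbb R$ set $$\mathcal E(w):=\int_S \tfrac12|\nabla w|^2+G(w)\,dx-\int_{-1}^1\sqrt{2G(s)}\,ds,\qquad D(w):=\int_S|\nabla(\Delta w-G'(w))|^2\,dx,$$ $$H(w):=\inf\Big\{\int_S|F|^2\,dx\;:\;F\in L^2(S;\mathbb R^d),\ \operatorname{div}F=w-v_0 \text{ in the sense of distributions}\Big\},$$ with $\inf\emptyset=+\infty$. There exist universal constants $\bar\delta>0$ and $C>0$ such that the following holds. Let $T>0$ and let $u=u(t,x)$ be a smooth solution of $u_t-\Delta(G'(u)-\Delta u)=0$ on $(0,T)\times S$. For every $t\in(0,T)$ let $c(t)\in\mathbb R$ be a minimizer of $a\mapsto\|u(t)-v_a\|_{L^2(S)}$, and suppose that $H(u(t))<\infty$, $\mathcal E(u(t))<\infty$, $u(t)-v_{c(t)}\in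 H^3(S)$ and $\|u(t)-v_{c(t)}\|_{L^\infty(S)}\le\bar\delta$. Then, for every $t\in(0,T)$, $D(u(t))<\infty$, the functions $\mathcal E(u(\cdot))$, $H(u(\cdot))$ and $D(u(\cdot))$ are differentiable at $t$, and, writing $\mathcal E,H,D,c$ for their values at time $t$, $$\frac{d\mathcal E}{dt}=-D,$$ $$\frac{dH}{dt}\le C\Big(\big((|c|+1)c^2D\big)^{1/2}+\mathcal E^{\frac32-\frac{d'}{12}}D^{\frac{d'}{12}}\Big),$$ $$\frac{dD}{dt}\le C\Big(D^{3/2}+\mathcal E^{1-\frac{d'}{6}}D^{1+\frac{d'}{6}}\Big).$$ -/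

import Mathlib

open MeasureTheory Set
open scoped ENNReal ContDiff Gradient Laplacian

noncomputable section

namespace CahnHilliard

/-- `ℝ^d` with `d = n + 1`. A point is `x = (x', z)`, where `x'` consists of the first `n`
coordinates and `z` is the last one. Functions on the strip `S = (ℝ/ℤ)^n × ℝ` are the functions
on `ℝ^d` that are `1`-periodic in each of the coordinates of `x'`. -/
abbrev Space (n : ℕ) : Type := EuclideanSpace ℝ (Fin (n + 1))

/-- The coordinate `z` along the strip. -/
def zCoord {n : ℕ} (x : Space n) : ℝ := x (Fin.last n)

/-- `w` is `1`-periodic in every coordinate of `x'`, that is, `w` is a function on the strip. -/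
def IsPeriodic {n : ℕ} (w : Space n → ℝ) : Prop :=
  ∀ (i : Fin n) (x : Space n), w (x + EuclideanSpace.single i.castSucc (1 : ℝ)) = w x

/-- The fundamental cell `[0,1)^n × ℝ` of the strip. -/
def cell (n : ℕ) : Set (Space n) := {x | ∀ i : Fin n, x i.castSucc ∈ Ico (0 : ℝ) 1}

/-- Lebesgue measure on the strip, carried by the fundamental cell: `∫_S w dx` is
`∫ x, w x ∂(stripMeasure n)`. -/
def stripMeasure (n : ℕ) : Measure (Space n) := volume.restrict (cell n)

/-- The double well potential `G(s) = (1 - s²)² / 4`. -/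
def doubleWell (s : ℝ) : ℝ := (1 - s ^ 2) ^ 2 / 4

/-- The kink `v_a(x', z) = tanh ((z - a) / √2)`. -/
def kink (n : ℕ) (a : ℝ) (x : Space n) : ℝ := Real.tanh ((zCoord x - a) / √2)

/-- The energy `E(w) = ∫_S ½ |∇w|² + G(w) dx`, with values in `[0, ∞]`. -/
def energy {n : ℕ} (w : Space n → ℝ) : ℝ≥0∞ :=
  ∫⁻ x, ENNReal.ofReal (1 / 2 * ‖∇ w x‖ ^ 2 + doubleWell (w x)) ∂(stripMeasure n)

/-- The energy `m₀ = ∫_{-1}^{1} √(2 G(s)) ds` of a kink. -/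
def kinkEnergy : ℝ := ∫ s in (-1 : ℝ)..1, √(2 * doubleWell s)

/-- The energy gap `E(w) - m₀`, for functions with `E(w) < ∞`. -/
def energyGap {n : ℕ} (w : Space n → ℝ) : ℝ := (energy w).toReal - kinkEnergy

/-- The dissipation `D(w) = ∫_S |∇(Δw - G'(w))|² dx`, with values in `[0, ∞]`. -/
def dissipation {n : ℕ} (w : Space n → ℝ) : ℝ≥0∞ :=
  ∫⁻ x, ‖∇ (fun y => (Δ w) y - deriv doubleWell (w y)) x‖ₑ ^ 2 ∂(stripMeasure n)

/-- Test functions on the strip: smooth, and supported in a bounded range of `z`. -/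
structure IsTestFunction {n : ℕ} (φ : Space n → ℝ) : Prop where
  smooth : ContDiff ℝ ∞ φ
  periodic : IsPeriodic φ
  boundedSupport : ∃ R : ℝ, ∀ x, R < |zCoord x| → φ x = 0

/-- `div F = f` on the strip in the sense of distributions. As the test functions are periodic,
this includes the absence of jumps of the normal components of `F` across the faces of the cell. -/
def HasWeakDiv {n : ℕ} (F : Space n → Space n) (f : Space n → ℝ) : Prop :=
  ∀ φ : Space n → ℝ, IsTestFunction φ →
    ∫ x, inner ℝ (F x) (∇ φ x) ∂(stripMeasure n) = -∫ x, f x * φ x ∂(stripMeasure n)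

/-- The squared distance `H(w) = inf {∫_S |F|² dx : F ∈ L²(S), div F = w - v₀}`, with values in
`[0, ∞]`; the infimum of the empty set is `∞`. -/
def sqDist {n : ℕ} (w : Space n → ℝ) : ℝ≥0∞ :=
  ⨅ (F : Space n → Space n)
    (_ : MemLp F 2 (stripMeasure n) ∧ HasWeakDiv F (fun x => w x - kink n 0 x)),
    ∫⁻ x, ‖F x‖ₑ ^ 2 ∂(stripMeasure n)

/-- Membership in the Sobolev space `H^k(S)` of a smooth function `f` on the strip: all its
derivatives up to order `k` (which are its weak derivatives) are in `L²(S)`. -/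
def SmoothMemSobolev {n : ℕ} (k : ℕ) (f : Space n → ℝ) : Prop :=
  ∀ j ≤ k, MemLp (iteratedFDeriv ℝ j f) 2 (stripMeasure n)

/-- `v_a` is an `L²(S)`-closest kink to `w`. -/
def IsClosestKink {n : ℕ} (w : Space n → ℝ) (a : ℝ) : Prop :=
  ∀ b : ℝ, eLpNorm (fun x => w x - kink n a x) 2 (stripMeasure n) ≤
    eLpNorm (fun x => w x - kink n b x) 2 (stripMeasure n)

/-- `u = u(t, x)` is a smooth solution of `u_t - Δ(G'(u) - Δu) = 0` on `(0, T) × S`. -/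
structure IsSmoothSolution {n : ℕ} (T : ℝ) (u : ℝ → Space n → ℝ) : Prop where
  smooth : ContDiffOn ℝ ∞ (fun p : ℝ × Space n => u p.1 p.2) (Ioo 0 T ×ˢ univ)
  periodic : ∀ t ∈ Ioo 0 T, IsPeriodic (u t)
  equation : ∀ t ∈ Ioo 0 T, ∀ x : Space n,
    deriv (fun s => u s x) t - (Δ (fun y => deriv doubleWell (u t y) - (Δ (u t)) y)) x = 0

end CahnHilliard

end

noncomputable section

namespace CahnHilliard

/-! ### Partial derivatives and smooth functions on the strip -/

variable {n : ℕ}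

/-! Write μ = G'(u) - Δu, so that u_t = Δμ and D = ∫|∇μ|², and let f = u - v_c, ψ = ∂_z v_c. The
proof has two halves: qualitative regularity, which makes the formal identities for the three
derivatives true, and quantitative estimates at one fixed time. Since f is uniformly small, all
terms of higher order in f are absorbed by quadratic ones. What is really shown is dH/dt ≤
C((|c|+1)c²D)^{1/2} and dD/dt ≤ C D^{3/2}; the terms mixing ℰ and D enter only through their sign,
that is, through ℰ ≥ 0.

Regularity. No hypothesis is uniform in time, so every estimate is localized by a cutoff in z and
the cutoff is then removed. One energy estimate for a_t = -Δ²a + h + Δg with |g| ≤ M|a| and |h| ≤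
M|Δa| (`energy_estimate`) is applied in turn to u - v_0, to μ and to u_t. The second variation Q =
∫|∇u_t|² + G''(u)u_t² satisfies dD/dt = -2Q and dQ/dt = -2∫|∇μ_t|² + 6∫u u_t³. The cubic term is
integrable in space-time by a Sobolev inequality, which is one place where d ≤ 5 enters
(`lintegral_rpow_le`). The flux of the balance law for Q is absorbed by |∇μ_t|² (`second_flux_le`).
Hence Q is continuous in time, D is continuously differentiable, and dℰ/dt = -D.

The distance. The time integral of ∇μ over [s,t] translates the competitors for H(u(s)) onto those
for H(u(t)). Its inner product with a competitor is the same for all competitors, because the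
divergence may be tested with μ ∈ H¹. So the infimum changes by an explicit amount
(`sqDist_translate`), no minimizer is needed, and dH/dt = -2∫(u - v_0)μ (`Flow.hasDerivAt_sqDist`).

Linear analysis. Minimality of c makes f orthogonal to ψ. The operator L = -Δ + G''(v_c) annihilates
ψ and has a spectral gap on its orthogonal complement (`spectral_gap`): substituting g = ψh turns
the form of L into ∫ψ²|∇h|², and a weighted Poincaré inequality applies. As μ = Lf plus terms
quadratic in f, a weighted version of this argument gives ∫ψf² ≤ C D
(`NearKink.integral_slope_mul_sq_le`); the weight is needed because D controls only the gradient of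
μ on an unbounded strip.

Conclusion. In -2∫(u - v_0)μ the part with f has a good sign. The part with v_c - v_0 is integrated
by parts against a square integrable primitive, and the leftover c∫ψμ is quadratic in f
(`NearKink.neg_pairing_le`). In -2Q one splits u_t = αψ + g with g ⊥ ψ: g is controlled by the gap,
α² ≤ 4D, and what remains is α²∫|f|ψ² ≤ C D^{3/2} (`NearKink.neg_secondDensity_le`). -/

/-- The partial derivative in the direction of the `i`-th coordinate. -/
def pd (i : Fin (n + 1)) (g : Space n → ℝ) : Space n → ℝ :=
  fun x => fderiv ℝ g x (EuclideanSpace.single i (1 : ℝ))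

/-- The Laplacian as a sum of second partial derivatives. -/
def lap (g : Space n → ℝ) : Space n → ℝ := fun x => ∑ i, pd i (pd i g) x

/-- The squared norm of the gradient. -/
def gradSq (g : Space n → ℝ) : Space n → ℝ := fun x => ∑ i, pd i g x ^ 2

/-- The derivative in the direction of the strip. -/
def pz (g : Space n → ℝ) : Space n → ℝ := pd (Fin.last n) g

/-- Smooth functions on the strip. -/
structure SP (g : Space n → ℝ) : Prop where
  smooth : ContDiff ℝ ∞ g
  periodic : IsPeriodic g

theorem IsTestFunction.sp {g : Space n → ℝ} (h : IsTestFunction g) : SP g := ⟨h.smooth, h.periodic⟩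

theorem SP.diff {g : Space n → ℝ} (h : SP g) (x : Space n) : DifferentiableAt ℝ g x :=
  (h.smooth.differentiable (by simp)) x

theorem SP.continuous {g : Space n → ℝ} (h : SP g) : Continuous g := h.smooth.continuous

theorem contDiff_pd {g : Space n → ℝ} (h : ContDiff ℝ ∞ g) (i : Fin (n + 1)) :
    ContDiff ℝ ∞ (pd i g) := by
  have h1 : ContDiff ℝ ∞ (fderiv ℝ g) := h.fderiv_right (by simp)
  exact h1.clm_apply contDiff_const

theorem IsPeriodic.pd {g : Space n → ℝ} (h : IsPeriodic g) (i : Fin (n + 1)) :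
    IsPeriodic (pd i g) := by
  intro j x
  have h1 : (fun y => g (y + EuclideanSpace.single j.castSucc (1 : ℝ))) = g := by
    ext y; exact h j y
  have h2 := fderiv_comp_add_right (𝕜 := ℝ) (f := g) (x := x)
    (EuclideanSpace.single j.castSucc (1 : ℝ))
  rw [h1] at h2
  simp only [CahnHilliard.pd, h2]

theorem SP.pd {g : Space n → ℝ} (h : SP g) (i : Fin (n + 1)) : SP (pd i g) :=
  ⟨contDiff_pd h.smooth i, h.periodic.pd i⟩

theorem SP.pz {g : Space n → ℝ} (h : SP g) : SP (pz g) := h.pd _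

theorem SP.const (c : ℝ) : SP (fun _ : Space n => c) := ⟨contDiff_const, fun _ _ => rfl⟩

theorem SP.add {f g : Space n → ℝ} (hf : SP f) (hg : SP g) : SP (fun x => f x + g x) :=
  ⟨hf.smooth.add hg.smooth, fun i x => by rw [hf.periodic, hg.periodic]⟩

theorem SP.sub {f g : Space n → ℝ} (hf : SP f) (hg : SP g) : SP (fun x => f x - g x) :=
  ⟨hf.smooth.sub hg.smooth, fun i x => by rw [hf.periodic, hg.periodic]⟩

theorem SP.mul {f g : Space n → ℝ} (hf : SP f) (hg : SP g) : SP (fun x => f x * g x) :=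
  ⟨hf.smooth.mul hg.smooth, fun i x => by rw [hf.periodic, hg.periodic]⟩

theorem SP.neg {f : Space n → ℝ} (hf : SP f) : SP (fun x => - f x) :=
  ⟨hf.smooth.neg, fun i x => by rw [hf.periodic]⟩

theorem SP.pow {f : Space n → ℝ} (hf : SP f) (k : ℕ) : SP (fun x => f x ^ k) :=
  ⟨hf.smooth.pow k, fun i x => by rw [hf.periodic]⟩

theorem SP.const_mul {f : Space n → ℝ} (hf : SP f) (c : ℝ) : SP (fun x => c * f x) :=
  (SP.const c).mul hf

theorem SP.sum {ι : Type*} {s : Finset ι} {f : ι → Space n → ℝ} (hf : ∀ i, SP (f i)) :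
    SP (fun x => ∑ i ∈ s, f i x) :=
  ⟨ContDiff.sum fun i _ => (hf i).smooth,
    fun j x => Finset.sum_congr rfl fun i _ => (hf i).periodic j x⟩

theorem SP.lap {g : Space n → ℝ} (h : SP g) : SP (lap g) := SP.sum fun i => (h.pd i).pd i

theorem SP.gradSq {g : Space n → ℝ} (h : SP g) : SP (gradSq g) := SP.sum fun i => (h.pd i).pow 2

section rules
variable {f g : Space n → ℝ} (i : Fin (n + 1))

theorem pd_const (c : ℝ) : pd i (fun _ : Space n => c) = fun _ => 0 := by
  ext x; simp [pd]

theorem pd_add (hf : SP f) (hg : SP g) : pd i (fun x => f x + g x) = fun x => pd i f x + pd i g x := by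
  ext x; simp [pd, fderiv_fun_add (hf.diff x) (hg.diff x)]

theorem pd_sub (hf : SP f) (hg : SP g) : pd i (fun x => f x - g x) = fun x => pd i f x - pd i g x := by
  ext x; simp [pd, fderiv_fun_sub (hf.diff x) (hg.diff x)]

theorem pd_neg : pd i (fun x => - f x) = fun x => - pd i f x := by
  ext x; simp [pd, fderiv_fun_neg]

theorem pd_mul (hf : SP f) (hg : SP g) :
    pd i (fun x => f x * g x) = fun x => f x * pd i g x + pd i f x * g x := by
  ext x; simp [pd, fderiv_fun_mul (hf.diff x) (hg.diff x)]; ring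

theorem pd_const_mul (hf : SP f) (c : ℝ) : pd i (fun x => c * f x) = fun x => c * pd i f x := by
  rw [pd_mul i (SP.const c) hf]; simp [pd_const]

theorem pd_pow (hf : SP f) (k : ℕ) :
    pd i (fun x => f x ^ k) = fun x => k * f x ^ (k - 1) * pd i f x := by
  ext x; simp [pd, fderiv_fun_pow k (hf.diff x)]

theorem pd_sum {ι : Type*} {s : Finset ι} {f : ι → Space n → ℝ} (hf : ∀ i, SP (f i)) :
    pd i (fun x => ∑ j ∈ s, f j x) = fun x => ∑ j ∈ s, pd i (f j) x := by
  ext x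
  simp [pd, fderiv_fun_sum fun j _ => (hf j).diff x]

theorem pd_comm (hf : ContDiff ℝ ∞ f) (i j : Fin (n + 1)) : pd i (pd j f) = pd j (pd i f) := by
  ext x
  have h1 : ContDiff ℝ ∞ (fderiv ℝ f) := hf.fderiv_right (by simp)
  have hd : DifferentiableAt ℝ (fderiv ℝ f) x := h1.differentiable (by simp) x
  have key : ∀ k l : Fin (n + 1), pd k (pd l f) x =
      fderiv ℝ (fderiv ℝ f) x (EuclideanSpace.single k 1) (EuclideanSpace.single l 1) := by
    intro k l
    have : pd l f = fun y => fderiv ℝ f y (EuclideanSpace.single l (1 : ℝ)) := rfl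
    rw [this]; simp only [pd]
    rw [fderiv_clm_apply hd (differentiableAt_const _)]
    simp
  rw [key, key]
  exact (hf.contDiffAt.isSymmSndFDerivAt (by simpa using WithTop.coe_le_coe.2 (le_top : (2 : ℕ∞) ≤ ⊤))) _ _

theorem lap_sub (hf : SP f) (hg : SP g) : lap (fun x => f x - g x) = fun x => lap f x - lap g x := by
  ext x
  simp only [lap, pd_sub _ hf hg, pd_sub _ (hf.pd _) (hg.pd _), Finset.sum_sub_distrib]

theorem lap_mul (hf : SP f) (hg : SP g) : lap (fun x => f x * g x) =
    fun x => f x * lap g x + 2 * (∑ i, pd i f x * pd i g x) + lap f x * g x := by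
  ext x
  simp only [lap, pd_mul _ hf hg, pd_add _ (hf.mul (hg.pd _)) ((hf.pd _).mul hg),
    pd_mul _ hf (hg.pd _), pd_mul _ (hf.pd _) hg, Finset.mul_sum, Finset.sum_mul,
    ← Finset.sum_add_distrib]
  exact Finset.sum_congr rfl fun i _ => by ring

theorem pd_lap (hf : SP f) : pd i (lap f) = lap (pd i f) := by
  ext x
  unfold lap
  rw [pd_sum i fun j => (hf.pd j).pd j]
  refine Finset.sum_congr rfl fun j _ => ?_
  rw [pd_comm (hf.pd j).smooth i j, pd_comm hf.smooth i j]

end rules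

/-! ### The operators of the statement -/

theorem laplacian_eq_lap {g : Space n → ℝ} (hg : ContDiff ℝ ∞ g) : Δ g = lap g := by
  rw [InnerProductSpace.laplacian_eq_iteratedFDeriv_orthonormalBasis g
    (EuclideanSpace.basisFun (Fin (n + 1)) ℝ)]
  ext x
  refine Finset.sum_congr rfl fun i _ => ?_
  have h1 : ContDiff ℝ ∞ (fderiv ℝ g) := hg.fderiv_right (by simp)
  have hd : DifferentiableAt ℝ (fderiv ℝ g) x := h1.differentiable (by simp) x
  rw [iteratedFDeriv_two_apply]
  have : pd i g = fun y => fderiv ℝ g y (EuclideanSpace.single i (1 : ℝ)) := rfl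
  rw [this]; simp only [pd]
  rw [fderiv_clm_apply hd (differentiableAt_const _)]
  simp

theorem inner_gradient (g : Space n → ℝ) (x v : Space n) :
    inner ℝ v (∇ g x) = ∑ i, v i * pd i g x := by
  rw [real_inner_comm, inner_gradient_left]
  conv_lhs => rw [← (EuclideanSpace.basisFun (Fin (n + 1)) ℝ).sum_repr v]
  simp [pd]

theorem gradient_apply {g : Space n → ℝ} {x : Space n} (i : Fin (n + 1)) :
    (∇ g x) i = pd i g x := by
  have h := inner_gradient_left (𝕜 := ℝ) (f := g) (x := x) (y := EuclideanSpace.single i (1 : ℝ)) 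
  rw [EuclideanSpace.inner_single_right] at h
  simpa [pd] using h

theorem norm_gradient_sq (g : Space n → ℝ) (x : Space n) : ‖∇ g x‖ ^ 2 = gradSq g x := by
  rw [EuclideanSpace.norm_sq_eq]
  simp [gradSq, gradient_apply]

theorem gradSq_nonneg (g : Space n → ℝ) (x : Space n) : 0 ≤ gradSq g x :=
  Finset.sum_nonneg fun _ _ => sq_nonneg _

theorem pd_sq_le_gradSq (g : Space n → ℝ) (i : Fin (n + 1)) (x : Space n) :
    pd i g x ^ 2 ≤ gradSq g x :=
  Finset.single_le_sum (f := fun i => pd i g x ^ 2) (fun _ _ => sq_nonneg _) (Finset.mem_univ i)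

/-! ### Smooth functions of time and space -/

/-- Smooth functions of time `t ∈ (0, T)` and of a point on the strip. -/
structure ST (T : ℝ) (a : ℝ → Space n → ℝ) : Prop where
  smooth : ContDiffOn ℝ ∞ (fun p : ℝ × Space n => a p.1 p.2) (Ioo 0 T ×ˢ univ)
  periodic : ∀ t ∈ Ioo 0 T, IsPeriodic (a t)

/-- The time derivative. -/
def td (a : ℝ → Space n → ℝ) : ℝ → Space n → ℝ := fun t x => deriv (fun s => a s x) t

variable {T : ℝ} {a b : ℝ → Space n → ℝ} {t : ℝ}

theorem isOpen_timeStrip (T : ℝ) : IsOpen (Ioo 0 T ×ˢ (univ : Set (Space n))) :=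
  isOpen_Ioo.prod isOpen_univ

theorem ST.contDiffAt (h : ST T a) (ht : t ∈ Ioo 0 T) (x : Space n) :
    ContDiffAt ℝ ∞ (fun p : ℝ × Space n => a p.1 p.2) (t, x) :=
  h.smooth.contDiffAt ((isOpen_timeStrip T).mem_nhds ⟨ht, mem_univ _⟩)

theorem ST.sp (h : ST T a) (ht : t ∈ Ioo 0 T) : SP (a t) := by
  refine ⟨contDiff_iff_contDiffAt.2 fun x => ?_, h.periodic t ht⟩
  exact (h.contDiffAt ht x).comp x (contDiffAt_const.prodMk contDiffAt_id)

/-- Expressing space and time derivatives through the one joint derivative on time × space yields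
their joint smoothness. Their commutation is then the symmetry of the second joint derivative. -/
theorem ST.pd_eq (h : ST T a) (ht : t ∈ Ioo 0 T) (i : Fin (n + 1)) (x : Space n) :
    pd i (a t) x = fderiv ℝ (fun p : ℝ × Space n => a p.1 p.2) (t, x)
      (0, EuclideanSpace.single i (1 : ℝ)) := by
  have h1 := ((h.contDiffAt ht x).differentiableAt (by simp)).hasFDerivAt
  have h2 : HasFDerivAt (fun y : Space n => (t, y)) (ContinuousLinearMap.inr ℝ ℝ (Space n)) x :=
    hasFDerivAt_prodMk_right t x
  have := (HasFDerivAt.comp x h1 h2).fderiv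
  simp only [Function.comp_def] at this
  simp [pd, this]

theorem ST.hasDerivAt_eq (h : ST T a) (ht : t ∈ Ioo 0 T) (x : Space n) :
    HasDerivAt (fun s => a s x) (fderiv ℝ (fun p : ℝ × Space n => a p.1 p.2) (t, x) (1, 0)) t := by
  have h1 := ((h.contDiffAt ht x).differentiableAt (by simp)).hasFDerivAt
  have h2 : HasDerivAt (fun s : ℝ => (s, x)) ((1 : ℝ), (0 : Space n)) t :=
    (hasDerivAt_id t).prodMk (hasDerivAt_const t x)
  exact HasFDerivAt.comp_hasDerivAt t h1 h2

theorem ST.hasDerivAt (h : ST T a) (ht : t ∈ Ioo 0 T) (x : Space n) :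
    HasDerivAt (fun s => a s x) (td a t x) t :=
  (h.hasDerivAt_eq ht x).differentiableAt.hasDerivAt

theorem ST.td_eq (h : ST T a) (ht : t ∈ Ioo 0 T) (x : Space n) :
    td a t x = fderiv ℝ (fun p : ℝ × Space n => a p.1 p.2) (t, x) (1, 0) :=
  (h.hasDerivAt_eq ht x).deriv

theorem ST.contDiffOn_fderiv (h : ST T a) :
    ContDiffOn ℝ ∞ (fderiv ℝ (fun p : ℝ × Space n => a p.1 p.2)) (Ioo 0 T ×ˢ univ) :=
  h.smooth.fderiv_of_isOpen (isOpen_timeStrip T) (by simp)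

theorem ST.pd (h : ST T a) (i : Fin (n + 1)) : ST T (fun t => pd i (a t)) := by
  refine ⟨?_, fun t ht => (h.periodic t ht).pd i⟩
  refine (h.contDiffOn_fderiv.clm_apply
    (contDiffOn_const (c := ((0 : ℝ), EuclideanSpace.single i (1 : ℝ))))).congr ?_
  rintro ⟨t, x⟩ ⟨ht, -⟩
  exact h.pd_eq ht i x

theorem ST.td (h : ST T a) : ST T (td a) := by
  refine ⟨?_, fun t ht j x => ?_⟩
  · refine (h.contDiffOn_fderiv.clm_apply
      (contDiffOn_const (c := ((1 : ℝ), (0 : Space n))))).congr ?_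
    rintro ⟨t, x⟩ ⟨ht, -⟩
    exact h.td_eq ht x
  · refine Filter.EventuallyEq.deriv_eq ?_
    filter_upwards [isOpen_Ioo.mem_nhds ht] with s hs
    exact h.periodic s hs j x

theorem ST.td_pd (h : ST T a) (ht : t ∈ Ioo 0 T) (i : Fin (n + 1)) (x : Space n) :
    CahnHilliard.td (fun t => CahnHilliard.pd i (a t)) t x =
      CahnHilliard.pd i (CahnHilliard.td a t) x := by
  set A := fun p : ℝ × Space n => a p.1 p.2 with hA
  have hC : ContDiffAt ℝ ∞ A (t, x) := h.contDiffAt ht x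
  have hd : DifferentiableAt ℝ (fderiv ℝ A) (t, x) :=
    (h.contDiffOn_fderiv.contDiffAt ((isOpen_timeStrip T).mem_nhds ⟨ht, mem_univ _⟩)).differentiableAt
      (by simp)
  have hU : Ioo 0 T ×ˢ (univ : Set (Space n)) ∈ nhds (t, x) :=
    (isOpen_timeStrip T).mem_nhds ⟨ht, mem_univ _⟩
  have key : ∀ v w : ℝ × Space n, fderiv ℝ (fun p => fderiv ℝ A p v) (t, x) w =
      fderiv ℝ (fderiv ℝ A) (t, x) w v := by
    intro v w
    rw [fderiv_clm_apply hd (differentiableAt_const _)]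
    simp
  rw [(h.pd i).td_eq ht x, h.td.pd_eq ht i x]
  have e1 : (fun p : ℝ × Space n => CahnHilliard.pd i (a p.1) p.2) =ᶠ[nhds (t, x)]
      fun p => fderiv ℝ A p (0, EuclideanSpace.single i (1 : ℝ)) := by
    filter_upwards [hU] with p hp
    exact h.pd_eq hp.1 i p.2
  have e2 : (fun p : ℝ × Space n => CahnHilliard.td a p.1 p.2) =ᶠ[nhds (t, x)]
      fun p => fderiv ℝ A p (1, 0) := by
    filter_upwards [hU] with p hp
    exact h.td_eq hp.1 p.2
  rw [e1.fderiv_eq, e2.fderiv_eq, key, key]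
  exact (hC.isSymmSndFDerivAt (by simpa using WithTop.coe_le_coe.2 (le_top : (2 : ℕ∞) ≤ ⊤))) _ _

theorem ST.static {g : Space n → ℝ} (hg : SP g) : ST T (fun _ => g) :=
  ⟨hg.smooth.comp_contDiffOn contDiff_snd.contDiffOn, fun _ _ => hg.periodic⟩

theorem ST.time {φ : ℝ → ℝ} (hφ : ContDiff ℝ ∞ φ) : ST T (fun t (_ : Space n) => φ t) :=
  ⟨hφ.comp_contDiffOn contDiff_fst.contDiffOn, fun _ _ _ _ => rfl⟩

theorem ST.const (c : ℝ) : ST T (fun _ (_ : Space n) => c) := ST.static (SP.const c)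

theorem ST.add (ha : ST T a) (hb : ST T b) : ST T (fun t x => a t x + b t x) :=
  ⟨ha.smooth.add hb.smooth, fun t ht => ((ha.sp ht).add (hb.sp ht)).periodic⟩

theorem ST.sub (ha : ST T a) (hb : ST T b) : ST T (fun t x => a t x - b t x) :=
  ⟨ha.smooth.sub hb.smooth, fun t ht => ((ha.sp ht).sub (hb.sp ht)).periodic⟩

theorem ST.mul (ha : ST T a) (hb : ST T b) : ST T (fun t x => a t x * b t x) :=
  ⟨ha.smooth.mul hb.smooth, fun t ht => ((ha.sp ht).mul (hb.sp ht)).periodic⟩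

theorem ST.neg (ha : ST T a) : ST T (fun t x => - a t x) :=
  ⟨ha.smooth.neg, fun t ht => (ha.sp ht).neg.periodic⟩

theorem ST.pow (ha : ST T a) (k : ℕ) : ST T (fun t x => a t x ^ k) :=
  ⟨ha.smooth.pow k, fun t ht => ((ha.sp ht).pow k).periodic⟩

theorem ST.const_mul (ha : ST T a) (c : ℝ) : ST T (fun t x => c * a t x) := (ST.const c).mul ha

theorem ST.sum {ι : Type*} {s : Finset ι} {f : ι → ℝ → Space n → ℝ} (hf : ∀ i, ST T (f i)) :
    ST T (fun t x => ∑ i ∈ s, f i t x) :=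
  ⟨ContDiffOn.sum fun i _ => (hf i).smooth,
    fun t ht => (SP.sum (s := s) fun i => (hf i).sp ht).periodic⟩

theorem ST.lap (ha : ST T a) : ST T (fun t => lap (a t)) := ST.sum fun i => (ha.pd i).pd i

theorem ST.gradSq (ha : ST T a) : ST T (fun t => gradSq (a t)) := ST.sum fun i => (ha.pd i).pow 2

theorem ST.congr (ha : ST T a) (h : ∀ t ∈ Ioo 0 T, ∀ x, b t x = a t x) : ST T b :=
  ⟨ha.smooth.congr fun p hp => h p.1 hp.1 p.2, fun t ht i x => by
    rw [h t ht, h t ht, ha.periodic t ht]⟩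

theorem ST.td_lap (ha : ST T a) (ht : t ∈ Ioo 0 T) (x : Space n) :
    CahnHilliard.td (fun t => CahnHilliard.lap (a t)) t x = CahnHilliard.lap (CahnHilliard.td a t) x := by
  have h1 : HasDerivAt (fun s => ∑ i, CahnHilliard.pd i (CahnHilliard.pd i (a s)) x)
      (∑ i, CahnHilliard.td (fun t => CahnHilliard.pd i (CahnHilliard.pd i (a t))) t x) t :=
    HasDerivAt.fun_sum fun i _ => ((ha.pd i).pd i).hasDerivAt ht x
  have h2 : CahnHilliard.td (fun t => CahnHilliard.lap (a t)) t x =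
      ∑ i, CahnHilliard.td (fun t => CahnHilliard.pd i (CahnHilliard.pd i (a t))) t x := h1.deriv
  rw [h2]
  refine Finset.sum_congr rfl fun i _ => ?_
  rw [(ha.pd i).td_pd ht i x]
  congr 1
  ext y
  exact ha.td_pd ht i y

theorem ST.td_sub (ha : ST T a) (hb : ST T b) (ht : t ∈ Ioo 0 T) (x : Space n) :
    CahnHilliard.td (fun t x => a t x - b t x) t x =
      CahnHilliard.td a t x - CahnHilliard.td b t x :=
  ((ha.hasDerivAt ht x).sub (hb.hasDerivAt ht x)).deriv

theorem ST.td_comp {φ φ' : ℝ → ℝ} (hφ : ∀ s, HasDerivAt φ (φ' s) s) (ha : ST T a)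
    (ht : t ∈ Ioo 0 T) (x : Space n) :
    CahnHilliard.td (fun t x => φ (a t x)) t x = φ' (a t x) * CahnHilliard.td a t x :=
  ((hφ (a t x)).comp t (ha.hasDerivAt ht x)).deriv

theorem ST.td_gradSq (ha : ST T a) (ht : t ∈ Ioo 0 T) (x : Space n) :
    CahnHilliard.td (fun t => CahnHilliard.gradSq (a t)) t x =
      2 * ∑ i, CahnHilliard.pd i (a t) x * CahnHilliard.pd i (CahnHilliard.td a t) x := by
  have h1 : HasDerivAt (fun s => ∑ i, CahnHilliard.pd i (a s) x ^ 2)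
      (∑ i, 2 * CahnHilliard.pd i (a t) x ^ 1 * CahnHilliard.td (fun t => CahnHilliard.pd i (a t)) t x) t :=
    HasDerivAt.fun_sum fun i _ => by
      simpa using ((ha.pd i).hasDerivAt ht x).fun_pow 2
  have h2 := h1.deriv
  rw [Finset.mul_sum]
  refine h2.trans (Finset.sum_congr rfl fun i _ => ?_)
  rw [ha.td_pd ht i x]; ring

theorem ST.continuousOn (ha : ST T a) :
    ContinuousOn (fun p : ℝ × Space n => a p.1 p.2) (Ioo 0 T ×ˢ univ) := ha.smooth.continuousOn

/-! ### The strip as a quotient of the full space -/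

/-- The lattice of periods. -/
def lattice (n : ℕ) : (Fin n → ℤ) →+ Space n where
  toFun k := WithLp.toLp 2 (Fin.lastCases (0 : ℝ) fun j => (k j : ℝ))
  map_zero' := by
    ext i; refine Fin.lastCases ?_ (fun j => ?_) i <;> simp
  map_add' k l := by
    ext i; refine Fin.lastCases ?_ (fun j => ?_) i <;> simp

theorem lattice_castSucc (k : Fin n → ℤ) (j : Fin n) : lattice n k j.castSucc = k j := by
  simp [lattice]

theorem lattice_last (k : Fin n → ℤ) : lattice n k (Fin.last n) = 0 := by
  simp [lattice]

theorem lattice_single (j : Fin n) :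
    lattice n (Pi.single j 1) = EuclideanSpace.single j.castSucc (1 : ℝ) := by
  ext i
  refine Fin.lastCases ?_ (fun k => ?_) i
  · rw [lattice_last]; simp [(Fin.castSucc_lt_last j).ne']
  · rw [lattice_castSucc]
    by_cases h : k = j
    · subst h; simp
    · simp [h]

theorem periodic_lattice {β : Type*} {F : Space n → β}
    (hF : ∀ (i : Fin n) (x : Space n), F (x + EuclideanSpace.single i.castSucc (1 : ℝ)) = F x)
    (k : Fin n → ℤ) (x : Space n) : F (lattice n k + x) = F x := by
  have h1 : ∀ (j : Fin n) (m : ℤ) (x : Space n), F (x + lattice n (Pi.single j m)) = F x := by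
    intro j m x
    have hp : Function.Periodic (fun m : ℤ => F (x + lattice n (Pi.single j m))) 1 := by
      intro m
      simp only [Pi.single_add, map_add, lattice_single, ← add_assoc]
      exact hF j _
    have := hp.int_mul_eq m
    simpa using this
  have h2 : ∀ (s : Finset (Fin n)) (x : Space n),
      F (x + lattice n (∑ j ∈ s, Pi.single j (k j))) = F x := by
    intro s
    induction s using Finset.induction_on with
    | empty => simp
    | insert j s hj ih =>
      intro x
      rw [Finset.sum_insert hj, map_add, ← add_assoc, ih, h1]
  have := h2 Finset.univ x
  rwa [Finset.univ_sum_single, add_comm] at this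

theorem measurableSet_cell (n : ℕ) : MeasurableSet (cell n) := by
  have : cell n = ⋂ i : Fin n, (fun x : Space n => x i.castSucc) ⁻¹' Ico (0 : ℝ) 1 := by
    ext x; simp [cell]
  rw [this]
  exact MeasurableSet.iInter fun i => (by fun_prop : Measurable fun x : Space n => x i.castSucc)
    measurableSet_Ico

/-- Subtracting integer parts is the unique lattice translation into the cell. Once the cell is a
fundamental domain, any translate of it gives the same integral of a periodic function, and all
later translation arguments on the strip rest on this. -/
theorem isAddFundamentalDomain_cell (n : ℕ) :
    IsAddFundamentalDomain (lattice n).range (cell n) := by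
  refine IsAddFundamentalDomain.mk' (measurableSet_cell n).nullMeasurableSet fun x => ?_
  refine ⟨⟨lattice n fun j => - ⌊x j.castSucc⌋, ⟨_, rfl⟩⟩, ?_, ?_⟩
  · intro j
    simp only [AddSubgroup.vadd_def, vadd_eq_add, PiLp.add_apply, lattice_castSucc]
    push_cast
    constructor
    · linarith [Int.floor_le (x j.castSucc)]
    · linarith [Int.lt_floor_add_one (x j.castSucc)]
  · rintro ⟨_, ⟨k, rfl⟩⟩ hk
    have : k = fun j => - ⌊x j.castSucc⌋ := by
      ext j
      have := hk j
      simp only [AddSubgroup.vadd_def, vadd_eq_add, PiLp.add_apply, lattice_castSucc] at this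
      have h3 : ⌊x j.castSucc⌋ = - k j := by
        rw [Int.floor_eq_iff]
        push_cast
        constructor <;> linarith [this.1, this.2]
      omega
    simp [this]

instance : Countable (lattice n).range :=
  (Set.countable_range (lattice n)).to_subtype

section shift
variable {E : Type*} [NormedAddCommGroup E]

theorem isAddFundamentalDomain_cell_add (τ : Space n) :
    IsAddFundamentalDomain (lattice n).range ((fun x => x + τ) ⁻¹' cell n) := by
  have h := isAddFundamentalDomain_cell n
  refine h.preimage_of_equiv (f := fun x => x + τ)
    (measurePreserving_add_right volume τ).quasiMeasurePreserving (e := id)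
    Function.bijective_id fun g x => ?_
  simp [AddSubgroup.vadd_def, add_assoc]

theorem lintegral_strip_shift {F : Space n → ℝ≥0∞}
    (hF : ∀ (i : Fin n) (x : Space n), F (x + EuclideanSpace.single i.castSucc (1 : ℝ)) = F x)
    (τ : Space n) : ∫⁻ x, F (x + τ) ∂(stripMeasure n) = ∫⁻ x, F x ∂(stripMeasure n) := by
  have h1 := (measurePreserving_add_right (volume : Measure (Space n)) (-τ)).setLIntegral_comp_preimage_emb
    (MeasurableEquiv.addRight (-τ)).measurableEmbedding (fun x => F (x + τ)) (cell n)
  simp only [neg_add_cancel_right] at h1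
  rw [stripMeasure, ← h1]
  refine (isAddFundamentalDomain_cell_add (-τ)).setLIntegral_eq (isAddFundamentalDomain_cell n) F ?_
  rintro ⟨_, ⟨k, rfl⟩⟩ x
  exact periodic_lattice hF k x

theorem integral_strip_shift [NormedSpace ℝ E] {F : Space n → E}
    (hF : ∀ (i : Fin n) (x : Space n), F (x + EuclideanSpace.single i.castSucc (1 : ℝ)) = F x)
    (τ : Space n) : ∫ x, F (x + τ) ∂(stripMeasure n) = ∫ x, F x ∂(stripMeasure n) := by
  have h1 := (measurePreserving_add_right (volume : Measure (Space n)) (-τ)).setIntegral_preimage_emb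
    (MeasurableEquiv.addRight (-τ)).measurableEmbedding (fun x => F (x + τ)) (cell n)
  simp only [neg_add_cancel_right] at h1
  rw [stripMeasure, ← h1]
  refine (isAddFundamentalDomain_cell_add (-τ)).setIntegral_eq (isAddFundamentalDomain_cell n) ?_
  rintro ⟨_, ⟨k, rfl⟩⟩ x
  exact periodic_lattice hF k x

end shift

/-- A periodic open condition that fails almost everywhere fails everywhere. -/
theorem forall_of_ae_strip {g : Space n → ℝ} (hg : Continuous g) (hp : IsPeriodic g) {c : ℝ}
    (h : ∀ᵐ x ∂(stripMeasure n), g x ≤ c) (x : Space n) : g x ≤ c := by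
  have h0 : volume {x | c < g x} = 0 := by
    refine (isAddFundamentalDomain_cell n).measure_zero_of_invariant _ ?_ ?_
    · rintro ⟨_, ⟨k, rfl⟩⟩
      ext y
      rw [Set.mem_vadd_set_iff_neg_vadd_mem]
      have : (- (⟨lattice n k, ⟨k, rfl⟩⟩ : (lattice n).range)) +ᵥ y = lattice n (-k) + y := by
        rw [map_neg]; rfl
      rw [this]
      simp only [mem_ofPred_eq]
      rw [periodic_lattice hp]
    · have h2 := h
      rw [ae_iff, stripMeasure, Measure.restrict_apply₀'
        (measurableSet_cell n).nullMeasurableSet] at h2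
      simpa using h2
  have h1 : IsOpen {x | c < g x} := isOpen_lt continuous_const hg
  have := h1.measure_eq_zero_iff (μ := volume) |>.1 h0
  by_contra hx
  have hx' : x ∈ {x | c < g x} := not_le.1 hx
  rw [this] at hx'
  exact hx'

/-! ### Product structure -/

/-- The point with first coordinates `p.2` and last coordinate `p.1`. -/
def join (n : ℕ) (p : ℝ × (Fin n → ℝ)) : Space n :=
  WithLp.toLp 2 ((Fin.last n).insertNth p.1 p.2)

theorem join_castSucc (p : ℝ × (Fin n → ℝ)) (i : Fin n) : join n p i.castSucc = p.2 i := by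
  have := Fin.insertNth_apply_succAbove (α := fun _ => ℝ) (Fin.last n) p.1 p.2 i
  rwa [Fin.succAbove_last] at this

theorem join_last (p : ℝ × (Fin n → ℝ)) : join n p (Fin.last n) = p.1 := by
  simp [join]

theorem zCoord_join (p : ℝ × (Fin n → ℝ)) : zCoord (join n p) = p.1 := join_last p

theorem measurePreserving_join (n : ℕ) : MeasurePreserving (join n) :=
  (PiLp.volume_preserving_toLp (Fin (n + 1))).comp
    (volume_preserving_piFinSuccAbove (fun _ => ℝ) (Fin.last n)).symm

theorem measurable_join (n : ℕ) : Measurable (join n) := (measurePreserving_join n).measurable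

/-- The unit cube of the first coordinates. -/
def cube (n : ℕ) : Set (Fin n → ℝ) := Set.pi univ fun _ => Ico (0 : ℝ) 1

theorem volume_cube (n : ℕ) : volume (cube n) = 1 := by
  simp [cube, Real.volume_pi_Ico]

instance : IsProbabilityMeasure ((volume : Measure (Fin n → ℝ)).restrict (cube n)) :=
  ⟨by simp [volume_cube]⟩

theorem measurePreserving_join_strip (n : ℕ) : MeasurePreserving (join n)
    ((volume : Measure ℝ).prod ((volume : Measure (Fin n → ℝ)).restrict (cube n)))
    (stripMeasure n) := by
  have h := (measurePreserving_join n).restrict_preimage (measurableSet_cell n)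
  have h2 : join n ⁻¹' cell n = univ ×ˢ cube n := by
    ext p
    simp only [mem_preimage, cell, mem_ofPred_eq, join_castSucc, cube, mem_prod, mem_univ, true_and,
      Set.mem_pi, true_imp_iff]
  rw [h2, Measure.volume_eq_prod, ← Measure.prod_restrict, Measure.restrict_univ] at h
  exact h

/-- The cross section is a unit cube of mass one, so functions of `z` alone integrate over the strip
as over the line. -/
theorem measurePreserving_zCoord (n : ℕ) :
    MeasurePreserving (zCoord : Space n → ℝ) (stripMeasure n) volume := by
  have hz : Measurable (zCoord : Space n → ℝ) := by unfold zCoord; fun_prop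
  refine ⟨hz, ?_⟩
  rw [← (measurePreserving_join_strip n).map_eq, Measure.map_map hz (measurable_join n)]
  have : (zCoord : Space n → ℝ) ∘ join n = Prod.fst := by ext p; exact zCoord_join p
  rw [this, Measure.map_fst_prod]
  simp

theorem continuous_zCoord : Continuous (zCoord : Space n → ℝ) := by unfold zCoord; fun_prop

theorem integrable_zCoord {φ : ℝ → ℝ} (h : Integrable φ) :
    Integrable (fun x : Space n => φ (zCoord x)) (stripMeasure n) :=
  (measurePreserving_zCoord n).integrable_comp_of_integrable h

theorem integral_zCoord {φ : ℝ → ℝ} (h : AEStronglyMeasurable φ) :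
    ∫ x : Space n, φ (zCoord x) ∂(stripMeasure n) = ∫ s, φ s := by
  rw [← (measurePreserving_zCoord n).map_eq, integral_map]
  · exact (measurePreserving_zCoord n).aemeasurable
  · rwa [(measurePreserving_zCoord n).map_eq]

theorem stripMeasure_zCoord_le (R : ℝ) :
    stripMeasure n {x | |zCoord x| ≤ R} = ENNReal.ofReal (2 * R) := by
  have h := (measurePreserving_zCoord n).measure_preimage (s := Icc (-R) R)
    measurableSet_Icc.nullMeasurableSet
  rw [Real.volume_Icc] at h
  convert h using 2
  · ext x; simp [abs_le]
  · ring

instance : SFinite (stripMeasure n) := by unfold stripMeasure; infer_instance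

/-! ### Functions of the last coordinate -/

theorem SP.zfun {φ : ℝ → ℝ} (hφ : ContDiff ℝ ∞ φ) : SP (fun x : Space n => φ (zCoord x)) := by
  constructor
  · have : ContDiff ℝ ∞ (zCoord : Space n → ℝ) := by unfold zCoord; fun_prop
    exact hφ.comp this
  · intro i x
    simp [zCoord, (Fin.castSucc_lt_last i).ne']

theorem pd_zfun {φ φ' : ℝ → ℝ} (hφ : ∀ s, HasDerivAt φ (φ' s) s) (i : Fin (n + 1)) :
    pd i (fun x : Space n => φ (zCoord x)) =
      fun x => if i = Fin.last n then φ' (zCoord x) else 0 := by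
  ext x
  have hz : HasFDerivAt (zCoord : Space n → ℝ)
      (EuclideanSpace.proj (Fin.last n) : Space n →L[ℝ] ℝ) x :=
    (EuclideanSpace.proj (Fin.last n) : Space n →L[ℝ] ℝ).hasFDerivAt
  have := ((hφ (zCoord x)).comp_hasFDerivAt x hz).fderiv
  simp only [Function.comp_def] at this
  simp only [pd, this]
  by_cases h : i = Fin.last n <;> simp [h, eq_comm]

theorem pz_zfun {φ φ' : ℝ → ℝ} (hφ : ∀ s, HasDerivAt φ (φ' s) s) :
    pz (fun x : Space n => φ (zCoord x)) = fun x => φ' (zCoord x) := by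
  simp [pz, pd_zfun hφ]

theorem sum_pd_zfun_mul {φ φ' : ℝ → ℝ} (hφ : ∀ s, HasDerivAt φ (φ' s) s) (F : Fin (n + 1) → ℝ)
    (x : Space n) :
    ∑ i, pd i (fun x : Space n => φ (zCoord x)) x * F i = φ' (zCoord x) * F (Fin.last n) := by
  simp [pd_zfun hφ]

theorem lap_zfun {φ φ' φ'' : ℝ → ℝ} (hφ : ∀ s, HasDerivAt φ (φ' s) s)
    (hφ' : ∀ s, HasDerivAt φ' (φ'' s) s) :
    lap (fun x : Space n => φ (zCoord x)) = fun x => φ'' (zCoord x) := by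
  ext x
  have h : ∀ i : Fin (n + 1), pd i (pd i (fun x : Space n => φ (zCoord x))) x =
      if i = Fin.last n then φ'' (zCoord x) else 0 := by
    intro i
    rw [pd_zfun hφ]
    by_cases h : i = Fin.last n
    · simp only [h, if_true]
      rw [pd_zfun hφ']; simp
    · simp only [h, if_false]
      rw [pd_const]
  simp [lap, h]

/-! ### Test functions -/

namespace IsTestFunction
variable {F G : Space n → ℝ}

theorem mul (hF : IsTestFunction F) (hG : SP G) : IsTestFunction (fun x => F x * G x) := by
  obtain ⟨R, hR⟩ := hF.boundedSupport
  exact ⟨(hF.sp.mul hG).smooth, (hF.sp.mul hG).periodic, R, fun x hx => by simp [hR x hx]⟩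

theorem mul' (hG : SP G) (hF : IsTestFunction F) : IsTestFunction (fun x => G x * F x) := by
  simpa [mul_comm] using hF.mul hG

theorem add (hF : IsTestFunction F) (hG : IsTestFunction G) :
    IsTestFunction (fun x => F x + G x) := by
  obtain ⟨R, hR⟩ := hF.boundedSupport
  obtain ⟨R', hR'⟩ := hG.boundedSupport
  exact ⟨(hF.sp.add hG.sp).smooth, (hF.sp.add hG.sp).periodic, max R R', fun x hx => by
    simp [hR x ((le_max_left _ _).trans_lt hx), hR' x ((le_max_right _ _).trans_lt hx)]⟩

theorem const_mul (hF : IsTestFunction F) (c : ℝ) : IsTestFunction (fun x => c * F x) :=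
  mul' (SP.const c) hF

theorem sum {ι : Type*} {s : Finset ι} {f : ι → Space n → ℝ} (hf : ∀ i, IsTestFunction (f i)) :
    IsTestFunction (fun x => ∑ i ∈ s, f i x) := by
  classical
  induction s using Finset.induction_on with
  | empty => simpa using ⟨contDiff_const, fun _ _ => rfl, 0, fun _ _ => rfl⟩
  | insert j s hj ih => simp only [Finset.sum_insert hj]; exact (hf j).add ih

theorem sub (hF : IsTestFunction F) (hG : IsTestFunction G) :
    IsTestFunction (fun x => F x - G x) := by
  simpa [sub_eq_add_neg] using hF.add (hG.const_mul (-1))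

theorem neg (hF : IsTestFunction F) : IsTestFunction (fun x => - F x) := by
  simpa using hF.const_mul (-1)

theorem pow (hF : IsTestFunction F) (k : ℕ) : IsTestFunction (fun x => F x ^ (k + 1)) := by
  simpa [pow_succ] using mul' (hF.sp.pow k) hF

theorem pd (hF : IsTestFunction F) (i : Fin (n + 1)) : IsTestFunction (pd i F) := by
  obtain ⟨R, hR⟩ := hF.boundedSupport
  refine ⟨(hF.sp.pd i).smooth, (hF.sp.pd i).periodic, R, fun x hx => ?_⟩
  have : F =ᶠ[nhds x] fun _ => 0 := by
    filter_upwards [(isOpen_lt continuous_const continuous_zCoord.abs).mem_nhds hx] with y hy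
    exact hR y hy
  simp [CahnHilliard.pd, this.fderiv_eq]

theorem lap (hF : IsTestFunction F) : IsTestFunction (lap F) := sum fun i => (hF.pd i).pd i

end IsTestFunction

/-- A compact set containing the part of the cell with `|z| ≤ R`. -/
def box (n : ℕ) (R : ℝ) : Set (Space n) :=
  WithLp.toLp 2 '' (Set.pi univ fun _ => Icc (-(|R| + 1)) (|R| + 1))

theorem isCompact_box (n : ℕ) (R : ℝ) : IsCompact (box n R) :=
  (isCompact_univ_pi fun _ => isCompact_Icc).image (PiLp.continuous_toLp 2 _)

theorem mem_box {R : ℝ} {x : Space n} (hx : x ∈ cell n) (hz : |zCoord x| ≤ R) : x ∈ box n R := by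
  refine ⟨WithLp.ofLp x, fun i _ => ?_, rfl⟩
  refine Fin.lastCases ?_ (fun j => ?_) i
  · have := abs_le.1 (hz.trans (le_abs_self R))
    constructor <;> simp only [zCoord] at this <;> linarith [this.1, this.2]
  · have := hx j
    have := abs_nonneg R
    constructor <;> linarith [(hx j).1, (hx j).2]

theorem exists_mem_cell (x : Space n) : ∃ k, lattice n k + x ∈ cell n := by
  refine ⟨fun j => - ⌊x j.castSucc⌋, fun j => ?_⟩
  simp only [PiLp.add_apply, lattice_castSucc]
  push_cast
  constructor
  · linarith [Int.floor_le (x j.castSucc)]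
  · linarith [Int.lt_floor_add_one (x j.castSucc)]

theorem ae_mem_cell (n : ℕ) : ∀ᵐ x ∂(stripMeasure n), x ∈ cell n :=
  ae_restrict_mem (measurableSet_cell n)

theorem integrable_of_zsupport {E : Type*} [NormedAddCommGroup E] {g : Space n → E}
    (hg : Continuous g) {R : ℝ} (hR : ∀ x, R < |zCoord x| → g x = 0) :
    Integrable g (stripMeasure n) := by
  have h1 : IntegrableOn g (box n R) volume := hg.continuousOn.integrableOn_compact (isCompact_box n R)
  have h2 : IntegrableOn g (cell n ∩ {x | |zCoord x| ≤ R}) volume :=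
    h1.mono_set fun x hx => mem_box hx.1 hx.2
  refine h2.of_forall_sdiff_eq_zero (measurableSet_cell n) fun x hx => hR x ?_
  by_contra h
  exact hx.2 ⟨hx.1, not_lt.1 h⟩

theorem IsTestFunction.integrable {F : Space n → ℝ} (hF : IsTestFunction F) :
    Integrable F (stripMeasure n) := by
  obtain ⟨R, hR⟩ := hF.boundedSupport
  exact integrable_of_zsupport hF.smooth.continuous hR

theorem IsTestFunction.exists_bound {F : Space n → ℝ} (hF : IsTestFunction F) :
    ∃ M, ∀ x, |F x| ≤ M := by
  obtain ⟨R, hR⟩ := hF.boundedSupport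
  obtain ⟨M, hM⟩ := (isCompact_box n R).exists_bound_of_continuousOn hF.smooth.continuous.continuousOn
  refine ⟨max M 0, fun x => ?_⟩
  obtain ⟨k, hk⟩ := exists_mem_cell x
  rw [← periodic_lattice hF.periodic k x]
  by_cases h : |zCoord (lattice n k + x)| ≤ R
  · exact (hM _ (mem_box hk h)).trans (le_max_left _ _)
  · rw [hR _ (not_le.1 h)]; simp

/-! ### Integration by parts -/

/-- Integrate F(x+e) - F(x) = ∫₀¹ ∂F(x+se) ds over the strip: by translation invariance the left
side vanishes and the right side is ∫∂F. The periodic directions and `z` are treated alike, and no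
boundary terms occur. -/
theorem IsTestFunction.integral_pd {F : Space n → ℝ} (hF : IsTestFunction F) (i : Fin (n + 1)) :
    ∫ x, CahnHilliard.pd i F x ∂(stripMeasure n) = 0 := by
  set e : Space n := EuclideanSpace.single i (1 : ℝ) with he
  have hG := hF.pd i
  set G := CahnHilliard.pd i F with hGdef
  obtain ⟨R, hR⟩ := hG.boundedSupport
  obtain ⟨M, hM⟩ := hG.exists_bound
  have hze : |zCoord e| ≤ 1 := by
    simp only [he, zCoord, PiLp.single_apply]
    split_ifs <;> simp
  have hftc : ∀ x : Space n, F (x + e) - F x = ∫ s in (0 : ℝ)..1, G (x + s • e) := by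
    intro x
    have hd : ∀ s ∈ uIcc (0 : ℝ) 1, HasDerivAt (fun s : ℝ => F (x + s • e)) (G (x + s • e)) s := by
      intro s _
      have h1 : HasDerivAt (fun s : ℝ => x + s • e) e s := by
        simpa using ((hasDerivAt_id s).smul_const e).const_add x
      exact (hF.sp.diff _).hasFDerivAt.comp_hasDerivAt s h1
    rw [intervalIntegral.integral_eq_sub_of_hasDerivAt hd]
    · simp
    · exact (hG.smooth.continuous.comp (by fun_prop)).intervalIntegrable _ _
  have hint : Integrable (fun p : ℝ × Space n => G (p.2 + p.1 • e))
      ((volume.restrict (Ioc (0 : ℝ) 1)).prod (stripMeasure n)) := by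
    -- For 0 < s ≤ 1 the translate is supported in |z| ≤ R + 1, so a constant on that slab
    -- dominates.
    have hb : Integrable (fun p : ℝ × Space n => ({x | |zCoord x| ≤ R + 1} : Set (Space n)).indicator
        (fun _ => M) p.2) ((volume.restrict (Ioc (0 : ℝ) 1)).prod (stripMeasure n)) := by
      refine Integrable.comp_snd (f := ({x | |zCoord x| ≤ R + 1} : Set (Space n)).indicator
        (fun _ => M)) ?_ _
      refine (integrable_indicator_iff
        (isClosed_le continuous_zCoord.abs continuous_const).measurableSet).2 ?_
      refine integrableOn_const ?_
      rw [stripMeasure_zCoord_le]; exact ENNReal.ofReal_ne_top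
    refine hb.mono' (hG.smooth.continuous.comp (by fun_prop)).aestronglyMeasurable ?_
    have : ∀ᵐ p ∂((volume.restrict (Ioc (0 : ℝ) 1)).prod (stripMeasure n)), p.1 ∈ Ioc (0 : ℝ) 1 :=
      Measure.quasiMeasurePreserving_fst.ae (ae_restrict_mem measurableSet_Ioc)
    filter_upwards [this] with p hp
    by_cases h : |zCoord p.2| ≤ R + 1
    · rw [indicator_of_mem (by exact h)]
      exact hM _
    · rw [indicator_of_notMem (by exact h), hR, norm_zero]
      have h1 : zCoord (p.2 + p.1 • e) = zCoord p.2 + p.1 * zCoord e := by simp [zCoord]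
      rw [h1]
      have h2 : |p.1 * zCoord e| ≤ 1 := by
        rw [abs_mul, abs_of_pos hp.1]
        nlinarith [hp.2, hp.1, abs_nonneg (zCoord e)]
      have h3 := abs_sub_abs_le_abs_sub (zCoord p.2) (-(p.1 * zCoord e))
      rw [abs_neg, sub_neg_eq_add] at h3
      linarith [not_le.1 h]
  have h1 : ∫ x, (F (x + e) - F x) ∂(stripMeasure n) = 0 := by
    have hs : ∫ x, F (x + e) ∂(stripMeasure n) = _ := integral_strip_shift hF.periodic e
    have hi : Integrable (fun x => F (x + e)) (stripMeasure n) := by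
      obtain ⟨R', hR'⟩ := hF.boundedSupport
      refine integrable_of_zsupport (R := R' + 1) (hF.smooth.continuous.comp (by fun_prop)) fun x hx => hR' _ ?_
      have h1 : zCoord (x + e) = zCoord x + zCoord e := by simp [zCoord]
      rw [h1]
      have h3 := abs_sub_abs_le_abs_sub (zCoord x) (-(zCoord e))
      rw [abs_neg, sub_neg_eq_add] at h3
      linarith
    rw [integral_sub hi hF.integrable, hs, sub_self]
  have h2 : ∫ x, (F (x + e) - F x) ∂(stripMeasure n) =
      ∫ s in Ioc (0 : ℝ) 1, ∫ x, G (x + s • e) ∂(stripMeasure n) := by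
    rw [integral_integral_swap hint]
    refine integral_congr_ae (Filter.Eventually.of_forall fun x => ?_)
    exact (hftc x).trans (intervalIntegral.integral_of_le zero_le_one)
  have h3 : ∀ s : ℝ, ∫ x, G (x + s • e) ∂(stripMeasure n) = ∫ x, G x ∂(stripMeasure n) :=
    fun s => integral_strip_shift hG.periodic _
  simp only [h3] at h2
  rw [h1] at h2
  simpa using h2.symm

theorem IsTestFunction.integral_mul_pd {F G : Space n → ℝ} (hF : IsTestFunction F) (hG : SP G)
    (i : Fin (n + 1)) : ∫ x, F x * CahnHilliard.pd i G x ∂(stripMeasure n) =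
      - ∫ x, CahnHilliard.pd i F x * G x ∂(stripMeasure n) := by
  have h := (hF.mul hG).integral_pd i
  rw [pd_mul i hF.sp hG, integral_add (hF.mul (hG.pd i)).integrable ((hF.pd i).mul hG).integrable] at h
  linarith

theorem IsTestFunction.integral_mul_lap {F G : Space n → ℝ} (hF : IsTestFunction F) (hG : SP G) :
    ∫ x, F x * CahnHilliard.lap G x ∂(stripMeasure n) =
      - ∫ x, (∑ i, CahnHilliard.pd i F x * CahnHilliard.pd i G x) ∂(stripMeasure n) := by
  simp only [CahnHilliard.lap, Finset.mul_sum]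
  rw [integral_finsetSum _ fun i _ => (hF.mul ((hG.pd i).pd i)).integrable,
    integral_finsetSum _ fun i _ => ((hF.pd i).mul (hG.pd i)).integrable, ← Finset.sum_neg_distrib]
  exact Finset.sum_congr rfl fun i _ => hF.integral_mul_pd (hG.pd i) i

theorem IsTestFunction.integral_mul_lap' {F G : Space n → ℝ} (hF : IsTestFunction F) (hG : SP G) :
    ∫ x, F x * CahnHilliard.lap G x ∂(stripMeasure n) =
      ∫ x, CahnHilliard.lap F x * G x ∂(stripMeasure n) := by
  simp only [CahnHilliard.lap, Finset.mul_sum, Finset.sum_mul]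
  rw [integral_finsetSum _ fun i _ => (hF.mul ((hG.pd i).pd i)).integrable,
    integral_finsetSum _ fun i _ => (((hF.pd i).pd i).mul hG).integrable]
  refine Finset.sum_congr rfl fun i _ => ?_
  rw [hF.integral_mul_pd (hG.pd i) i, (hF.pd i).integral_mul_pd hG i, neg_neg]

/-! ### Time derivatives of localized integrals -/

/-- The test function confines the integrand to a compact set of times and points, on which the
smooth time derivative is bounded; no decay of `b` is needed. -/
theorem ST.hasDerivAt_integral {T : ℝ} {b : ℝ → Space n → ℝ} (hb : ST T b) {χ : Space n → ℝ}
    (hχ : IsTestFunction χ) {t : ℝ} (ht : t ∈ Ioo 0 T) :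
    HasDerivAt (fun r => ∫ x, χ x * b r x ∂(stripMeasure n))
      (∫ x, χ x * CahnHilliard.td b t x ∂(stripMeasure n)) t := by
  obtain ⟨R, hR⟩ := hχ.boundedSupport
  obtain ⟨ε, hε, hsub⟩ := Metric.nhds_basis_closedBall.mem_iff.1 (isOpen_Ioo.mem_nhds ht)
  have hcomp : IsCompact (Metric.closedBall t ε ×ˢ box n R) :=
    (isCompact_closedBall t ε).prod (isCompact_box n R)
  have hcont : ContinuousOn (fun p : ℝ × Space n => χ p.2 * CahnHilliard.td b p.1 p.2)
      (Metric.closedBall t ε ×ˢ box n R) :=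
    ((hχ.smooth.continuous.comp continuous_snd).continuousOn).mul
      (hb.td.continuousOn.mono (prod_mono hsub (subset_univ _)))
  obtain ⟨M, hM⟩ := hcomp.exists_bound_of_continuousOn hcont
  refine (hasDerivAt_integral_of_dominated_loc_of_deriv_le (s := Metric.closedBall t ε)
    (F := fun r x => χ x * b r x) (F' := fun r x => χ x * CahnHilliard.td b r x)
    (bound := ({x | |zCoord x| ≤ R} : Set (Space n)).indicator (fun _ => M))
    (Metric.closedBall_mem_nhds t hε) ?_ ?_ ?_ ?_ ?_ ?_).2
  · filter_upwards [Metric.closedBall_mem_nhds t hε] with r hr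
    exact (hχ.mul (hb.sp (hsub hr))).smooth.continuous.aestronglyMeasurable
  · exact (hχ.mul (hb.sp ht)).integrable
  · exact (hχ.mul (hb.td.sp ht)).smooth.continuous.aestronglyMeasurable
  · filter_upwards [ae_mem_cell n] with x hx r hr
    by_cases h : |zCoord x| ≤ R
    · rw [indicator_of_mem (by exact h)]
      exact hM (r, x) ⟨hr, mem_box hx h⟩
    · rw [indicator_of_notMem (by exact h), hR x (not_le.1 h)]
      simp
  · refine (integrable_indicator_iff
        (isClosed_le continuous_zCoord.abs continuous_const).measurableSet).2 ?_
    refine integrableOn_const ?_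
    rw [stripMeasure_zCoord_le]; exact ENNReal.ofReal_ne_top
  · refine Filter.Eventually.of_forall fun x r hr => ?_
    exact (hb.hasDerivAt (hsub hr) x).const_mul (χ x)

theorem ST.continuousOn_integral {T : ℝ} {b : ℝ → Space n → ℝ} (hb : ST T b) {χ : Space n → ℝ}
    (hχ : IsTestFunction χ) :
    ContinuousOn (fun r => ∫ x, χ x * b r x ∂(stripMeasure n)) (Ioo 0 T) :=
  fun _ ht => (hb.hasDerivAt_integral hχ ht).continuousAt.continuousWithinAt

theorem ST.integral_sub_integral {T : ℝ} {b : ℝ → Space n → ℝ} (hb : ST T b) {χ : Space n → ℝ}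
    (hχ : IsTestFunction χ) {t₁ t₂ : ℝ} (h1 : t₁ ∈ Ioo 0 T) (h2 : t₂ ∈ Ioo 0 T) :
    ∫ x, χ x * b t₂ x ∂(stripMeasure n) - ∫ x, χ x * b t₁ x ∂(stripMeasure n) =
      ∫ r in t₁..t₂, ∫ x, χ x * CahnHilliard.td b r x ∂(stripMeasure n) := by
  have hsub : uIcc t₁ t₂ ⊆ Ioo 0 T := (ordConnected_Ioo.uIcc_subset h1 h2)
  rw [intervalIntegral.integral_eq_sub_of_hasDerivAt fun r hr => hb.hasDerivAt_integral hχ (hsub hr)]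
  exact ((hb.td.continuousOn_integral hχ).mono hsub).intervalIntegrable

/-! ### Cutoff functions -/

/-- A smooth profile equal to `1` on `[-1, 1]` and to `0` outside `[-2, 2]`. -/
def cutProfile (s : ℝ) : ℝ := Real.smoothTransition (2 - s ^ 2)

theorem contDiff_cutProfile : ContDiff ℝ ∞ cutProfile :=
  Real.smoothTransition.contDiff.comp (by fun_prop)

/-- The cutoff at scale `R` in the direction of the strip. -/
def cut (n : ℕ) (R : ℝ) (x : Space n) : ℝ := cutProfile (R⁻¹ * zCoord x)

theorem cut_nonneg (R : ℝ) (x : Space n) : 0 ≤ cut n R x := Real.smoothTransition.nonneg _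

theorem cut_le_one (R : ℝ) (x : Space n) : cut n R x ≤ 1 := Real.smoothTransition.le_one _

theorem cutProfile_eq_one {s : ℝ} (h : |s| ≤ 1) : cutProfile s = 1 :=
  Real.smoothTransition.one_of_one_le (by nlinarith [sq_abs s, abs_nonneg s])

theorem cutProfile_eq_zero {s : ℝ} (h : 2 ≤ |s|) : cutProfile s = 0 :=
  Real.smoothTransition.zero_of_nonpos (by nlinarith [sq_abs s, abs_nonneg s])

theorem cut_eq_one {R : ℝ} (hR : 0 < R) {x : Space n} (h : |zCoord x| ≤ R) : cut n R x = 1 := by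
  refine cutProfile_eq_one ?_
  rw [abs_mul, abs_inv, abs_of_pos hR, inv_mul_le_iff₀ hR]; linarith

theorem cut_eq_zero {R : ℝ} (hR : 0 < R) {x : Space n} (h : 2 * R ≤ |zCoord x|) :
    cut n R x = 0 := by
  refine cutProfile_eq_zero ?_
  rw [abs_mul, abs_inv, abs_of_pos hR, le_inv_mul_iff₀ hR]; linarith

theorem isTestFunction_cut {R : ℝ} (hR : 0 < R) : IsTestFunction (cut n R) := by
  have h := SP.zfun (n := n) (φ := fun s => cutProfile (R⁻¹ * s)) (contDiff_cutProfile.comp (by fun_prop))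
  exact ⟨h.smooth, h.periodic, 2 * R, fun x hx => cut_eq_zero hR hx.le⟩

theorem contDiff_deriv_cutProfile : ContDiff ℝ ∞ (deriv cutProfile) :=
  (contDiff_infty_iff_deriv.1 contDiff_cutProfile).2

theorem hasDerivAt_cutProfile (s : ℝ) : HasDerivAt cutProfile (deriv cutProfile s) s :=
  (contDiff_cutProfile.differentiable (by simp) s).hasDerivAt

theorem hasDerivAt_cut (R s : ℝ) : HasDerivAt (fun s => cutProfile (R⁻¹ * s))
    (R⁻¹ * deriv cutProfile (R⁻¹ * s)) s := by
  have h : HasDerivAt (fun s => R⁻¹ * s) R⁻¹ s := by simpa using (hasDerivAt_id s).const_mul R⁻¹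
  have := (hasDerivAt_cutProfile (R⁻¹ * s)).comp s h
  rw [mul_comm]; exact this

theorem hasDerivAt_cut' (R s : ℝ) : HasDerivAt (fun s => R⁻¹ * deriv cutProfile (R⁻¹ * s))
    (R⁻¹ ^ 2 * deriv (deriv cutProfile) (R⁻¹ * s)) s := by
  have h : HasDerivAt (fun s => R⁻¹ * s) R⁻¹ s := by simpa using (hasDerivAt_id s).const_mul R⁻¹
  have h2 := ((contDiff_deriv_cutProfile.differentiable (by simp) (R⁻¹ * s)).hasDerivAt.comp s h).const_mul R⁻¹
  refine h2.congr_deriv ?_; ring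

theorem exists_cutProfile_bound : ∃ K : ℝ, 1 ≤ K ∧ ∀ s, |deriv cutProfile s| ≤ K ∧
    |deriv (deriv cutProfile) s| ≤ K := by
  have hc : HasCompactSupport cutProfile := by
    refine HasCompactSupport.of_support_subset_isCompact (isCompact_Icc (a := (-2 : ℝ)) (b := 2)) ?_
    intro s hs
    by_contra h
    refine hs (cutProfile_eq_zero ?_)
    by_contra h2
    exact h (abs_le.1 (not_le.1 h2).le)
  obtain ⟨K1, h1⟩ := hc.deriv.exists_bound_of_continuous contDiff_deriv_cutProfile.continuous
  obtain ⟨K2, h2⟩ := hc.deriv.deriv.exists_bound_of_continuous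
    (contDiff_infty_iff_deriv.1 contDiff_deriv_cutProfile).2.continuous
  exact ⟨max 1 (max K1 K2), le_max_left _ _, fun s =>
    ⟨(h1 s).trans ((le_max_left _ _).trans (le_max_right _ _)),
      (h2 s).trans ((le_max_right _ _).trans (le_max_right _ _))⟩⟩

/-! ### Exhaustion by cutoffs -/

/-- Fatou's lemma. This is how bounds on localized integrals, uniform in the cutoff, become
finiteness of the full integrals. -/
theorem lintegral_le_of_exhaustion {X : Type*} [MeasurableSpace X] {m : Measure X} {f : X → ℝ}
    {χ : ℕ → X → ℝ} {K : ℝ} (hf : ∀ᵐ x ∂m, 0 ≤ f x) (hχ : ∀ N x, 0 ≤ χ N x)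
    (hev : ∀ x, ∀ᶠ N in Filter.atTop, χ N x = 1)
    (hint : ∀ N, Integrable (fun x => χ N x * f x) m)
    (hK : ∀ᶠ N in Filter.atTop, ∫ x, χ N x * f x ∂m ≤ K) :
    ∫⁻ x, ENNReal.ofReal (f x) ∂m ≤ ENNReal.ofReal K := by
  calc ∫⁻ x, ENNReal.ofReal (f x) ∂m
      ≤ ∫⁻ x, Filter.liminf (fun N => ENNReal.ofReal (χ N x * f x)) Filter.atTop ∂m := by
        refine lintegral_mono fun x => ?_
        refine Filter.le_liminf_of_le (by isBoundedDefault) ?_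
        filter_upwards [hev x] with N hN
        simp [hN]
    _ ≤ Filter.liminf (fun N => ∫⁻ x, ENNReal.ofReal (χ N x * f x) ∂m) Filter.atTop :=
        lintegral_liminf_le' fun N => (hint N).1.aemeasurable.ennreal_ofReal
    _ ≤ ENNReal.ofReal K := by
        refine Filter.liminf_le_of_le (by isBoundedDefault) fun b hb => ?_
        obtain ⟨N, h1, h2⟩ := (hb.and hK).exists
        refine h1.trans ?_
        rw [← ofReal_integral_eq_lintegral_ofReal (hint N)
          (by filter_upwards [hf] with x hx using mul_nonneg (hχ N x) hx)]
        exact ENNReal.ofReal_le_ofReal h2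

theorem tendsto_integral_of_exhaustion {X : Type*} [MeasurableSpace X] {m : Measure X} {f : X → ℝ}
    {χ : ℕ → X → ℝ} (hχ : ∀ N x, |χ N x| ≤ 1) (hmeas : ∀ N, AEStronglyMeasurable (χ N) m)
    (hev : ∀ x, ∀ᶠ N in Filter.atTop, χ N x = 1) (hf : Integrable f m) :
    Filter.Tendsto (fun N => ∫ x, χ N x * f x ∂m) Filter.atTop (nhds (∫ x, f x ∂m)) := by
  refine tendsto_integral_of_dominated_convergence (fun x => ‖f x‖)
    (fun N => (hmeas N).mul hf.1) hf.norm ?_ ?_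
  · intro N
    refine Filter.Eventually.of_forall fun x => ?_
    rw [norm_mul]
    exact mul_le_of_le_one_left (norm_nonneg _) (hχ N x)
  · refine Filter.Eventually.of_forall fun x => tendsto_const_nhds.congr' ?_
    filter_upwards [hev x] with N hN
    simp [hN]

/-- The weight used to localize integrals. -/
def wt (n : ℕ) (R : ℝ) (x : Space n) : ℝ := cut n R x ^ 4

theorem wt_nonneg (R : ℝ) (x : Space n) : 0 ≤ wt n R x := pow_nonneg (cut_nonneg R x) 4

theorem wt_le_one (R : ℝ) (x : Space n) : wt n R x ≤ 1 := pow_le_one₀ (cut_nonneg R x) (cut_le_one R x)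

theorem isTestFunction_wt {R : ℝ} (hR : 0 < R) : IsTestFunction (wt n R) :=
  (isTestFunction_cut hR).pow 3

theorem eventually_wt_eq_one (x : Space n) :
    ∀ᶠ N : ℕ in Filter.atTop, wt n ((N : ℝ) + 1) x = 1 := by
  filter_upwards [(tendsto_natCast_atTop_atTop (R := ℝ)).eventually_ge_atTop |zCoord x|] with N hN
  rw [wt, cut_eq_one (by positivity) (by linarith), one_pow]

theorem lintegral_strip_le {f : Space n → ℝ} (hf : Continuous f) (h0 : ∀ x, 0 ≤ f x) {K R₀ : ℝ}
    (hK : ∀ R, 1 ≤ R → R₀ ≤ R → ∫ x, wt n R x * f x ∂(stripMeasure n) ≤ K) :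
    ∫⁻ x, ENNReal.ofReal (f x) ∂(stripMeasure n) ≤ ENNReal.ofReal K := by
  refine lintegral_le_of_exhaustion (χ := fun N => wt n ((N : ℝ) + 1))
    (Filter.Eventually.of_forall h0) (fun N => wt_nonneg _) eventually_wt_eq_one ?_ ?_
  · intro N
    obtain ⟨R, hR⟩ := (isTestFunction_wt (n := n) (R := (N : ℝ) + 1) (by positivity)).boundedSupport
    exact integrable_of_zsupport (R := R)
      ((isTestFunction_wt (by positivity)).smooth.continuous.mul hf) fun x hx => by simp [hR x hx]
  · filter_upwards [(tendsto_natCast_atTop_atTop (R := ℝ)).eventually_ge_atTop R₀] with N hN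
    exact hK _ (by simp) (by linarith)

theorem integrable_of_lintegral_le {X : Type*} [MeasurableSpace X] {m : Measure X} {f : X → ℝ}
    (hm : AEStronglyMeasurable f m) (h0 : ∀ x, 0 ≤ f x)
    (h : ∫⁻ x, ENNReal.ofReal (f x) ∂m < ⊤) : Integrable f m :=
  ⟨hm, (hasFiniteIntegral_iff_ofReal (Filter.Eventually.of_forall h0)).2 h⟩

theorem Integrable.lintegral_ofReal_lt_top {X : Type*} [MeasurableSpace X] {m : Measure X} {f : X → ℝ}
    (hf : Integrable f m) : ∫⁻ x, ENNReal.ofReal (f x) ∂m < ⊤ :=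
  (lintegral_ofReal_le_lintegral_enorm f).trans_lt hf.2

theorem tendsto_integral_wt {f : Space n → ℝ} (hf : Integrable f (stripMeasure n)) :
    Filter.Tendsto (fun N : ℕ => ∫ x, wt n ((N : ℝ) + 1) x * f x ∂(stripMeasure n)) Filter.atTop
      (nhds (∫ x, f x ∂(stripMeasure n))) := by
  refine tendsto_integral_of_exhaustion (χ := fun (N : ℕ) => wt n ((N : ℝ) + 1)) ?_ ?_
    eventually_wt_eq_one hf
  · intro N x
    rw [abs_of_nonneg (wt_nonneg _ _)]; exact wt_le_one _ _
  · intro N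
    exact (isTestFunction_wt (by positivity)).smooth.continuous.aestronglyMeasurable

/-- A bound for the derivatives of the cutoff profile. -/
def cutK : ℝ := Classical.choose exists_cutProfile_bound

theorem one_le_cutK : 1 ≤ cutK := (Classical.choose_spec exists_cutProfile_bound).1

theorem abs_deriv_cutProfile_le (s : ℝ) : |deriv cutProfile s| ≤ cutK :=
  ((Classical.choose_spec exists_cutProfile_bound).2 s).1

theorem abs_deriv_deriv_cutProfile_le (s : ℝ) : |deriv (deriv cutProfile) s| ≤ cutK :=
  ((Classical.choose_spec exists_cutProfile_bound).2 s).2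

/-! ### Derivatives of powers of the cutoff -/

section cutpow
variable (k : ℕ) (R : ℝ)

theorem hasDerivAt_cut_pow (s : ℝ) : HasDerivAt (fun s => cutProfile (R⁻¹ * s) ^ (k + 2))
    ((k + 2) * cutProfile (R⁻¹ * s) ^ (k + 1) * (R⁻¹ * deriv cutProfile (R⁻¹ * s))) s := by
  simpa using (hasDerivAt_cut R s).fun_pow (k + 2)

theorem hasDerivAt_cut_pow' (s : ℝ) :
    HasDerivAt (fun s => (k + 2) * cutProfile (R⁻¹ * s) ^ (k + 1) * (R⁻¹ * deriv cutProfile (R⁻¹ * s)))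
    ((k + 2) * cutProfile (R⁻¹ * s) ^ k * R⁻¹ ^ 2 * ((k + 1) * deriv cutProfile (R⁻¹ * s) ^ 2 +
      cutProfile (R⁻¹ * s) * deriv (deriv cutProfile) (R⁻¹ * s))) s := by
  have h := (((hasDerivAt_cut R s).fun_pow (k + 1)).const_mul ((k : ℝ) + 2)).mul (hasDerivAt_cut' R s)
  refine h.congr_deriv ?_
  push_cast
  ring

variable {R}

/-- Each derivative costs one power of the cutoff and gains a factor 1/R. For the fourth power this
leaves cut² after two derivatives, which is the square root of the weight and hence fits Young's
inequality against the weighted leading term. -/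
theorem abs_pz_cut_pow_le (hR : 0 < R) (x : Space n) :
    |pz (fun x => cut n R x ^ (k + 2)) x| ≤ (k + 2) * cutK / R * cut n R x ^ (k + 1) := by
  have h := pz_zfun (n := n) (hasDerivAt_cut_pow k R)
  have h2 : pz (fun x => cut n R x ^ (k + 2)) x = _ := congrFun h x
  rw [h2, abs_mul, abs_mul, abs_mul, abs_pow]
  have h3 : |cutProfile (R⁻¹ * zCoord x)| = cut n R x := abs_of_nonneg (cut_nonneg R x)
  rw [h3, abs_of_nonneg (by positivity : (0 : ℝ) ≤ k + 2), abs_of_pos (inv_pos.2 hR)]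
  calc _ ≤ (k + 2) * cut n R x ^ (k + 1) * (R⁻¹ * cutK) := by
        gcongr
        · exact mul_nonneg (by positivity) (pow_nonneg (cut_nonneg _ _) _)
        · exact abs_deriv_cutProfile_le _
    _ = _ := by field_simp

theorem lap_cut_pow (x : Space n) : lap (fun x => cut n R x ^ (k + 2)) x =
    (k + 2) * cutProfile (R⁻¹ * zCoord x) ^ k * R⁻¹ ^ 2 *
      ((k + 1) * deriv cutProfile (R⁻¹ * zCoord x) ^ 2 +
      cutProfile (R⁻¹ * zCoord x) * deriv (deriv cutProfile) (R⁻¹ * zCoord x)) :=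
  congrFun (lap_zfun (n := n) (hasDerivAt_cut_pow k R) (hasDerivAt_cut_pow' k R)) x

theorem abs_lap_cut_pow_le (hR : 0 < R) (x : Space n) :
    |lap (fun x => cut n R x ^ (k + 2)) x| ≤ ((k + 2) * cutK) ^ 2 / R ^ 2 * cut n R x ^ k := by
  rw [lap_cut_pow, abs_mul, abs_mul, abs_mul, abs_pow, abs_pow]
  have h3 : |cutProfile (R⁻¹ * zCoord x)| = cut n R x := abs_of_nonneg (cut_nonneg R x)
  rw [h3, abs_of_nonneg (by positivity : (0 : ℝ) ≤ k + 2), abs_of_pos (inv_pos.2 hR)]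
  have hK := one_le_cutK
  have h4 : |((k : ℝ) + 1) * deriv cutProfile (R⁻¹ * zCoord x) ^ 2 +
      cutProfile (R⁻¹ * zCoord x) * deriv (deriv cutProfile) (R⁻¹ * zCoord x)| ≤
      (k + 2) * cutK ^ 2 := by
    refine (abs_add_le _ _).trans ?_
    rw [abs_mul, abs_mul, abs_pow, h3, abs_of_nonneg (by positivity : (0 : ℝ) ≤ k + 1)]
    have h5 := pow_le_pow_left₀ (abs_nonneg _) (abs_deriv_cutProfile_le (R⁻¹ * zCoord x)) 2
    have h6 := abs_deriv_deriv_cutProfile_le (R⁻¹ * zCoord x)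
    have h7 : cut n R x * |deriv (deriv cutProfile) (R⁻¹ * zCoord x)| ≤ 1 * cutK :=
      mul_le_mul (cut_le_one _ _) h6 (abs_nonneg _) zero_le_one
    have h8 := mul_le_mul_of_nonneg_left h5 (by positivity : (0 : ℝ) ≤ k + 1)
    nlinarith
  calc _ ≤ (k + 2) * cut n R x ^ k * R⁻¹ ^ 2 * ((k + 2) * cutK ^ 2) := by
        gcongr
        exact mul_nonneg (mul_nonneg (by positivity) (pow_nonneg (cut_nonneg _ _) _)) (by positivity)
    _ = _ := by field_simp

theorem sum_pd_cut_pow_mul (F : Fin (n + 1) → ℝ) (x : Space n) :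
    ∑ i, pd i (fun x => cut n R x ^ (k + 2)) x * F i =
      pz (fun x => cut n R x ^ (k + 2)) x * F (Fin.last n) := by
  have h := sum_pd_zfun_mul (n := n) (hasDerivAt_cut_pow k R) F x
  refine h.trans ?_
  congr 1
  exact (congrFun (pz_zfun (n := n) (hasDerivAt_cut_pow k R)) x).symm

theorem sum_pd_pz_cut_pow_mul (F : Fin (n + 1) → ℝ) (x : Space n) :
    ∑ i, pd i (pz (fun x => cut n R x ^ (k + 2))) x * F i =
      lap (fun x => cut n R x ^ (k + 2)) x * F (Fin.last n) := by
  have h1 := pz_zfun (n := n) (hasDerivAt_cut_pow k R)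
  have h2 : pz (fun x : Space n => cut n R x ^ (k + 2)) = _ := h1
  have h := sum_pd_zfun_mul (n := n) (hasDerivAt_cut_pow' k R) F x
  rw [h2, lap_cut_pow]
  exact h

end cutpow

/-! ### Interpolation inequalities -/

theorem lap_sq {a : Space n → ℝ} (ha : SP a) (x : Space n) :
    lap (fun x => a x ^ 2) x = 2 * (a x * lap a x) + 2 * gradSq a x := by
  have : (fun x => a x ^ 2) = fun x => a x * a x := by ext; ring
  rw [this, lap_mul ha ha]
  simp only [gradSq, pow_two]
  ring

/-- Integrate Δ(a²) = 2aΔa + 2|∇a|² against F and move the Laplacian onto F. The error then contains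
a² and not ∇a, so nothing need be known about the gradient beforehand. -/
theorem IsTestFunction.integral_mul_gradSq {F a : Space n → ℝ} (hF : IsTestFunction F) (ha : SP a) :
    ∫ x, F x * CahnHilliard.gradSq a x ∂(stripMeasure n) =
      - ∫ x, F x * (a x * CahnHilliard.lap a x) ∂(stripMeasure n) +
        1 / 2 * ∫ x, CahnHilliard.lap F x * a x ^ 2 ∂(stripMeasure n) := by
  have h := hF.integral_mul_lap' (ha.pow 2)
  have h2 : ∀ x, F x * CahnHilliard.lap (fun x => a x ^ 2) x =
      2 * (F x * (a x * CahnHilliard.lap a x)) + 2 * (F x * CahnHilliard.gradSq a x) := by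
    intro x; rw [lap_sq ha]; ring
  simp only [h2] at h
  rw [integral_add, integral_const_mul, integral_const_mul] at h
  · linarith
  · exact ((hF.mul (ha.mul ha.lap)).const_mul 2).integrable
  · exact ((hF.mul ha.gradSq).const_mul 2).integrable

theorem lintegral_ofReal_eq {X : Type*} [MeasurableSpace X] {m : Measure X} {f : X → ℝ}
    (hf : Integrable f m) (h0 : ∀ x, 0 ≤ f x) :
    ∫⁻ x, ENNReal.ofReal (f x) ∂m = ENNReal.ofReal (∫ x, f x ∂m) :=
  (ofReal_integral_eq_lintegral_ofReal hf (Filter.Eventually.of_forall h0)).symm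

/-- Young's inequality in -∫aΔa, localized. Once R ≥ 16K²/l the derivatives of the weight contribute
at most (l/2)a². Working in [0,∞] makes the statement free of integrability hypotheses; the
parameter l is optimized later. -/
theorem lintegral_gradSq_le {a : Space n → ℝ} (ha : SP a) {l : ℝ} (hl : 0 < l) :
    ∫⁻ x, ENNReal.ofReal (gradSq a x) ∂(stripMeasure n) ≤
      ENNReal.ofReal l * ∫⁻ x, ENNReal.ofReal (a x ^ 2) ∂(stripMeasure n) +
      ENNReal.ofReal l⁻¹ * ∫⁻ x, ENNReal.ofReal (lap a x ^ 2) ∂(stripMeasure n) := by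
  by_cases hA : ∫⁻ x, ENNReal.ofReal (a x ^ 2) ∂(stripMeasure n) = ⊤
  · rw [hA, ENNReal.mul_top (by simpa using hl)]; simp
  by_cases hB : ∫⁻ x, ENNReal.ofReal (lap a x ^ 2) ∂(stripMeasure n) = ⊤
  · rw [hB, ENNReal.mul_top (by simpa using hl)]; simp
  have iA : Integrable (fun x => a x ^ 2) (stripMeasure n) :=
    integrable_of_lintegral_le (ha.pow 2).continuous.aestronglyMeasurable (fun _ => sq_nonneg _)
      (lt_top_iff_ne_top.2 hA)
  have iB : Integrable (fun x => lap a x ^ 2) (stripMeasure n) :=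
    integrable_of_lintegral_le (ha.lap.pow 2).continuous.aestronglyMeasurable (fun _ => sq_nonneg _)
      (lt_top_iff_ne_top.2 hB)
  rw [lintegral_ofReal_eq iA fun _ => sq_nonneg _, lintegral_ofReal_eq iB fun _ => sq_nonneg _,
    ← ENNReal.ofReal_mul hl.le, ← ENNReal.ofReal_mul (inv_pos.2 hl).le,
    ← ENNReal.ofReal_add (mul_nonneg hl.le (integral_nonneg fun _ => sq_nonneg _))
      (mul_nonneg (inv_pos.2 hl).le (integral_nonneg fun _ => sq_nonneg _))]
  refine lintegral_strip_le (R₀ := 16 * cutK ^ 2 / l) ha.gradSq.continuous (gradSq_nonneg a) fun R hR1 hR => ?_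
  have hR0 : 0 < R := by linarith
  have hF := isTestFunction_wt (n := n) hR0
  rw [hF.integral_mul_gradSq ha, ← integral_neg, ← integral_const_mul,
    ← integral_add (hF.mul (ha.mul ha.lap)).neg.integrable
      ((hF.lap.mul (ha.pow 2)).const_mul _).integrable, ← integral_const_mul, ← integral_const_mul,
    ← integral_add (iA.const_mul _) (iB.const_mul _)]
  refine integral_mono (((hF.mul (ha.mul ha.lap)).neg).add
      ((hF.lap.mul (ha.pow 2)).const_mul _)).integrable ((iA.const_mul _).add (iB.const_mul _)) fun x => ?_
  have h1 := abs_lap_cut_pow_le (n := n) 2 hR0 x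
  have h2 : |lap (wt n R) x| ≤ l := by
    refine h1.trans ?_
    have h3 : cut n R x ^ 2 ≤ 1 := pow_le_one₀ (cut_nonneg R x) (cut_le_one R x)
    have h4 : (((2 : ℕ) + 2 : ℝ) * cutK) ^ 2 / R ^ 2 ≤ l := by
      rw [div_le_iff₀ hl] at hR
      rw [div_le_iff₀ (by positivity)]
      push_cast
      nlinarith [mul_le_mul_of_nonneg_left hR1 (mul_nonneg hl.le hR0.le)]
    calc _ ≤ l * 1 := mul_le_mul h4 h3 (sq_nonneg _) hl.le
      _ = l := mul_one l
  have h5 : wt n R x * |a x * lap a x| ≤ 1 / 2 * (l * a x ^ 2 + l⁻¹ * lap a x ^ 2) := by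
    have h6 : |a x * lap a x| ≤ 1 / 2 * (l * a x ^ 2 + l⁻¹ * lap a x ^ 2) := by
      rw [abs_mul, ← sq_abs (a x), ← sq_abs (lap a x)]
      have h7 : 0 ≤ l⁻¹ * (l * |a x| - |lap a x|) ^ 2 := mul_nonneg (inv_pos.2 hl).le (sq_nonneg _)
      have h8 : l⁻¹ * (l * |a x| - |lap a x|) ^ 2 =
          l * |a x| ^ 2 + l⁻¹ * |lap a x| ^ 2 - 2 * (|a x| * |lap a x|) := by
        field_simp; ring
      linarith
    exact (mul_le_of_le_one_left (abs_nonneg _) (wt_le_one R x)).trans h6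
  have h9 : -(wt n R x * (a x * lap a x)) ≤ wt n R x * |a x * lap a x| := by
    rw [← mul_neg]
    exact mul_le_mul_of_nonneg_left (neg_le_abs _) (wt_nonneg _ _)
  have h10 : lap (wt n R) x * a x ^ 2 ≤ l * a x ^ 2 :=
    mul_le_mul_of_nonneg_right ((le_abs_self _).trans h2) (sq_nonneg _)
  have h11 : 0 ≤ l⁻¹ * lap a x ^ 2 := mul_nonneg (inv_pos.2 hl).le (sq_nonneg _)
  simp only
  linarith

/-- The gradient formula applied to each ∂_j a, followed by one integration by parts in Δ∂_j a =
∂_jΔa, trades the Hessian for (Δa)² up to terms carrying derivatives of the cutoff. -/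
theorem integral_mul_hessSq {a : Space n → ℝ} (ha : SP a) (k : ℕ) {R : ℝ} (hR : 0 < R) :
    ∫ x, cut n R x ^ (k + 2) * (∑ j, gradSq (pd j a) x) ∂(stripMeasure n) =
      ∫ x, (cut n R x ^ (k + 2) * lap a x ^ 2 + pz (fun x => cut n R x ^ (k + 2)) x * (pz a x * lap a x)
        + 1 / 2 * (lap (fun x => cut n R x ^ (k + 2)) x * gradSq a x)) ∂(stripMeasure n) := by
  set F : Space n → ℝ := fun x => cut n R x ^ (k + 2) with hFdef
  have hF : IsTestFunction F := (isTestFunction_cut hR).pow (k + 1)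
  have h1 : ∀ j, ∫ x, F x * gradSq (pd j a) x ∂(stripMeasure n) =
      ∫ x, (pd j F x * pd j a x * lap a x + F x * pd j (pd j a) x * lap a x +
        1 / 2 * (lap F x * pd j a x ^ 2)) ∂(stripMeasure n) := by
    intro j
    rw [hF.integral_mul_gradSq (ha.pd j)]
    have h2 := (hF.mul (ha.pd j)).integral_mul_pd ha.lap j
    rw [pd_lap j ha, pd_mul j hF.sp (ha.pd j)] at h2
    have h3 : ∀ x, F x * (pd j a x * lap (pd j a) x) = F x * pd j a x * lap (pd j a) x := by
      intro x; ring
    simp only [h3]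
    rw [h2, neg_neg, ← integral_const_mul, ← integral_add]
    · refine integral_congr_ae (Filter.Eventually.of_forall fun x => ?_)
      simp only; ring
    · exact (((hF.mul ((ha.pd j).pd j)).add ((hF.pd j).mul (ha.pd j))).mul ha.lap).integrable
    · exact ((hF.lap.mul ((ha.pd j).pow 2)).const_mul _).integrable
  have h4 : ∀ x, F x * (∑ j, gradSq (pd j a) x) = ∑ j, F x * gradSq (pd j a) x := fun x => by
    rw [Finset.mul_sum]
  change ∫ x, F x * (∑ j, gradSq (pd j a) x) ∂(stripMeasure n) = _
  simp only [h4]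
  rw [integral_finsetSum _ fun j _ => (hF.mul (ha.pd j).gradSq).integrable]
  simp only [h1]
  rw [← integral_finsetSum]
  · refine integral_congr_ae (Filter.Eventually.of_forall fun x => ?_)
    simp only [Finset.sum_add_distrib]
    congr 1
    · rw [add_comm]
      congr 1
      · simp only [mul_assoc, ← Finset.mul_sum]
        rw [← Finset.sum_mul]
        simp only [lap, pow_two, hFdef]
      · simp only [mul_assoc]
        rw [hFdef, sum_pd_cut_pow_mul]
        rfl
    · rw [← Finset.mul_sum, ← Finset.mul_sum]
      rfl
  · intro j _
    exact (((((hF.pd j).mul (ha.pd j)).mul ha.lap).add ((hF.mul ((ha.pd j).pd j)).mul ha.lap)).add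
      ((hF.lap.mul ((ha.pd j).pow 2)).const_mul _)).integrable

theorem lintegral_hessSq_le {a : Space n → ℝ} (ha : SP a) :
    ∫⁻ x, ENNReal.ofReal (∑ j, gradSq (pd j a) x) ∂(stripMeasure n) ≤
      ENNReal.ofReal (32 * cutK ^ 2) * (∫⁻ x, ENNReal.ofReal (a x ^ 2) ∂(stripMeasure n) +
       ∫⁻ x, ENNReal.ofReal (lap a x ^ 2) ∂(stripMeasure n)) := by
  have hK := one_le_cutK
  have hK2 : 0 < 32 * cutK ^ 2 := by positivity
  by_cases hA : ∫⁻ x, ENNReal.ofReal (a x ^ 2) ∂(stripMeasure n) = ⊤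
  · rw [hA, top_add, ENNReal.mul_top (by simpa using by positivity)]; simp
  by_cases hB : ∫⁻ x, ENNReal.ofReal (lap a x ^ 2) ∂(stripMeasure n) = ⊤
  · rw [hB, add_top, ENNReal.mul_top (by simpa using by positivity)]; simp
  have iA : Integrable (fun x => a x ^ 2) (stripMeasure n) :=
    integrable_of_lintegral_le (ha.pow 2).continuous.aestronglyMeasurable (fun _ => sq_nonneg _)
      (lt_top_iff_ne_top.2 hA)
  have iB : Integrable (fun x => lap a x ^ 2) (stripMeasure n) :=
    integrable_of_lintegral_le (ha.lap.pow 2).continuous.aestronglyMeasurable (fun _ => sq_nonneg _)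
      (lt_top_iff_ne_top.2 hB)
  have hG := lintegral_gradSq_le ha (l := 1) one_pos
  have iG : Integrable (gradSq a) (stripMeasure n) := by
    refine integrable_of_lintegral_le ha.gradSq.continuous.aestronglyMeasurable (gradSq_nonneg a)
      (hG.trans_lt ?_)
    simp only [ENNReal.ofReal_one, one_mul, inv_one]
    exact ENNReal.add_lt_top.2 ⟨lt_top_iff_ne_top.2 hA, lt_top_iff_ne_top.2 hB⟩
  simp only [ENNReal.ofReal_one, one_mul, inv_one] at hG
  have nA : 0 ≤ ∫ x, a x ^ 2 ∂(stripMeasure n) := integral_nonneg fun _ => sq_nonneg _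
  have nB : 0 ≤ ∫ x, lap a x ^ 2 ∂(stripMeasure n) := integral_nonneg fun _ => sq_nonneg _
  rw [lintegral_ofReal_eq iA fun _ => sq_nonneg _, lintegral_ofReal_eq iB fun _ => sq_nonneg _,
    lintegral_ofReal_eq iG (gradSq_nonneg a), ← ENNReal.ofReal_add nA nB,
    ENNReal.ofReal_le_ofReal_iff (add_nonneg nA nB)] at hG
  rw [lintegral_ofReal_eq iA fun _ => sq_nonneg _, lintegral_ofReal_eq iB fun _ => sq_nonneg _,
    ← ENNReal.ofReal_add nA nB, ← ENNReal.ofReal_mul hK2.le]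
  refine lintegral_strip_le (R₀ := 1) (SP.sum fun j => (ha.pd j).gradSq).continuous
    (fun x => Finset.sum_nonneg fun j _ => gradSq_nonneg _ _) fun R hR1 _ => ?_
  have hR0 : 0 < R := by linarith
  have hbound : ∫ x, wt n R x * (∑ j, gradSq (pd j a) x) ∂(stripMeasure n) ≤
      ∫ x, ((1 + 2 * cutK) * lap a x ^ 2 + (2 * cutK + 8 * cutK ^ 2) * gradSq a x) ∂(stripMeasure n) := by
    refine (integral_mul_hessSq ha 2 hR0).trans_le ?_
    have hF : IsTestFunction (fun x : Space n => cut n R x ^ (2 + 2)) := isTestFunction_wt hR0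
    refine integral_mono (((hF.mul (ha.lap.pow 2)).add ((hF.pd _).mul (ha.pz.mul ha.lap))).add
      ((hF.lap.mul ha.gradSq).const_mul _)).integrable ((iB.const_mul _).add (iG.const_mul _)) fun x => ?_
    have h1 := abs_pz_cut_pow_le (n := n) 2 hR0 x
    have h2 := abs_lap_cut_pow_le (n := n) 2 hR0 x
    have hc3 : cut n R x ^ 3 ≤ 1 := pow_le_one₀ (cut_nonneg R x) (cut_le_one R x)
    have hc2 : cut n R x ^ 2 ≤ 1 := pow_le_one₀ (cut_nonneg R x) (cut_le_one R x)
    have hc4 : cut n R x ^ (2 + 2) ≤ 1 := pow_le_one₀ (cut_nonneg R x) (cut_le_one R x)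
    have h1' : |pz (fun x => cut n R x ^ (2 + 2)) x| ≤ 4 * cutK := by
      refine h1.trans ?_
      have : (((2 : ℕ) : ℝ) + 2) * cutK / R ≤ 4 * cutK := by
        rw [div_le_iff₀ hR0]; push_cast; nlinarith
      calc _ ≤ 4 * cutK * 1 := mul_le_mul this hc3 (pow_nonneg (cut_nonneg _ _) _) (by positivity)
        _ = _ := mul_one _
    have h2' : |lap (fun x => cut n R x ^ (2 + 2)) x| ≤ 16 * cutK ^ 2 := by
      refine h2.trans ?_
      have : ((((2 : ℕ) : ℝ) + 2) * cutK) ^ 2 / R ^ 2 ≤ 16 * cutK ^ 2 := by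
        rw [div_le_iff₀ (by positivity)]; push_cast
        have : 1 ≤ R ^ 2 := one_le_pow₀ hR1
        nlinarith [sq_nonneg cutK]
      calc _ ≤ 16 * cutK ^ 2 * 1 := mul_le_mul this hc2 (pow_nonneg (cut_nonneg _ _) _) (by positivity)
        _ = _ := mul_one _
    have h3 : pz (fun x => cut n R x ^ (2 + 2)) x * (pz a x * lap a x) ≤
        4 * cutK * (1 / 2 * (gradSq a x + lap a x ^ 2)) := by
      refine (le_abs_self _).trans ?_
      rw [abs_mul]
      refine mul_le_mul h1' ?_ (abs_nonneg _) (by positivity)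
      have := pd_sq_le_gradSq a (Fin.last n) x
      rw [abs_mul]
      change pz a x ^ 2 ≤ _ at this
      nlinarith [sq_abs (pz a x), sq_abs (lap a x), sq_nonneg (|pz a x| - |lap a x|)]
    have h4 : lap (fun x => cut n R x ^ (2 + 2)) x * gradSq a x ≤ 16 * cutK ^ 2 * gradSq a x :=
      mul_le_mul_of_nonneg_right ((le_abs_self _).trans h2') (gradSq_nonneg _ _)
    have h6 : cut n R x ^ (2 + 2) * lap a x ^ 2 ≤ lap a x ^ 2 :=
      mul_le_of_le_one_left (sq_nonneg _) hc4
    simp only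
    linear_combination h3 + 1 / 2 * h4 + h6
  refine hbound.trans ?_
  rw [integral_add (iB.const_mul _) (iG.const_mul _), integral_const_mul, integral_const_mul]
  nlinarith [mul_nonneg (sub_nonneg.2 hK) nA, mul_nonneg (sub_nonneg.2 hK) nB,
    mul_nonneg (mul_nonneg (sub_nonneg.2 hK) (sub_nonneg.2 hK)) nB,
    mul_nonneg (mul_nonneg (sub_nonneg.2 hK) (sub_nonneg.2 hK)) nA, mul_le_mul_of_nonneg_left hG
    (by positivity : 0 ≤ 2 * cutK + 8 * cutK ^ 2)]

/-! ### The localized energy inequality for fourth order equations -/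

theorem isTestFunction_cut_sq {R : ℝ} (hR : 0 < R) : IsTestFunction (fun x : Space n => cut n R x ^ 2) :=
  (isTestFunction_cut hR).pow 1

theorem le_cut_two_mul {R : ℝ} (hR : 0 < R) (x : Space n) {y : ℝ} (hy : y ≤ 1)
    (h : 2 * R < |zCoord x| → y ≤ 0) : y ≤ cut n (2 * R) x := by
  by_cases hx : |zCoord x| ≤ 2 * R
  · rwa [cut_eq_one (by positivity) hx]
  · exact (h (not_le.1 hx)).trans (cut_nonneg _ _)

theorem abs_lap_cut_sq_le {R : ℝ} (hR : 1 ≤ R) (x : Space n) :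
    |lap (fun x => cut n R x ^ 2) x| ≤ 4 * cutK ^ 2 * cut n (2 * R) x := by
  have hR0 : 0 < R := by linarith
  have h := abs_lap_cut_pow_le (n := n) 0 hR0 x
  have hK := one_le_cutK
  by_cases hx : |zCoord x| ≤ 2 * R
  · rw [cut_eq_one (by positivity) hx]
    refine h.trans ?_
    rw [pow_zero, mul_one, mul_one, div_le_iff₀ (by positivity)]
    have : 1 ≤ R ^ 2 := one_le_pow₀ hR
    push_cast
    nlinarith [sq_nonneg cutK]
  · have : (fun x : Space n => cut n R x ^ 2) =ᶠ[nhds x] fun _ => 0 := by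
      filter_upwards [(isOpen_lt continuous_const continuous_zCoord.abs).mem_nhds (not_le.1 hx)] with y hy
      rw [cut_eq_zero hR0 (le_of_lt hy)]; ring
    have h0 : lap (fun x : Space n => cut n R x ^ 2) x = 0 := by
      refine Finset.sum_eq_zero fun i _ => ?_
      have h1 : pd i (fun x : Space n => cut n R x ^ 2) =ᶠ[nhds x] fun _ => 0 := by
        filter_upwards [this.eventuallyEq_nhds] with y hy
        simp [pd, hy.fderiv_eq]
      simp [pd, h1.fderiv_eq]
    rw [h0, abs_zero]
    exact mul_nonneg (by positivity) (cut_nonneg _ _)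

/-- The weight cut² is the geometric mean of cut⁴, which goes with (Δa)², and of 1. The wider cutoff
at scale 2R equals one on the support of the narrow one and collects the remaining a². -/
theorem integral_cut_sq_gradSq_le {a : Space n → ℝ} (ha : SP a) {R : ℝ} (hR : 1 ≤ R) :
    ∫ x, cut n R x ^ 2 * gradSq a x ∂(stripMeasure n) ≤
      1 / 2 * ∫ x, wt n R x * lap a x ^ 2 ∂(stripMeasure n) +
        (1 / 2 + 2 * cutK ^ 2) * ∫ x, cut n (2 * R) x * a x ^ 2 ∂(stripMeasure n) := by
  have hR0 : 0 < R := by linarith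
  have hF := isTestFunction_cut_sq (n := n) hR0
  rw [hF.integral_mul_gradSq ha, ← integral_neg, ← integral_const_mul,
    ← integral_add (hF.mul (ha.mul ha.lap)).neg.integrable
      ((hF.lap.mul (ha.pow 2)).const_mul _).integrable, ← integral_const_mul, ← integral_const_mul,
    ← integral_add (((isTestFunction_wt hR0).mul (ha.lap.pow 2)).const_mul _).integrable
      (((isTestFunction_cut (by positivity)).mul (ha.pow 2)).const_mul _).integrable]
  refine integral_mono (((hF.mul (ha.mul ha.lap)).neg).add
      ((hF.lap.mul (ha.pow 2)).const_mul _)).integrable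
      ((((isTestFunction_wt hR0).mul (ha.lap.pow 2)).const_mul _).add
      (((isTestFunction_cut (by positivity)).mul (ha.pow 2)).const_mul _)).integrable fun x => ?_
  simp only
  have h1 : lap (fun x => cut n R x ^ 2) x * a x ^ 2 ≤ 4 * cutK ^ 2 * cut n (2 * R) x * a x ^ 2 :=
    mul_le_mul_of_nonneg_right ((le_abs_self _).trans (abs_lap_cut_sq_le hR x)) (sq_nonneg _)
  have h2 : 1 ≤ cut n (2 * R) x ∨ cut n R x = 0 := by
    by_cases hx : |zCoord x| ≤ 2 * R
    · left; rw [cut_eq_one (by positivity) hx]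
    · right; exact cut_eq_zero hR0 (not_le.1 hx).le
  have h3 : -(cut n R x ^ 2 * (a x * lap a x)) ≤ 1 / 2 * (wt n R x * lap a x ^ 2) +
      1 / 2 * (cut n (2 * R) x * a x ^ 2) := by
    have h4 : a x ^ 2 ≤ cut n (2 * R) x * a x ^ 2 ∨ cut n R x = 0 := by
      rcases h2 with h2 | h2
      · left; nlinarith [sq_nonneg (a x)]
      · right; exact h2
    rcases h4 with h4 | h4
    · unfold wt
      nlinarith [sq_nonneg (cut n R x ^ 2 * lap a x + a x)]
    · unfold wt
      rw [h4]
      have := mul_nonneg (cut_nonneg (2 * R) x) (sq_nonneg (a x))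
      nlinarith
  linear_combination h3 + 1 / 2 * h1

/-- The constant in the localized energy inequality. -/
def energyC (M : ℝ) : ℝ := 4 * M ^ 2 + 16 * cutK ^ 2 * (2 + M + M ^ 2 + 2 * cutK ^ 2)

theorem energyC_nonneg {M : ℝ} (hM : 0 ≤ M) : 0 ≤ energyC M := by
  unfold energyC; have := one_le_cutK; positivity

/-- The pointwise Young inequalities behind the localized energy estimate. Here s is the cutoff, l =
Δa, p = ∂_z a, G = |∇a|², p₁ and p₂ are the first and second z-derivatives of s⁴, X is a² times the
wider cutoff, and κ is of order 1/R. -/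
theorem localized_energy_pointwise {κ M s a l p g h p₁ p₂ G X : ℝ} (hκ0 : 0 ≤ κ) (hM : 0 ≤ M)
    (hs0 : 0 ≤ s) (hg : |g| ≤ M * |a|) (hh : |h| ≤ M * |l|) (b1 : |p₁| ≤ κ / 2 * s ^ 3)
    (b2 : |p₂| ≤ κ * s ^ 2) (hPg : p ^ 2 ≤ G) (hX0 : 0 ≤ X) (hξA : s ^ 2 * a ^ 2 ≤ X)
    (hξA' : s ^ 2 * (|a| * |l|) ≤ 1 / 2 * (s ^ 4 * l ^ 2) + 1 / 2 * X) :
    -((s ^ 4 * l + 2 * (p₁ * p) + p₂ * a) * l) + s ^ 4 * a * h +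
      (s ^ 4 * l + 2 * (p₁ * p) + p₂ * a) * g ≤
    (- (3 / 4) + κ) * (s ^ 4 * l ^ 2) + (4 * M ^ 2 + κ * M ^ 2) * (s ^ 4 * a ^ 2) +
      κ * (s ^ 2 * G) + κ * (1 + M) * X := by
  set A := |a| with hA
  set L := |l| with hL
  set P := |p| with hP
  have hA0 : 0 ≤ A := abs_nonneg _
  have hL0 : 0 ≤ L := abs_nonneg _
  have hP0 : 0 ≤ P := abs_nonneg _
  have hL2 : l ^ 2 = L ^ 2 := by rw [hL, sq_abs]
  have hA2 : a ^ 2 = A ^ 2 := by rw [hA, sq_abs]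
  rw [← sq_abs p] at hPg
  rw [hL2] at hξA'
  rw [hA2] at hξA
  have hs4 := pow_nonneg hs0 4
  have r1 : -(2 * (p₁ * p * l)) ≤ κ * (s ^ 3 * P * L) := by
    have : |p₁ * p * l| ≤ κ / 2 * s ^ 3 * P * L := by
      rw [abs_mul, abs_mul]; gcongr
    linarith [neg_abs_le (p₁ * p * l)]
  have r2 : -(p₂ * a * l) ≤ κ * (s ^ 2 * (A * L)) := by
    have : |p₂ * a * l| ≤ κ * s ^ 2 * A * L := by
      rw [abs_mul, abs_mul]; gcongr
    linarith [neg_abs_le (p₂ * a * l)]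
  have t2 : s ^ 4 * a * h ≤ s ^ 4 * (M * (A * L)) := by
    have : |s ^ 4 * a * h| ≤ s ^ 4 * A * (M * L) := by
      rw [abs_mul, abs_mul, abs_of_nonneg hs4]
      gcongr
    linarith [le_abs_self (s ^ 4 * a * h)]
  have q0 : s ^ 4 * l * g ≤ s ^ 4 * (M * (A * L)) := by
    have : |s ^ 4 * l * g| ≤ s ^ 4 * L * (M * A) := by
      rw [abs_mul, abs_mul, abs_of_nonneg hs4]
      gcongr
    linarith [le_abs_self (s ^ 4 * l * g)]
  have q1 : 2 * (p₁ * p * g) ≤ κ * (M * (s ^ 3 * P * A)) := by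
    have : |p₁ * p * g| ≤ κ / 2 * s ^ 3 * P * (M * A) := by
      rw [abs_mul, abs_mul]; gcongr
    linarith [le_abs_self (p₁ * p * g)]
  have q2 : p₂ * a * g ≤ κ * M * (s ^ 2 * A ^ 2) := by
    have : |p₂ * a * g| ≤ κ * s ^ 2 * A * (M * A) := by
      rw [abs_mul, abs_mul]; gcongr
    linarith [le_abs_self (p₂ * a * g)]
  have u0 : s ^ 2 * P ^ 2 ≤ s ^ 2 * G := mul_le_mul_of_nonneg_left hPg (sq_nonneg s)
  have u1 : s ^ 3 * P * L ≤ 1 / 2 * (s ^ 4 * L ^ 2) + 1 / 2 * (s ^ 2 * G) := by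
    linear_combination 1 / 2 * sq_nonneg (s ^ 2 * L - s * P) + 1 / 2 * u0
  have u2 : M * (s ^ 3 * P * A) ≤ 1 / 2 * M ^ 2 * (s ^ 4 * A ^ 2) + 1 / 2 * (s ^ 2 * G) := by
    linear_combination 1 / 2 * sq_nonneg (M * s ^ 2 * A - s * P) + 1 / 2 * u0
  have u3 : 2 * (s ^ 4 * (M * (A * L))) ≤ 1 / 4 * (s ^ 4 * L ^ 2) + 4 * M ^ 2 * (s ^ 4 * A ^ 2) := by
    linear_combination sq_nonneg (s ^ 2 * (1 / 2 * L - 2 * M * A))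
  have hpos : 0 ≤ κ * M ^ 2 * (s ^ 4 * A ^ 2) := by positivity
  have v1 := mul_le_mul_of_nonneg_left u1 hκ0
  have v2 := mul_le_mul_of_nonneg_left u2 hκ0
  have v3 := mul_le_mul_of_nonneg_left hξA' hκ0
  have v4 := mul_le_mul_of_nonneg_left hξA (mul_nonneg hκ0 hM)
  have v5 : 0 ≤ κ * X := mul_nonneg hκ0 hX0
  have w0 : s ^ 4 * l * l = s ^ 4 * L ^ 2 := by rw [← hL2]; ring
  rw [hA2, hL2]
  linear_combination r1 + r2 + t2 + q0 + q1 + q2 + v1 + v2 + v3 + v4 + u3 + 1 / 2 * hpos + 1 / 2 * v5 - w0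

/-- Test with wt·a and move one Laplacian onto this product. The leading term is -wt(Δa)²; g and h
are absorbed at the price of a². The condition on R makes κ ≤ 1/6, whence the coefficient -3/4 +
3κ/2 ≤ -1/2. The factor 1/R in the last term is essential: it allows the integral of a² at scale 2R
to grow linearly. -/
theorem localized_energy_inequality {M : ℝ} (hM : 0 ≤ M) {R : ℝ} (hR : 96 * cutK ^ 2 ≤ R)
    {a g h : Space n → ℝ} (ha : SP a) (hg : SP g) (hh : SP h) (hgM : ∀ x, |g x| ≤ M * |a x|)
    (hhM : ∀ x, |h x| ≤ M * |lap a x|) :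
    ∫ x, wt n R x * (a x * (- lap (lap a) x + h x + lap g x)) ∂(stripMeasure n) ≤
      - (1 / 2) * ∫ x, wt n R x * lap a x ^ 2 ∂(stripMeasure n) +
      energyC M * ∫ x, wt n R x * a x ^ 2 ∂(stripMeasure n) +
      energyC M / R * ∫ x, cut n (2 * R) x * a x ^ 2 ∂(stripMeasure n) := by
  have hK := one_le_cutK
  have hR1 : 1 ≤ R := by nlinarith
  have hR0 : 0 < R := by linarith
  have hF := isTestFunction_wt (n := n) hR0
  have hξ := isTestFunction_cut (n := n) (R := 2 * R) (by positivity)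
  have hζ := isTestFunction_cut_sq (n := n) hR0
  set κ : ℝ := 16 * cutK ^ 2 / R with hκ
  have hκ0 : 0 ≤ κ := by positivity
  have hκ6 : κ ≤ 1 / 6 := by rw [hκ, div_le_iff₀ hR0]; linarith
  have e1 : ∫ x, wt n R x * (a x * (- lap (lap a) x + h x + lap g x)) ∂(stripMeasure n) =
      ∫ x, (- (lap (fun x => wt n R x * a x) x * lap a x) + wt n R x * a x * h x +
        lap (fun x => wt n R x * a x) x * g x) ∂(stripMeasure n) := by
    have hFa := hF.mul ha
    have i1 := hFa.integral_mul_lap' ha.lap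
    have i2 := hFa.integral_mul_lap' hg
    rw [integral_add (((hFa.lap.mul ha.lap).neg).add (hFa.mul hh)).integrable (hFa.lap.mul hg).integrable,
      integral_add (hFa.lap.mul ha.lap).neg.integrable (hFa.mul hh).integrable, integral_neg,
      ← i1, ← i2, ← integral_neg, ← integral_add (hFa.mul ha.lap.lap).neg.integrable (hFa.mul hh).integrable,
      ← integral_add ((hFa.mul ha.lap.lap).neg.add (hFa.mul hh)).integrable (hFa.mul hg.lap).integrable]
    refine integral_congr_ae (Filter.Eventually.of_forall fun x => ?_)
    simp only; ring
  have hpt : ∀ x, - (lap (fun x => wt n R x * a x) x * lap a x) + wt n R x * a x * h x +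
        lap (fun x => wt n R x * a x) x * g x ≤
      (- (3 / 4) + κ) * (wt n R x * lap a x ^ 2) + (4 * M ^ 2 + κ * M ^ 2) * (wt n R x * a x ^ 2) +
      κ * (cut n R x ^ 2 * gradSq a x) + κ * (1 + M) * (cut n (2 * R) x * a x ^ 2) := by
    intro x
    have hl : lap (fun x => wt n R x * a x) x =
        wt n R x * lap a x + 2 * (pz (wt n R) x * pz a x) + lap (wt n R) x * a x := by
      rw [lap_mul hF.sp ha]
      simp only
      congr 3
      exact sum_pd_cut_pow_mul 2 (fun i => pd i a x) x
    set s := cut n R x with hs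
    have hs0 : 0 ≤ s := cut_nonneg R x
    have hs1 : s ≤ 1 := cut_le_one R x
    have hwt : wt n R x = s ^ 4 := rfl
    have b1 : |pz (wt n R) x| ≤ κ / 2 * s ^ 3 := by
      refine (abs_pz_cut_pow_le (n := n) 2 hR0 x).trans ?_
      refine mul_le_mul_of_nonneg_right ?_ (pow_nonneg hs0 3)
      rw [hκ, div_div, mul_comm R 2, ← div_div]
      refine div_le_div_of_nonneg_right ?_ hR0.le
      push_cast; nlinarith
    have b2 : |lap (wt n R) x| ≤ κ * s ^ 2 := by
      refine (abs_lap_cut_pow_le (n := n) 2 hR0 x).trans ?_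
      refine mul_le_mul_of_nonneg_right ?_ (pow_nonneg hs0 2)
      rw [hκ]
      have : (((2 : ℕ) + 2 : ℝ) * cutK) ^ 2 = 16 * cutK ^ 2 := by push_cast; ring
      rw [this]
      refine div_le_div_of_nonneg_left (by positivity) hR0 ?_
      nlinarith
    have hPg : pz a x ^ 2 ≤ gradSq a x := pd_sq_le_gradSq a _ x
    have hX0 : 0 ≤ cut n (2 * R) x * a x ^ 2 := mul_nonneg (cut_nonneg _ _) (sq_nonneg _)
    have hξA : s ^ 2 * a x ^ 2 ≤ cut n (2 * R) x * a x ^ 2 := by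
      refine mul_le_mul_of_nonneg_right ?_ (sq_nonneg _)
      refine le_cut_two_mul hR0 x (pow_le_one₀ hs0 hs1) fun hx => ?_
      rw [hs, cut_eq_zero hR0 hx.le]; simp
    have hξA' : s ^ 2 * (|a x| * |lap a x|) ≤
        1 / 2 * (s ^ 4 * lap a x ^ 2) + 1 / 2 * (cut n (2 * R) x * a x ^ 2) := by
      rcases hs0.eq_or_lt with h0 | h0
      · rw [← h0]
        simp; linarith
      · have : |a x| ^ 2 ≤ cut n (2 * R) x * a x ^ 2 := by
          rw [cut_eq_one (by positivity), one_mul, sq_abs]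
          by_contra hx
          rw [hs, cut_eq_zero hR0 (not_le.1 hx).le] at h0
          exact lt_irrefl _ h0
        rw [← sq_abs (lap a x)]
        nlinarith [sq_nonneg (s ^ 2 * |lap a x| - |a x|)]
    rw [hl, hwt]
    exact localized_energy_pointwise hκ0 hM hs0 (hgM x) (hhM x) b1 b2 hPg hX0 hξA hξA'
  have iW := (hF.mul (ha.lap.pow 2))
  have iA := (hF.mul (ha.pow 2))
  have iG := (hζ.mul ha.gradSq)
  have iX := (hξ.mul (ha.pow 2))
  have hint : ∫ x, wt n R x * (a x * (- lap (lap a) x + h x + lap g x)) ∂(stripMeasure n) ≤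
      (- (3 / 4) + κ) * ∫ x, wt n R x * lap a x ^ 2 ∂(stripMeasure n) +
      (4 * M ^ 2 + κ * M ^ 2) * ∫ x, wt n R x * a x ^ 2 ∂(stripMeasure n) +
      κ * ∫ x, cut n R x ^ 2 * gradSq a x ∂(stripMeasure n) +
      κ * (1 + M) * ∫ x, cut n (2 * R) x * a x ^ 2 ∂(stripMeasure n) := by
    rw [e1, ← integral_const_mul, ← integral_const_mul, ← integral_const_mul, ← integral_const_mul,
      ← integral_add (iW.const_mul _).integrable (iA.const_mul _).integrable,
      ← integral_add ((iW.const_mul _).add (iA.const_mul _)).integrable (iG.const_mul _).integrable,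
      ← integral_add (((iW.const_mul _).add (iA.const_mul _)).add (iG.const_mul _)).integrable
        (iX.const_mul _).integrable]
    have hFa := hF.mul ha
    exact integral_mono (((hFa.lap.mul ha.lap).neg.add (hFa.mul hh)).add (hFa.lap.mul hg)).integrable
      ((((iW.const_mul _).add (iA.const_mul _)).add (iG.const_mul _)).add (iX.const_mul _)).integrable hpt
  refine hint.trans ?_
  have hG := integral_cut_sq_gradSq_le ha hR1
  have nW : 0 ≤ ∫ x, wt n R x * lap a x ^ 2 ∂(stripMeasure n) :=
    integral_nonneg fun x => mul_nonneg (wt_nonneg _ _) (sq_nonneg _)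
  have nA : 0 ≤ ∫ x, wt n R x * a x ^ 2 ∂(stripMeasure n) :=
    integral_nonneg fun x => mul_nonneg (wt_nonneg _ _) (sq_nonneg _)
  have nX : 0 ≤ ∫ x, cut n (2 * R) x * a x ^ 2 ∂(stripMeasure n) :=
    integral_nonneg fun x => mul_nonneg (cut_nonneg _ _) (sq_nonneg _)
  set W := ∫ x, wt n R x * lap a x ^ 2 ∂(stripMeasure n)
  set A := ∫ x, wt n R x * a x ^ 2 ∂(stripMeasure n)
  set X := ∫ x, cut n (2 * R) x * a x ^ 2 ∂(stripMeasure n)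
  have hG' := mul_le_mul_of_nonneg_left hG hκ0
  have c1 : (4 * M ^ 2 + κ * M ^ 2) * A ≤ energyC M * A := by
    refine mul_le_mul_of_nonneg_right ?_ nA
    unfold energyC
    nlinarith [mul_le_mul_of_nonneg_right hκ6 (sq_nonneg M), mul_nonneg (sub_nonneg.2 hK) (sq_nonneg M),
      sq_nonneg M, sq_nonneg cutK, mul_nonneg (sq_nonneg cutK) hM, mul_nonneg (sq_nonneg cutK) (sq_nonneg M),
      sq_nonneg (cutK * cutK)]
  have c2 : (κ * (1 / 2 + 2 * cutK ^ 2) + κ * (1 + M)) * X ≤ energyC M / R * X := by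
    refine mul_le_mul_of_nonneg_right ?_ nX
    rw [hκ, le_div_iff₀ hR0]
    have : (16 * cutK ^ 2 / R * (1 / 2 + 2 * cutK ^ 2) + 16 * cutK ^ 2 / R * (1 + M)) * R =
        16 * cutK ^ 2 * (3 / 2 + M + 2 * cutK ^ 2) := by field_simp; ring
    rw [this]
    unfold energyC
    nlinarith [sq_nonneg cutK, sq_nonneg M, mul_nonneg (sq_nonneg cutK) (sq_nonneg M)]
  have c3 : (- (3 / 4) + κ + κ * (1 / 2)) * W ≤ - (1 / 2) * W :=
    mul_le_mul_of_nonneg_right (by linarith) nW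
  linear_combination c1 + c2 + c3 + hG'

/-! ### Space-time integrals -/

/-- The measure on a time interval times the strip. -/
def stMeasure (n : ℕ) (t₁ t₂ : ℝ) : Measure (ℝ × Space n) :=
  ((volume : Measure ℝ).restrict (Ioc t₁ t₂)).prod (stripMeasure n)

theorem stMeasure_eq (t₁ t₂ : ℝ) : stMeasure n t₁ t₂ =
    ((volume : Measure ℝ).prod (volume : Measure (Space n))).restrict (Ioc t₁ t₂ ×ˢ cell n) := by
  rw [stMeasure, stripMeasure, Measure.prod_restrict]

theorem ae_st_mem (t₁ t₂ : ℝ) : ∀ᵐ p ∂(stMeasure n t₁ t₂), p.1 ∈ Ioc t₁ t₂ :=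
  Measure.quasiMeasurePreserving_fst.ae (ae_restrict_mem measurableSet_Ioc)

section
variable {T t₁ t₂ : ℝ} {a b : ℝ → Space n → ℝ}

theorem Icc_subset_of_mem (h1 : t₁ ∈ Ioo 0 T) (h2 : t₂ ∈ Ioo 0 T) : Icc t₁ t₂ ⊆ Ioo 0 T :=
  fun _ hr => ⟨h1.1.trans_le hr.1, hr.2.trans_lt h2.2⟩

theorem ST.aestronglyMeasurable (hb : ST T b) (h1 : t₁ ∈ Ioo 0 T) (h2 : t₂ ∈ Ioo 0 T) :
    AEStronglyMeasurable (fun p : ℝ × Space n => b p.1 p.2) (stMeasure n t₁ t₂) := by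
  rw [stMeasure_eq]
  refine (hb.continuousOn.mono ?_).aestronglyMeasurable (measurableSet_Ioc.prod (measurableSet_cell n))
  exact prod_mono (Ioc_subset_Icc_self.trans (Icc_subset_of_mem h1 h2)) (subset_univ _)

theorem ST.integrable_st (hb : ST T b) (h1 : t₁ ∈ Ioo 0 T) (h2 : t₂ ∈ Ioo 0 T) {χ : Space n → ℝ}
    (hχ : IsTestFunction χ) :
    Integrable (fun p : ℝ × Space n => χ p.2 * b p.1 p.2) (stMeasure n t₁ t₂) := by
  obtain ⟨R, hR⟩ := hχ.boundedSupport
  have hcont : ContinuousOn (fun p : ℝ × Space n => χ p.2 * b p.1 p.2) (Icc t₁ t₂ ×ˢ box n R) :=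
    ((hχ.smooth.continuous.comp continuous_snd).continuousOn).mul
      (hb.continuousOn.mono (prod_mono (Icc_subset_of_mem h1 h2) (subset_univ _)))
  have i1 := hcont.integrableOn_compact (μ := (volume : Measure ℝ).prod (volume : Measure (Space n)))
    (isCompact_Icc.prod (isCompact_box n R))
  have i2 := i1.mono_set (s := Ioc t₁ t₂ ×ˢ (cell n ∩ {x | |zCoord x| ≤ R}))
    (prod_mono Ioc_subset_Icc_self fun x hx => mem_box hx.1 hx.2)
  rw [stMeasure_eq]
  refine i2.of_forall_sdiff_eq_zero (measurableSet_Ioc.prod (measurableSet_cell n)) fun p hp => ?_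
  rw [hR p.2, zero_mul]
  by_contra h
  exact hp.2 ⟨hp.1.1, hp.1.2, not_lt.1 h⟩

theorem ST.integral_st (hb : ST T b) (h1 : t₁ ∈ Ioo 0 T) (h2 : t₂ ∈ Ioo 0 T) (h12 : t₁ ≤ t₂)
    {χ : Space n → ℝ} (hχ : IsTestFunction χ) :
    ∫ p, χ p.2 * b p.1 p.2 ∂(stMeasure n t₁ t₂) =
      ∫ r in t₁..t₂, ∫ x, χ x * b r x ∂(stripMeasure n) := by
  rw [intervalIntegral.integral_of_le h12]
  exact integral_prod _ (hb.integrable_st h1 h2 hχ)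

theorem eventually_wt_snd_eq_one (p : ℝ × Space n) :
    ∀ᶠ N : ℕ in Filter.atTop, wt n ((N : ℝ) + 1) p.2 = 1 := eventually_wt_eq_one _

theorem ST.st_lintegral_le (hb : ST T b) (h1 : t₁ ∈ Ioo 0 T) (h2 : t₂ ∈ Ioo 0 T) (h12 : t₁ ≤ t₂)
    (h0 : ∀ r ∈ Ioo 0 T, ∀ x, 0 ≤ b r x) {K R₀ : ℝ}
    (hK : ∀ R, 1 ≤ R → R₀ ≤ R → ∫ r in t₁..t₂, ∫ x, wt n R x * b r x ∂(stripMeasure n) ≤ K) :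
    ∫⁻ p, ENNReal.ofReal (b p.1 p.2) ∂(stMeasure n t₁ t₂) ≤ ENNReal.ofReal K := by
  refine lintegral_le_of_exhaustion (X := ℝ × Space n) (f := fun p => b p.1 p.2)
    (χ := fun (N : ℕ) (p : ℝ × Space n) => wt n ((N : ℝ) + 1) p.2) ?_
    (fun N p => wt_nonneg ((N : ℝ) + 1) p.2) eventually_wt_snd_eq_one ?_ ?_
  · filter_upwards [ae_st_mem t₁ t₂] with p hp
    exact h0 _ (Icc_subset_of_mem h1 h2 (Ioc_subset_Icc_self hp)) _
  · intro N
    have hF := isTestFunction_wt (n := n) (R := (N : ℝ) + 1) (by positivity)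
    exact hb.integrable_st (χ := wt n ((N : ℝ) + 1)) h1 h2 hF
  · filter_upwards [(tendsto_natCast_atTop_atTop (R := ℝ)).eventually_ge_atTop R₀] with N hN
    have hF := isTestFunction_wt (n := n) (R := (N : ℝ) + 1) (by positivity)
    exact (hb.integral_st (χ := wt n ((N : ℝ) + 1)) h1 h2 h12 hF).trans_le (hK _ (by simp) (by linarith))

theorem ST.integrable_of_lintegral (hb : ST T b) (h1 : t₁ ∈ Ioo 0 T) (h2 : t₂ ∈ Ioo 0 T)
    (h0 : ∀ r ∈ Ioo 0 T, ∀ x, 0 ≤ b r x)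
    (h : ∫⁻ p, ENNReal.ofReal (b p.1 p.2) ∂(stMeasure n t₁ t₂) < ⊤) :
    Integrable (fun p : ℝ × Space n => b p.1 p.2) (stMeasure n t₁ t₂) := by
  refine ⟨hb.aestronglyMeasurable h1 h2, (hasFiniteIntegral_iff_ofReal ?_).2 h⟩
  filter_upwards [ae_st_mem t₁ t₂] with p hp
  exact h0 _ (Icc_subset_of_mem h1 h2 (Ioc_subset_Icc_self hp)) _

theorem tendsto_integral_st_wt {f : ℝ × Space n → ℝ} (hf : Integrable f (stMeasure n t₁ t₂)) :
    Filter.Tendsto (fun N : ℕ => ∫ p, wt n ((N : ℝ) + 1) p.2 * f p ∂(stMeasure n t₁ t₂)) Filter.atTop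
      (nhds (∫ p, f p ∂(stMeasure n t₁ t₂))) := by
  refine tendsto_integral_of_exhaustion (X := ℝ × Space n)
    (χ := fun (N : ℕ) (p : ℝ × Space n) => wt n ((N : ℝ) + 1) p.2) ?_ ?_
    eventually_wt_snd_eq_one hf
  · intro N x
    rw [abs_of_nonneg (wt_nonneg _ _)]; exact wt_le_one _ _
  · intro N
    exact ((isTestFunction_wt (by positivity)).smooth.continuous.comp continuous_snd).aestronglyMeasurable

/-- Localized balance laws with vanishing error become global balance laws. -/
theorem balance_of_localized (ha : ST T a) (h1 : t₁ ∈ Ioo 0 T) (h2 : t₂ ∈ Ioo 0 T) (h12 : t₁ ≤ t₂)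
    {e₁ e₂ : Space n → ℝ} (i1 : Integrable e₁ (stripMeasure n)) (i2 : Integrable e₂ (stripMeasure n))
    (hs : Integrable (fun p : ℝ × Space n => a p.1 p.2) (stMeasure n t₁ t₂)) {K : ℝ}
    (hK : ∀ R, 1 ≤ R → |∫ x, wt n R x * e₂ x ∂(stripMeasure n) - ∫ x, wt n R x * e₁ x ∂(stripMeasure n) -
      ∫ r in t₁..t₂, ∫ x, wt n R x * a r x ∂(stripMeasure n)| ≤ K / R) :
    ∫ x, e₂ x ∂(stripMeasure n) - ∫ x, e₁ x ∂(stripMeasure n) =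
      ∫ p, a p.1 p.2 ∂(stMeasure n t₁ t₂) := by
  have l1 := ((tendsto_integral_wt i2).sub (tendsto_integral_wt i1)).sub (tendsto_integral_st_wt hs)
  have l2 : Filter.Tendsto (fun N : ℕ => K / ((N : ℝ) + 1)) Filter.atTop (nhds 0) :=
    tendsto_const_div_atTop_nhds_zero_nat K |>.comp (Filter.tendsto_add_atTop_nat 1) |>.congr fun N => by
      simp
  have l3 : Filter.Tendsto (fun N : ℕ => |∫ x, wt n ((N : ℝ) + 1) x * e₂ x ∂(stripMeasure n) -
      ∫ x, wt n ((N : ℝ) + 1) x * e₁ x ∂(stripMeasure n) -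
      ∫ p, wt n ((N : ℝ) + 1) p.2 * a p.1 p.2 ∂(stMeasure n t₁ t₂)|) Filter.atTop (nhds 0) := by
    refine squeeze_zero (fun _ => abs_nonneg _) (fun N => ?_) l2
    have hF := isTestFunction_wt (n := n) (R := (N : ℝ) + 1) (by positivity)
    rw [ha.integral_st (χ := wt n ((N : ℝ) + 1)) h1 h2 h12 hF]
    exact hK _ (by simp)
  have := tendsto_nhds_unique l1.abs l3
  have := abs_eq_zero.1 this
  linarith

/-- A spatial inequality whose constants do not depend on time is integrated in time by Tonelli. -/
theorem integrable_slice_le (h1 : t₁ ∈ Ioo 0 T) (h2 : t₂ ∈ Ioo 0 T)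
    {G : ℝ → Space n → ℝ} (hG : ST T G) (hG0 : ∀ r ∈ Ioo 0 T, ∀ x, 0 ≤ G r x) {c₁ c₂ : ℝ≥0∞} (hc₁ : c₁ ≠ ⊤) (hc₂ : c₂ ≠ ⊤)
    (hle : ∀ r ∈ Ioo 0 T, ∫⁻ x, ENNReal.ofReal (G r x) ∂(stripMeasure n) ≤
      c₁ * ∫⁻ x, ENNReal.ofReal (a r x ^ 2) ∂(stripMeasure n) +
      c₂ * ∫⁻ x, ENNReal.ofReal (lap (a r) x ^ 2) ∂(stripMeasure n))
    (ia : Integrable (fun p : ℝ × Space n => a p.1 p.2 ^ 2) (stMeasure n t₁ t₂))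
    (il : Integrable (fun p : ℝ × Space n => lap (a p.1) p.2 ^ 2) (stMeasure n t₁ t₂)) :
    Integrable (fun p : ℝ × Space n => G p.1 p.2) (stMeasure n t₁ t₂) := by
  refine hG.integrable_of_lintegral h1 h2 hG0 ?_
  have m1 : AEMeasurable (fun p : ℝ × Space n => ENNReal.ofReal (G p.1 p.2)) (stMeasure n t₁ t₂) :=
    (hG.aestronglyMeasurable h1 h2).aemeasurable.ennreal_ofReal
  have m2 : AEMeasurable (fun p : ℝ × Space n => ENNReal.ofReal (a p.1 p.2 ^ 2)) (stMeasure n t₁ t₂) :=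
    ia.1.aemeasurable.ennreal_ofReal
  have m3 : AEMeasurable (fun p : ℝ × Space n => ENNReal.ofReal (lap (a p.1) p.2 ^ 2)) (stMeasure n t₁ t₂) :=
    il.1.aemeasurable.ennreal_ofReal
  have f2 := Integrable.lintegral_ofReal_lt_top ia
  have f3 := Integrable.lintegral_ofReal_lt_top il
  unfold stMeasure at m1 m2 m3 f2 f3 ⊢
  rw [lintegral_prod _ m2] at f2
  rw [lintegral_prod _ m3] at f3
  rw [lintegral_prod _ m1]
  refine (setLIntegral_mono_ae' measurableSet_Ioc (Filter.Eventually.of_forall fun r hr =>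
    hle r (Icc_subset_of_mem h1 h2 (Ioc_subset_Icc_self hr)))).trans_lt ?_
  rw [lintegral_add_left' (m2.lintegral_prod_right'.const_mul _), lintegral_const_mul' _ _ hc₁,
    lintegral_const_mul' _ _ hc₂]
  exact ENNReal.add_lt_top.2 ⟨ENNReal.mul_lt_top (lt_top_iff_ne_top.2 hc₁) f2,
    ENNReal.mul_lt_top (lt_top_iff_ne_top.2 hc₂) f3⟩

theorem ST.integrable_gradSq (ha : ST T a) (h1 : t₁ ∈ Ioo 0 T) (h2 : t₂ ∈ Ioo 0 T)
    (ia : Integrable (fun p : ℝ × Space n => a p.1 p.2 ^ 2) (stMeasure n t₁ t₂))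
    (il : Integrable (fun p : ℝ × Space n => CahnHilliard.lap (a p.1) p.2 ^ 2) (stMeasure n t₁ t₂)) :
    Integrable (fun p : ℝ × Space n => CahnHilliard.gradSq (a p.1) p.2) (stMeasure n t₁ t₂) :=
  integrable_slice_le h1 h2 ha.gradSq (fun _ _ => gradSq_nonneg _) ENNReal.ofReal_ne_top
    ENNReal.ofReal_ne_top (fun _ hr => lintegral_gradSq_le (ha.sp hr) one_pos) ia il

theorem ST.integrable_hessSq (ha : ST T a) (h1 : t₁ ∈ Ioo 0 T) (h2 : t₂ ∈ Ioo 0 T)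
    (ia : Integrable (fun p : ℝ × Space n => a p.1 p.2 ^ 2) (stMeasure n t₁ t₂))
    (il : Integrable (fun p : ℝ × Space n => CahnHilliard.lap (a p.1) p.2 ^ 2) (stMeasure n t₁ t₂)) :
    Integrable (fun p : ℝ × Space n => ∑ j, CahnHilliard.gradSq (CahnHilliard.pd j (a p.1)) p.2)
      (stMeasure n t₁ t₂) :=
  integrable_slice_le h1 h2 (ST.sum fun j => (ha.pd j).gradSq)
    (fun _ _ _ => Finset.sum_nonneg fun _ _ => gradSq_nonneg _ _) ENNReal.ofReal_ne_top
    ENNReal.ofReal_ne_top (fun _ hr => (lintegral_hessSq_le (ha.sp hr)).trans_eq (mul_add _ _ _)) ia il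

/-- The energy estimate for `a_t = -Δ²a + h + Δg`. -/
theorem energy_estimate (ha : ST T a) (h1 : t₁ ∈ Ioo 0 T) (h2 : t₂ ∈ Ioo 0 T)
    {g h : ℝ → Space n → ℝ} (hg : ST T g) (hh : ST T h) {M C₀ : ℝ} (hM : 0 ≤ M)
    (hgM : ∀ r ∈ Ioo 0 T, ∀ x, |g r x| ≤ M * |a r x|)
    (hhM : ∀ r ∈ Ioo 0 T, ∀ x, |h r x| ≤ M * |lap (a r) x|)
    (heq : ∀ r ∈ Ioo 0 T, ∀ x, td a r x = - lap (lap (a r)) x + h r x + lap (g r) x)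
    (hinit : Integrable (fun x => a t₁ x ^ 2) (stripMeasure n))
    (hC₀ : ∀ R, 1 ≤ R → ∀ t ∈ Icc t₁ t₂,
      ∫ r in t₁..t, ∫ x, cut n (2 * R) x * a r x ^ 2 ∂(stripMeasure n) ≤ C₀ * R) :
    ∃ B, 0 ≤ B ∧ (∀ t ∈ Icc t₁ t₂, ∫⁻ x, ENNReal.ofReal (a t x ^ 2) ∂(stripMeasure n) ≤ ENNReal.ofReal B) ∧
      ∀ t ∈ Icc t₁ t₂, Integrable (fun p : ℝ × Space n => lap (a p.1) p.2 ^ 2) (stMeasure n t₁ t) := by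
  have hK := one_le_cutK
  set l := energyC M with hl
  have hl0 : 0 ≤ l := energyC_nonneg hM
  set J := ∫ x, a t₁ x ^ 2 ∂(stripMeasure n) with hJ
  have hJ0 : 0 ≤ J := integral_nonneg fun _ => sq_nonneg _
  have hφ : ContDiff ℝ ∞ (fun t : ℝ => Real.exp (-(2 * l) * t)) := by fun_prop
  -- The factor exp(-2lt) is Grönwall's argument built into the integrand: it cancels the term
  -- l∫wt·a² and leaves a quantity to integrate in time directly.
  set b : ℝ → Space n → ℝ := fun t x => Real.exp (-(2 * l) * t) * a t x ^ 2 with hb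
  have hbST : ST T b := (ST.time hφ).mul (ha.pow 2)
  have htd : ∀ r ∈ Ioo 0 T, ∀ x, td b r x = Real.exp (-(2 * l) * r) *
      (2 * (a r x * (- lap (lap (a r)) x + h r x + lap (g r) x)) - 2 * l * a r x ^ 2) := by
    intro r hr x
    have d1 : HasDerivAt (fun t : ℝ => Real.exp (-(2 * l) * t)) (Real.exp (-(2 * l) * r) * (-(2 * l))) r := by
      have := ((hasDerivAt_id r).const_mul (-(2 * l))).exp
      simpa using this
    have d2 := (ha.hasDerivAt hr x).fun_pow 2
    have d3 := (d1.mul d2).deriv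
    rw [heq r hr x] at d3
    refine d3.trans ?_
    push_cast
    ring
  have hexp : ∀ r ∈ Ioo 0 T, Real.exp (-(2 * l) * r) ≤ 1 := fun r hr => by
    rw [Real.exp_le_one_iff]
    have := mul_nonneg hl0 hr.1.le
    linarith
  have hexp2 : ∀ r ∈ Icc t₁ t₂, Real.exp (-(2 * l) * t₂) ≤ Real.exp (-(2 * l) * r) := fun r hr => by
    rw [Real.exp_le_exp]
    have := mul_le_mul_of_nonneg_left hr.2 hl0
    linarith
  set e₀ := Real.exp (-(2 * l) * t₂) with he₀
  have he₀0 : 0 < e₀ := Real.exp_pos _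
  -- The error (2l/R)∫∫cut(2R)a² stays below 2lC₀ because growth linear in R is permitted. This is
  -- what makes the estimate available for functions known only to be bounded.
  have key : ∀ R, 1 ≤ R → 96 * cutK ^ 2 ≤ R → ∀ t ∈ Icc t₁ t₂,
      e₀ * ∫ x, wt n R x * a t x ^ 2 ∂(stripMeasure n) +
        e₀ * ∫ r in t₁..t, ∫ x, wt n R x * lap (a r) x ^ 2 ∂(stripMeasure n) ≤ J + 2 * l * C₀ := by
    intro R hR1 hR t ht
    have hR0 : 0 < R := by linarith
    have htT := Icc_subset_of_mem h1 h2 ht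
    have hF := isTestFunction_wt (n := n) hR0
    have hξ := isTestFunction_cut (n := n) (R := 2 * R) (by positivity)
    have hsub : Icc t₁ t ⊆ Ioo 0 T := Icc_subset_of_mem h1 htT
    have hsub' : uIcc t₁ t ⊆ Ioo 0 T := by rw [uIcc_of_le ht.1]; exact hsub
    have cW := ((ha.lap.pow 2).continuousOn_integral hF).mono hsub'
    have cX := ((ha.pow 2).continuousOn_integral hξ).mono hsub'
    have hbal := hbST.integral_sub_integral hF h1 htT
    have hmono : ∫ r in t₁..t, ∫ x, wt n R x * td b r x ∂(stripMeasure n) ≤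
        ∫ r in t₁..t, (- e₀ * ∫ x, wt n R x * lap (a r) x ^ 2 ∂(stripMeasure n) +
          2 * l / R * ∫ x, cut n (2 * R) x * a r x ^ 2 ∂(stripMeasure n)) := by
      refine intervalIntegral.integral_mono_on ht.1
        ((hbST.td.continuousOn_integral hF).mono hsub').intervalIntegrable
        ((cW.const_smul (- e₀)).add (cX.const_smul (2 * l / R))).intervalIntegrable fun r hr => ?_
      have hrT := hsub hr
      have e1 : ∫ x, wt n R x * td b r x ∂(stripMeasure n) = Real.exp (-(2 * l) * r) *
          (2 * ∫ x, wt n R x * (a r x * (- lap (lap (a r)) x + h r x + lap (g r) x)) ∂(stripMeasure n) -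
            2 * l * ∫ x, wt n R x * a r x ^ 2 ∂(stripMeasure n)) := by
        have sa := ha.sp hrT
        have iL := hF.mul (sa.mul ((sa.lap.lap.neg.add (hh.sp hrT)).add (hg.sp hrT).lap))
        have iA := hF.mul (sa.pow 2)
        rw [← integral_const_mul, ← integral_const_mul, ← integral_sub (iL.const_mul _).integrable
          (iA.const_mul _).integrable, ← integral_const_mul]
        refine integral_congr_ae (Filter.Eventually.of_forall fun x => ?_)
        simp only [htd r hrT x]
        ring
      have hle := localized_energy_inequality hM hR (ha.sp hrT) (hg.sp hrT) (hh.sp hrT)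
        (hgM r hrT) (hhM r hrT)
      have nW : 0 ≤ ∫ x, wt n R x * lap (a r) x ^ 2 ∂(stripMeasure n) :=
        integral_nonneg fun x => mul_nonneg (wt_nonneg _ _) (sq_nonneg _)
      have nX : 0 ≤ ∫ x, cut n (2 * R) x * a r x ^ 2 ∂(stripMeasure n) :=
        integral_nonneg fun x => mul_nonneg (cut_nonneg _ _) (sq_nonneg _)
      rw [e1]
      set E := ∫ x, wt n R x * (a r x * (- lap (lap (a r)) x + h r x + lap (g r) x)) ∂(stripMeasure n)
      set W := ∫ x, wt n R x * lap (a r) x ^ 2 ∂(stripMeasure n)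
      set A := ∫ x, wt n R x * a r x ^ 2 ∂(stripMeasure n)
      set X := ∫ x, cut n (2 * R) x * a r x ^ 2 ∂(stripMeasure n)
      have s1 : 2 * E - 2 * l * A ≤ - W + 2 * l / R * X := by
        have : 2 * l / R * X = 2 * (l / R * X) := by ring
        rw [this]; linarith
      have hr0 := Real.exp_pos (-(2 * l) * r)
      have s2 := mul_le_mul_of_nonneg_left s1 hr0.le
      have s3 := mul_le_mul_of_nonneg_right (hexp2 r ⟨hr.1, hr.2.trans ht.2⟩) nW
      have s4 := mul_le_mul_of_nonneg_right (hexp r hrT) (mul_nonneg (by positivity : 0 ≤ 2 * l / R) nX)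
      linarith
    have iW := (cW.intervalIntegrable (μ := volume)).const_mul (- e₀)
    have iX := (cX.intervalIntegrable (μ := volume)).const_mul (2 * l / R)
    rw [intervalIntegral.integral_add iW iX, intervalIntegral.integral_const_mul,
      intervalIntegral.integral_const_mul] at hmono
    have hX := mul_le_mul_of_nonneg_left (hC₀ R hR1 t ht) (by positivity : 0 ≤ 2 * l / R)
    have hX2 : 2 * l / R * (C₀ * R) = 2 * l * C₀ := by field_simp
    have hb1 : ∫ x, wt n R x * b t₁ x ∂(stripMeasure n) ≤ J := by
      refine integral_mono (hF.mul (hbST.sp h1)).integrable hinit fun x => ?_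
      have q1 : b t₁ x ≤ a t₁ x ^ 2 := mul_le_of_le_one_left (sq_nonneg _) (hexp _ h1)
      have q2 : 0 ≤ b t₁ x := mul_nonneg (Real.exp_pos _).le (sq_nonneg _)
      exact (mul_le_of_le_one_left q2 (wt_le_one _ _)).trans q1
    have hb2 : e₀ * ∫ x, wt n R x * a t x ^ 2 ∂(stripMeasure n) ≤
        ∫ x, wt n R x * b t x ∂(stripMeasure n) := by
      rw [← integral_const_mul]
      refine integral_mono ((hF.mul ((ha.sp htT).pow 2)).const_mul _).integrable
        (hF.mul (hbST.sp htT)).integrable fun x => ?_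
      have q1 := mul_le_mul_of_nonneg_right (hexp2 t ht)
        (mul_nonneg (wt_nonneg R x) (sq_nonneg (a t x)))
      simp only [hb]
      linarith
    linarith
  refine ⟨max 0 ((J + 2 * l * C₀) / e₀), le_max_left _ _, fun t ht => ?_, fun t ht => ?_⟩
  · refine lintegral_strip_le (R₀ := 96 * cutK ^ 2) ((ha.sp (Icc_subset_of_mem h1 h2 ht)).pow 2).continuous
      (fun _ => sq_nonneg _) fun R hR1 hR => ?_
    refine le_trans ?_ (le_max_right _ _)
    rw [le_div_iff₀ he₀0]
    have := key R hR1 hR t ht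
    have n1 : 0 ≤ ∫ r in t₁..t, ∫ x, wt n R x * lap (a r) x ^ 2 ∂(stripMeasure n) :=
      intervalIntegral.integral_nonneg ht.1 fun r _ =>
        integral_nonneg fun x => mul_nonneg (wt_nonneg _ _) (sq_nonneg _)
    nlinarith [mul_nonneg he₀0.le n1]
  · have htT := Icc_subset_of_mem h1 h2 ht
    refine (ha.lap.pow 2).integrable_of_lintegral h1 htT (fun _ _ _ => sq_nonneg _) ?_
    refine ((ha.lap.pow 2).st_lintegral_le (K := (J + 2 * l * C₀) / e₀) (R₀ := 96 * cutK ^ 2) h1 htT ht.1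
      (fun _ _ _ => sq_nonneg _) fun R hR1 hR => ?_).trans_lt ENNReal.ofReal_lt_top
    rw [le_div_iff₀ he₀0]
    have := key R hR1 hR t ht
    have n1 : 0 ≤ ∫ x, wt n R x * a t x ^ 2 ∂(stripMeasure n) :=
      integral_nonneg fun x => mul_nonneg (wt_nonneg _ _) (sq_nonneg _)
    nlinarith [mul_nonneg he₀0.le n1]

end

/-! ### A Sobolev inequality -/

theorem setLIntegral_biUnion_finset_le {X ι : Type*} [MeasurableSpace X] {m : Measure X} (K : Finset ι)
    (s : ι → Set X) (F : X → ℝ≥0∞) :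
    ∫⁻ x in ⋃ k ∈ K, s k, F x ∂m ≤ ∑ k ∈ K, ∫⁻ x in s k, F x ∂m := by
  classical
  induction K using Finset.induction_on with
  | empty => simp
  | insert k K hk ih =>
    rw [Finset.set_biUnion_insert, Finset.sum_insert hk]
    exact (lintegral_union_le _ _ _).trans (add_le_add le_rfl ih)

/-- Finitely many lattice translates of the cell cover the slab, and each contributes the integral
over the strip. -/
theorem lintegral_slab_le {F : Space n → ℝ≥0∞}
    (hF : ∀ (i : Fin n) (x : Space n), F (x + EuclideanSpace.single i.castSucc (1 : ℝ)) = F x)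
    (r : ℕ) : ∫⁻ x in {x : Space n | ∀ j : Fin n, |x j.castSucc| ≤ r}, F x ≤
      ((Fintype.piFinset fun _ : Fin n => Finset.Icc (-((r : ℤ) + 1)) (r + 1)).card : ℝ≥0∞) *
        ∫⁻ x, F x ∂(stripMeasure n) := by
  set K := Fintype.piFinset fun _ : Fin n => Finset.Icc (-((r : ℤ) + 1)) (r + 1) with hK
  have hsub : {x : Space n | ∀ j : Fin n, |x j.castSucc| ≤ r} ⊆
      ⋃ k ∈ K, (fun x => lattice n k + x) ⁻¹' cell n := by
    intro x hx
    simp only [mem_iUnion, exists_prop]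
    refine ⟨fun j => - ⌊x j.castSucc⌋, ?_, ?_⟩
    · rw [hK, Fintype.mem_piFinset]
      intro j
      have h1 := abs_le.1 (hx j)
      rw [Finset.mem_Icc, neg_le_neg_iff]
      constructor
      · have : (⌊x j.castSucc⌋ : ℝ) ≤ r := (Int.floor_le _).trans h1.2
        have : ⌊x j.castSucc⌋ ≤ (r : ℤ) := by exact_mod_cast this
        omega
      · have : -(r : ℤ) ≤ ⌊x j.castSucc⌋ := Int.le_floor.2 (by push_cast; exact h1.1)
        omega
    · intro j
      simp only [PiLp.add_apply, lattice_castSucc]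
      push_cast
      constructor
      · linarith [Int.floor_le (x j.castSucc)]
      · linarith [Int.lt_floor_add_one (x j.castSucc)]
  have hone : ∀ k, ∫⁻ x in (fun x => lattice n k + x) ⁻¹' cell n, F x = ∫⁻ x, F x ∂(stripMeasure n) := by
    intro k
    have h1 := (measurePreserving_add_left (volume : Measure (Space n)) (lattice n k)).setLIntegral_comp_preimage_emb
      (MeasurableEquiv.addLeft (lattice n k)).measurableEmbedding F (cell n)
    simp only [periodic_lattice hF] at h1
    exact h1
  refine (lintegral_mono_set hsub).trans ((setLIntegral_biUnion_finset_le K _ F).trans ?_)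
  simp only [hone]
  simp

theorem norm_fderiv_sq (g : Space n → ℝ) (x : Space n) : ‖fderiv ℝ g x‖ ^ 2 = gradSq g x := by
  rw [← norm_gradient_sq]
  simp [gradient]

/-- Compression of the direction of the strip. -/
def squeeze (n m : ℕ) (R : ℝ) : Space n × EuclideanSpace ℝ (Fin m) →L[ℝ] Space n × EuclideanSpace ℝ (Fin m) :=
  ContinuousLinearMap.prodMap (LinearMap.toContinuousLinearMap
    { toFun := fun x : Space n => WithLp.toLp 2 fun i => (if i = Fin.last n then R⁻¹ else 1) * x i
      map_add' := fun x y => by ext i; simp [mul_add]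
      map_smul' := fun c x => by ext i; simp [mul_left_comm] }) (ContinuousLinearMap.id ℝ _)

theorem squeeze_apply (m : ℕ) (R : ℝ) (p : Space n × EuclideanSpace ℝ (Fin m)) (i : Fin (n + 1)) :
    (squeeze n m R p).1 i = (if i = Fin.last n then R⁻¹ else 1) * p.1 i := rfl

theorem squeeze_snd (m : ℕ) (R : ℝ) (p : Space n × EuclideanSpace ℝ (Fin m)) :
    (squeeze n m R p).2 = p.2 := rfl

theorem norm_squeeze_le (m : ℕ) {R : ℝ} (hR : 1 ≤ R) : ‖squeeze n m R‖ ≤ 1 := by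
  refine ContinuousLinearMap.opNorm_le_bound _ zero_le_one fun p => ?_
  rw [one_mul]
  refine max_le_max ?_ le_rfl
  rw [EuclideanSpace.norm_eq, EuclideanSpace.norm_eq]
  refine Real.sqrt_le_sqrt (Finset.sum_le_sum fun i _ => ?_)
  rw [squeeze_apply, norm_mul]
  have : ‖(if i = Fin.last n then R⁻¹ else 1 : ℝ)‖ ≤ 1 := by
    split_ifs
    · rw [norm_inv, Real.norm_of_nonneg (by linarith)]; exact inv_le_one_of_one_le₀ hR
    · simp
  exact pow_le_pow_left₀ (by positivity) (mul_le_of_le_one_left (norm_nonneg _) this) 2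

theorem norm_le_of_coord_le (x : Space n) {r : ℝ} (hr : 0 ≤ r) (h : ∀ i, |x i| ≤ r) :
    ‖x‖ ≤ (n + 1) * r := by
  rw [EuclideanSpace.norm_eq]
  refine (Real.sqrt_le_sqrt (Finset.sum_le_sum (g := fun _ => r ^ 2) fun i _ =>
    pow_le_pow_left₀ (norm_nonneg _) (h i) 2)).trans ?_
  rw [Real.sqrt_le_left (by positivity)]
  simp only [Finset.sum_const, Finset.card_univ, Fintype.card_fin, nsmul_eq_mul]
  push_cast
  nlinarith [mul_nonneg (Nat.cast_nonneg (α := ℝ) n) (sq_nonneg r),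
    mul_nonneg (mul_nonneg (Nat.cast_nonneg (α := ℝ) n) (Nat.cast_nonneg (α := ℝ) n)) (sq_nonneg r)]

-- The Gagliardo–Nirenberg–Sobolev inequality is always used in dimension five: adjoining 4 - n
-- dummy variables fixes the exponent 10/3. The function is multiplied by a bump composed with a
-- compression of z by 1/R. The bump is one on the part of the cell with |z| ≤ R, and the
-- compression has norm at most one, so the constant does not depend on R and R may tend to
-- infinity.
open Module in
theorem lintegral_rpow_le (hn : n ≤ 4) : ∃ C : ℝ≥0∞, C ≠ ⊤ ∧ ∀ q : Space n → ℝ, SP q →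
    ∫⁻ x, ‖q x‖ₑ ^ (10 / 3 : ℝ) ∂(stripMeasure n) ≤
      C * (∫⁻ x, ENNReal.ofReal (q x ^ 2 + gradSq q x) ∂(stripMeasure n)) ^ (5 / 3 : ℝ) := by
  set m := 4 - n with hm
  let E := Space n × EuclideanSpace ℝ (Fin m)
  have hdim : finrank ℝ E = 5 := by
    simp only [E, finrank_prod, finrank_euclideanSpace, Fintype.card_fin]
    omega
  -- The inner radius n + 1 contains every point whose n + 1 coordinates are at most one, that is,
  -- the compressed cell.
  let B : ContDiffBump (0 : E) := ⟨(n : ℝ) + 1, (n : ℝ) + 2, by positivity, by linarith⟩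
  have hBs : ContDiff ℝ ∞ B := B.contDiff
  obtain ⟨K, hK⟩ := (B.hasCompactSupport.fderiv (𝕜 := ℝ)).exists_bound_of_continuous
    (B.contDiff.continuous_fderiv (n := ∞) (by simp))
  have hK0 : 0 ≤ K := (norm_nonneg _).trans (hK 0)
  have : (volume : Measure E).IsAddHaarMeasure :=
    inferInstanceAs ((volume : Measure (Space n)).prod
      (volume : Measure (EuclideanSpace ℝ (Fin m)))).IsAddHaarMeasure
  set S := SNormLESNormFDerivOfEqConst ℝ (volume : Measure E) (2 : NNReal) with hS
  set V := volume (Metric.closedBall (0 : EuclideanSpace ℝ (Fin m)) ((n : ℝ) + 2)) with hV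
  set v := volume (Metric.closedBall (0 : EuclideanSpace ℝ (Fin m)) 1) with hv
  have hVt : V ≠ ⊤ := (isCompact_closedBall _ _).measure_lt_top.ne
  have hv0 : v ≠ 0 := (Metric.measure_closedBall_pos _ _ one_pos).ne'
  have hvt : v ≠ ⊤ := (isCompact_closedBall _ _).measure_lt_top.ne
  set N : ℝ≥0∞ := ((Fintype.piFinset fun _ : Fin n => Finset.Icc (-(((n + 2 : ℕ) : ℤ) + 1)) ((n + 2 : ℕ) + 1)).card : ℝ≥0∞) with hN
  have hNt : N ≠ ⊤ := ENNReal.natCast_ne_top _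
  set C := v⁻¹ * ((S : ℝ≥0∞) ^ (10 / 3 : ℝ) * (ENNReal.ofReal (2 * (1 + K ^ 2)) * (V * N)) ^ (5 / 3 : ℝ)) with hC
  refine ⟨C, ?_, fun q hq => ?_⟩
  · refine ENNReal.mul_ne_top (ENNReal.inv_ne_top.2 hv0) (ENNReal.mul_ne_top ?_ ?_)
    · exact ENNReal.rpow_ne_top_of_nonneg (by norm_num) ENNReal.coe_ne_top
    · exact ENNReal.rpow_ne_top_of_nonneg (by norm_num)
        (ENNReal.mul_ne_top ENNReal.ofReal_ne_top (ENNReal.mul_ne_top hVt hNt))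
  set I := ∫⁻ x, ENNReal.ofReal (q x ^ 2 + gradSq q x) ∂(stripMeasure n) with hI
  have hFper : ∀ (i : Fin n) (x : Space n), ENNReal.ofReal (q (x + EuclideanSpace.single i.castSucc (1 : ℝ)) ^ 2 +
      gradSq q (x + EuclideanSpace.single i.castSucc (1 : ℝ))) = ENNReal.ofReal (q x ^ 2 + gradSq q x) := by
    intro i x
    rw [hq.periodic, hq.gradSq.periodic]
  have key : ∀ R : ℝ, 1 ≤ R →
      ∫⁻ x in {x | |zCoord x| ≤ R}, ‖q x‖ₑ ^ (10 / 3 : ℝ) ∂(stripMeasure n) ≤ C * I ^ (5 / 3 : ℝ) := by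
    intro R hR
    have hR0 : 0 < R := by linarith
    set A := squeeze n m R with hA
    let U : E → ℝ := fun p => B (A p) * q p.1
    have hU : ContDiff ℝ ∞ U := (hBs.comp A.contDiff).mul (hq.smooth.comp contDiff_fst)
    have hsupp : ∀ p, ((n : ℝ) + 2) < ‖A p‖ → B (A p) = 0 := fun p hp =>
      B.zero_of_le_dist (by rw [dist_zero_right]; exact hp.le)
    have hAfst : ∀ (p : E) (j : Fin n), |p.1 j.castSucc| ≤ ‖A p‖ := by
      intro p j
      have h1 : (A p).1 j.castSucc = p.1 j.castSucc := by
        rw [hA, squeeze_apply, if_neg (Fin.castSucc_lt_last j).ne, one_mul]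
      rw [← h1]
      exact (PiLp.norm_apply_le (A p).1 j.castSucc).trans (norm_fst_le _)
    have hAsnd : ∀ (p : E), ‖p.2‖ ≤ ‖A p‖ := fun p => by
      have := norm_snd_le (A p)
      rwa [hA, squeeze_snd] at this
    have hAz : ∀ (p : E), |zCoord p.1| ≤ R * ‖A p‖ := by
      intro p
      have h1 : (A p).1 (Fin.last n) = R⁻¹ * zCoord p.1 := by
        rw [hA, squeeze_apply, if_pos rfl]; rfl
      have h2 : |R⁻¹ * zCoord p.1| ≤ ‖A p‖ := by
        rw [← h1]
        exact (PiLp.norm_apply_le (A p).1 (Fin.last n)).trans (norm_fst_le _)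
      rw [abs_mul, abs_inv, abs_of_pos hR0, inv_mul_le_iff₀ hR0] at h2
      exact h2
    have hcs : HasCompactSupport U := by
      refine HasCompactSupport.of_support_subset_isCompact
        (isCompact_closedBall (0 : E) ((n + 1) * (R * ((n : ℝ) + 2)))) fun p hp => ?_
      have hle : ‖A p‖ ≤ (n : ℝ) + 2 := by
        by_contra h
        exact hp (by simp only [U, hsupp p (not_le.1 h), zero_mul])
      have hnn : (0 : ℝ) ≤ (n : ℝ) + 2 := by positivity
      rw [mem_closedBall_zero_iff, Prod.norm_def, max_le_iff]
      constructor
      · refine norm_le_of_coord_le p.1 (by positivity) fun i => ?_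
        refine Fin.lastCases ?_ (fun j => ?_) i
        · exact (hAz p).trans (mul_le_mul_of_nonneg_left hle hR0.le)
        · refine (hAfst p j).trans (hle.trans ?_)
          nlinarith
      · refine (hAsnd p).trans (hle.trans ?_)
        have h1 : (n : ℝ) + 2 ≤ R * ((n : ℝ) + 2) := by nlinarith
        have h2 : (0 : ℝ) ≤ n * (R * ((n : ℝ) + 2)) := by positivity
        linarith
    -- The exponents satisfy 1/2 - 1/5 = 3/10.
    have hsob := eLpNorm_le_eLpNorm_fderiv_of_eq (F := ℝ) (volume : Measure E) (u := U)
      (hU.of_le (by simp)) hcs (p := 2) (p' := (10 / 3 : NNReal)) (by norm_num) (by rw [hdim]; norm_num)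
      (by rw [hdim]; push_cast; norm_num)
    have hden : ∀ p, ‖fderiv ℝ U p‖ₑ ^ (2 : ℝ) ≤
        ({x : Space n | ∀ j : Fin n, |x j.castSucc| ≤ ((n + 2 : ℕ) : ℝ)} ×ˢ
          Metric.closedBall (0 : EuclideanSpace ℝ (Fin m)) ((n : ℝ) + 2)).indicator
        (fun p => ENNReal.ofReal (2 * (1 + K ^ 2)) * ENNReal.ofReal (q p.1 ^ 2 + gradSq q p.1)) p := by
      intro p
      by_cases hp : ‖A p‖ ≤ (n : ℝ) + 2
      · rw [indicator_of_mem]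
        swap
        · refine ⟨fun j => (hAfst p j).trans (hp.trans (by push_cast; exact le_rfl)), ?_⟩
          rw [mem_closedBall_zero_iff]; exact (hAsnd p).trans hp
        have d1 : HasFDerivAt (fun p => B (A p)) ((fderiv ℝ B (A p)).comp A) p :=
          ((hBs.differentiable (by simp) (A p)).hasFDerivAt).comp p A.hasFDerivAt
        have d2 : HasFDerivAt (fun p : E => q p.1) ((fderiv ℝ q p.1).comp (ContinuousLinearMap.fst ℝ _ _)) p :=
          ((hq.diff p.1).hasFDerivAt).comp p hasFDerivAt_fst
        have d3 := (d1.mul d2).fderiv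
        have hnorm : ‖fderiv ℝ U p‖ ≤ ‖fderiv ℝ q p.1‖ + K * |q p.1| := by
          have : fderiv ℝ U p = _ := d3
          rw [this]
          refine (norm_add_le _ _).trans ?_
          rw [norm_smul, norm_smul]
          have n1 : ‖B (A p)‖ ≤ 1 := by
            rw [Real.norm_of_nonneg (B.nonneg)]; exact B.le_one
          have n2 : ‖(fderiv ℝ q p.1).comp (ContinuousLinearMap.fst ℝ (Space n) (EuclideanSpace ℝ (Fin m)))‖ ≤
              ‖fderiv ℝ q p.1‖ := by
            refine (ContinuousLinearMap.opNorm_comp_le _ _).trans ?_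
            exact mul_le_of_le_one_right (norm_nonneg _) (ContinuousLinearMap.norm_fst_le _ _ _)
          have n3 : ‖(fderiv ℝ B (A p)).comp A‖ ≤ K := by
            refine (ContinuousLinearMap.opNorm_comp_le _ _).trans ?_
            exact (mul_le_of_le_one_right (norm_nonneg _) (norm_squeeze_le m hR)).trans (hK _)
          have m1 := mul_le_mul n1 n2 (norm_nonneg _) zero_le_one
          have m2 := mul_le_mul_of_nonneg_left n3 (abs_nonneg (q p.1))
          rw [one_mul] at m1
          rw [Real.norm_eq_abs (q p.1)]
          linarith
        rw [← ofReal_norm, ENNReal.ofReal_rpow_of_nonneg (norm_nonneg _) (by norm_num),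
          ← ENNReal.ofReal_mul (by positivity)]
        refine ENNReal.ofReal_le_ofReal ?_
        rw [Real.rpow_two, ← norm_fderiv_sq]
        have h1 := pow_le_pow_left₀ (norm_nonneg _) hnorm 2
        have h2 := norm_nonneg (fderiv ℝ q p.1)
        refine h1.trans ?_
        rw [← sq_abs (q p.1)]
        nlinarith [sq_nonneg (‖fderiv ℝ q p.1‖ - K * |q p.1|), sq_nonneg (q p.1), sq_nonneg K,
          mul_nonneg (sq_nonneg K) (sq_nonneg ‖fderiv ℝ q p.1‖), sq_nonneg (|q p.1|)]
      · have hzero : U =ᶠ[nhds p] fun _ => 0 := by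
          have hopen : IsOpen {p' : E | (n : ℝ) + 2 < ‖A p'‖} := isOpen_lt continuous_const (by fun_prop)
          filter_upwards [hopen.mem_nhds (not_le.1 hp)] with p' hp'
          simp only [U, hsupp p' hp', zero_mul]
        have hz : fderiv ℝ U p = 0 := by rw [hzero.fderiv_eq]; simp
        have hz' : ‖fderiv ℝ U p‖ₑ = 0 := by
          rw [← ofReal_norm, hz]
          simp
        rw [hz', ENNReal.zero_rpow_of_pos (by norm_num)]
        exact zero_le
    have hR2 : eLpNorm (fderiv ℝ U) 2 (volume : Measure E) ^ (2 : ℝ) ≤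
        ENNReal.ofReal (2 * (1 + K ^ 2)) * (V * N) * I := by
      have e1 : eLpNorm (fderiv ℝ U) 2 (volume : Measure E) ^ (2 : ℝ) = ∫⁻ p, ‖fderiv ℝ U p‖ₑ ^ (2 : ℝ) := by
        have := eLpNorm_nnreal_pow_eq_lintegral (f := fderiv ℝ U) (μ := (volume : Measure E)) (p := 2) (by norm_num)
        simpa using this
      rw [e1]
      refine (lintegral_mono hden).trans ?_
      have hslab : MeasurableSet {x : Space n | ∀ j : Fin n, |x j.castSucc| ≤ ((n + 2 : ℕ) : ℝ)} := by
        have : {x : Space n | ∀ j : Fin n, |x j.castSucc| ≤ ((n + 2 : ℕ) : ℝ)} =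
          ⋂ j : Fin n, {x : Space n | |x j.castSucc| ≤ ((n + 2 : ℕ) : ℝ)} := by ext; simp
        rw [this]
        exact MeasurableSet.iInter fun j => (isClosed_le (by fun_prop) continuous_const).measurableSet
      rw [lintegral_indicator (hslab.prod Metric.isClosed_closedBall.measurableSet), Measure.volume_eq_prod,
        ← Measure.prod_restrict]
      have hmeas : Measurable fun x : Space n => ENNReal.ofReal (q x ^ 2 + gradSq q x) :=
        ((hq.pow 2).add hq.gradSq).continuous.measurable.ennreal_ofReal
      have hm1 : Measurable fun p : Space n × EuclideanSpace ℝ (Fin m) =>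
          ENNReal.ofReal (q p.1 ^ 2 + gradSq q p.1) := hmeas.comp measurable_fst
      rw [lintegral_const_mul _ hm1, lintegral_prod _ hm1.aemeasurable]
      simp only [lintegral_const, Measure.restrict_apply_univ]
      rw [lintegral_mul_const _ hmeas, ← hV]
      have := lintegral_slab_le (F := fun x => ENNReal.ofReal (q x ^ 2 + gradSq q x)) hFper (n + 2)
      calc _ ≤ ENNReal.ofReal (2 * (1 + K ^ 2)) * (N * I * V) := by gcongr
        _ = _ := by ring
    have hL : v * ∫⁻ x in {x | |zCoord x| ≤ R}, ‖q x‖ₑ ^ (10 / 3 : ℝ) ∂(stripMeasure n) ≤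
        eLpNorm U (10 / 3 : NNReal) (volume : Measure E) ^ (10 / 3 : ℝ) := by
      have e1 : eLpNorm U (10 / 3 : NNReal) (volume : Measure E) ^ (10 / 3 : ℝ) = ∫⁻ p, ‖U p‖ₑ ^ (10 / 3 : ℝ) := by
        have := eLpNorm_nnreal_pow_eq_lintegral (f := U) (μ := (volume : Measure E)) (p := 10 / 3) (by norm_num)
        simpa using this
      rw [e1]
      have hcm : MeasurableSet ({x : Space n | |zCoord x| ≤ R} ∩ cell n) :=
        (isClosed_le continuous_zCoord.abs continuous_const).measurableSet.inter (measurableSet_cell n)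
      have hmeas : Measurable fun x : Space n => ‖q x‖ₑ ^ (10 / 3 : ℝ) :=
        hq.continuous.measurable.enorm.pow_const _
      have hm1 : Measurable fun p : Space n × EuclideanSpace ℝ (Fin m) =>
          ‖q p.1‖ₑ ^ (10 / 3 : ℝ) := hmeas.comp measurable_fst
      calc v * ∫⁻ x in {x | |zCoord x| ≤ R}, ‖q x‖ₑ ^ (10 / 3 : ℝ) ∂(stripMeasure n)
          = ∫⁻ p in (({x : Space n | |zCoord x| ≤ R} ∩ cell n) ×ˢ
              Metric.closedBall (0 : EuclideanSpace ℝ (Fin m)) 1), ‖q p.1‖ₑ ^ (10 / 3 : ℝ) := by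
            rw [Measure.volume_eq_prod, ← Measure.prod_restrict,
              lintegral_prod _ hm1.aemeasurable]
            simp only [lintegral_const, Measure.restrict_apply_univ]
            rw [lintegral_mul_const _ hmeas, ← hv, mul_comm, stripMeasure, Measure.restrict_restrict
              (isClosed_le continuous_zCoord.abs continuous_const).measurableSet]
        _ ≤ ∫⁻ p in (({x : Space n | |zCoord x| ≤ R} ∩ cell n) ×ˢ
              Metric.closedBall (0 : EuclideanSpace ℝ (Fin m)) 1), ‖U p‖ₑ ^ (10 / 3 : ℝ) := by
            refine setLIntegral_mono' (hcm.prod Metric.isClosed_closedBall.measurableSet) fun p hp => ?_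
            have hone : B (A p) = 1 := by
              refine B.one_of_mem_closedBall ?_
              rw [mem_closedBall_zero_iff, Prod.norm_def, max_le_iff]
              constructor
              · have := norm_le_of_coord_le (A p).1 zero_le_one fun i => ?_
                · rwa [mul_one] at this
                · rw [hA, squeeze_apply]
                  refine Fin.lastCases ?_ (fun j => ?_) i
                  · rw [if_pos rfl, abs_mul, abs_inv, abs_of_pos hR0, inv_mul_le_iff₀ hR0, mul_one]
                    exact hp.1.1
                  · rw [if_neg (Fin.castSucc_lt_last j).ne, one_mul]
                    have := hp.1.2 j
                    rw [abs_le]; constructor <;> linarith [this.1, this.2]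
              · rw [hA, squeeze_snd]
                have h1 := hp.2
                rw [mem_closedBall_zero_iff] at h1
                have : (0 : ℝ) ≤ n := Nat.cast_nonneg n
                exact h1.trans (by simp only [B]; linarith)
            simp only [U, hone, one_mul]
            exact le_rfl
        _ ≤ _ := setLIntegral_le_lintegral _ _
    have h3 : eLpNorm U (10 / 3 : NNReal) (volume : Measure E) ^ (10 / 3 : ℝ) ≤
        (S : ℝ≥0∞) ^ (10 / 3 : ℝ) * (ENNReal.ofReal (2 * (1 + K ^ 2)) * (V * N) * I) ^ (5 / 3 : ℝ) := by
      calc _ ≤ ((S : ℝ≥0∞) * eLpNorm (fderiv ℝ U) 2 (volume : Measure E)) ^ (10 / 3 : ℝ) := by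
            refine ENNReal.rpow_le_rpow ?_ (by norm_num)
            exact_mod_cast hsob
        _ = (S : ℝ≥0∞) ^ (10 / 3 : ℝ) * (eLpNorm (fderiv ℝ U) 2 (volume : Measure E) ^ (2 : ℝ)) ^ (5 / 3 : ℝ) := by
            rw [ENNReal.mul_rpow_of_nonneg _ _ (by norm_num), ← ENNReal.rpow_mul]
            norm_num
        _ ≤ _ := by gcongr
    rw [ENNReal.mul_rpow_of_nonneg _ I (by norm_num)] at h3
    have h4 := hL.trans h3
    calc ∫⁻ x in {x | |zCoord x| ≤ R}, ‖q x‖ₑ ^ (10 / 3 : ℝ) ∂(stripMeasure n)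
        = v⁻¹ * (v * ∫⁻ x in {x | |zCoord x| ≤ R}, ‖q x‖ₑ ^ (10 / 3 : ℝ) ∂(stripMeasure n)) := by
          rw [← mul_assoc, ENNReal.inv_mul_cancel hv0 hvt, one_mul]
      _ ≤ v⁻¹ * ((S : ℝ≥0∞) ^ (10 / 3 : ℝ) *
          ((ENNReal.ofReal (2 * (1 + K ^ 2)) * (V * N)) ^ (5 / 3 : ℝ) * I ^ (5 / 3 : ℝ))) :=
          mul_le_mul_right h4 _
      _ = C * I ^ (5 / 3 : ℝ) := by rw [hC]; ring
  have hun : (⋃ k : ℕ, {x : Space n | |zCoord x| ≤ (k : ℝ) + 1}) = univ := by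
    ext x
    simp only [mem_iUnion, mem_univ, iff_true]
    obtain ⟨k, hk⟩ := exists_nat_ge |zCoord x|
    exact ⟨k, by simp only [mem_ofPred_eq]; linarith⟩
  have hmono : Monotone fun k : ℕ => {x : Space n | |zCoord x| ≤ (k : ℝ) + 1} := by
    intro k l hkl x hx
    have : (k : ℝ) ≤ l := by exact_mod_cast hkl
    simp only [mem_ofPred_eq] at hx ⊢
    linarith
  rw [← setLIntegral_univ, ← hun, setLIntegral_iUnion_of_directed _ hmono.directed_le]
  exact iSup_le fun k => key _ (by simp)

/-! ### Cubic space-time integrability -/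

/-- The exponent 3 lies between 2 and 10/3. -/
theorem enorm_pow_three_le (s : ℝ) : ‖s ^ 3‖ₑ ≤ ENNReal.ofReal (s ^ 2) + ‖s‖ₑ ^ (10 / 3 : ℝ) := by
  rw [← ofReal_norm, ← ofReal_norm, ENNReal.ofReal_rpow_of_nonneg (norm_nonneg _) (by norm_num),
    ← ENNReal.ofReal_add (sq_nonneg _) (by positivity)]
  refine ENNReal.ofReal_le_ofReal ?_
  rw [norm_pow, Real.norm_eq_abs, ← sq_abs]
  rcases le_total |s| 1 with h | h
  · have h1 : |s| ^ 3 ≤ |s| ^ 2 := pow_le_pow_of_le_one (abs_nonneg _) h (by norm_num)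
    have h2 : 0 ≤ |s| ^ (10 / 3 : ℝ) := by positivity
    linarith
  · have h1 : |s| ^ (3 : ℝ) ≤ |s| ^ (10 / 3 : ℝ) := Real.rpow_le_rpow_of_exponent_le h (by norm_num)
    rw [show (3 : ℝ) = ((3 : ℕ) : ℝ) by norm_num, Real.rpow_natCast] at h1
    have h2 : 0 ≤ |s| ^ 2 := by positivity
    linarith

/-- At every time, `(‖a‖² + ‖∇a‖²)^{5/3}` is controlled by `1 + ‖Δa‖²` once `‖a‖²` is bounded. -/
theorem sobolev_norm_rpow_le {a : Space n → ℝ} (ha : SP a) {B : ℝ} (hB : 0 ≤ B)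
    (hA : ∫⁻ x, ENNReal.ofReal (a x ^ 2) ∂(stripMeasure n) ≤ ENNReal.ofReal B) :
    (∫⁻ x, ENNReal.ofReal (a x ^ 2 + gradSq a x) ∂(stripMeasure n)) ^ (5 / 3 : ℝ) ≤
      ENNReal.ofReal ((2 * B + 1) ^ (5 / 3 : ℝ)) *
        (1 + ∫⁻ x, ENNReal.ofReal (lap a x ^ 2) ∂(stripMeasure n)) := by
  rcases eq_or_ne (∫⁻ x, ENNReal.ofReal (lap a x ^ 2) ∂(stripMeasure n)) ⊤ with hL | hL
  · rw [hL, add_top, ENNReal.mul_top]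
    · exact le_top
    · rw [ne_eq, ENNReal.ofReal_eq_zero, not_le]; positivity
  · obtain ⟨L, hL0, hLe⟩ : ∃ L : ℝ, 0 ≤ L ∧
        ∫⁻ x, ENNReal.ofReal (lap a x ^ 2) ∂(stripMeasure n) = ENNReal.ofReal L :=
      ⟨_, ENNReal.toReal_nonneg, (ENNReal.ofReal_toReal hL).symm⟩
    have hs : 1 ≤ √(1 + L) := Real.one_le_sqrt.2 (by linarith)
    have hs2 : √(1 + L) ^ 2 = 1 + L := Real.sq_sqrt (by linarith)
    -- The choice l = √(1+L) balances both terms and bounds the squared H¹ norm by a multiple of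
    -- (1+L)^{1/2}. Its power 5/3 is then of order (1+L)^{5/6} ≤ 1+L, which is integrable in time.
    have h1 := lintegral_gradSq_le ha (l := √(1 + L)) (by linarith)
    rw [hLe, ← ENNReal.ofReal_mul (by positivity)] at h1
    have hG : ∫⁻ x, ENNReal.ofReal (a x ^ 2 + gradSq a x) ∂(stripMeasure n) ≤
        ENNReal.ofReal ((2 * B + 1) * √(1 + L)) := by
      have e1 : ∫⁻ x, ENNReal.ofReal (a x ^ 2 + gradSq a x) ∂(stripMeasure n) =
          ∫⁻ x, ENNReal.ofReal (a x ^ 2) ∂(stripMeasure n) +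
            ∫⁻ x, ENNReal.ofReal (gradSq a x) ∂(stripMeasure n) := by
        rw [← lintegral_add_left (ha.pow 2).continuous.measurable.ennreal_ofReal]
        exact lintegral_congr fun x => ENNReal.ofReal_add (sq_nonneg _) (gradSq_nonneg _ _)
      rw [e1]
      calc _ ≤ ENNReal.ofReal B + (ENNReal.ofReal √(1 + L) * ENNReal.ofReal B +
            ENNReal.ofReal ((√(1 + L))⁻¹ * L)) := by
            refine add_le_add hA (h1.trans ?_)
            gcongr
        _ = ENNReal.ofReal (B + (√(1 + L) * B + (√(1 + L))⁻¹ * L)) := by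
            rw [← ENNReal.ofReal_mul (by positivity), ← ENNReal.ofReal_add (by positivity) (by positivity),
              ← ENNReal.ofReal_add (by positivity) (by positivity)]
        _ ≤ _ := by
            refine ENNReal.ofReal_le_ofReal ?_
            have : (√(1 + L))⁻¹ * L ≤ √(1 + L) := by
              rw [inv_mul_le_iff₀ (by linarith)]; nlinarith
            nlinarith [mul_le_mul_of_nonneg_left hs hB]
    rw [hLe]
    refine (ENNReal.rpow_le_rpow hG (by norm_num)).trans ?_
    rw [ENNReal.ofReal_rpow_of_nonneg (by positivity) (by norm_num), ← ENNReal.ofReal_one,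
      ← ENNReal.ofReal_add zero_le_one hL0, ← ENNReal.ofReal_mul (by positivity)]
    refine ENNReal.ofReal_le_ofReal ?_
    rw [Real.mul_rpow (by positivity) (by positivity)]
    refine mul_le_mul_of_nonneg_left ?_ (by positivity)
    calc √(1 + L) ^ (5 / 3 : ℝ) ≤ √(1 + L) ^ (2 : ℝ) :=
          Real.rpow_le_rpow_of_exponent_le hs (by norm_num)
      _ = 1 + L := by rw [Real.rpow_two, hs2]

/-- Bounds for a in L^∞(L²) and for Δa in L²(L²) are interpolated at each time; the Sobolev term is
at most linear in ∫(Δa)², so it can be integrated in time. -/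
theorem ST.integrable_cube (hn : n ≤ 4) {T t₁ t₂ : ℝ} {a : ℝ → Space n → ℝ} (ha : ST T a)
    (h1 : t₁ ∈ Ioo 0 T) (h2 : t₂ ∈ Ioo 0 T) {B : ℝ} (hB : 0 ≤ B)
    (hA : ∀ t ∈ Icc t₁ t₂, ∫⁻ x, ENNReal.ofReal (a t x ^ 2) ∂(stripMeasure n) ≤ ENNReal.ofReal B)
    (il : Integrable (fun p : ℝ × Space n => CahnHilliard.lap (a p.1) p.2 ^ 2) (stMeasure n t₁ t₂)) :
    Integrable (fun p : ℝ × Space n => a p.1 p.2 ^ 3) (stMeasure n t₁ t₂) := by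
  obtain ⟨C, hC, hsob⟩ := lintegral_rpow_le hn
  have hm := (ha.pow 3).aestronglyMeasurable h1 h2
  refine ⟨hm, ?_⟩
  have m3 : AEMeasurable (fun p : ℝ × Space n => ENNReal.ofReal (CahnHilliard.lap (a p.1) p.2 ^ 2))
    (stMeasure n t₁ t₂) := il.1.aemeasurable.ennreal_ofReal
  have f3 := Integrable.lintegral_ofReal_lt_top il
  have m1 : AEMeasurable (fun p : ℝ × Space n => ‖a p.1 p.2 ^ 3‖ₑ) (stMeasure n t₁ t₂) := hm.enorm
  unfold HasFiniteIntegral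
  unfold stMeasure at m1 m3 f3 ⊢
  rw [lintegral_prod _ m3] at f3
  rw [lintegral_prod _ m1]
  set K := ENNReal.ofReal ((2 * B + 1) ^ (5 / 3 : ℝ)) with hK
  have hle : ∀ r ∈ Ioc t₁ t₂, ∫⁻ x, ‖a r x ^ 3‖ₑ ∂(stripMeasure n) ≤
      (ENNReal.ofReal B + C * K) + C * K * ∫⁻ x, ENNReal.ofReal (CahnHilliard.lap (a r) x ^ 2) ∂(stripMeasure n) := by
    intro r hr
    have hr' := Ioc_subset_Icc_self hr
    have hs := ha.sp (Icc_subset_of_mem h1 h2 hr')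
    calc ∫⁻ x, ‖a r x ^ 3‖ₑ ∂(stripMeasure n)
        ≤ ∫⁻ x, (ENNReal.ofReal (a r x ^ 2) + ‖a r x‖ₑ ^ (10 / 3 : ℝ)) ∂(stripMeasure n) :=
          lintegral_mono fun x => enorm_pow_three_le _
      _ = ∫⁻ x, ENNReal.ofReal (a r x ^ 2) ∂(stripMeasure n) +
          ∫⁻ x, ‖a r x‖ₑ ^ (10 / 3 : ℝ) ∂(stripMeasure n) :=
          lintegral_add_left (hs.pow 2).continuous.measurable.ennreal_ofReal _
      _ ≤ ENNReal.ofReal B + C * (K * (1 + ∫⁻ x, ENNReal.ofReal (CahnHilliard.lap (a r) x ^ 2) ∂(stripMeasure n))) := by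
          refine add_le_add (hA r hr') ((hsob _ hs).trans ?_)
          gcongr
          exact sobolev_norm_rpow_le hs hB (hA r hr')
      _ = _ := by ring
  have hCK : C * K ≠ ⊤ := ENNReal.mul_ne_top hC ENNReal.ofReal_ne_top
  refine (setLIntegral_mono_ae' measurableSet_Ioc (Filter.Eventually.of_forall hle)).trans_lt ?_
  rw [lintegral_add_left measurable_const, lintegral_const_mul' _ _ hCK]
  refine ENNReal.add_lt_top.2 ⟨?_, ENNReal.mul_lt_top (lt_top_iff_ne_top.2 hCK) f3⟩
  rw [lintegral_const]
  refine ENNReal.mul_lt_top (ENNReal.add_lt_top.2 ⟨ENNReal.ofReal_lt_top, lt_top_iff_ne_top.2 hCK⟩) ?_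
  simp

/-! ### The kink -/

/-- The profile of the kink centred at `a`. -/
def kinkProfile (a s : ℝ) : ℝ := Real.tanh ((s - a) / √2)

/-- The derivative of the profile of the kink. -/
def kinkSlope (a s : ℝ) : ℝ := (1 - kinkProfile a s ^ 2) / √2

theorem hasDerivAt_tanh (s : ℝ) : HasDerivAt Real.tanh (1 - Real.tanh s ^ 2) s := by
  have h := (Real.hasDerivAt_sinh s).div (Real.hasDerivAt_cosh s) (Real.cosh_pos s).ne'
  have e : Real.tanh = fun x => Real.sinh x / Real.cosh x := funext Real.tanh_eq_sinh_div_cosh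
  rw [e]
  refine h.congr_deriv ?_
  have := (Real.cosh_pos s).ne'
  field_simp

theorem hasDerivAt_kinkProfile (a s : ℝ) : HasDerivAt (kinkProfile a) (kinkSlope a s) s := by
  have h1 : HasDerivAt (fun s : ℝ => (s - a) / √2) (1 / √2) s :=
    ((hasDerivAt_id s).sub_const a).div_const _
  have := (hasDerivAt_tanh ((s - a) / √2)).comp s h1
  rwa [mul_one_div] at this

theorem sqrt_two_sq : √2 ^ 2 = (2 : ℝ) := Real.sq_sqrt (by norm_num)

/-- Differentiating v' = (1 - v²)/√2 gives the second order equation v'' = G'(v). -/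
theorem hasDerivAt_kinkSlope (a s : ℝ) :
    HasDerivAt (kinkSlope a) (kinkProfile a s ^ 3 - kinkProfile a s) s := by
  have h := (((hasDerivAt_kinkProfile a s).fun_pow 2).const_sub 1).div_const √2
  refine h.congr_deriv ?_
  unfold kinkSlope
  have h2 : √2 * √2 = (2 : ℝ) := Real.mul_self_sqrt (by norm_num)
  have : √2 ≠ 0 := by positivity
  field_simp
  push_cast
  rw [sqrt_two_sq]
  ring

theorem contDiff_tanh : ContDiff ℝ ∞ Real.tanh := by
  have e : Real.tanh = fun x => Real.sinh x / Real.cosh x := funext Real.tanh_eq_sinh_div_cosh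
  rw [e]
  exact Real.contDiff_sinh.div Real.contDiff_cosh fun x => (Real.cosh_pos x).ne'

theorem contDiff_kinkProfile (a : ℝ) : ContDiff ℝ ∞ (kinkProfile a) :=
  contDiff_tanh.comp (by fun_prop)

theorem contDiff_kinkSlope (a : ℝ) : ContDiff ℝ ∞ (kinkSlope a) :=
  (contDiff_const.sub ((contDiff_kinkProfile a).pow 2)).div_const _

theorem sp_kink (a : ℝ) : SP (kink n a) := SP.zfun (contDiff_kinkProfile a)

theorem kinkProfile_sq_lt_one (a s : ℝ) : kinkProfile a s ^ 2 < 1 := by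
  unfold kinkProfile
  rw [Real.tanh_eq_sinh_div_cosh, div_pow, div_lt_one (by positivity)]
  have := Real.cosh_sq ((s - a) / √2)
  linarith

theorem abs_kinkProfile_lt_one (a s : ℝ) : |kinkProfile a s| < 1 :=
  (sq_lt_one_iff_abs_lt_one _).1 (kinkProfile_sq_lt_one a s)

theorem kinkSlope_pos (a s : ℝ) : 0 < kinkSlope a s :=
  div_pos (by linarith [kinkProfile_sq_lt_one a s]) (by positivity)

theorem kinkSlope_le_one (a s : ℝ) : kinkSlope a s ≤ 1 := by
  unfold kinkSlope
  have : 1 ≤ √2 := Real.one_le_sqrt.2 (by norm_num)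
  rw [div_le_one (by positivity)]
  linarith [sq_nonneg (kinkProfile a s)]

theorem lap_kink (a : ℝ) : lap (kink n a) = fun x => kink n a x ^ 3 - kink n a x :=
  lap_zfun (hasDerivAt_kinkProfile a) (hasDerivAt_kinkSlope a)

theorem pd_kink (a : ℝ) (i : Fin (n + 1)) :
    pd i (kink n a) = fun x => if i = Fin.last n then kinkSlope a (zCoord x) else 0 :=
  pd_zfun (hasDerivAt_kinkProfile a) i

theorem gradSq_kink (a : ℝ) (x : Space n) : gradSq (kink n a) x = kinkSlope a (zCoord x) ^ 2 := by
  simp [gradSq, pd_kink]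

theorem continuous_kinkSlope (a : ℝ) : Continuous (kinkSlope a) := (contDiff_kinkSlope a).continuous

theorem tendsto_kinkProfile_atTop (a : ℝ) : Filter.Tendsto (kinkProfile a) Filter.atTop (nhds 1) := by
  have h1 : Filter.Tendsto (fun s : ℝ => (s - a) / √2) Filter.atTop Filter.atTop :=
    (Filter.tendsto_atTop_add_const_right _ (-a) Filter.tendsto_id).atTop_div_const (by positivity)
  have h2 : Filter.Tendsto (fun s : ℝ => Real.exp (-(2 * s))) Filter.atTop (nhds 0) :=
    Real.tendsto_exp_neg_atTop_nhds_zero.comp (Filter.tendsto_id.const_mul_atTop two_pos)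
  have h3 : Filter.Tendsto (fun s : ℝ => (1 - Real.exp (-(2 * s))) / (1 + Real.exp (-(2 * s))))
      Filter.atTop (nhds ((1 - 0) / (1 + 0))) :=
    (h2.const_sub 1).div (h2.const_add 1) (by norm_num)
  rw [sub_zero, add_zero, div_one] at h3
  refine (h3.comp h1).congr fun s => ?_
  simp only [Function.comp, kinkProfile]
  set y := (s - a) / √2
  have h4 : Real.exp (-(2 * y)) = Real.exp (-y) * Real.exp (-y) := by rw [← Real.exp_add]; ring_nf
  have h5 : Real.exp y * Real.exp (-y) = 1 := by rw [← Real.exp_add]; simp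
  have h6 := Real.exp_pos y
  have h7 := Real.exp_pos (-y)
  rw [Real.tanh_eq_sinh_div_cosh, Real.sinh_eq, Real.cosh_eq, h4, div_div_div_cancel_right₀ two_ne_zero,
    div_eq_div_iff (by positivity) (by positivity)]
  linear_combination (-2 * Real.exp (-y)) * h5

theorem kinkProfile_neg (a s : ℝ) : kinkProfile a s = - kinkProfile (-a) (-s) := by
  unfold kinkProfile
  rw [← Real.tanh_neg]
  congr 1
  ring

theorem tendsto_kinkProfile_atBot (a : ℝ) : Filter.Tendsto (kinkProfile a) Filter.atBot (nhds (-1)) := by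
  have := ((tendsto_kinkProfile_atTop (-a)).comp Filter.tendsto_neg_atBot_atTop).neg
  exact this.congr fun s => (kinkProfile_neg a s).symm

theorem integrable_of_hasDerivAt_of_bounded {F f : ℝ → ℝ} (hF : ∀ s, HasDerivAt F (f s) s)
    (hf : Continuous f) (h0 : ∀ s, 0 ≤ f s) {K : ℝ} (hK : ∀ s, |F s| ≤ K) : Integrable f := by
  refine integrable_of_intervalIntegral_norm_bounded (l := Filter.atTop) (a := fun i : ℝ => -i) (b := fun i : ℝ => i)
    (2 * K) (fun i => (hf.integrableOn_Icc).mono_set Ioc_subset_Icc_self) Filter.tendsto_neg_atTop_atBot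
    Filter.tendsto_id (Filter.Eventually.of_forall fun i => ?_)
  have e : ∀ s, ‖f s‖ = f s := fun s => by rw [Real.norm_eq_abs, abs_of_nonneg (h0 s)]
  simp only [e]
  rw [intervalIntegral.integral_eq_sub_of_hasDerivAt (fun s _ => hF s) (hf.intervalIntegrable _ _)]
  have h1 := abs_le.1 (hK i)
  have h2 := abs_le.1 (hK (-i))
  linarith [h1.2, h2.1]

theorem integrable_kinkSlope (a : ℝ) : Integrable (kinkSlope a) :=
  integrable_of_hasDerivAt_of_bounded (hasDerivAt_kinkProfile a) (continuous_kinkSlope a)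
    (fun s => (kinkSlope_pos a s).le) fun s => (abs_kinkProfile_lt_one a s).le

theorem integrable_gradSq_kink (a : ℝ) : Integrable (gradSq (kink n a)) (stripMeasure n) := by
  have h : Integrable (fun s => kinkSlope a s ^ 2) := by
    refine (integrable_kinkSlope a).mono' ((continuous_kinkSlope a).pow 2).aestronglyMeasurable
      (Filter.Eventually.of_forall fun s => ?_)
    have h0 := kinkSlope_pos a s
    rw [Real.norm_eq_abs, abs_of_nonneg (sq_nonneg _), sq]
    exact mul_le_of_le_one_left h0.le (kinkSlope_le_one a s)
  exact (integrable_zCoord (n := n) h).congr (Filter.Eventually.of_forall fun x => (gradSq_kink a x).symm)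

/-! ### Smooth flows with finite energy and square integrable chemical potential -/

/-- The chemical potential `G'(w) - Δw`. -/
def chem (w : Space n → ℝ) : Space n → ℝ := fun x => w x ^ 3 - w x - lap w x

/-- A smooth solution of the Cahn–Hilliard equation, bounded, and square integrable after
subtraction of a kink. -/
structure Flow (T : ℝ) (u : ℝ → Space n → ℝ) : Prop where
  st : ST T u
  eq : ∀ t ∈ Ioo 0 T, ∀ x, td u t x = lap (chem (u t)) x
  bdd : ∀ t ∈ Ioo 0 T, ∀ x, |u t x| ≤ 2
  sq_w : ∀ t ∈ Ioo 0 T, Integrable (fun x => (u t x - kink n 0 x) ^ 2) (stripMeasure n)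
  sq_chem : ∀ t ∈ Ioo 0 T, Integrable (fun x => chem (u t) x ^ 2) (stripMeasure n)

section
variable {T t₁ t₂ : ℝ} {a b : ℝ → Space n → ℝ}

theorem stMeasure_mono {s₁ s₂ : ℝ} (h1 : s₁ ≤ t₁) (h2 : t₂ ≤ s₂) :
    stMeasure n t₁ t₂ ≤ stMeasure n s₁ s₂ := by
  rw [stMeasure_eq, stMeasure_eq]
  exact Measure.restrict_mono (prod_mono (Ioc_subset_Ioc h1 h2) subset_rfl) le_rfl

theorem ST.integrable_of_le (hb : ST T b) (h1 : t₁ ∈ Ioo 0 T) (h2 : t₂ ∈ Ioo 0 T)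
    {g : ℝ × Space n → ℝ} (hg : Integrable g (stMeasure n t₁ t₂))
    (hle : ∀ r ∈ Ioo 0 T, ∀ x, |b r x| ≤ g (r, x)) :
    Integrable (fun p : ℝ × Space n => b p.1 p.2) (stMeasure n t₁ t₂) := by
  refine hg.mono' (hb.aestronglyMeasurable h1 h2) ?_
  filter_upwards [ae_st_mem t₁ t₂] with p hp
  exact hle _ (Icc_subset_of_mem h1 h2 (Ioc_subset_Icc_self hp)) _

theorem ST.integrable_sq_of_bound (ha : ST T a) (h1 : t₁ ∈ Ioo 0 T) (h2 : t₂ ∈ Ioo 0 T) {B : ℝ}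
    (hA : ∀ t ∈ Icc t₁ t₂, ∫⁻ x, ENNReal.ofReal (a t x ^ 2) ∂(stripMeasure n) ≤ ENNReal.ofReal B) :
    Integrable (fun p : ℝ × Space n => a p.1 p.2 ^ 2) (stMeasure n t₁ t₂) := by
  refine (ha.pow 2).integrable_of_lintegral h1 h2 (fun _ _ _ => sq_nonneg _) ?_
  have m2 : AEMeasurable (fun p : ℝ × Space n => ENNReal.ofReal (a p.1 p.2 ^ 2)) (stMeasure n t₁ t₂) :=
    ((ha.pow 2).aestronglyMeasurable h1 h2).aemeasurable.ennreal_ofReal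
  unfold stMeasure at m2 ⊢
  rw [lintegral_prod _ m2]
  refine (setLIntegral_mono_ae' measurableSet_Ioc (Filter.Eventually.of_forall fun r hr =>
    hA r (Ioc_subset_Icc_self hr))).trans_lt ?_
  rw [lintegral_const]
  exact ENNReal.mul_lt_top ENNReal.ofReal_lt_top (by simp)

/-- The growth condition of the energy estimate holds for square integrable functions. -/
theorem ST.localized_growth (ha : ST T a) (h1 : t₁ ∈ Ioo 0 T) (h2 : t₂ ∈ Ioo 0 T)
    (ia : Integrable (fun p : ℝ × Space n => a p.1 p.2 ^ 2) (stMeasure n t₁ t₂)) :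
    ∀ R, 1 ≤ R → ∀ t ∈ Icc t₁ t₂, ∫ r in t₁..t, ∫ x, cut n (2 * R) x * a r x ^ 2 ∂(stripMeasure n) ≤
      (∫ p, a p.1 p.2 ^ 2 ∂(stMeasure n t₁ t₂)) * R := by
  intro R hR t ht
  have htT := Icc_subset_of_mem h1 h2 ht
  have hF := isTestFunction_cut (n := n) (R := 2 * R) (by positivity)
  rw [← (ha.pow 2).integral_st h1 htT ht.1 hF]
  have i0 := ia.mono_measure (stMeasure_mono (n := n) le_rfl ht.2)
  calc ∫ p, cut n (2 * R) p.2 * a p.1 p.2 ^ 2 ∂(stMeasure n t₁ t)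
      ≤ ∫ p, a p.1 p.2 ^ 2 ∂(stMeasure n t₁ t) :=
        integral_mono ((ha.pow 2).integrable_st h1 htT hF) i0 fun p =>
          mul_le_of_le_one_left (sq_nonneg _) (cut_le_one _ _)
    _ ≤ ∫ p, a p.1 p.2 ^ 2 ∂(stMeasure n t₁ t₂) :=
        integral_mono_measure (stMeasure_mono le_rfl ht.2)
          (Filter.Eventually.of_forall fun _ => sq_nonneg _) ia
    _ ≤ _ := le_mul_of_one_le_right (integral_nonneg fun _ => sq_nonneg _) hR

/-- The growth condition of the energy estimate holds for bounded functions. -/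
theorem ST.localized_growth_of_bounded (ha : ST T a) (h1 : t₁ ∈ Ioo 0 T) (h2 : t₂ ∈ Ioo 0 T) {M : ℝ}
    (hM : ∀ r ∈ Ioo 0 T, ∀ x, |a r x| ≤ M) :
    ∀ R, 1 ≤ R → ∀ t ∈ Icc t₁ t₂, ∫ r in t₁..t, ∫ x, cut n (2 * R) x * a r x ^ 2 ∂(stripMeasure n) ≤
      ((t₂ - t₁) * (8 * M ^ 2)) * R := by
  intro R hR t ht
  have htT := Icc_subset_of_mem h1 h2 ht
  have hF := isTestFunction_cut (n := n) (R := 2 * R) (by positivity)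
  have hS : MeasurableSet {x : Space n | |zCoord x| ≤ 4 * R} :=
    (isClosed_le continuous_zCoord.abs continuous_const).measurableSet
  have hμ := stripMeasure_zCoord_le (n := n) (4 * R)
  have hsub : uIcc t₁ t ⊆ Ioo 0 T := by rw [uIcc_of_le ht.1]; exact Icc_subset_of_mem h1 htT
  have hle : ∀ r ∈ Icc t₁ t, ∫ x, cut n (2 * R) x * a r x ^ 2 ∂(stripMeasure n) ≤ 8 * R * M ^ 2 := by
    intro r hr
    have hrT := Icc_subset_of_mem h1 htT hr
    calc ∫ x, cut n (2 * R) x * a r x ^ 2 ∂(stripMeasure n)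
        ≤ ∫ x, {x : Space n | |zCoord x| ≤ 4 * R}.indicator (fun _ => M ^ 2) x ∂(stripMeasure n) := by
          refine integral_mono (hF.mul ((ha.sp hrT).pow 2)).integrable ?_ fun x => ?_
          · refine (integrable_indicator_iff hS).2 (integrableOn_const ?_)
            rw [hμ]; exact ENNReal.ofReal_ne_top
          · simp only
            by_cases hx : |zCoord x| ≤ 4 * R
            · rw [indicator_of_mem (show x ∈ {x : Space n | |zCoord x| ≤ 4 * R} from hx)]
              have h3 : a r x ^ 2 ≤ M ^ 2 := by
                rw [← sq_abs (a r x)]; exact pow_le_pow_left₀ (abs_nonneg _) (hM r hrT x) 2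
              exact (mul_le_of_le_one_left (sq_nonneg _) (cut_le_one _ _)).trans h3
            · rw [indicator_of_notMem (show x ∉ {x : Space n | |zCoord x| ≤ 4 * R} from hx), cut_eq_zero (by positivity) (by linarith [not_le.1 hx]), zero_mul]
      _ = 8 * R * M ^ 2 := by
          rw [integral_indicator_const _ hS, smul_eq_mul, measureReal_def, hμ,
            ENNReal.toReal_ofReal (by positivity)]
          ring
  have c1 := ((ha.pow 2).continuousOn_integral hF).mono hsub
  calc _ ≤ ∫ r in t₁..t, 8 * R * M ^ 2 :=
        intervalIntegral.integral_mono_on ht.1 c1.intervalIntegrable intervalIntegrable_const hle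
    _ = (t - t₁) * (8 * R * M ^ 2) := by rw [intervalIntegral.integral_const, smul_eq_mul]
    _ ≤ (t₂ - t₁) * (8 * R * M ^ 2) :=
        mul_le_mul_of_nonneg_right (by linarith [ht.2]) (by positivity)
    _ = _ := by ring

/-- Supplies initial times for estimates of quantities that are known to be integrable only in
space-time. -/
theorem exists_slice_integrable {f : ℝ × Space n → ℝ} (h12 : t₁ < t₂)
    (hf : Integrable f (stMeasure n t₁ t₂)) :
    ∃ s ∈ Ioc t₁ t₂, Integrable (fun x => f (s, x)) (stripMeasure n) := by
  have h1 := Integrable.prod_right_ae (μ := (volume : Measure ℝ).restrict (Ioc t₁ t₂)) hf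
  have h2 := h1.and (ae_restrict_mem measurableSet_Ioc)
  have : ((ae ((volume : Measure ℝ).restrict (Ioc t₁ t₂)))).NeBot := by
    rw [ae_neBot, ne_eq, Measure.restrict_eq_zero, Real.volume_Ioc, ENNReal.ofReal_eq_zero, not_le]
    linarith
  obtain ⟨s, hs1, hs2⟩ := h2.exists
  exact ⟨s, hs2, hs1⟩

end

/-! ### Regularity of the flow -/

theorem SP.chem {w : Space n → ℝ} (hw : SP w) : SP (chem w) := ((hw.pow 3).sub hw).sub hw.lap

theorem ST.chem {T : ℝ} {u : ℝ → Space n → ℝ} (hu : ST T u) : ST T (fun t => chem (u t)) :=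
  ((hu.pow 3).sub hu).sub hu.lap

section
variable {T t₁ t₂ : ℝ} {u : ℝ → Space n → ℝ}

/-- The second derivative of the potential along the flow. -/
def well2 (w : Space n → ℝ) (x : Space n) : ℝ := 3 * w x ^ 2 - 1

theorem ST.well2 (hu : ST T u) : ST T (fun t => well2 (u t)) := ((hu.pow 2).const_mul 3).sub (ST.const 1)

theorem SP.well2 {w : Space n → ℝ} (hw : SP w) : SP (well2 w) := ((hw.pow 2).const_mul 3).sub (SP.const 1)

theorem hasDerivAt_well (s : ℝ) : HasDerivAt (fun s : ℝ => s ^ 3 - s) (3 * s ^ 2 - 1) s := by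
  have h := (hasDerivAt_pow 3 s).sub (hasDerivAt_id s)
  exact h.congr_deriv (by norm_num)

theorem ST.td_chem (hu : ST T u) {t : ℝ} (ht : t ∈ Ioo 0 T) (x : Space n) :
    CahnHilliard.td (fun t => CahnHilliard.chem (u t)) t x =
      CahnHilliard.well2 (u t) x * CahnHilliard.td u t x - CahnHilliard.lap (CahnHilliard.td u t) x := by
  have h1 := ST.td_sub ((hu.pow 3).sub hu) hu.lap ht x
  have h2 := ST.td_comp hasDerivAt_well hu ht x
  have h3 := ST.td_lap hu ht x
  rw [h3, h2] at h1
  exact h1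

theorem abs_well2_le {s : ℝ} (h : |s| ≤ 2) : |3 * s ^ 2 - 1| ≤ 11 := by
  have := sq_le_sq' (abs_le.1 h).1 (abs_le.1 h).2
  rw [abs_le]; constructor <;> nlinarith [sq_nonneg s]

theorem Flow.td_td (hu : Flow T u) {t : ℝ} (ht : t ∈ Ioo 0 T) (x : Space n) :
    td (td u) t x = lap (td (fun t => chem (u t)) t) x := by
  have h1 : td (td u) t x = td (fun t => lap (chem (u t))) t x := by
    refine Filter.EventuallyEq.deriv_eq ?_
    filter_upwards [isOpen_Ioo.mem_nhds ht] with s hs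
    exact hu.eq s hs x
  rw [h1, ST.td_lap hu.st.chem ht x]

/-- The deviation from the reference kink. -/
def dev (u : ℝ → Space n → ℝ) (t : ℝ) (x : Space n) : ℝ := u t x - kink n 0 x

theorem ST.dev (hu : ST T u) : ST T (dev u) := hu.sub (ST.static (sp_kink 0))

/-- The nonlinear term in the equation for the deviation from the kink. -/
def devWell (u : ℝ → Space n → ℝ) (t : ℝ) (x : Space n) : ℝ :=
  (u t x ^ 3 - u t x) - (kink n 0 x ^ 3 - kink n 0 x)

theorem ST.devWell (hu : ST T u) : ST T (devWell u) :=
  ((hu.pow 3).sub hu).sub (ST.static (((sp_kink 0).pow 3).sub (sp_kink 0)))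

theorem Flow.abs_devWell_le (hu : Flow T u) {t : ℝ} (ht : t ∈ Ioo 0 T) (x : Space n) :
    |devWell u t x| ≤ 11 * |dev u t x| := by
  have h1 := abs_le.1 (hu.bdd t ht x)
  have h2 : |kink n 0 x| < 1 := abs_kinkProfile_lt_one 0 _
  have h2 := abs_lt.1 h2
  have e : devWell u t x = (u t x ^ 2 + u t x * kink n 0 x + kink n 0 x ^ 2 - 1) * dev u t x := by
    simp only [devWell, dev]; ring
  rw [e, abs_mul]
  refine mul_le_mul_of_nonneg_right ?_ (abs_nonneg _)
  rw [abs_le]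
  constructor <;> nlinarith [sq_nonneg (u t x + kink n 0 x), sq_nonneg (u t x - kink n 0 x)]

theorem Flow.chem_eq (hu : Flow T u) {t : ℝ} (ht : t ∈ Ioo 0 T) :
    chem (u t) = fun x => devWell u t x - lap (dev u t) x := by
  have h := lap_sub (hu.st.sp ht) (sp_kink (n := n) 0)
  have h' : lap (dev u t) = fun x => lap (u t) x - (kink n 0 x ^ 3 - kink n 0 x) := by
    rw [lap_kink] at h; exact h
  funext x
  rw [h']
  simp only [chem, devWell]
  ring

theorem Flow.td_dev (hu : Flow T u) {t : ℝ} (ht : t ∈ Ioo 0 T) (x : Space n) :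
    td (dev u) t x = - lap (lap (dev u t)) x + 0 + lap (devWell u t) x := by
  have h1 : td (dev u) t x = td u t x := by
    simp only [td, dev]
    exact deriv_sub_const _
  rw [h1, hu.eq t ht x, hu.chem_eq ht,
    lap_sub (hu.st.devWell.sp ht) (hu.st.dev.sp ht).lap]
  ring

theorem sq_sub_le (a b : ℝ) : (a - b) ^ 2 ≤ 2 * a ^ 2 + 2 * b ^ 2 := by nlinarith [sq_nonneg (a + b)]

theorem sq_le_of_abs_le {a b M : ℝ} (h : |a| ≤ M * |b|) : a ^ 2 ≤ M ^ 2 * b ^ 2 := by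
  rw [← sq_abs a, ← sq_abs b, ← mul_pow]
  exact pow_le_pow_left₀ (abs_nonneg _) h 2

/-- First application of the energy estimate: w = u - v_0 solves w_t = -Δ²w + Δ(G'(u) - G'(v_0)),
and G' is Lipschitz on the range of u and v_0. Square integrability in space-time is not yet known,
so the growth condition comes from |w| ≤ 3. -/
theorem Flow.dev_bound (hu : Flow T u) (h1 : t₁ ∈ Ioo 0 T) (h2 : t₂ ∈ Ioo 0 T) :
    ∃ B, 0 ≤ B ∧
      (∀ t ∈ Icc t₁ t₂, ∫⁻ x, ENNReal.ofReal (dev u t x ^ 2) ∂(stripMeasure n) ≤ ENNReal.ofReal B) ∧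
      ∀ t ∈ Icc t₁ t₂, Integrable (fun p : ℝ × Space n => lap (dev u p.1) p.2 ^ 2) (stMeasure n t₁ t) := by
  refine energy_estimate hu.st.dev h1 h2 (g := devWell u) (h := fun _ _ => 0) hu.st.devWell (ST.const 0)
    (M := 11) (C₀ := (t₂ - t₁) * (8 * 3 ^ 2)) (by norm_num) (fun r hr x => hu.abs_devWell_le hr x)
    (fun r hr x => by simp) (fun r hr x => hu.td_dev hr x) (hu.sq_w t₁ h1) ?_
  refine hu.st.dev.localized_growth_of_bounded h1 h2 fun r hr x => ?_
  have b1 := abs_le.1 (hu.bdd r hr x)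
  have b2 : |kink n 0 x| < 1 := abs_kinkProfile_lt_one 0 _
  have b2 := abs_lt.1 b2
  simp only [dev]
  rw [abs_le]; constructor <;> linarith [b1.1, b1.2, b2.1, b2.2]

theorem Flow.integrable_dev (hu : Flow T u) (h1 : t₁ ∈ Ioo 0 T) (h2 : t₂ ∈ Ioo 0 T) :
    Integrable (fun p : ℝ × Space n => dev u p.1 p.2 ^ 2) (stMeasure n t₁ t₂) := by
  obtain ⟨B, _, hB, _⟩ := hu.dev_bound h1 h2
  exact hu.st.dev.integrable_sq_of_bound h1 h2 hB

theorem stMeasure_eq_zero (h : t₂ ≤ t₁) : stMeasure n t₁ t₂ = 0 := by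
  rw [stMeasure_eq, Ioc_eq_empty (not_lt.2 h), empty_prod, Measure.restrict_empty]

theorem Flow.integrable_lap_dev (hu : Flow T u) (h1 : t₁ ∈ Ioo 0 T) (h2 : t₂ ∈ Ioo 0 T) :
    Integrable (fun p : ℝ × Space n => lap (dev u p.1) p.2 ^ 2) (stMeasure n t₁ t₂) := by
  rcases le_total t₁ t₂ with h | h
  · obtain ⟨B, _, _, hB⟩ := hu.dev_bound h1 h2
    exact hB t₂ (right_mem_Icc.2 h)
  · rw [stMeasure_eq_zero h]; exact integrable_zero_measure

theorem Flow.integrable_chem (hu : Flow T u) (h1 : t₁ ∈ Ioo 0 T) (h2 : t₂ ∈ Ioo 0 T) :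
    Integrable (fun p : ℝ × Space n => chem (u p.1) p.2 ^ 2) (stMeasure n t₁ t₂) := by
  refine (hu.st.chem.pow 2).integrable_of_le h1 h2 (g := fun p => 2 * (11 ^ 2 * dev u p.1 p.2 ^ 2) +
    2 * lap (dev u p.1) p.2 ^ 2) ((((hu.integrable_dev h1 h2).const_mul _).const_mul 2).add
      ((hu.integrable_lap_dev h1 h2).const_mul 2)) fun r hr x => ?_
  rw [abs_of_nonneg (sq_nonneg _), hu.chem_eq hr]
  have := sq_le_of_abs_le (hu.abs_devWell_le hr x)
  refine (sq_sub_le _ _).trans ?_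
  simp only
  linarith

/-- Second application: μ_t = -Δ²μ + G''(u)Δμ. The resulting bound on ∫∫(Δμ)² is a bound on ∫∫u_t².
-/
theorem Flow.chem_bound (hu : Flow T u) (h1 : t₁ ∈ Ioo 0 T) (h2 : t₂ ∈ Ioo 0 T) :
    ∃ B, 0 ≤ B ∧
      (∀ t ∈ Icc t₁ t₂, ∫⁻ x, ENNReal.ofReal (chem (u t) x ^ 2) ∂(stripMeasure n) ≤ ENNReal.ofReal B) ∧
      ∀ t ∈ Icc t₁ t₂,
        Integrable (fun p : ℝ × Space n => lap (chem (u p.1)) p.2 ^ 2) (stMeasure n t₁ t) := by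
  refine energy_estimate hu.st.chem h1 h2 (g := fun _ _ => 0)
    (h := fun t x => well2 (u t) x * lap (chem (u t)) x) (ST.const 0) (hu.st.well2.mul hu.st.chem.lap)
    (M := 11) (by norm_num) (fun r hr x => by simp) (fun r hr x => ?_) (fun r hr x => ?_)
    (hu.sq_chem t₁ h1) (hu.st.chem.localized_growth h1 h2 (hu.integrable_chem h1 h2))
  · rw [abs_mul]
    exact mul_le_mul_of_nonneg_right (abs_well2_le (hu.bdd r hr x)) (abs_nonneg _)
  · have e : td u r = lap (chem (u r)) := funext fun x => hu.eq r hr x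
    have e0 : lap (fun _ : Space n => (0 : ℝ)) x = 0 := by simp [lap, pd_const]
    rw [hu.st.td_chem hr x, e, e0]
    ring

theorem Flow.integrable_td (hu : Flow T u) (h1 : t₁ ∈ Ioo 0 T) (h2 : t₂ ∈ Ioo 0 T) :
    Integrable (fun p : ℝ × Space n => td u p.1 p.2 ^ 2) (stMeasure n t₁ t₂) := by
  rcases le_total t₁ t₂ with h | h
  · obtain ⟨B, _, _, hB⟩ := hu.chem_bound h1 h2
    refine (hu.st.td.pow 2).integrable_of_le h1 h2 (hB t₂ (right_mem_Icc.2 h)) fun r hr x => ?_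
    rw [abs_of_nonneg (sq_nonneg _), hu.eq r hr x]
  · rw [stMeasure_eq_zero h]; exact integrable_zero_measure

/-- Third application, to the linearized equation for u_t. Square integrability of u_t at a fixed
time is not given, so the estimate starts from a good slice in (t₁/2, t₁]. -/
theorem Flow.td_bound (hu : Flow T u) (h1 : t₁ ∈ Ioo 0 T) (h2 : t₂ ∈ Ioo 0 T) :
    ∃ B, 0 ≤ B ∧
      (∀ t ∈ Icc t₁ t₂, ∫⁻ x, ENNReal.ofReal (td u t x ^ 2) ∂(stripMeasure n) ≤ ENNReal.ofReal B) ∧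
      Integrable (fun p : ℝ × Space n => lap (td u p.1) p.2 ^ 2) (stMeasure n t₁ t₂) := by
  rcases le_or_gt t₁ t₂ with h | h
  swap
  · refine ⟨0, le_rfl, fun t ht => absurd (ht.1.trans ht.2) (not_le.2 h), ?_⟩
    rw [stMeasure_eq_zero h.le]; exact integrable_zero_measure
  have h0 : t₁ / 2 ∈ Ioo 0 T := ⟨by linarith [h1.1], by linarith [h1.1, h1.2]⟩
  obtain ⟨s, hs, hsi⟩ := exists_slice_integrable (by linarith [h1.1]) (hu.integrable_td h0 h1)
  have hsT := Icc_subset_of_mem h0 h1 (Ioc_subset_Icc_self hs)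
  have hg : ∀ r ∈ Ioo 0 T, ∀ x, |well2 (u r) x * td u r x| ≤ 11 * |td u r x| := fun r hr x => by
    rw [abs_mul]
    exact mul_le_mul_of_nonneg_right (abs_well2_le (hu.bdd r hr x)) (abs_nonneg _)
  have heq : ∀ r ∈ Ioo 0 T, ∀ x, td (td u) r x = - lap (lap (td u r)) x + 0 +
      lap (fun x => well2 (u r) x * td u r x) x := fun r hr x => by
    have e : td (fun t => chem (u t)) r = fun x => well2 (u r) x * td u r x - lap (td u r) x :=
      funext fun x => hu.st.td_chem hr x
    rw [hu.td_td hr, e, lap_sub ((hu.st.well2.sp hr).mul (hu.st.td.sp hr)) (hu.st.td.sp hr).lap]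
    ring
  obtain ⟨B, hB0, hB, hB'⟩ := energy_estimate hu.st.td hsT h2
    (g := fun t x => well2 (u t) x * td u t x) (h := fun _ _ => 0)
    (hu.st.well2.mul hu.st.td) (ST.const 0) (M := 11) (by norm_num) hg
    (fun r hr x => by simp) heq hsi
    (hu.st.td.localized_growth hsT h2 (hu.integrable_td hsT h2))
  exact ⟨B, hB0, fun t ht => hB t ⟨hs.2.trans ht.1, ht.2⟩,
    (hB' t₂ ⟨hs.2.trans h, le_rfl⟩).mono_measure (stMeasure_mono hs.2 le_rfl)⟩

theorem Flow.integrable_lap_td (hu : Flow T u) (h1 : t₁ ∈ Ioo 0 T) (h2 : t₂ ∈ Ioo 0 T) :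
    Integrable (fun p : ℝ × Space n => lap (td u p.1) p.2 ^ 2) (stMeasure n t₁ t₂) :=
  (hu.td_bound h1 h2).choose_spec.2.2

theorem Flow.integrable_td_cube (hn : n ≤ 4) (hu : Flow T u) (h1 : t₁ ∈ Ioo 0 T) (h2 : t₂ ∈ Ioo 0 T) :
    Integrable (fun p : ℝ × Space n => td u p.1 p.2 ^ 3) (stMeasure n t₁ t₂) := by
  obtain ⟨B, hB0, hB, hl⟩ := hu.td_bound h1 h2
  exact hu.st.td.integrable_cube hn h1 h2 hB0 hB hl

theorem Flow.integrable_gradSq_chem (hu : Flow T u) (h1 : t₁ ∈ Ioo 0 T) (h2 : t₂ ∈ Ioo 0 T) :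
    Integrable (fun p : ℝ × Space n => gradSq (chem (u p.1)) p.2) (stMeasure n t₁ t₂) := by
  refine hu.st.chem.integrable_gradSq h1 h2 (hu.integrable_chem h1 h2) ?_
  refine (hu.st.chem.lap.pow 2).integrable_of_le h1 h2 (hu.integrable_td h1 h2) fun r hr x => ?_
  rw [abs_of_nonneg (sq_nonneg _), hu.eq r hr x]

theorem Flow.integrable_gradSq_td (hu : Flow T u) (h1 : t₁ ∈ Ioo 0 T) (h2 : t₂ ∈ Ioo 0 T) :
    Integrable (fun p : ℝ × Space n => gradSq (td u p.1) p.2) (stMeasure n t₁ t₂) :=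
  hu.st.td.integrable_gradSq h1 h2 (hu.integrable_td h1 h2) (hu.integrable_lap_td h1 h2)

theorem Flow.integrable_hessSq_td (hu : Flow T u) (h1 : t₁ ∈ Ioo 0 T) (h2 : t₂ ∈ Ioo 0 T) :
    Integrable (fun p : ℝ × Space n => ∑ j, gradSq (pd j (td u p.1)) p.2) (stMeasure n t₁ t₂) :=
  hu.st.td.integrable_hessSq h1 h2 (hu.integrable_td h1 h2) (hu.integrable_lap_td h1 h2)

theorem Flow.integrable_gradSq_dev (hu : Flow T u) (h1 : t₁ ∈ Ioo 0 T) (h2 : t₂ ∈ Ioo 0 T) :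
    Integrable (fun p : ℝ × Space n => gradSq (dev u p.1) p.2) (stMeasure n t₁ t₂) :=
  hu.st.dev.integrable_gradSq h1 h2 (hu.integrable_dev h1 h2) (hu.integrable_lap_dev h1 h2)

/-- The time derivative of the chemical potential is square integrable in space-time. -/
theorem Flow.integrable_td_chem (hu : Flow T u) (h1 : t₁ ∈ Ioo 0 T) (h2 : t₂ ∈ Ioo 0 T) :
    Integrable (fun p : ℝ × Space n => td (fun t => chem (u t)) p.1 p.2 ^ 2) (stMeasure n t₁ t₂) := by
  refine (hu.st.chem.td.pow 2).integrable_of_le h1 h2 (g := fun p => 2 * (11 ^ 2 * td u p.1 p.2 ^ 2) +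
    2 * lap (td u p.1) p.2 ^ 2) ((((hu.integrable_td h1 h2).const_mul _).const_mul 2).add
      ((hu.integrable_lap_td h1 h2).const_mul 2)) fun r hr x => ?_
  rw [abs_of_nonneg (sq_nonneg _), hu.st.td_chem hr x]
  have : |well2 (u r) x * td u r x| ≤ 11 * |td u r x| := by
    rw [abs_mul]
    exact mul_le_mul_of_nonneg_right (abs_well2_le (hu.bdd r hr x)) (abs_nonneg _)
  have := sq_le_of_abs_le this
  refine (sq_sub_le _ _).trans ?_
  simp only
  linarith

end

/-! ### Localized balance laws -/

/-- The divergence of `P A ∇B`, for a weight `P` with `∇P = (0, P')`. -/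
def divTerm (P P' A B : Space n → ℝ) (x : Space n) : ℝ :=
  P x * (∑ i, pd i A x * pd i B x) + P x * (A x * lap B x) + P' x * (A x * pz B x)

theorem isTestFunction_divTerm {P P' A B : Space n → ℝ} (hP : IsTestFunction P) (hP' : IsTestFunction P')
    (hA : SP A) (hB : SP B) : IsTestFunction (divTerm P P' A B) :=
  ((hP.mul (SP.sum fun i => (hA.pd i).mul (hB.pd i))).add (hP.mul (hA.mul hB.lap))).add
    (hP'.mul (hA.mul hB.pz))

theorem integral_divTerm {P P' A B : Space n → ℝ} (hP : IsTestFunction P) (hP' : IsTestFunction P')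
    (h : ∀ (F : Fin (n + 1) → ℝ) (x : Space n), ∑ i, pd i P x * F i = P' x * F (Fin.last n))
    (hA : SP A) (hB : SP B) : ∫ x, divTerm P P' A B x ∂(stripMeasure n) = 0 := by
  have h1 := (hP.mul hA).integral_mul_lap hB
  have h2 : ∀ x, ∑ i, pd i (fun x => P x * A x) x * pd i B x =
      P x * (∑ i, pd i A x * pd i B x) + P' x * (A x * pz B x) := by
    intro x
    have := h (fun i => A x * pd i B x) x
    rw [show P' x * (A x * pz B x) = P' x * (A x * pd (Fin.last n) B x) from rfl, ← this,
      Finset.mul_sum, ← Finset.sum_add_distrib]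
    refine Finset.sum_congr rfl fun i _ => ?_
    rw [pd_mul _ hP.sp hA]
    ring
  simp only [h2] at h1
  have i1 := ((hP.mul (SP.sum (s := Finset.univ) fun i => (hA.pd i).mul (hB.pd i))).add
    (hP'.mul (hA.mul hB.pz))).integrable
  have i2 := ((hP.mul hA).mul hB.lap).integrable
  have : ∫ x, divTerm P P' A B x ∂(stripMeasure n) = ∫ x, ((P x * A x * lap B x) +
      (P x * (∑ i, pd i A x * pd i B x) + P' x * (A x * pz B x))) ∂(stripMeasure n) := by
    refine integral_congr_ae (Filter.Eventually.of_forall fun x => ?_)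
    simp only [divTerm]; ring
  rw [this, integral_add i2 i1, h1]
  ring

/-- Subtracting a localized exact divergence N, which integrates to zero, leaves only the flux
through the region where the cutoff varies. -/
theorem abs_integral_wt_sub_le_of_test {e a N G : Space n → ℝ} (he : SP e) (ha : SP a)
    (hG : IsTestFunction G) (hN : IsTestFunction N) (hN0 : ∫ x, N x ∂(stripMeasure n) = 0) {R : ℝ} (hR : 0 < R)
    (hle : ∀ x, |wt n R x * e x - wt n R x * a x - N x| ≤ G x) :
    |∫ x, wt n R x * e x ∂(stripMeasure n) - ∫ x, wt n R x * a x ∂(stripMeasure n)| ≤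
      ∫ x, G x ∂(stripMeasure n) := by
  have hw := isTestFunction_wt (n := n) hR
  have i1 := (hw.mul he).integrable
  have i2 := (hw.mul ha).integrable
  have : ∫ x, wt n R x * e x ∂(stripMeasure n) - ∫ x, wt n R x * a x ∂(stripMeasure n) =
      ∫ x, (wt n R x * e x - wt n R x * a x - N x) ∂(stripMeasure n) := by
    have i3 : Integrable (fun x => wt n R x * e x - wt n R x * a x) (stripMeasure n) := i1.sub i2
    rw [integral_sub i3 hN.integrable, hN0, integral_sub i1 i2, sub_zero]
  rw [this]
  refine (abs_integral_le_integral_abs).trans ?_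
  exact integral_mono ((i1.sub i2).sub hN.integrable).abs hG.integrable hle

theorem abs_integral_wt_sub_le {e a N g : Space n → ℝ} (he : SP e) (ha : SP a) (hg : SP g)
    (hN : IsTestFunction N) (hN0 : ∫ x, N x ∂(stripMeasure n) = 0) {C R : ℝ} (hR : 0 < R)
    (hle : ∀ x, |wt n R x * e x - wt n R x * a x - N x| ≤ C / R * (cut n R x * g x)) :
    |∫ x, wt n R x * e x ∂(stripMeasure n) - ∫ x, wt n R x * a x ∂(stripMeasure n)| ≤
      C / R * ∫ x, cut n R x * g x ∂(stripMeasure n) := by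
  rw [← integral_const_mul]
  exact abs_integral_wt_sub_le_of_test he ha (((isTestFunction_cut hR).mul hg).const_mul _) hN hN0 hR hle

section
variable {T t₁ t₂ : ℝ} {a e g : ℝ → Space n → ℝ}

theorem ST.integral_cut_le (hg : ST T g) (h1 : t₁ ∈ Ioo 0 T) (h2 : t₂ ∈ Ioo 0 T) (h12 : t₁ ≤ t₂)
    (hg0 : ∀ r ∈ Ioo 0 T, ∀ x, 0 ≤ g r x)
    (ig : Integrable (fun p : ℝ × Space n => g p.1 p.2) (stMeasure n t₁ t₂)) {R : ℝ} (hR : 0 < R) :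
    ∫ r in t₁..t₂, ∫ x, cut n R x * g r x ∂(stripMeasure n) ≤ ∫ p, g p.1 p.2 ∂(stMeasure n t₁ t₂) := by
  have hF := isTestFunction_cut (n := n) hR
  rw [← hg.integral_st h1 h2 h12 hF]
  refine integral_mono_ae (hg.integrable_st h1 h2 hF) ig ?_
  filter_upwards [ae_st_mem t₁ t₂] with p hp
  exact mul_le_of_le_one_left (hg0 _ (Icc_subset_of_mem h1 h2 (Ioc_subset_Icc_self hp)) _) (cut_le_one _ _)

/-- A localized balance law with source `a` and a flux controlled by `g` is a global balance law. -/
theorem balance_law (he : ST T e) (ha : ST T a) (hg : ST T g) (h1 : t₁ ∈ Ioo 0 T) (h2 : t₂ ∈ Ioo 0 T)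
    (h12 : t₁ ≤ t₂) (i1 : Integrable (e t₁) (stripMeasure n)) (i2 : Integrable (e t₂) (stripMeasure n))
    (ia : Integrable (fun p : ℝ × Space n => a p.1 p.2) (stMeasure n t₁ t₂))
    (ig : Integrable (fun p : ℝ × Space n => g p.1 p.2) (stMeasure n t₁ t₂))
    (hg0 : ∀ r ∈ Ioo 0 T, ∀ x, 0 ≤ g r x) {C : ℝ} (hC : 0 ≤ C)
    (hle : ∀ R, 1 ≤ R → ∀ r ∈ Ioo 0 T,
      |∫ x, wt n R x * td e r x ∂(stripMeasure n) - ∫ x, wt n R x * a r x ∂(stripMeasure n)| ≤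
        C / R * ∫ x, cut n R x * g r x ∂(stripMeasure n)) :
    ∫ x, e t₂ x ∂(stripMeasure n) - ∫ x, e t₁ x ∂(stripMeasure n) =
      ∫ p, a p.1 p.2 ∂(stMeasure n t₁ t₂) := by
  refine balance_of_localized ha h1 h2 h12 i1 i2 ia
    (K := C * ∫ p, g p.1 p.2 ∂(stMeasure n t₁ t₂)) fun R hR => ?_
  have hR0 : 0 < R := by linarith
  have hw := isTestFunction_wt (n := n) hR0
  have hsub : uIcc t₁ t₂ ⊆ Ioo 0 T := by rw [uIcc_of_le h12]; exact Icc_subset_of_mem h1 h2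
  have c1 := ((he.td.continuousOn_integral hw).mono hsub).intervalIntegrable (μ := volume)
  have c2 := ((ha.continuousOn_integral hw).mono hsub).intervalIntegrable (μ := volume)
  have c3 := ((hg.continuousOn_integral (isTestFunction_cut hR0)).mono hsub).intervalIntegrable (μ := volume)
  rw [he.integral_sub_integral hw h1 h2, ← intervalIntegral.integral_sub c1 c2]
  calc _ ≤ ∫ r in t₁..t₂, |∫ x, wt n R x * td e r x ∂(stripMeasure n) -
            ∫ x, wt n R x * a r x ∂(stripMeasure n)| := intervalIntegral.abs_integral_le_integral_abs h12
    _ ≤ ∫ r in t₁..t₂, C / R * ∫ x, cut n R x * g r x ∂(stripMeasure n) := by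
        refine intervalIntegral.integral_mono_on h12 (c1.sub c2).abs (c3.const_mul _) fun r hr => ?_
        exact hle R hR r (Icc_subset_of_mem h1 h2 hr)
    _ = C / R * ∫ r in t₁..t₂, ∫ x, cut n R x * g r x ∂(stripMeasure n) :=
        intervalIntegral.integral_const_mul _ _
    _ ≤ C / R * ∫ p, g p.1 p.2 ∂(stMeasure n t₁ t₂) :=
        mul_le_mul_of_nonneg_left (hg.integral_cut_le h1 h2 h12 hg0 ig hR0) (by positivity)
    _ = _ := by ring

end

theorem abs_pz_wt_le {R : ℝ} (hR : 0 < R) (x : Space n) :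
    |pz (wt n R) x| ≤ 4 * cutK / R * cut n R x := by
  have h := abs_pz_cut_pow_le (n := n) (R := R) 2 hR x
  have e : (fun x => cut n R x ^ (2 + 2)) = wt n R := rfl
  rw [e] at h
  refine h.trans ?_
  have h0 := cut_nonneg (n := n) R x
  have h1 := cut_le_one (n := n) R x
  have : cut n R x ^ (2 + 1) ≤ cut n R x := by
    calc cut n R x ^ 3 ≤ cut n R x ^ 1 := pow_le_pow_of_le_one h0 h1 (by norm_num)
      _ = _ := pow_one _
  have hK := one_le_cutK
  norm_num
  exact mul_le_mul_of_nonneg_left this (by positivity)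

theorem sum_pd_wt_mul (R : ℝ) (F : Fin (n + 1) → ℝ) (x : Space n) :
    ∑ i, pd i (wt n R) x * F i = pz (wt n R) x * F (Fin.last n) := sum_pd_cut_pow_mul 2 F x

theorem isTestFunction_pz_wt {R : ℝ} (hR : 0 < R) : IsTestFunction (pz (wt n R)) :=
  (isTestFunction_wt hR).pd _

theorem abs_mul_le_half (a b : ℝ) : |a * b| ≤ 1 / 2 * (a ^ 2 + b ^ 2) := by
  rw [abs_mul, ← sq_abs a, ← sq_abs b]; nlinarith [sq_nonneg (|a| - |b|)]

theorem pz_sq_le_gradSq (g : Space n → ℝ) (x : Space n) : pz g x ^ 2 ≤ gradSq g x :=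
  pd_sq_le_gradSq g _ x

/-! ### Balance laws for the energy and the dissipation -/

/-- The energy density `½ |∇w|² + G(w)`. -/
def energyDensity (w : Space n → ℝ) (x : Space n) : ℝ := 1 / 2 * gradSq w x + doubleWell (w x)

theorem hasDerivAt_doubleWell (s : ℝ) : HasDerivAt doubleWell (s ^ 3 - s) s := by
  have h := ((((hasDerivAt_pow 2 s).const_sub 1).fun_pow 2).div_const 4)
  refine h.congr_deriv ?_
  push_cast
  ring

theorem ST.energyDensity {T : ℝ} {u : ℝ → Space n → ℝ} (hu : ST T u) :
    ST T (fun t => energyDensity (u t)) :=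
  ((hu.gradSq.const_mul (1 / 2)).add ((((ST.const 1).sub (hu.pow 2)).pow 2).const_mul (1 / 4))).congr
    fun t _ x => by simp only [CahnHilliard.energyDensity, doubleWell]; ring

section
variable {T t₁ t₂ : ℝ} {u : ℝ → Space n → ℝ}

theorem ST.td_energyDensity (hu : ST T u) {t : ℝ} (ht : t ∈ Ioo 0 T) (x : Space n) :
    CahnHilliard.td (fun t => CahnHilliard.energyDensity (u t)) t x =
      ∑ i, CahnHilliard.pd i (u t) x * CahnHilliard.pd i (CahnHilliard.td u t) x +
        (u t x ^ 3 - u t x) * CahnHilliard.td u t x := by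
  have h1 := (hu.gradSq.hasDerivAt ht x).const_mul (1 / 2)
  have h2 := (hasDerivAt_doubleWell (u t x)).comp t (hu.hasDerivAt ht x)
  rw [hu.td_gradSq ht x] at h1
  refine (h1.add h2).deriv.trans ?_
  ring

theorem Flow.integrable_gradSq (hu : Flow T u) (h1 : t₁ ∈ Ioo 0 T) (h2 : t₂ ∈ Ioo 0 T) :
    Integrable (fun p : ℝ × Space n => gradSq (u p.1) p.2) (stMeasure n t₁ t₂) := by
  have ik : Integrable (fun p : ℝ × Space n => gradSq (kink n 0) p.2) (stMeasure n t₁ t₂) :=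
    (integrable_gradSq_kink (n := n) 0).comp_snd _
  refine hu.st.gradSq.integrable_of_le h1 h2
    (((hu.integrable_gradSq_dev h1 h2).const_mul 2).add (ik.const_mul 2)) fun r hr x => ?_
  rw [abs_of_nonneg (gradSq_nonneg _ _)]
  have e : u r = fun x => dev u r x + kink n 0 x := by funext x; simp [dev]
  simp only [Pi.add_apply]
  simp only [gradSq, Finset.mul_sum, ← Finset.sum_add_distrib]
  refine Finset.sum_le_sum fun i _ => ?_
  have : pd i (u r) x = pd i (dev u r) x + pd i (kink n 0) x := by
    conv_lhs => rw [e]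
    rw [pd_add _ (hu.st.dev.sp hr) (sp_kink 0)]
  rw [this]
  nlinarith [sq_nonneg (pd i (dev u r) x - pd i (kink n 0) x)]

/-- The energy identity. -/
theorem Flow.energy_balance (hu : Flow T u) (h1 : t₁ ∈ Ioo 0 T) (h2 : t₂ ∈ Ioo 0 T) (h12 : t₁ ≤ t₂)
    (i1 : Integrable (energyDensity (u t₁)) (stripMeasure n))
    (i2 : Integrable (energyDensity (u t₂)) (stripMeasure n)) :
    ∫ x, energyDensity (u t₂) x ∂(stripMeasure n) - ∫ x, energyDensity (u t₁) x ∂(stripMeasure n) =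
      ∫ p, - gradSq (chem (u p.1)) p.2 ∂(stMeasure n t₁ t₂) := by
  have hK := one_le_cutK
  refine balance_law (a := fun t x => - gradSq (chem (u t)) x)
    (g := fun t x => td u t x ^ 2 + gradSq (u t) x + (chem (u t) x ^ 2 + gradSq (chem (u t)) x))
    hu.st.energyDensity hu.st.chem.gradSq.neg
    (((hu.st.td.pow 2).add hu.st.gradSq).add ((hu.st.chem.pow 2).add hu.st.chem.gradSq))
    h1 h2 h12 i1 i2 (hu.integrable_gradSq_chem h1 h2).neg
    (((hu.integrable_td h1 h2).add (hu.integrable_gradSq h1 h2)).add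
      ((hu.integrable_chem h1 h2).add (hu.integrable_gradSq_chem h1 h2)))
    (fun r hr x => ?_) (C := 2 * cutK) (by positivity) fun R hR r hr => ?_
  · have := gradSq_nonneg (u r) x
    have := gradSq_nonneg (chem (u r)) x
    positivity
  have hR0 : 0 < R := by linarith
  have hw := isTestFunction_wt (n := n) hR0
  have hw' := isTestFunction_pz_wt (n := n) hR0
  have su := hu.st.sp hr
  have sq := hu.st.td.sp hr
  have sm := hu.st.chem.sp hr
  -- The density satisfies ∇u·∇u_t + G'(u)u_t = div(u_t∇u) + μu_t, and μu_t = μΔμ = div(μ∇μ) -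
  -- |∇μ|². These are the two divergences in N.
  refine abs_integral_wt_sub_le (hu.st.energyDensity.td.sp hr) sm.gradSq.neg
    (((sq.pow 2).add su.gradSq).add ((sm.pow 2).add sm.gradSq))
    (N := fun x => divTerm (wt n R) (pz (wt n R)) (td u r) (u r) x +
      divTerm (wt n R) (pz (wt n R)) (chem (u r)) (chem (u r)) x)
    ((isTestFunction_divTerm hw hw' sq su).add (isTestFunction_divTerm hw hw' sm sm)) ?_ hR0 fun x => ?_
  · rw [integral_add (isTestFunction_divTerm hw hw' sq su).integrable
      (isTestFunction_divTerm hw hw' sm sm).integrable,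
      integral_divTerm hw hw' (sum_pd_wt_mul R) sq su, integral_divTerm hw hw' (sum_pd_wt_mul R) sm sm, add_zero]
  · have e : wt n R x * td (fun t => energyDensity (u t)) r x - wt n R x * (- gradSq (chem (u r)) x) -
        (divTerm (wt n R) (pz (wt n R)) (td u r) (u r) x +
          divTerm (wt n R) (pz (wt n R)) (chem (u r)) (chem (u r)) x) =
        - (pz (wt n R) x * (td u r x * pz (u r) x + chem (u r) x * pz (chem (u r)) x)) := by
      have h3 : ∑ i, pd i (u r) x * pd i (td u r) x = ∑ i, pd i (td u r) x * pd i (u r) x :=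
        Finset.sum_congr rfl fun i _ => mul_comm _ _
      have h4 : gradSq (chem (u r)) x = ∑ i, pd i (chem (u r)) x * pd i (chem (u r)) x :=
        Finset.sum_congr rfl fun i _ => pow_two _
      have h5 : u r x ^ 3 - u r x = chem (u r) x + lap (u r) x := by simp [chem]
      rw [hu.st.td_energyDensity hr x, divTerm, divTerm, ← hu.eq r hr x, h3, h4, h5]
      ring
    rw [e, abs_neg, abs_mul]
    have b1 := abs_pz_wt_le (n := n) hR0 x
    have b2 := abs_mul_le_half (td u r x) (pz (u r) x)
    have b3 := abs_mul_le_half (chem (u r) x) (pz (chem (u r)) x)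
    have b4 := pz_sq_le_gradSq (u r) x
    have b5 := pz_sq_le_gradSq (chem (u r)) x
    have b6 : |td u r x * pz (u r) x + chem (u r) x * pz (chem (u r)) x| ≤
        1 / 2 * (td u r x ^ 2 + gradSq (u r) x + (chem (u r) x ^ 2 + gradSq (chem (u r)) x)) :=
      (abs_add_le _ _).trans (by linarith)
    refine (mul_le_mul b1 b6 (abs_nonneg _) ((abs_nonneg _).trans b1)).trans_eq ?_
    ring

/-- The density of the second variation of the energy in the direction `w_t`. -/
def secondDensity (w q : Space n → ℝ) (x : Space n) : ℝ := gradSq q x + well2 w x * q x ^ 2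

theorem ST.secondDensity {q : ℝ → Space n → ℝ} (hu : ST T u) (hq : ST T q) :
    ST T (fun t => secondDensity (u t) (q t)) := hq.gradSq.add (hu.well2.mul (hq.pow 2))

theorem Flow.integrable_secondDensity (hu : Flow T u) (h1 : t₁ ∈ Ioo 0 T) (h2 : t₂ ∈ Ioo 0 T) :
    Integrable (fun p : ℝ × Space n => secondDensity (u p.1) (td u p.1) p.2) (stMeasure n t₁ t₂) := by
  refine (hu.st.secondDensity hu.st.td).integrable_of_le h1 h2
    ((hu.integrable_gradSq_td h1 h2).add ((hu.integrable_td h1 h2).const_mul 11)) fun r hr x => ?_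
  simp only [secondDensity, Pi.add_apply]
  refine (abs_add_le _ _).trans ?_
  rw [abs_of_nonneg (gradSq_nonneg _ _), abs_mul, abs_of_nonneg (sq_nonneg (td u r x))]
  have := mul_le_mul_of_nonneg_right (abs_well2_le (hu.bdd r hr x)) (sq_nonneg (td u r x))
  simp only [well2]
  linarith

/-- The identity for the derivative of the dissipation, in integrated form. -/
theorem Flow.dissipation_balance (hu : Flow T u) (h1 : t₁ ∈ Ioo 0 T) (h2 : t₂ ∈ Ioo 0 T) (h12 : t₁ ≤ t₂)
    (i1 : Integrable (gradSq (chem (u t₁))) (stripMeasure n))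
    (i2 : Integrable (gradSq (chem (u t₂))) (stripMeasure n)) :
    ∫ x, gradSq (chem (u t₂)) x ∂(stripMeasure n) - ∫ x, gradSq (chem (u t₁)) x ∂(stripMeasure n) =
      ∫ p, -2 * secondDensity (u p.1) (td u p.1) p.2 ∂(stMeasure n t₁ t₂) := by
  have hK := one_le_cutK
  set m := td (fun t => chem (u t)) with hm
  have hmST : ST T m := hu.st.chem.td
  refine balance_law (a := fun t x => -2 * secondDensity (u t) (td u t) x)
    (e := fun t => gradSq (chem (u t)))
    (g := fun t x => m t x ^ 2 + gradSq (chem (u t)) x + (td u t x ^ 2 + gradSq (td u t) x))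
    hu.st.chem.gradSq ((hu.st.secondDensity hu.st.td).const_mul (-2))
    (((hmST.pow 2).add hu.st.chem.gradSq).add ((hu.st.td.pow 2).add hu.st.td.gradSq))
    h1 h2 h12 i1 i2 ((hu.integrable_secondDensity h1 h2).const_mul (-2))
    (((hu.integrable_td_chem h1 h2).add (hu.integrable_gradSq_chem h1 h2)).add
      ((hu.integrable_td h1 h2).add (hu.integrable_gradSq_td h1 h2)))
    (fun r hr x => ?_) (C := 4 * cutK) (by positivity) fun R hR r hr => ?_
  · have := gradSq_nonneg (td u r) x
    have := gradSq_nonneg (chem (u r)) x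
    positivity
  have hR0 : 0 < R := by linarith
  have hw := isTestFunction_wt (n := n) hR0
  have hw' := isTestFunction_pz_wt (n := n) hR0
  have sq := hu.st.td.sp hr
  have sm := hu.st.chem.sp hr
  have s3 := hmST.sp hr
  have d1 := isTestFunction_divTerm hw hw' s3 sm
  have d2 := isTestFunction_divTerm hw hw' sq sq
  -- Here 2∇μ·∇μ_t = 2div(μ_t∇μ) - 2μ_t u_t, and -μ_t u_t = u_tΔu_t - G''(u)u_t² = div(u_t∇u_t) -
  -- |∇u_t|² - G''(u)u_t².
  refine abs_integral_wt_sub_le (hu.st.chem.gradSq.td.sp hr) (((hu.st.secondDensity hu.st.td).const_mul (-2)).sp hr)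
    (((s3.pow 2).add sm.gradSq).add ((sq.pow 2).add sq.gradSq))
    (N := fun x => 2 * divTerm (wt n R) (pz (wt n R)) (m r) (chem (u r)) x +
      2 * divTerm (wt n R) (pz (wt n R)) (td u r) (td u r) x)
    ((d1.const_mul 2).add (d2.const_mul 2)) ?_ hR0 fun x => ?_
  · rw [integral_add (d1.const_mul 2).integrable (d2.const_mul 2).integrable, integral_const_mul,
      integral_const_mul,
      integral_divTerm hw hw' (sum_pd_wt_mul R) s3 sm, integral_divTerm hw hw' (sum_pd_wt_mul R) sq sq]
    ring
  · have e : wt n R x * td (fun t => gradSq (chem (u t))) r x -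
        wt n R x * (-2 * secondDensity (u r) (td u r) x) -
        (2 * divTerm (wt n R) (pz (wt n R)) (m r) (chem (u r)) x +
          2 * divTerm (wt n R) (pz (wt n R)) (td u r) (td u r) x) =
        - (2 * (pz (wt n R) x * (m r x * pz (chem (u r)) x + td u r x * pz (td u r) x))) := by
      have h3 : ∑ i, pd i (chem (u r)) x * pd i (m r) x = ∑ i, pd i (m r) x * pd i (chem (u r)) x :=
        Finset.sum_congr rfl fun i _ => mul_comm _ _
      have h4 : gradSq (td u r) x = ∑ i, pd i (td u r) x * pd i (td u r) x :=
        Finset.sum_congr rfl fun i _ => pow_two _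
      have h5 : lap (td u r) x = well2 (u r) x * td u r x - m r x := by
        rw [hm, hu.st.td_chem hr x]; ring
      rw [hu.st.chem.td_gradSq hr x, divTerm, divTerm, ← hu.eq r hr x, h3, secondDensity, h4, h5]
      ring
    rw [e, abs_neg, abs_mul, abs_mul, abs_two]
    have b1 := abs_pz_wt_le (n := n) hR0 x
    have b2 := abs_mul_le_half (m r x) (pz (chem (u r)) x)
    have b3 := abs_mul_le_half (td u r x) (pz (td u r) x)
    have b4 := pz_sq_le_gradSq (td u r) x
    have b5 := pz_sq_le_gradSq (chem (u r)) x
    have b6 : |m r x * pz (chem (u r)) x + td u r x * pz (td u r) x| ≤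
        1 / 2 * (m r x ^ 2 + gradSq (chem (u r)) x + (td u r x ^ 2 + gradSq (td u r) x)) :=
      (abs_add_le _ _).trans (by linarith)
    have := mul_le_mul b1 b6 (abs_nonneg _) ((abs_nonneg _).trans b1)
    refine (mul_le_mul_of_nonneg_left this zero_le_two).trans_eq ?_
    ring

end

/-! ### Higher regularity: the second variation along the flow -/

section
variable {T t₁ t₂ : ℝ} {u : ℝ → Space n → ℝ}

/-- The time derivative of the chemical potential. -/
def chemT (u : ℝ → Space n → ℝ) : ℝ → Space n → ℝ := td (fun t => chem (u t))

theorem ST.chemT (hu : ST T u) : ST T (chemT u) := hu.chem.td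

theorem Flow.td_secondDensity (hu : Flow T u) {t : ℝ} (ht : t ∈ Ioo 0 T) (x : Space n) :
    td (fun t => secondDensity (u t) (td u t)) t x =
      2 * ∑ i, pd i (lap (chemT u t)) x * pd i (td u t) x +
        (6 * (u t x * td u t x ^ 3) + 2 * (well2 (u t) x * (td u t x * lap (chemT u t) x))) := by
  have h1 := hu.st.td.gradSq.hasDerivAt ht x
  rw [hu.st.td.td_gradSq ht x] at h1
  have h2 := (((hu.st.hasDerivAt ht x).fun_pow 2).const_mul 3).sub_const 1
  have h3 := (hu.st.td.hasDerivAt ht x).fun_pow 2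
  have h4 := h1.add (h2.mul h3)
  have e : td (td u) t = lap (chemT u t) := funext fun x => hu.td_td ht x
  rw [e] at h4
  refine h4.deriv.trans ?_
  have h5 : ∑ i, pd i (td u t) x * pd i (lap (chemT u t)) x =
      ∑ i, pd i (lap (chemT u t)) x * pd i (td u t) x := Finset.sum_congr rfl fun i _ => mul_comm _ _
  rw [h5]
  simp only [well2]
  push_cast
  ring

/-- The source in the balance law for the second variation. -/
def secondSource (u : ℝ → Space n → ℝ) (t : ℝ) (x : Space n) : ℝ :=
  -2 * gradSq (chemT u t) x + 6 * (u t x * td u t x ^ 3)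

theorem ST.secondSource (hu : ST T u) : ST T (secondSource u) :=
  (hu.chemT.gradSq.const_mul (-2)).add ((hu.mul (hu.td.pow 3)).const_mul 6)

/-- The divergence term in the balance law for the second variation. -/
def secondDiv (u : ℝ → Space n → ℝ) (R t : ℝ) (x : Space n) : ℝ :=
  2 * divTerm (wt n R) (pz (wt n R)) (lap (chemT u t)) (td u t) x +
    2 * divTerm (wt n R) (pz (wt n R)) (chemT u t) (chemT u t) x -
    2 * divTerm (pz (wt n R)) (lap (wt n R)) (pz (td u t)) (chemT u t) x

theorem isTestFunction_lap_wt {R : ℝ} (hR : 0 < R) : IsTestFunction (lap (wt n R)) :=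
  (isTestFunction_wt hR).lap

theorem ST.isTestFunction_secondDiv (hu : ST T u) {t : ℝ} (ht : t ∈ Ioo 0 T) {R : ℝ} (hR : 0 < R) :
    IsTestFunction (secondDiv u R t) := by
  have hw := isTestFunction_wt (n := n) hR
  have hw' := isTestFunction_pz_wt (n := n) hR
  have hw'' := isTestFunction_lap_wt (n := n) hR
  have sq := hu.td.sp ht
  have s3 := hu.chemT.sp ht
  exact (((isTestFunction_divTerm hw hw' s3.lap sq).const_mul 2).add
    ((isTestFunction_divTerm hw hw' s3 s3).const_mul 2)).sub
    ((isTestFunction_divTerm hw' hw'' sq.pz s3).const_mul 2)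

theorem ST.integral_secondDiv (hu : ST T u) {t : ℝ} (ht : t ∈ Ioo 0 T) {R : ℝ} (hR : 0 < R) :
    ∫ x, secondDiv u R t x ∂(stripMeasure n) = 0 := by
  have hw := isTestFunction_wt (n := n) hR
  have hw' := isTestFunction_pz_wt (n := n) hR
  have hw'' := isTestFunction_lap_wt (n := n) hR
  have sq := hu.td.sp ht
  have s3 := hu.chemT.sp ht
  have d1 := (isTestFunction_divTerm hw hw' s3.lap sq).const_mul 2
  have d2 := (isTestFunction_divTerm hw hw' s3 s3).const_mul 2
  have d3 := (isTestFunction_divTerm hw' hw'' sq.pz s3).const_mul 2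
  unfold secondDiv
  rw [integral_sub (d1.add d2).integrable d3.integrable, integral_add d1.integrable d2.integrable,
    integral_const_mul, integral_const_mul, integral_const_mul,
    integral_divTerm hw hw' (sum_pd_wt_mul R) s3.lap sq, integral_divTerm hw hw' (sum_pd_wt_mul R) s3 s3,
    integral_divTerm hw' hw'' (fun F x => sum_pd_pz_cut_pow_mul 2 F x) sq.pz s3]
  ring

/-- The first divergence in `secondDiv` alone would leave the flux wt'·∂_z u_t·Δμ_t, over which
there is no control. The third one, with weight wt', moves that Laplacian away, so the remaining
flux contains only μ_t, ∇μ_t, ∂_z u_t and the Hessian of u_t. -/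
theorem Flow.second_flux_eq (hu : Flow T u) {t : ℝ} (ht : t ∈ Ioo 0 T) (R : ℝ) (x : Space n) :
    wt n R x * td (fun t => secondDensity (u t) (td u t)) t x - wt n R x * secondSource u t x -
      secondDiv u R t x =
    2 * (pz (wt n R) x * (∑ i, pd i (pz (td u t)) x * pd i (chemT u t) x -
      chemT u t x * pz (chemT u t) x) + lap (wt n R) x * (pz (td u t) x * pz (chemT u t) x)) := by
  have h4 : gradSq (chemT u t) x = ∑ i, pd i (chemT u t) x * pd i (chemT u t) x :=
    Finset.sum_congr rfl fun i _ => pow_two _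
  have h5 : lap (td u t) x = well2 (u t) x * td u t x - chemT u t x := by
    rw [chemT, hu.st.td_chem ht x]; ring
  rw [hu.td_secondDensity ht x, secondSource, secondDiv, divTerm, divTerm, divTerm, h4, h5]
  ring

/-- The coefficient 1/8 is chosen for three flux terms, each occurring twice: together they use 3/4
of the dissipation. -/
theorem mul_abs_sum_le {ι : Type*} (s : Finset ι) (a b : ι → ℝ) {K y : ℝ} (hK : 0 ≤ K) (hy : 0 ≤ y) :
    K * y * |∑ i ∈ s, a i * b i| ≤ 1 / 8 * (y ^ 2 * ∑ i ∈ s, b i ^ 2) + 2 * K ^ 2 * ∑ i ∈ s, a i ^ 2 := by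
  calc K * y * |∑ i ∈ s, a i * b i| ≤ K * y * ∑ i ∈ s, |a i * b i| :=
        mul_le_mul_of_nonneg_left (Finset.abs_sum_le_sum_abs _ _) (by positivity)
    _ ≤ ∑ i ∈ s, (1 / 8 * (y ^ 2 * b i ^ 2) + 2 * K ^ 2 * a i ^ 2) := by
        rw [Finset.mul_sum]
        refine Finset.sum_le_sum fun i _ => ?_
        rw [abs_mul, ← sq_abs (a i), ← sq_abs (b i)]
        nlinarith [sq_nonneg (y * |b i| - 4 * (K * |a i|))]
    _ = _ := by rw [Finset.sum_add_distrib, Finset.mul_sum, Finset.mul_sum, Finset.mul_sum]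

theorem gradSq_pz_le (g : Space n → ℝ) (x : Space n) : gradSq (pz g) x ≤ ∑ j, gradSq (pd j g) x :=
  Finset.single_le_sum (f := fun j => gradSq (pd j g) x) (fun _ _ => gradSq_nonneg _ _) (Finset.mem_univ _)

theorem abs_pz_wt_le_cube {R : ℝ} (hR : 1 ≤ R) (x : Space n) :
    |pz (wt n R) x| ≤ 4 * cutK * cut n R x ^ 2 := by
  have h := abs_pz_cut_pow_le (n := n) (R := R) 2 (by linarith) x
  have e : (fun x => cut n R x ^ (2 + 2)) = wt n R := rfl
  rw [e] at h
  refine h.trans ?_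
  have h0 := cut_nonneg (n := n) R x
  have h1 := cut_le_one (n := n) R x
  have : cut n R x ^ (2 + 1) ≤ cut n R x ^ 2 := pow_le_pow_of_le_one h0 h1 (by norm_num)
  have hK := one_le_cutK
  norm_num
  refine mul_le_mul ?_ this (by positivity) (by positivity)
  exact div_le_self (by positivity) hR

theorem abs_lap_wt_le {R : ℝ} (hR : 1 ≤ R) (x : Space n) :
    |lap (wt n R) x| ≤ (4 * cutK) ^ 2 * cut n R x ^ 2 := by
  have h := abs_lap_cut_pow_le (n := n) (R := R) 2 (by linarith) x
  have e : (fun x => cut n R x ^ (2 + 2)) = wt n R := rfl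
  rw [e] at h
  refine h.trans ?_
  have hK := one_le_cutK
  norm_num
  refine mul_le_mul_of_nonneg_right ?_ (by positivity)
  exact div_le_self (by positivity) (one_le_pow₀ hR)

theorem abs_lap_wt_le' {R : ℝ} (hR : 1 ≤ R) (x : Space n) :
    |lap (wt n R) x| ≤ (4 * cutK) ^ 2 / R * cut n R x := by
  have h := abs_lap_cut_pow_le (n := n) (R := R) 2 (by linarith) x
  have e : (fun x => cut n R x ^ (2 + 2)) = wt n R := rfl
  rw [e] at h
  refine h.trans ?_
  have h0 := cut_nonneg (n := n) R x
  have h1 := cut_le_one (n := n) R x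
  have hK := one_le_cutK
  have h2 : cut n R x ^ 2 ≤ cut n R x := by
    calc cut n R x ^ 2 ≤ cut n R x ^ 1 := pow_le_pow_of_le_one h0 h1 (by norm_num)
      _ = _ := pow_one _
  norm_num
  refine mul_le_mul ?_ h2 (by positivity) (by positivity)
  exact div_le_div_of_nonneg_left (by positivity) (by linarith) (by nlinarith)

/-- The quantity controlling the flux of the second variation. -/
def fluxBound (u : ℝ → Space n → ℝ) (t : ℝ) (x : Space n) : ℝ :=
  chemT u t x ^ 2 + gradSq (td u t) x + ∑ j, gradSq (pd j (td u t)) x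

theorem ST.fluxBound (hu : ST T u) : ST T (fluxBound u) :=
  ((hu.chemT.pow 2).add hu.td.gradSq).add (ST.sum fun j => (hu.td.pd j).gradSq)

theorem fluxBound_nonneg (u : ℝ → Space n → ℝ) (t : ℝ) (x : Space n) : 0 ≤ fluxBound u t x :=
  add_nonneg (add_nonneg (sq_nonneg _) (gradSq_nonneg _ _))
    (Finset.sum_nonneg fun _ _ => gradSq_nonneg _ _)

theorem Flow.integrable_fluxBound (hu : Flow T u) (h1 : t₁ ∈ Ioo 0 T) (h2 : t₂ ∈ Ioo 0 T) :
    Integrable (fun p : ℝ × Space n => fluxBound u p.1 p.2) (stMeasure n t₁ t₂) :=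
  ((hu.integrable_td_chem h1 h2).add (hu.integrable_gradSq_td h1 h2)).add (hu.integrable_hessSq_td h1 h2)

/-- The derivatives of the weight are bounded by cut², the square root of the weight. Young's
inequality therefore puts cut⁴|∇μ_t|² on the side of the dissipation, and everything else is bounded
by quantities already integrable in space-time. -/
theorem second_flux_le {R : ℝ} (hR : 1 ≤ R) (t : ℝ) (x : Space n) :
    |2 * (pz (wt n R) x * (∑ i, pd i (pz (td u t)) x * pd i (chemT u t) x -
      chemT u t x * pz (chemT u t) x) + lap (wt n R) x * (pz (td u t) x * pz (chemT u t) x))| ≤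
    3 / 4 * (wt n R x * gradSq (chemT u t) x) +
      4 * (4 * cutK) ^ 4 * (cut n (2 * R) x * fluxBound u t x) := by
  have hK := one_le_cutK
  set K := 4 * cutK with hKd
  have hK1 : 1 ≤ K := by linarith
  set s := cut n R x with hs
  have hs0 : 0 ≤ s := cut_nonneg _ _
  have hs1 : s ≤ 1 := cut_le_one _ _
  have hwt : wt n R x = (s ^ 2) ^ 2 := by rw [wt, ← hs]; ring
  have b1 := abs_pz_wt_le_cube hR x
  have b2 := abs_lap_wt_le hR x
  rw [← hs, ← hKd] at b1 b2
  by_cases hz : 2 * R < |zCoord x|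
  · have h0 : s = 0 := cut_eq_zero (by linarith) hz.le
    rw [h0] at b1 b2
    norm_num at b1 b2
    rw [hwt, h0, b1, b2]
    have := fluxBound_nonneg u t x
    have := cut_nonneg (n := n) (2 * R) x
    norm_num
    positivity
  · have hc : cut n (2 * R) x = 1 := cut_eq_one (by linarith) (not_lt.1 hz)
    rw [hc, hwt, one_mul]
    have c1 := mul_abs_sum_le Finset.univ (fun i => pd i (pz (td u t)) x) (fun i => pd i (chemT u t) x)
      (K := K) (y := s ^ 2) (by linarith) (by positivity)
    have c2 := mul_abs_sum_le (Finset.univ : Finset (Fin 1)) (fun _ => chemT u t x)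
      (fun _ => pz (chemT u t) x) (K := K) (y := s ^ 2) (by linarith) (by positivity)
    have c3 := mul_abs_sum_le (Finset.univ : Finset (Fin 1)) (fun _ => pz (td u t) x)
      (fun _ => pz (chemT u t) x) (K := K ^ 2) (y := s ^ 2) (by positivity) (by positivity)
    simp only [Finset.univ_unique, Finset.sum_singleton] at c2 c3
    change K * s ^ 2 * |_| ≤ 1 / 8 * ((s ^ 2) ^ 2 * gradSq (chemT u t) x) + 2 * K ^ 2 * gradSq (pz (td u t)) x at c1
    have g1 := pz_sq_le_gradSq (chemT u t) x
    have g2 := pz_sq_le_gradSq (td u t) x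
    have g3 := gradSq_pz_le (td u t) x
    have y0 : 0 ≤ (s ^ 2) ^ 2 := by positivity
    have g4 := mul_le_mul_of_nonneg_left g1 y0
    have k1 : K ^ 2 ≤ K ^ 4 := pow_le_pow_right₀ hK1 (by norm_num)
    set S := ∑ i, pd i (pz (td u t)) x * pd i (chemT u t) x
    set m := chemT u t x
    set mz := pz (chemT u t) x
    set qz := pz (td u t) x
    have e1 : |pz (wt n R) x * (S - m * mz)| ≤ K * s ^ 2 * |S| + K * s ^ 2 * |m * mz| := by
      rw [abs_mul, ← mul_add]
      exact mul_le_mul b1 (abs_sub _ _) (abs_nonneg _) (by positivity)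
    have e2 : |lap (wt n R) x * (qz * mz)| ≤ K ^ 2 * s ^ 2 * |qz * mz| := by
      rw [abs_mul]
      exact mul_le_mul_of_nonneg_right b2 (abs_nonneg _)
    rw [abs_mul, abs_two]
    have e3 := abs_add_le (pz (wt n R) x * (S - m * mz)) (lap (wt n R) x * (qz * mz))
    have p1 : 2 * K ^ 2 * m ^ 2 ≤ 2 * K ^ 4 * m ^ 2 :=
      mul_le_mul_of_nonneg_right (by linarith) (sq_nonneg _)
    have p2 : 2 * (K ^ 2) ^ 2 * qz ^ 2 ≤ 2 * K ^ 4 * gradSq (td u t) x := by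
      have : 2 * (K ^ 2) ^ 2 = 2 * K ^ 4 := by ring
      rw [this]
      exact mul_le_mul_of_nonneg_left g2 (by positivity)
    have p3 : 2 * K ^ 2 * gradSq (pz (td u t)) x ≤ 2 * K ^ 4 * ∑ j, gradSq (pd j (td u t)) x :=
      mul_le_mul (by linarith) g3 (gradSq_nonneg _ _) (by positivity)
    have e4 : fluxBound u t x = m ^ 2 + gradSq (td u t) x + ∑ j, gradSq (pd j (td u t)) x := rfl
    rw [e4]
    linarith

theorem abs_mul_cube_le {s q : ℝ} (h : |s| ≤ 2) : |s * q ^ 3| ≤ 2 * |q ^ 3| := by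
  rw [abs_mul]; exact mul_le_mul_of_nonneg_right h (abs_nonneg _)

theorem Flow.integrable_mul_cube (hn : n ≤ 4) (hu : Flow T u) (h1 : t₁ ∈ Ioo 0 T) (h2 : t₂ ∈ Ioo 0 T) :
    Integrable (fun p : ℝ × Space n => u p.1 p.2 * td u p.1 p.2 ^ 3) (stMeasure n t₁ t₂) :=
  (hu.st.mul (hu.st.td.pow 3)).integrable_of_le h1 h2 (((hu.integrable_td_cube hn h1 h2).abs).const_mul 2)
    fun r hr x => abs_mul_cube_le (hu.bdd r hr x)

/-- The localized estimate for the second variation. -/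
theorem Flow.exists_localized_second_le (hn : n ≤ 4) (hu : Flow T u) (h1 : t₁ ∈ Ioo 0 T) (h2 : t₂ ∈ Ioo 0 T)
    (h12 : t₁ ≤ t₂) : ∃ K : ℝ, ∀ R, 1 ≤ R →
      ∫ x, wt n R x * secondDensity (u t₂) (td u t₂) x ∂(stripMeasure n) +
        ∫ r in t₁..t₂, ∫ x, wt n R x * gradSq (chemT u r) x ∂(stripMeasure n) ≤
      ∫ x, wt n R x * secondDensity (u t₁) (td u t₁) x ∂(stripMeasure n) + K := by
  have hK := one_le_cutK
  set C := 4 * (4 * cutK) ^ 4 with hC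
  have hC0 : 0 ≤ C := by positivity
  refine ⟨6 * ∫ p, |u p.1 p.2 * td u p.1 p.2 ^ 3| ∂(stMeasure n t₁ t₂) +
    C * ∫ p, fluxBound u p.1 p.2 ∂(stMeasure n t₁ t₂), fun R hR => ?_⟩
  have hR0 : 0 < R := by linarith
  have hR20 : 0 < 2 * R := by linarith
  have hw := isTestFunction_wt (n := n) hR0
  have hc := isTestFunction_cut (n := n) hR20
  have hsub : uIcc t₁ t₂ ⊆ Ioo 0 T := by rw [uIcc_of_le h12]; exact Icc_subset_of_mem h1 h2
  have hφ := hu.st.secondDensity hu.st.td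
  have hq3 := hu.st.mul (hu.st.td.pow 3)
  have c0 := ((hφ.td.continuousOn_integral hw).mono hsub).intervalIntegrable (μ := volume)
  have c1 := ((hu.st.chemT.gradSq.continuousOn_integral hw).mono hsub).intervalIntegrable (μ := volume)
  have c2 := ((hq3.continuousOn_integral hw).mono hsub).intervalIntegrable (μ := volume)
  have c3 := ((hu.st.fluxBound.continuousOn_integral hc).mono hsub).intervalIntegrable (μ := volume)
  have hbal := hφ.integral_sub_integral hw h1 h2
  -- The source contains -2|∇μ_t|² and the flux returns at most 3/4 of |∇μ_t|², so the coefficient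
  -- -1 may be kept.
  have hmono : ∫ r in t₁..t₂, ∫ x, wt n R x * td (fun t => secondDensity (u t) (td u t)) r x ∂(stripMeasure n) ≤
      ∫ r in t₁..t₂, (-1 * ∫ x, wt n R x * gradSq (chemT u r) x ∂(stripMeasure n) +
        6 * ∫ x, wt n R x * (u r x * td u r x ^ 3) ∂(stripMeasure n) +
        C * ∫ x, cut n (2 * R) x * fluxBound u r x ∂(stripMeasure n)) := by
    refine intervalIntegral.integral_mono_on h12 c0 (((c1.const_mul _).add (c2.const_mul _)).add
      (c3.const_mul _)) fun r hr => ?_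
    have hrT := Icc_subset_of_mem h1 h2 hr
    have tA := hw.mul (hu.st.chemT.gradSq.sp hrT)
    have tB := hw.mul (hq3.sp hrT)
    have tC := hc.mul (hu.st.fluxBound.sp hrT)
    have := abs_integral_wt_sub_le_of_test (hφ.td.sp hrT) (hu.st.secondSource.sp hrT)
      ((tA.const_mul (3 / 4)).add (tC.const_mul C)) (hu.st.isTestFunction_secondDiv hrT hR0)
      (hu.st.integral_secondDiv hrT hR0) hR0 fun x => by
        rw [hu.second_flux_eq hrT]; exact second_flux_le hR r x
    rw [integral_add (tA.const_mul _).integrable (tC.const_mul _).integrable, integral_const_mul,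
      integral_const_mul] at this
    have e1 : ∫ x, wt n R x * secondSource u r x ∂(stripMeasure n) =
        -2 * ∫ x, wt n R x * gradSq (chemT u r) x ∂(stripMeasure n) +
          6 * ∫ x, wt n R x * (u r x * td u r x ^ 3) ∂(stripMeasure n) := by
      rw [← integral_const_mul, ← integral_const_mul,
        ← integral_add (tA.const_mul _).integrable (tB.const_mul _).integrable]
      refine integral_congr_ae (Filter.Eventually.of_forall fun x => ?_)
      simp only [secondSource]; ring
    have nA : 0 ≤ ∫ x, wt n R x * gradSq (chemT u r) x ∂(stripMeasure n) :=
      integral_nonneg fun x => mul_nonneg (wt_nonneg _ _) (gradSq_nonneg _ _)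
    have := (abs_le.1 this).2
    linarith
  rw [intervalIntegral.integral_add ((c1.const_mul _).add (c2.const_mul _)) (c3.const_mul _),
    intervalIntegral.integral_add (c1.const_mul _) (c2.const_mul _),
    intervalIntegral.integral_const_mul, intervalIntegral.integral_const_mul,
    intervalIntegral.integral_const_mul, ← hq3.integral_st h1 h2 h12 hw,
    ← hu.st.fluxBound.integral_st h1 h2 h12 hc] at hmono
  have f1 : ∫ p, wt n R p.2 * (u p.1 p.2 * td u p.1 p.2 ^ 3) ∂(stMeasure n t₁ t₂) ≤
      ∫ p, |u p.1 p.2 * td u p.1 p.2 ^ 3| ∂(stMeasure n t₁ t₂) := by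
    refine integral_mono (hq3.integrable_st h1 h2 hw) (hu.integrable_mul_cube hn h1 h2).abs fun p => ?_
    refine (mul_le_mul_of_nonneg_left (le_abs_self _) (wt_nonneg _ _)).trans ?_
    exact mul_le_of_le_one_left (abs_nonneg _) (wt_le_one _ _)
  have f2 : ∫ p, cut n (2 * R) p.2 * fluxBound u p.1 p.2 ∂(stMeasure n t₁ t₂) ≤
      ∫ p, fluxBound u p.1 p.2 ∂(stMeasure n t₁ t₂) := by
    refine integral_mono (hu.st.fluxBound.integrable_st h1 h2 hc) (hu.integrable_fluxBound h1 h2) fun p => ?_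
    exact mul_le_of_le_one_left (fluxBound_nonneg _ _ _) (cut_le_one _ _)
  have f3 := mul_le_mul_of_nonneg_left f2 hC0
  linarith

end

/-! ### Derivatives of the energy and of the dissipation -/

section
variable {T t₁ t₂ : ℝ} {u : ℝ → Space n → ℝ}

theorem Flow.integrable_td_slice (hu : Flow T u) {t : ℝ} (ht : t ∈ Ioo 0 T) :
    Integrable (fun x => td u t x ^ 2) (stripMeasure n) := by
  -- The degenerate interval suffices: the estimate behind this bound starts at an earlier time.
  obtain ⟨B, _, hB, _⟩ := hu.td_bound ht ht
  exact integrable_of_lintegral_le ((hu.st.td.sp ht).pow 2).continuous.aestronglyMeasurable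
    (fun _ => sq_nonneg _) ((hB t (left_mem_Icc.2 le_rfl)).trans_lt ENNReal.ofReal_lt_top)

theorem integrable_gradSq_of_sq {a : Space n → ℝ} (ha : SP a)
    (h0 : Integrable (fun x => a x ^ 2) (stripMeasure n))
    (h2 : Integrable (fun x => lap a x ^ 2) (stripMeasure n)) :
    Integrable (gradSq a) (stripMeasure n) := by
  refine integrable_of_lintegral_le ha.gradSq.continuous.aestronglyMeasurable (gradSq_nonneg _) ?_
  refine (lintegral_gradSq_le ha one_pos).trans_lt ?_
  exact ENNReal.add_lt_top.2 ⟨ENNReal.mul_lt_top ENNReal.ofReal_lt_top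
    (Integrable.lintegral_ofReal_lt_top h0), ENNReal.mul_lt_top ENNReal.ofReal_lt_top
    (Integrable.lintegral_ofReal_lt_top h2)⟩

theorem Flow.lap_chem_eq (hu : Flow T u) {t : ℝ} (ht : t ∈ Ioo 0 T) : lap (chem (u t)) = td u t :=
  funext fun x => (hu.eq t ht x).symm

theorem Flow.integrable_gradSq_chem_slice (hu : Flow T u) {t : ℝ} (ht : t ∈ Ioo 0 T) :
    Integrable (gradSq (chem (u t))) (stripMeasure n) :=
  integrable_gradSq_of_sq (hu.st.chem.sp ht) (hu.sq_chem t ht)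
    (by rw [hu.lap_chem_eq ht]; exact hu.integrable_td_slice ht)

theorem neg_sq_le_secondDensity (w q : Space n → ℝ) (x : Space n) : gradSq q x - q x ^ 2 ≤ secondDensity w q x := by
  simp only [secondDensity, well2]
  nlinarith [mul_nonneg (sq_nonneg (w x)) (sq_nonneg (q x))]

/-- A starting time for the estimate of the second variation. -/
theorem Flow.exists_start (hu : Flow T u) (h1 : t₁ ∈ Ioo 0 T) :
    ∃ s ∈ Ioo 0 T, s ≤ t₁ ∧ Integrable (secondDensity (u s) (td u s)) (stripMeasure n) := by
  have h0 : t₁ / 2 ∈ Ioo 0 T := ⟨by linarith [h1.1], by linarith [h1.1, h1.2]⟩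
  obtain ⟨s, hs, hsi⟩ := exists_slice_integrable (by linarith [h1.1]) (hu.integrable_secondDensity h0 h1)
  exact ⟨s, Icc_subset_of_mem h0 h1 (Ioc_subset_Icc_self hs), hs.2, hsi⟩

/-- The second variation has no sign, but G'' ≥ -1, so adding the finite quantity ∫u_t² makes it
control |∇u_t|². -/
theorem Flow.exists_bound_second (hn : n ≤ 4) (hu : Flow T u) (h1 : t₁ ∈ Ioo 0 T) (h2 : t₂ ∈ Ioo 0 T)
    (h12 : t₁ ≤ t₂) (hi : Integrable (secondDensity (u t₁) (td u t₁)) (stripMeasure n)) :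
    ∃ K : ℝ, ∀ R, 1 ≤ R →
      ∫ x, wt n R x * gradSq (td u t₂) x ∂(stripMeasure n) +
        ∫ r in t₁..t₂, ∫ x, wt n R x * gradSq (chemT u r) x ∂(stripMeasure n) ≤ K := by
  obtain ⟨K, hK⟩ := hu.exists_localized_second_le hn h1 h2 h12
  refine ⟨∫ x, |secondDensity (u t₁) (td u t₁) x| ∂(stripMeasure n) + K +
    ∫ x, td u t₂ x ^ 2 ∂(stripMeasure n), fun R hR => ?_⟩
  have hw := isTestFunction_wt (n := n) (R := R) (by linarith)
  have hφ := hu.st.secondDensity hu.st.td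
  have t1 := hw.mul (hφ.sp h1)
  have t2 := hw.mul (hφ.sp h2)
  have t3 := hw.mul (hu.st.td.sp h2).gradSq
  have t4 := hw.mul ((hu.st.td.sp h2).pow 2)
  have f1 : ∫ x, wt n R x * secondDensity (u t₁) (td u t₁) x ∂(stripMeasure n) ≤
      ∫ x, |secondDensity (u t₁) (td u t₁) x| ∂(stripMeasure n) := by
    refine integral_mono t1.integrable hi.abs fun x => ?_
    exact (mul_le_mul_of_nonneg_left (le_abs_self _) (wt_nonneg _ _)).trans
      (mul_le_of_le_one_left (abs_nonneg _) (wt_le_one _ _))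
  have f2 : ∫ x, wt n R x * gradSq (td u t₂) x ∂(stripMeasure n) ≤
      ∫ x, (wt n R x * secondDensity (u t₂) (td u t₂) x + td u t₂ x ^ 2) ∂(stripMeasure n) := by
    refine integral_mono t3.integrable (t2.integrable.add (hu.integrable_td_slice h2)) fun x => ?_
    have := mul_le_mul_of_nonneg_left (neg_sq_le_secondDensity (u t₂) (td u t₂) x) (wt_nonneg R x)
    have := mul_le_of_le_one_left (sq_nonneg (td u t₂ x)) (wt_le_one R x)
    simp only
    linarith
  rw [integral_add t2.integrable (hu.integrable_td_slice h2)] at f2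
  linarith [hK R hR]

theorem Flow.integrable_gradSq_chemT (hn : n ≤ 4) (hu : Flow T u) (h1 : t₁ ∈ Ioo 0 T) (h2 : t₂ ∈ Ioo 0 T) :
    Integrable (fun p : ℝ × Space n => gradSq (chemT u p.1) p.2) (stMeasure n t₁ t₂) := by
  rcases le_total t₂ t₁ with h | h
  · rw [stMeasure_eq_zero h]; exact integrable_zero_measure
  obtain ⟨s, hs, hst, hi⟩ := hu.exists_start h1
  obtain ⟨K, hK⟩ := hu.exists_bound_second hn hs h2 (hst.trans h) hi
  have := hu.st.chemT.gradSq.integrable_of_lintegral hs h2 (fun _ _ _ => gradSq_nonneg _ _)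
    ((hu.st.chemT.gradSq.st_lintegral_le (K := K) (R₀ := 1) hs h2 (hst.trans h)
      (fun _ _ _ => gradSq_nonneg _ _) fun R hR _ => ?_).trans_lt ENNReal.ofReal_lt_top)
  · exact this.mono_measure (stMeasure_mono hst le_rfl)
  · have n1 : 0 ≤ ∫ x, wt n R x * gradSq (td u t₂) x ∂(stripMeasure n) :=
      integral_nonneg fun x => mul_nonneg (wt_nonneg _ _) (gradSq_nonneg _ _)
    linarith [hK R hR]

theorem Flow.integrable_gradSq_td_slice (hn : n ≤ 4) (hu : Flow T u) {t : ℝ} (ht : t ∈ Ioo 0 T) :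
    Integrable (gradSq (td u t)) (stripMeasure n) := by
  obtain ⟨s, hs, hst, hi⟩ := hu.exists_start ht
  obtain ⟨K, hK⟩ := hu.exists_bound_second hn hs ht hst hi
  refine integrable_of_lintegral_le (hu.st.td.sp ht).gradSq.continuous.aestronglyMeasurable
    (gradSq_nonneg _) ((lintegral_strip_le (hu.st.td.sp ht).gradSq.continuous (gradSq_nonneg _)
      (K := K) (R₀ := 1) fun R hR _ => ?_).trans_lt ENNReal.ofReal_lt_top)
  have n1 : 0 ≤ ∫ r in s..t, ∫ x, wt n R x * gradSq (chemT u r) x ∂(stripMeasure n) :=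
    intervalIntegral.integral_nonneg hst fun r _ =>
      integral_nonneg fun x => mul_nonneg (wt_nonneg _ _) (gradSq_nonneg _ _)
  linarith [hK R hR]

theorem Flow.integrable_secondDensity_slice (hn : n ≤ 4) (hu : Flow T u) {t : ℝ} (ht : t ∈ Ioo 0 T) :
    Integrable (secondDensity (u t) (td u t)) (stripMeasure n) := by
  refine Integrable.mono' ((hu.integrable_gradSq_td_slice hn ht).add ((hu.integrable_td_slice ht).const_mul 11))
    ((hu.st.secondDensity hu.st.td).sp ht).continuous.aestronglyMeasurable
    (Filter.Eventually.of_forall fun x => ?_)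
  simp only [secondDensity, Pi.add_apply, Real.norm_eq_abs]
  refine (abs_add_le _ _).trans ?_
  rw [abs_of_nonneg (gradSq_nonneg _ _), abs_mul, abs_of_nonneg (sq_nonneg (td u t x))]
  have := mul_le_mul_of_nonneg_right (abs_well2_le (hu.bdd t ht x)) (sq_nonneg (td u t x))
  simp only [well2]
  linarith

theorem Flow.integrable_secondSource (hn : n ≤ 4) (hu : Flow T u) (h1 : t₁ ∈ Ioo 0 T) (h2 : t₂ ∈ Ioo 0 T) :
    Integrable (fun p : ℝ × Space n => secondSource u p.1 p.2) (stMeasure n t₁ t₂) :=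
  ((hu.integrable_gradSq_chemT hn h1 h2).const_mul (-2)).add ((hu.integrable_mul_cube hn h1 h2).const_mul 6)

/-- Since ∇μ_t is now known to be square integrable in space-time, the same flux can be estimated
with a factor 1/R in front, and the inequality becomes an identity. -/
theorem Flow.second_balance (hn : n ≤ 4) (hu : Flow T u) (h1 : t₁ ∈ Ioo 0 T) (h2 : t₂ ∈ Ioo 0 T)
    (h12 : t₁ ≤ t₂) :
    ∫ x, secondDensity (u t₂) (td u t₂) x ∂(stripMeasure n) -
        ∫ x, secondDensity (u t₁) (td u t₁) x ∂(stripMeasure n) =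
      ∫ p, secondSource u p.1 p.2 ∂(stMeasure n t₁ t₂) := by
  have hK := one_le_cutK
  refine balance_law (a := secondSource u) (e := fun t => secondDensity (u t) (td u t))
    (g := fun t x => fluxBound u t x + gradSq (chemT u t) x)
    (hu.st.secondDensity hu.st.td) hu.st.secondSource (hu.st.fluxBound.add hu.st.chemT.gradSq)
    h1 h2 h12 (hu.integrable_secondDensity_slice hn h1) (hu.integrable_secondDensity_slice hn h2)
    (hu.integrable_secondSource hn h1 h2)
    ((hu.integrable_fluxBound h1 h2).add (hu.integrable_gradSq_chemT hn h1 h2))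
    (fun r hr x => add_nonneg (fluxBound_nonneg _ _ _) (gradSq_nonneg _ _)) (C := 4 * (4 * cutK) ^ 2)
    (by positivity) fun R hR r hr => ?_
  have hR0 : 0 < R := by linarith
  refine abs_integral_wt_sub_le ((hu.st.secondDensity hu.st.td).td.sp hr) (hu.st.secondSource.sp hr)
    ((hu.st.fluxBound.add hu.st.chemT.gradSq).sp hr)
    (hu.st.isTestFunction_secondDiv hr hR0) (hu.st.integral_secondDiv hr hR0) hR0 fun x => ?_
  rw [hu.second_flux_eq hr]
  have b1 := abs_pz_wt_le (n := n) hR0 x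
  have b2 := abs_lap_wt_le' (n := n) hR x
  have c0 := cut_nonneg (n := n) R x
  have hKK : 4 * cutK ≤ (4 * cutK) ^ 2 := by nlinarith
  have b3 : |pz (wt n R) x| ≤ (4 * cutK) ^ 2 / R * cut n R x :=
    b1.trans (mul_le_mul_of_nonneg_right (div_le_div_of_nonneg_right hKK hR0.le) c0)
  have g1 := pz_sq_le_gradSq (chemT u r) x
  have g2 := pz_sq_le_gradSq (td u r) x
  have g3 := gradSq_pz_le (td u r) x
  have s1 : |∑ i, pd i (pz (td u r)) x * pd i (chemT u r) x| ≤
      1 / 2 * (gradSq (pz (td u r)) x + gradSq (chemT u r) x) := by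
    refine (Finset.abs_sum_le_sum_abs _ _).trans ?_
    simp only [gradSq]
    rw [← Finset.sum_add_distrib, Finset.mul_sum]
    exact Finset.sum_le_sum fun i _ => abs_mul_le_half _ _
  have s2 := abs_mul_le_half (chemT u r x) (pz (chemT u r) x)
  have s3 := abs_mul_le_half (pz (td u r) x) (pz (chemT u r) x)
  set P := (4 * cutK) ^ 2 / R * cut n R x with hP
  have hP0 : 0 ≤ P := by positivity
  have e1 := mul_le_mul b3 ((abs_sub (∑ i, pd i (pz (td u r)) x * pd i (chemT u r) x)
    (chemT u r x * pz (chemT u r) x)).trans (add_le_add s1 s2)) (abs_nonneg _) hP0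
  have e2 := mul_le_mul b2 s3 (abs_nonneg _) hP0
  rw [← abs_mul] at e1 e2
  rw [abs_mul, abs_two]
  have e3 := abs_add_le (pz (wt n R) x * (∑ i, pd i (pz (td u r)) x * pd i (chemT u r) x -
    chemT u r x * pz (chemT u r) x)) (lap (wt n R) x * (pz (td u r) x * pz (chemT u r) x))
  have e4 : 1 / 2 * (gradSq (pz (td u r)) x + gradSq (chemT u r) x) +
      1 / 2 * (chemT u r x ^ 2 + pz (chemT u r) x ^ 2) + 1 / 2 * (pz (td u r) x ^ 2 + pz (chemT u r) x ^ 2) ≤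
      2 * (fluxBound u r x + gradSq (chemT u r) x) := by
    simp only [fluxBound]
    have := gradSq_nonneg (td u r) x
    have := gradSq_nonneg (chemT u r) x
    have := gradSq_nonneg (pz (td u r)) x
    have := sq_nonneg (chemT u r x)
    linarith
  have e5 := mul_le_mul_of_nonneg_left e4 hP0
  have e6 : 4 * (4 * cutK) ^ 2 / R * (cut n R x * (fluxBound u r x + gradSq (chemT u r) x)) =
      2 * (P * (2 * (fluxBound u r x + gradSq (chemT u r) x))) := by rw [hP]; ring
  rw [e6]
  linarith

end

/-! ### From integrated identities to derivatives in time -/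

/-- A function with an integrable "derivative" is continuous. -/
theorem continuousOn_of_integral_eq {T : ℝ} {J g : ℝ → ℝ}
    (hg : ∀ s ∈ Ioo 0 T, ∀ t ∈ Ioo 0 T, s ≤ t → IntervalIntegrable g volume s t)
    (hJ : ∀ s ∈ Ioo 0 T, ∀ t ∈ Ioo 0 T, s ≤ t → J t - J s = ∫ r in s..t, g r) :
    ContinuousOn J (Ioo 0 T) := by
  intro t ht
  refine ContinuousAt.continuousWithinAt ?_
  set a := t / 2
  set b := (t + T) / 2
  have ha : a ∈ Ioo 0 T := ⟨by simp only [a]; linarith [ht.1], by simp only [a]; linarith [ht.1, ht.2]⟩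
  have hb : b ∈ Ioo 0 T := ⟨by simp only [b]; linarith [ht.1, ht.2], by simp only [b]; linarith [ht.2]⟩
  have hat : a < t := by simp only [a]; linarith [ht.1]
  have htb : t < b := by simp only [b]; linarith [ht.2]
  have hc : ContinuousOn (fun r => ∫ s in a..r, g s) (uIcc a b) :=
    intervalIntegral.continuousOn_primitive_interval' (hg a ha b hb (hat.trans htb).le) left_mem_uIcc
  rw [uIcc_of_le (hat.trans htb).le] at hc
  have hc2 : ContinuousAt (fun r => J a + ∫ s in a..r, g s) t :=
    continuousAt_const.add (hc.continuousAt (Icc_mem_nhds hat htb))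
  refine hc2.congr ?_
  filter_upwards [Ioo_mem_nhds hat htb] with r hr
  have := hJ a ha r ⟨ha.1.trans hr.1, hr.2.trans hb.2⟩ hr.1.le
  linarith

theorem hasDerivAt_of_integral_eq {T : ℝ} {J g : ℝ → ℝ} (hg : ContinuousOn g (Ioo 0 T))
    (hJ : ∀ s ∈ Ioo 0 T, ∀ t ∈ Ioo 0 T, s ≤ t → J t - J s = ∫ r in s..t, g r) {t : ℝ} (ht : t ∈ Ioo 0 T) :
    HasDerivAt J (g t) t := by
  set a := t / 2
  have ha : a ∈ Ioo 0 T := ⟨by simp only [a]; linarith [ht.1], by simp only [a]; linarith [ht.1, ht.2]⟩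
  have hat : a < t := by simp only [a]; linarith [ht.1]
  have hi : IntervalIntegrable g volume a t := (hg.mono (by
    rw [uIcc_of_le hat.le]; exact Icc_subset_of_mem ha ht)).intervalIntegrable
  have h := intervalIntegral.integral_hasDerivAt_right hi
    (hg.stronglyMeasurableAtFilter isOpen_Ioo t ht) (hg.continuousAt (isOpen_Ioo.mem_nhds ht))
  refine (h.const_add (J a)).congr_of_eventuallyEq ?_
  filter_upwards [Ioo_mem_nhds hat ht.2] with r hr
  have := hJ a ha r ⟨ha.1.trans hr.1, hr.2⟩ hr.1.le
  linarith

theorem intervalIntegrable_of_st {t₁ t₂ : ℝ} {f : ℝ × Space n → ℝ} (h12 : t₁ ≤ t₂)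
    (hf : Integrable f (stMeasure n t₁ t₂)) :
    IntervalIntegrable (fun r => ∫ x, f (r, x) ∂(stripMeasure n)) volume t₁ t₂ := by
  rw [intervalIntegrable_iff_integrableOn_Ioc_of_le h12]
  exact Integrable.integral_prod_left hf

theorem integral_st_eq {t₁ t₂ : ℝ} {f : ℝ × Space n → ℝ} (h12 : t₁ ≤ t₂)
    (hf : Integrable f (stMeasure n t₁ t₂)) :
    ∫ p, f p ∂(stMeasure n t₁ t₂) = ∫ r in t₁..t₂, ∫ x, f (r, x) ∂(stripMeasure n) := by
  rw [intervalIntegral.integral_of_le h12]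
  exact integral_prod _ hf

section
variable {T : ℝ} {u : ℝ → Space n → ℝ}

theorem Flow.continuousOn_second (hn : n ≤ 4) (hu : Flow T u) :
    ContinuousOn (fun t => ∫ x, secondDensity (u t) (td u t) x ∂(stripMeasure n)) (Ioo 0 T) :=
  continuousOn_of_integral_eq (g := fun r => ∫ x, secondSource u r x ∂(stripMeasure n))
    (fun _ hs _ ht hst => intervalIntegrable_of_st hst (hu.integrable_secondSource hn hs ht))
    fun s hs t ht hst => by
      rw [hu.second_balance hn hs ht hst]
      exact integral_st_eq hst (hu.integrable_secondSource hn hs ht)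

/-- The integrated identity for D has the second variation as its integrand, which is continuous in
time by its own balance law. The integrability of u_t³, and with it the restriction on the
dimension, enters through that continuity. -/
theorem Flow.hasDerivAt_dissipation (hn : n ≤ 4) (hu : Flow T u) {t : ℝ} (ht : t ∈ Ioo 0 T) :
    HasDerivAt (fun t => ∫ x, gradSq (chem (u t)) x ∂(stripMeasure n))
      (-2 * ∫ x, secondDensity (u t) (td u t) x ∂(stripMeasure n)) t := by
  refine hasDerivAt_of_integral_eq (g := fun t => -2 * ∫ x, secondDensity (u t) (td u t) x ∂(stripMeasure n))
    ((hu.continuousOn_second hn).const_smul (-2 : ℝ)) (fun s hs t ht hst => ?_) ht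
  rw [hu.dissipation_balance hs ht hst (hu.integrable_gradSq_chem_slice hs)
    (hu.integrable_gradSq_chem_slice ht)]
  rw [integral_st_eq hst ((hu.integrable_secondDensity hs ht).const_mul (-2))]
  simp only [integral_const_mul]

theorem Flow.hasDerivAt_energy (hn : n ≤ 4) (hu : Flow T u)
    (hE : ∀ t ∈ Ioo 0 T, Integrable (energyDensity (u t)) (stripMeasure n)) {t : ℝ} (ht : t ∈ Ioo 0 T) :
    HasDerivAt (fun t => ∫ x, energyDensity (u t) x ∂(stripMeasure n))
      (- ∫ x, gradSq (chem (u t)) x ∂(stripMeasure n)) t := by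
  refine hasDerivAt_of_integral_eq (g := fun t => - ∫ x, gradSq (chem (u t)) x ∂(stripMeasure n))
    (fun t ht => (hu.hasDerivAt_dissipation hn ht).continuousAt.continuousWithinAt.neg)
    (fun s hs t ht hst => ?_) ht
  rw [hu.energy_balance hs ht hst (hE s hs) (hE t ht)]
  rw [integral_neg, integral_st_eq hst (hu.integrable_gradSq_chem hs ht), intervalIntegral.integral_neg]

end

/-! ### Derivative of the squared distance -/

/-- The competitors in the definition of `sqDist w`. -/
def Admissible (w : Space n → ℝ) (F : Space n → Space n) : Prop :=
  MemLp F 2 (stripMeasure n) ∧ HasWeakDiv F (fun x => w x - kink n 0 x)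

theorem inner_eq_sum (v w : Space n) : inner ℝ v w = ∑ i, v i * w i := by
  rw [PiLp.inner_apply]
  exact Finset.sum_congr rfl fun i _ => by simp [mul_comm]

theorem integrable_inner_of_memLp {X : Type*} [MeasurableSpace X] {m : Measure X} {F G : X → Space n}
    (hF : MemLp F 2 m) (hG : MemLp G 2 m) : Integrable (fun x => inner ℝ (F x) (G x)) m := by
  have i1 := (memLp_two_iff_integrable_sq_norm hF.1).1 hF
  have i2 := (memLp_two_iff_integrable_sq_norm hG.1).1 hG
  refine (i1.add i2).mono' (hF.1.inner hG.1) (Filter.Eventually.of_forall fun x => ?_)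
  refine (norm_inner_le_norm _ _).trans ?_
  simp only [Pi.add_apply]
  nlinarith [sq_nonneg (‖F x‖ - ‖G x‖), sq_nonneg ‖F x‖, sq_nonneg ‖G x‖]

theorem tendsto_const_div_succ (C : ℝ) :
    Filter.Tendsto (fun N : ℕ => C / ((N : ℝ) + 1)) Filter.atTop (nhds 0) :=
  tendsto_const_div_atTop_nhds_zero_nat C |>.comp (Filter.tendsto_add_atTop_nat 1) |>.congr fun N => by
    simp

theorem lintegral_enorm_sq_eq {X : Type*} [MeasurableSpace X] {m : Measure X} {F : X → Space n}
    (hF : MemLp F 2 m) : ∫⁻ x, ‖F x‖ₑ ^ 2 ∂m = ENNReal.ofReal (∫ x, ‖F x‖ ^ 2 ∂m) := by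
  rw [← lintegral_ofReal_eq ((memLp_two_iff_integrable_sq_norm hF.1).1 hF) fun _ => sq_nonneg _]
  refine lintegral_congr fun x => ?_
  rw [ENNReal.ofReal_pow (norm_nonneg _), ofReal_norm]

theorem sqDist_toReal_le {w : Space n → ℝ} {F : Space n → Space n} (hF : Admissible w F) :
    (sqDist w).toReal ≤ ∫ x, ‖F x‖ ^ 2 ∂(stripMeasure n) := by
  have h : sqDist w ≤ ∫⁻ x, ‖F x‖ₑ ^ 2 ∂(stripMeasure n) := iInf₂_le F hF
  rw [lintegral_enorm_sq_eq hF.1] at h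
  exact ENNReal.toReal_le_of_le_ofReal (integral_nonneg fun _ => sq_nonneg _) h

theorem exists_admissible_lt {w : Space n → ℝ} (hw : sqDist w < ⊤) {ε : ℝ} (hε : 0 < ε) :
    ∃ F, Admissible w F ∧ ∫ x, ‖F x‖ ^ 2 ∂(stripMeasure n) < (sqDist w).toReal + ε := by
  have h : sqDist w < ENNReal.ofReal ((sqDist w).toReal + ε) := by
    rw [ENNReal.lt_ofReal_iff_toReal_lt hw.ne]; linarith
  rw [sqDist] at h
  obtain ⟨F, hF⟩ := iInf_lt_iff.1 h
  obtain ⟨hF1, hF2⟩ := iInf_lt_iff.1 hF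
  refine ⟨F, hF1, ?_⟩
  rw [lintegral_enorm_sq_eq hF1.1] at hF2
  exact (ENNReal.ofReal_lt_ofReal_iff'.1 hF2).1

theorem integrable_inner_test {F : Space n → Space n} (hF : MemLp F 2 (stripMeasure n)) {φ : Space n → ℝ}
    (hφ : IsTestFunction φ) : Integrable (fun x => inner ℝ (F x) (∇ φ x)) (stripMeasure n) := by
  have hg : Integrable (gradSq φ) (stripMeasure n) := by
    have := IsTestFunction.sum (s := Finset.univ) fun i => (hφ.pd i).mul (hφ.pd i).sp
    refine this.integrable.congr (Filter.Eventually.of_forall fun x => ?_)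
    exact Finset.sum_congr rfl fun i _ => (pow_two _).symm
  have hm : AEStronglyMeasurable (fun x => ∇ φ x) (stripMeasure n) := by
    have : Continuous fun x => ∇ φ x := by
      have h := (hφ.smooth.continuous_fderiv (by norm_num))
      exact (InnerProductSpace.toDual ℝ (Space n)).symm.continuous.comp h
    exact this.aestronglyMeasurable
  have hG : MemLp (fun x => ∇ φ x) 2 (stripMeasure n) := by
    rw [memLp_two_iff_integrable_sq_norm hm]
    simpa only [norm_gradient_sq] using hg
  exact integrable_inner_of_memLp hF hG

/-- A translation of the set of competitors changes the squared distance in a controlled way. -/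
theorem sqDist_translate {w w' : Space n → ℝ} (hw : sqDist w < ⊤) (hw' : sqDist w' < ⊤)
    {G : Space n → Space n} (hG : MemLp G 2 (stripMeasure n))
    (hdiv : ∀ φ : Space n → ℝ, IsTestFunction φ →
      ∫ x, inner ℝ (G x) (∇ φ x) ∂(stripMeasure n) = - ∫ x, φ x * (w' x - w x) ∂(stripMeasure n))
    (cw : SP w) (cw' : SP w')
    {c : ℝ} (hc : ∀ F, Admissible w F → ∫ x, inner ℝ (F x) (G x) ∂(stripMeasure n) = c) :
    (sqDist w').toReal = (sqDist w).toReal + 2 * c + ∫ x, ‖G x‖ ^ 2 ∂(stripMeasure n) := by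
  have k0 := sp_kink (n := n) 0
  have hadd : ∀ F, Admissible w F → Admissible w' (fun x => F x + G x) := by
    intro F hF
    refine ⟨hF.1.add hG, fun φ hφ => ?_⟩
    have i1 := integrable_inner_test hF.1 hφ
    have i2 := integrable_inner_test hG hφ
    have e1 := hF.2 φ hφ
    have e2 := hdiv φ hφ
    have t1 := (hφ.mul (cw.sub k0)).integrable
    have t2 := (hφ.mul (cw'.sub cw)).integrable
    simp only [inner_add_left]
    rw [integral_add i1 i2, e1, e2]
    have t3 : ∫ x, (w x - kink n 0 x) * φ x ∂(stripMeasure n) = ∫ x, φ x * (w x - kink n 0 x) ∂(stripMeasure n) :=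
      integral_congr_ae (Filter.Eventually.of_forall fun x => mul_comm _ _)
    rw [t3, ← neg_add, ← integral_add t1 t2]
    congr 1
    exact integral_congr_ae (Filter.Eventually.of_forall fun x => by simp only; ring)
  have hsub : ∀ F, Admissible w' F → Admissible w (fun x => F x - G x) := by
    intro F hF
    refine ⟨hF.1.sub hG, fun φ hφ => ?_⟩
    have i1 := integrable_inner_test hF.1 hφ
    have i2 := integrable_inner_test hG hφ
    have e1 := hF.2 φ hφ
    have e2 := hdiv φ hφ
    have t1 := (hφ.mul (cw'.sub k0)).integrable
    have t2 := (hφ.mul (cw'.sub cw)).integrable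
    simp only [inner_sub_left]
    rw [integral_sub i1 i2, e1, e2]
    have t3 : ∫ x, (w' x - kink n 0 x) * φ x ∂(stripMeasure n) = ∫ x, φ x * (w' x - kink n 0 x) ∂(stripMeasure n) :=
      integral_congr_ae (Filter.Eventually.of_forall fun x => mul_comm _ _)
    rw [t3, ← neg_sub', ← integral_sub t1 t2]
    congr 1
    exact integral_congr_ae (Filter.Eventually.of_forall fun x => by simp only; ring)
  have hsq : ∀ F, Admissible w F → ∫ x, ‖F x + G x‖ ^ 2 ∂(stripMeasure n) =
      ∫ x, ‖F x‖ ^ 2 ∂(stripMeasure n) + 2 * c + ∫ x, ‖G x‖ ^ 2 ∂(stripMeasure n) := by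
    intro F hF
    have i1 := (memLp_two_iff_integrable_sq_norm hF.1.1).1 hF.1
    have i2 := (memLp_two_iff_integrable_sq_norm hG.1).1 hG
    have i3 : Integrable (fun x => inner ℝ (F x) (G x)) (stripMeasure n) := integrable_inner_of_memLp hF.1 hG
    have i4 : Integrable (fun x => ‖F x‖ ^ 2 + 2 * inner ℝ (F x) (G x)) (stripMeasure n) :=
      i1.add (i3.const_mul 2)
    simp only [norm_add_sq_real]
    rw [integral_add i4 i2, integral_add i1 (i3.const_mul 2), integral_const_mul, hc F hF]
  -- Translation by G is a bijection between the two sets of competitors, and it changes the squared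
  -- norm by a constant because the inner product with G does not depend on the competitor. The
  -- infima differ by the same constant, attained or not.
  refine le_antisymm (le_of_forall_pos_le_add fun ε hε => ?_) (le_of_forall_pos_le_add fun ε hε => ?_)
  · obtain ⟨F, hF, hlt⟩ := exists_admissible_lt hw hε
    have h1 := sqDist_toReal_le (hadd F hF)
    rw [hsq F hF] at h1
    linarith
  · obtain ⟨F, hF, hlt⟩ := exists_admissible_lt hw' hε
    have h1 := sqDist_toReal_le (hsub F hF)
    have h2 := hsq _ (hsub F hF)
    simp only [sub_add_cancel] at h2
    linarith

/-- The weak divergence may be tested with smooth functions of class `H¹`. -/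
theorem weakDiv_sobolev {F : Space n → Space n} {f g : Space n → ℝ} (hF : MemLp F 2 (stripMeasure n))
    (hdiv : HasWeakDiv F f) (cf : SP f) (hg : SP g)
    (fi : Integrable (fun x => f x ^ 2) (stripMeasure n))
    (gi : Integrable (fun x => g x ^ 2) (stripMeasure n))
    (dgi : Integrable (gradSq g) (stripMeasure n)) :
    ∫ x, (∑ i, F x i * pd i g x) ∂(stripMeasure n) = - ∫ x, f x * g x ∂(stripMeasure n) := by
  have hK := one_le_cutK
  have Fi := (memLp_two_iff_integrable_sq_norm hF.1).1 hF
  have mF : ∀ i, AEStronglyMeasurable (fun x => F x i) (stripMeasure n) := fun i =>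
    (EuclideanSpace.proj (𝕜 := ℝ) i).continuous.comp_aestronglyMeasurable hF.1
  have nF : ∀ x, ‖F x‖ ^ 2 = ∑ i, F x i ^ 2 := fun x => EuclideanSpace.real_norm_sq_eq _
  have nFi : ∀ x i, F x i ^ 2 ≤ ‖F x‖ ^ 2 := fun x i => by
    rw [nF]; exact Finset.single_le_sum (f := fun j => F x j ^ 2) (fun _ _ => sq_nonneg _) (Finset.mem_univ i)
  have i1 : Integrable (fun x => ∑ i, F x i * pd i g x) (stripMeasure n) := by
    refine (Fi.add dgi).mono' ?_ (Filter.Eventually.of_forall fun x => ?_)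
    · exact Finset.aestronglyMeasurable_fun_sum _ fun i _ => (mF i).mul (hg.pd i).continuous.aestronglyMeasurable
    · rw [Real.norm_eq_abs, Pi.add_apply, nF]
      refine (Finset.abs_sum_le_sum_abs _ _).trans ?_
      simp only [gradSq]
      rw [← Finset.sum_add_distrib]
      refine Finset.sum_le_sum fun i _ => (abs_mul_le_half _ _).trans ?_
      nlinarith [sq_nonneg (F x i), sq_nonneg (pd i g x)]
  have i2 : Integrable (fun x => f x * g x) (stripMeasure n) := by
    refine (fi.add gi).mono' (cf.mul hg).continuous.aestronglyMeasurable (Filter.Eventually.of_forall fun x => ?_)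
    rw [Real.norm_eq_abs, Pi.add_apply]
    refine (abs_mul_le_half _ _).trans ?_
    nlinarith [sq_nonneg (f x), sq_nonneg (g x)]
  have i3 : Integrable (fun x => |F x (Fin.last n) * g x|) (stripMeasure n) := by
    refine Integrable.abs ((Fi.add gi).mono' ((mF _).mul hg.continuous.aestronglyMeasurable)
      (Filter.Eventually.of_forall fun x => ?_))
    rw [Real.norm_eq_abs, Pi.add_apply]
    refine (abs_mul_le_half _ _).trans ?_
    nlinarith [nFi x (Fin.last n), sq_nonneg (F x (Fin.last n)), sq_nonneg (g x), sq_nonneg ‖F x‖]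
  have l1 := (tendsto_integral_wt i1).add (tendsto_integral_wt i2)
  have l2 := tendsto_const_div_succ (4 * cutK * ∫ x, |F x (Fin.last n) * g x| ∂(stripMeasure n))
  have l3 : Filter.Tendsto (fun N : ℕ => |∫ x, wt n ((N : ℝ) + 1) x * (∑ i, F x i * pd i g x) ∂(stripMeasure n) +
      ∫ x, wt n ((N : ℝ) + 1) x * (f x * g x) ∂(stripMeasure n)|) Filter.atTop (nhds 0) := by
    refine squeeze_zero (fun _ => abs_nonneg _) (fun N => ?_) l2
    have hR : (0 : ℝ) < (N : ℝ) + 1 := by positivity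
    set R := (N : ℝ) + 1 with hRd
    have hw := isTestFunction_wt (n := n) hR
    have e1 := hdiv _ (hw.mul hg)
    have j1 : Integrable (fun x => wt n R x * (∑ i, F x i * pd i g x)) (stripMeasure n) := by
      refine i1.bdd_mul (c := 1) hw.smooth.continuous.aestronglyMeasurable (Filter.Eventually.of_forall fun x => ?_)
      rw [Real.norm_eq_abs, abs_of_nonneg (wt_nonneg _ _)]; exact wt_le_one _ _
    have hb : ∀ x, |pz (wt n R) x * (F x (Fin.last n) * g x)| ≤ 4 * cutK / R * |F x (Fin.last n) * g x| := by
      intro x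
      rw [abs_mul]
      refine mul_le_mul_of_nonneg_right ((abs_pz_wt_le hR x).trans ?_) (abs_nonneg _)
      exact mul_le_of_le_one_right (by positivity) (cut_le_one _ _)
    have j2 : Integrable (fun x => pz (wt n R) x * (F x (Fin.last n) * g x)) (stripMeasure n) := by
      refine (i3.const_mul (4 * cutK / R)).mono' ?_ (Filter.Eventually.of_forall hb)
      exact (isTestFunction_pz_wt hR).smooth.continuous.aestronglyMeasurable.mul
        ((mF _).mul hg.continuous.aestronglyMeasurable)
    have e2 : ∀ x, inner ℝ (F x) (∇ (fun x => wt n R x * g x) x) =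
        wt n R x * (∑ i, F x i * pd i g x) + pz (wt n R) x * (F x (Fin.last n) * g x) := by
      intro x
      have h1 := sum_pd_wt_mul R (fun i => F x i * g x) x
      rw [inner_gradient, ← h1, Finset.mul_sum, ← Finset.sum_add_distrib]
      refine Finset.sum_congr rfl fun i _ => ?_
      rw [pd_mul _ hw.sp hg]
      ring
    simp only [e2] at e1
    rw [integral_add j1 j2] at e1
    have e3 : ∫ x, f x * (wt n R x * g x) ∂(stripMeasure n) = ∫ x, wt n R x * (f x * g x) ∂(stripMeasure n) :=
      integral_congr_ae (Filter.Eventually.of_forall fun x => by simp only; ring)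
    rw [e3] at e1
    have e4 : ∫ x, wt n R x * (∑ i, F x i * pd i g x) ∂(stripMeasure n) +
        ∫ x, wt n R x * (f x * g x) ∂(stripMeasure n) =
        - ∫ x, pz (wt n R) x * (F x (Fin.last n) * g x) ∂(stripMeasure n) := by linarith
    rw [e4, abs_neg]
    refine abs_integral_le_integral_abs.trans ?_
    calc _ ≤ ∫ x, 4 * cutK / R * |F x (Fin.last n) * g x| ∂(stripMeasure n) :=
          integral_mono j2.abs (i3.const_mul _) hb
      _ = _ := by rw [integral_const_mul]; ring
  have := abs_eq_zero.1 (tendsto_nhds_unique l1.abs l3)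
  linarith

theorem sq_intervalIntegral_le {f : ℝ → ℝ} {s t : ℝ} (hst : s ≤ t) (hf : ContinuousOn f (Icc s t)) :
    (∫ r in s..t, f r) ^ 2 ≤ (t - s) * ∫ r in s..t, f r ^ 2 := by
  rcases hst.eq_or_lt with rfl | h
  · simp
  have h0 : 0 < t - s := by linarith
  rw [← uIcc_of_le hst] at hf
  have i1 := hf.intervalIntegrable (μ := volume)
  have i2 : IntervalIntegrable (fun r => f r ^ 2) volume s t := (hf.pow 2).intervalIntegrable
  set I := ∫ r in s..t, f r with hI
  have h1 : 0 ≤ ∫ r in s..t, ((t - s) * f r - I) ^ 2 :=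
    intervalIntegral.integral_nonneg hst fun r _ => sq_nonneg _
  have h2 : ∫ r in s..t, ((t - s) * f r - I) ^ 2 =
      (t - s) ^ 2 * (∫ r in s..t, f r ^ 2) - 2 * (t - s) * I * I + (t - s) * I ^ 2 := by
    have e : ∀ r, ((t - s) * f r - I) ^ 2 = (t - s) ^ 2 * f r ^ 2 - 2 * (t - s) * I * f r + I ^ 2 := fun r => by ring
    simp only [e]
    rw [intervalIntegral.integral_add ((i2.const_mul _).sub (i1.const_mul _)) intervalIntegrable_const,
      intervalIntegral.integral_sub (i2.const_mul _) (i1.const_mul _), intervalIntegral.integral_const_mul,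
      intervalIntegral.integral_const_mul, intervalIntegral.integral_const, ← hI, smul_eq_mul]
  rw [h2] at h1
  have h3 : 0 ≤ (t - s) * ((t - s) * (∫ r in s..t, f r ^ 2) - I ^ 2) := by linarith
  have := nonneg_of_mul_nonneg_right h3 h0
  linarith

section
variable {T s t : ℝ} {u : ℝ → Space n → ℝ}

/-- The time integral of the gradient of the chemical potential. -/
def timeGrad (u : ℝ → Space n → ℝ) (s t : ℝ) (x : Space n) : Space n :=
  WithLp.toLp 2 fun i => ∫ r in s..t, pd i (chem (u r)) x

theorem timeGrad_apply (i : Fin (n + 1)) (x : Space n) :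
    timeGrad u s t x i = ∫ r in s..t, pd i (chem (u r)) x := rfl

theorem ST.continuousOn_time {a : ℝ → Space n → ℝ} (ha : ST T a) (hs : s ∈ Ioo 0 T) (ht : t ∈ Ioo 0 T)
    (x : Space n) : ContinuousOn (fun r => a r x) (Icc s t) :=
  ha.continuousOn.comp (f := fun r => (r, x)) (Continuous.prodMk_left x).continuousOn fun _ hr => ⟨Icc_subset_of_mem hs ht hr, mem_univ _⟩

theorem ST.intervalIntegrable_time {a : ℝ → Space n → ℝ} (ha : ST T a) (hs : s ∈ Ioo 0 T) (ht : t ∈ Ioo 0 T)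
    (hst : s ≤ t) (x : Space n) : IntervalIntegrable (fun r => a r x) volume s t := by
  have := ha.continuousOn_time hs ht x
  rw [← uIcc_of_le hst] at this
  exact this.intervalIntegrable

theorem ST.aestronglyMeasurable_timeIntegral {a : ℝ → Space n → ℝ} (ha : ST T a) (hs : s ∈ Ioo 0 T)
    (ht : t ∈ Ioo 0 T) (hst : s ≤ t) :
    AEStronglyMeasurable (fun x => ∫ r in s..t, a r x) (stripMeasure n) := by
  have h := (ha.aestronglyMeasurable hs ht).prod_swap.integral_prod_right'
  simp only [intervalIntegral.integral_of_le hst]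
  exact h

theorem Flow.norm_timeGrad_sq_le (hu : Flow T u) (hs : s ∈ Ioo 0 T) (ht : t ∈ Ioo 0 T) (hst : s ≤ t)
    (x : Space n) :
    ‖timeGrad u s t x‖ ^ 2 ≤ (t - s) * ∫ r in s..t, gradSq (chem (u r)) x := by
  rw [EuclideanSpace.real_norm_sq_eq]
  have e : ∫ r in s..t, gradSq (chem (u r)) x = ∑ i, ∫ r in s..t, pd i (chem (u r)) x ^ 2 := by
    simp only [gradSq]
    exact intervalIntegral.integral_finsetSum fun i _ =>
      ((hu.st.chem.pd i).pow 2).intervalIntegrable_time hs ht hst x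
  rw [e, Finset.mul_sum]
  exact Finset.sum_le_sum fun i _ => sq_intervalIntegral_le hst ((hu.st.chem.pd i).continuousOn_time hs ht x)

theorem integrable_timeIntegral {f : ℝ × Space n → ℝ} (hst : s ≤ t) (hf : Integrable f (stMeasure n s t)) :
    Integrable (fun x => ∫ r in s..t, f (r, x)) (stripMeasure n) := by
  simp only [intervalIntegral.integral_of_le hst]
  exact Integrable.integral_prod_right hf

theorem integral_st_symm {f : ℝ × Space n → ℝ} (hst : s ≤ t) (hf : Integrable f (stMeasure n s t)) :
    ∫ x, (∫ r in s..t, f (r, x)) ∂(stripMeasure n) = ∫ r in s..t, ∫ x, f (r, x) ∂(stripMeasure n) := by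
  rw [← integral_st_eq hst hf]
  simp only [intervalIntegral.integral_of_le hst]
  exact (integral_prod_symm _ hf).symm

theorem Flow.memLp_timeGrad (hu : Flow T u) (hs : s ∈ Ioo 0 T) (ht : t ∈ Ioo 0 T) (hst : s ≤ t) :
    MemLp (timeGrad u s t) 2 (stripMeasure n) := by
  have hm : AEStronglyMeasurable (timeGrad u s t) (stripMeasure n) := by
    have : AEMeasurable (fun x (i : Fin (n + 1)) => ∫ r in s..t, pd i (chem (u r)) x) (stripMeasure n) :=
      aemeasurable_pi_lambda _ fun i =>
        ((hu.st.chem.pd i).aestronglyMeasurable_timeIntegral hs ht hst).aemeasurable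
    exact (PiLp.continuous_toLp 2 _).comp_aestronglyMeasurable this.aestronglyMeasurable
  rw [memLp_two_iff_integrable_sq_norm hm]
  refine ((integrable_timeIntegral hst (hu.integrable_gradSq_chem hs ht)).const_mul (t - s)).mono'
    (hm.norm.pow 2) (Filter.Eventually.of_forall fun x => ?_)
  rw [Real.norm_eq_abs, abs_of_nonneg (sq_nonneg _)]
  exact hu.norm_timeGrad_sq_le hs ht hst x

theorem Flow.integral_norm_timeGrad_sq_le (hu : Flow T u) (hs : s ∈ Ioo 0 T) (ht : t ∈ Ioo 0 T) (hst : s ≤ t) :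
    ∫ x, ‖timeGrad u s t x‖ ^ 2 ∂(stripMeasure n) ≤
      (t - s) * ∫ r in s..t, ∫ x, gradSq (chem (u r)) x ∂(stripMeasure n) := by
  have hi := hu.integrable_gradSq_chem hs ht
  have hG := hu.memLp_timeGrad hs ht hst
  calc _ ≤ ∫ x, ((t - s) * ∫ r in s..t, gradSq (chem (u r)) x) ∂(stripMeasure n) :=
        integral_mono ((memLp_two_iff_integrable_sq_norm hG.1).1 hG)
          ((integrable_timeIntegral hst hi).const_mul _) (hu.norm_timeGrad_sq_le hs ht hst)
    _ = _ := by rw [integral_const_mul, integral_st_symm hst hi]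

/-- Pairing of a vector field with the time integral of the gradient. -/
theorem Flow.integral_inner_timeGrad (hu : Flow T u) (hs : s ∈ Ioo 0 T) (ht : t ∈ Ioo 0 T) (hst : s ≤ t)
    {F : Space n → Space n}
    (hi : Integrable (fun p : ℝ × Space n => ∑ i, F p.2 i * pd i (chem (u p.1)) p.2) (stMeasure n s t)) :
    ∫ x, inner ℝ (F x) (timeGrad u s t x) ∂(stripMeasure n) =
      ∫ r in s..t, ∫ x, (∑ i, F x i * pd i (chem (u r)) x) ∂(stripMeasure n) := by
  rw [← integral_st_symm hst hi]
  refine integral_congr_ae (Filter.Eventually.of_forall fun x => ?_)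
  simp only [inner_eq_sum, timeGrad_apply]
  rw [intervalIntegral.integral_finsetSum fun i _ =>
    ((hu.st.chem.pd i).intervalIntegrable_time hs ht hst x).const_mul _]
  simp only [intervalIntegral.integral_const_mul]

theorem Flow.integrable_field_mul (hu : Flow T u) (hs : s ∈ Ioo 0 T) (ht : t ∈ Ioo 0 T)
    {F : Space n → Space n} (hF : MemLp F 2 (stripMeasure n)) :
    Integrable (fun p : ℝ × Space n => ∑ i, F p.2 i * pd i (chem (u p.1)) p.2) (stMeasure n s t) := by
  have Fi := ((memLp_two_iff_integrable_sq_norm hF.1).1 hF).comp_snd ((volume : Measure ℝ).restrict (Ioc s t))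
  have mF : ∀ i, AEStronglyMeasurable (fun p : ℝ × Space n => F p.2 i) (stMeasure n s t) := fun i =>
    ((EuclideanSpace.proj (𝕜 := ℝ) i).continuous.comp_aestronglyMeasurable hF.1).comp_snd
  refine (Fi.add (hu.integrable_gradSq_chem hs ht)).mono' ?_ (Filter.Eventually.of_forall fun p => ?_)
  · exact Finset.aestronglyMeasurable_fun_sum _ fun i _ =>
      (mF i).mul ((hu.st.chem.pd i).aestronglyMeasurable hs ht)
  · rw [Real.norm_eq_abs, Pi.add_apply, EuclideanSpace.real_norm_sq_eq]
    refine (Finset.abs_sum_le_sum_abs _ _).trans ?_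
    simp only [gradSq]
    rw [← Finset.sum_add_distrib]
    refine Finset.sum_le_sum fun i _ => (abs_mul_le_half _ _).trans ?_
    nlinarith [sq_nonneg (F p.2 i), sq_nonneg (pd i (chem (u p.1)) p.2)]

theorem Flow.weakDiv_timeGrad (hu : Flow T u) (hs : s ∈ Ioo 0 T) (ht : t ∈ Ioo 0 T) (hst : s ≤ t)
    {φ : Space n → ℝ} (hφ : IsTestFunction φ) :
    ∫ x, inner ℝ (timeGrad u s t x) (∇ φ x) ∂(stripMeasure n) =
      - ∫ x, φ x * (u t x - u s x) ∂(stripMeasure n) := by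
  have e0 : ∀ (r : ℝ) x, ∑ i, (∇ φ x) i * pd i (chem (u r)) x = ∑ i, pd i φ x * pd i (chem (u r)) x := by
    intro r x
    exact Finset.sum_congr rfl fun i _ => by rw [gradient_apply]
  have hm : AEStronglyMeasurable (fun x => ∇ φ x) (stripMeasure n) := by
    have : Continuous fun x => ∇ φ x :=
      (InnerProductSpace.toDual ℝ (Space n)).symm.continuous.comp (hφ.smooth.continuous_fderiv (by norm_num))
    exact this.aestronglyMeasurable
  have hG : MemLp (fun x => ∇ φ x) 2 (stripMeasure n) := by
    rw [memLp_two_iff_integrable_sq_norm hm]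
    have := IsTestFunction.sum (s := Finset.univ) fun i => (hφ.pd i).mul (hφ.pd i).sp
    refine this.integrable.congr (Filter.Eventually.of_forall fun x => ?_)
    simp only [norm_gradient_sq]
    exact Finset.sum_congr rfl fun i _ => (pow_two _).symm
  have h1 := hu.integral_inner_timeGrad hs ht hst (hu.integrable_field_mul hs ht hG)
  have h2 : ∫ x, inner ℝ (timeGrad u s t x) (∇ φ x) ∂(stripMeasure n) =
      ∫ x, inner ℝ (∇ φ x) (timeGrad u s t x) ∂(stripMeasure n) :=
    integral_congr_ae (Filter.Eventually.of_forall fun x => real_inner_comm _ _)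
  simp only [e0] at h1
  have i1 := (hφ.mul (hu.st.sp ht)).integrable
  have i2 := (hφ.mul (hu.st.sp hs)).integrable
  have h3 : ∫ x, φ x * (u t x - u s x) ∂(stripMeasure n) =
      ∫ x, φ x * u t x ∂(stripMeasure n) - ∫ x, φ x * u s x ∂(stripMeasure n) := by
    rw [← integral_sub i1 i2]
    exact integral_congr_ae (Filter.Eventually.of_forall fun x => by simp only; ring)
  rw [h2, h1, h3, hu.st.integral_sub_integral hφ hs ht, ← intervalIntegral.integral_neg]
  refine intervalIntegral.integral_congr fun r hr => ?_
  rw [uIcc_of_le hst] at hr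
  have hrT := Icc_subset_of_mem hs ht hr
  have h4 := hφ.integral_mul_lap (hu.st.chem.sp hrT)
  rw [hu.lap_chem_eq hrT] at h4
  simp only [h4, neg_neg]

/-- The pairing `∫ (u(s) - v₀) μ(r)`. -/
def pairing (u : ℝ → Space n → ℝ) (s r : ℝ) : ℝ :=
  ∫ x, (u s x - kink n 0 x) * chem (u r) x ∂(stripMeasure n)

/-- All competitors have the same divergence, and each μ(r) is an admissible H¹ test function; so
the inner product with the time integral of ∇μ depends only on that divergence. -/
theorem Flow.integral_admissible (hu : Flow T u) (hs : s ∈ Ioo 0 T) (ht : t ∈ Ioo 0 T) (hst : s ≤ t)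
    {r₀ : ℝ} (h0 : r₀ ∈ Ioo 0 T) {F : Space n → Space n} (hF : Admissible (u r₀) F) :
    ∫ x, inner ℝ (F x) (timeGrad u s t x) ∂(stripMeasure n) = - ∫ r in s..t, pairing u r₀ r := by
  rw [hu.integral_inner_timeGrad hs ht hst (hu.integrable_field_mul hs ht hF.1),
    ← intervalIntegral.integral_neg]
  refine intervalIntegral.integral_congr fun r hr => ?_
  rw [uIcc_of_le hst] at hr
  have hrT := Icc_subset_of_mem hs ht hr
  exact weakDiv_sobolev hF.1 hF.2 ((hu.st.sp h0).sub (sp_kink 0)) (hu.st.chem.sp hrT) (hu.sq_w r₀ h0)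
    (hu.sq_chem r hrT) (hu.integrable_gradSq_chem_slice hrT)

theorem Flow.sqDist_forward (hu : Flow T u) (hH : ∀ t ∈ Ioo 0 T, sqDist (u t) < ⊤)
    (hs : s ∈ Ioo 0 T) (ht : t ∈ Ioo 0 T) (hst : s ≤ t) :
    (sqDist (u t)).toReal = (sqDist (u s)).toReal - 2 * (∫ r in s..t, pairing u s r) +
      ∫ x, ‖timeGrad u s t x‖ ^ 2 ∂(stripMeasure n) := by
  rw [sqDist_translate (hH s hs) (hH t ht) (hu.memLp_timeGrad hs ht hst)
    (fun φ hφ => hu.weakDiv_timeGrad hs ht hst hφ) (hu.st.sp hs) (hu.st.sp ht)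
    fun F hF => hu.integral_admissible hs ht hst hs hF]
  ring

/-- Anchoring the pairing at the later time gives both one-sided difference quotients at t the same
integrand. -/
theorem Flow.sqDist_backward (hu : Flow T u) (hH : ∀ t ∈ Ioo 0 T, sqDist (u t) < ⊤)
    (hs : s ∈ Ioo 0 T) (ht : t ∈ Ioo 0 T) (hst : s ≤ t) :
    (sqDist (u s)).toReal = (sqDist (u t)).toReal + 2 * (∫ r in s..t, pairing u t r) +
      ∫ x, ‖timeGrad u s t x‖ ^ 2 ∂(stripMeasure n) := by
  have hG := hu.memLp_timeGrad hs ht hst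
  have h := sqDist_translate (c := ∫ r in s..t, pairing u t r) (hH t ht) (hH s hs) hG.neg
    (fun φ hφ => ?_) (hu.st.sp ht) (hu.st.sp hs) fun F hF => ?_
  · simpa using h
  · have := hu.weakDiv_timeGrad hs ht hst hφ
    simp only [Pi.neg_apply, inner_neg_left, integral_neg, this]
    rw [← integral_neg]
    congr 1
    exact integral_congr_ae (Filter.Eventually.of_forall fun x => by simp only; ring)
  · simp only [Pi.neg_apply, inner_neg_right, integral_neg]
    rw [hu.integral_admissible hs ht hst ht hF, neg_neg]

/-- The function r ↦ ∫wμ(r) has the integrable time derivative ∫wμ_t(r). No integration by parts in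
space takes place, hence the zero flux. -/
theorem Flow.continuousOn_pairing (hu : Flow T u) (h0 : s ∈ Ioo 0 T) : ContinuousOn (pairing u s) (Ioo 0 T) := by
  have sw := (hu.st.sp h0).sub (sp_kink (n := n) 0)
  have stw : ST T (fun (_ : ℝ) x => u s x - kink n 0 x) := ST.static sw
  have hint : ∀ r ∈ Ioo 0 T, ∀ t ∈ Ioo 0 T, Integrable
      (fun p : ℝ × Space n => (u s p.2 - kink n 0 p.2) * chemT u p.1 p.2) (stMeasure n r t) := by
    intro r hr t ht
    have iw := (hu.sq_w s h0).comp_snd ((volume : Measure ℝ).restrict (Ioc r t))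
    refine (stw.mul hu.st.chemT).integrable_of_le hr ht (iw.add (hu.integrable_td_chem hr ht)) fun t' ht' x => ?_
    refine (abs_mul_le_half _ _).trans ?_
    simp only [Pi.add_apply, chemT]
    nlinarith [sq_nonneg (u s x - kink n 0 x), sq_nonneg (td (fun t => chem (u t)) t' x)]
  have hsl : ∀ r ∈ Ioo 0 T, Integrable (fun x => (u s x - kink n 0 x) * chem (u r) x) (stripMeasure n) := by
    intro r hr
    refine ((hu.sq_w s h0).add (hu.sq_chem r hr)).mono' (sw.mul (hu.st.chem.sp hr)).continuous.aestronglyMeasurable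
      (Filter.Eventually.of_forall fun x => ?_)
    refine (abs_mul_le_half _ _).trans ?_
    simp only [Pi.add_apply]
    nlinarith [sq_nonneg (u s x - kink n 0 x), sq_nonneg (chem (u r) x)]
  refine continuousOn_of_integral_eq (g := fun r => ∫ x, (u s x - kink n 0 x) * chemT u r x ∂(stripMeasure n))
    (fun r hr t ht hrt => intervalIntegrable_of_st hrt (hint r hr t ht)) fun r hr t ht hrt => ?_
  rw [← integral_st_eq hrt (hint r hr t ht)]
  refine balance_law (e := fun t x => (u s x - kink n 0 x) * chem (u t) x)
    (a := fun t x => (u s x - kink n 0 x) * chemT u t x) (g := fun _ _ => 0)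
    (stw.mul hu.st.chem) (stw.mul hu.st.chemT) (ST.const 0) hr ht hrt (hsl r hr) (hsl t ht) (hint r hr t ht)
    (integrable_zero _ _ _) (fun _ _ _ => le_rfl) (C := 0) le_rfl fun R hR t' ht' => ?_
  have e : td (fun t x => (u s x - kink n 0 x) * chem (u t) x) t' =
      fun x => (u s x - kink n 0 x) * chemT u t' x := by
    funext x
    exact ((hu.st.chem.hasDerivAt ht' x).const_mul _).deriv
  rw [e]
  simp

theorem Flow.hasDerivAt_sqDist (hn : n ≤ 4) (hu : Flow T u) (hH : ∀ t ∈ Ioo 0 T, sqDist (u t) < ⊤) (ht : t ∈ Ioo 0 T) :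
    HasDerivAt (fun s => (sqDist (u s)).toReal) (-2 * pairing u t t) t := by
  have hP := hu.continuousOn_pairing ht
  have hD : ContinuousOn (fun r => ∫ x, gradSq (chem (u r)) x ∂(stripMeasure n)) (Ioo 0 T) :=
    fun r hr => (hu.hasDerivAt_dissipation hn hr).continuousAt.continuousWithinAt
  have d1 : HasDerivAt (fun s => ∫ r in t..s, pairing u t r) (pairing u t t) t :=
    intervalIntegral.integral_hasDerivAt_right IntervalIntegrable.refl
      (hP.stronglyMeasurableAtFilter isOpen_Ioo t ht) (hP.continuousAt (isOpen_Ioo.mem_nhds ht))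
  have d2 : HasDerivAt (fun s => ∫ r in t..s, ∫ x, gradSq (chem (u r)) x ∂(stripMeasure n))
      (∫ x, gradSq (chem (u t)) x ∂(stripMeasure n)) t :=
    intervalIntegral.integral_hasDerivAt_right IntervalIntegrable.refl
      (hD.stronglyMeasurableAtFilter isOpen_Ioo t ht) (hD.continuousAt (isOpen_Ioo.mem_nhds ht))
  -- The only remaining term is the squared norm of the time integral of ∇μ. It is at most |s-t|
  -- times the absolute value of the integral of D between s and t, hence o(s-t).
  have d3 : HasDerivAt (fun s => (sqDist (u s)).toReal - ((sqDist (u t)).toReal - 2 * ∫ r in t..s, pairing u t r)) 0 t := by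
    have d4 := ((hasDerivAt_id t).sub_const t).mul d2
    simp only [id, intervalIntegral.integral_same, mul_zero, sub_self, zero_mul, add_zero] at d4
    rw [hasDerivAt_iff_isLittleO] at d4 ⊢
    refine Asymptotics.IsBigO.trans_isLittleO (Asymptotics.IsBigO.of_bound 1 ?_) d4
    filter_upwards [isOpen_Ioo.mem_nhds ht] with s hs
    simp only [intervalIntegral.integral_same, mul_zero, sub_zero, smul_zero, Pi.mul_apply, sub_self,
      one_mul]
    have hnn : 0 ≤ ∫ x, ‖timeGrad u s t x‖ ^ 2 ∂(stripMeasure n) := integral_nonneg fun _ => sq_nonneg _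
    have hnn' : 0 ≤ ∫ x, ‖timeGrad u t s x‖ ^ 2 ∂(stripMeasure n) := integral_nonneg fun _ => sq_nonneg _
    rcases le_total s t with h | h
    · have h1 := hu.sqDist_backward hH hs ht h
      have h2 := hu.integral_norm_timeGrad_sq_le hs ht h
      rw [intervalIntegral.integral_symm s t, intervalIntegral.integral_symm s t]
      rw [Real.norm_eq_abs, Real.norm_eq_abs]
      refine abs_le_abs_of_nonneg ?_ ?_ <;> linarith
    · have h1 := hu.sqDist_forward hH ht hs h
      have h2 := hu.integral_norm_timeGrad_sq_le ht hs h
      rw [Real.norm_eq_abs, Real.norm_eq_abs]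
      refine abs_le_abs_of_nonneg ?_ ?_ <;> linarith
  have d5 := d3.add ((d1.const_mul 2).const_sub (sqDist (u t)).toReal)
  refine (d5.congr_deriv (by ring)).congr_of_eventuallyEq (Filter.Eventually.of_forall fun s => ?_)
  simp only [Pi.add_apply]
  ring

end

/-! ### Hardy inequalities on the line -/

/-- The function τ plays the role of the tail of the weight: -τ' ≥ l·r and 0 ≤ τ ≤ r. Integrate
(τφ²)', drop the nonnegative boundary term at L (the one at 0 vanishes with φ), and split 2φφ' so
that half of l·r·φ² is absorbed. This gives the constant 4/l². -/
theorem hardy_interval {r τ τ' φ φ' : ℝ → ℝ} {l L : ℝ} (hl : 0 < l) (hL : 0 ≤ L)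
    (hr : Continuous r) (hφ' : Continuous φ') (hτ' : Continuous τ')
    (dτ : ∀ y, HasDerivAt τ (τ' y) y) (dφ : ∀ y, HasDerivAt φ (φ' y) y)
    (h1 : ∀ y, 0 ≤ y → τ' y ≤ - l * r y) (h2 : ∀ y, 0 ≤ y → 0 ≤ τ y) (h3 : ∀ y, 0 ≤ y → τ y ≤ r y)
    (h0 : φ 0 = 0) : ∫ y in 0..L, r y * φ y ^ 2 ≤ 4 / l ^ 2 * ∫ y in 0..L, r y * φ' y ^ 2 := by
  have cφ : Continuous φ := continuous_iff_continuousAt.2 fun y => (dφ y).continuousAt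
  have cτ : Continuous τ := continuous_iff_continuousAt.2 fun y => (dτ y).continuousAt
  have hd : ∀ y, HasDerivAt (fun y => τ y * φ y ^ 2) (τ' y * φ y ^ 2 + τ y * (2 * φ y * φ' y)) y := by
    intro y
    refine ((dτ y).mul ((dφ y).fun_pow 2)).congr_deriv ?_
    push_cast; ring
  have hI := intervalIntegral.integral_eq_sub_of_hasDerivAt (a := 0) (b := L) (fun y _ => hd y)
    (by apply Continuous.intervalIntegrable; fun_prop)
  rw [h0] at hI
  have i1 : IntervalIntegrable (fun y => r y * φ y ^ 2) volume 0 L := by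
    apply Continuous.intervalIntegrable; fun_prop
  have i2 : IntervalIntegrable (fun y => r y * φ' y ^ 2) volume 0 L := by
    apply Continuous.intervalIntegrable; fun_prop
  have hmono : ∫ y in 0..L, (τ' y * φ y ^ 2 + τ y * (2 * φ y * φ' y)) ≤
      ∫ y in 0..L, (-(l / 2) * (r y * φ y ^ 2) + 2 / l * (r y * φ' y ^ 2)) := by
    refine intervalIntegral.integral_mono_on hL (by apply Continuous.intervalIntegrable; fun_prop)
      ((i1.const_mul _).add (i2.const_mul _)) fun y hy => ?_
    have a1 := mul_le_mul_of_nonneg_right (h1 y hy.1) (sq_nonneg (φ y))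
    have a2 : τ y * (2 * φ y * φ' y) ≤ τ y * (l / 2 * φ y ^ 2 + 2 / l * φ' y ^ 2) := by
      refine mul_le_mul_of_nonneg_left ?_ (h2 y hy.1)
      have : 0 ≤ (l * φ y - 2 * φ' y) ^ 2 / (2 * l) := by positivity
      have e : (l * φ y - 2 * φ' y) ^ 2 / (2 * l) = l / 2 * φ y ^ 2 + 2 / l * φ' y ^ 2 - 2 * φ y * φ' y := by
        field_simp; ring
      linarith
    have a3 : τ y * (l / 2 * φ y ^ 2 + 2 / l * φ' y ^ 2) ≤ r y * (l / 2 * φ y ^ 2 + 2 / l * φ' y ^ 2) :=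
      mul_le_mul_of_nonneg_right (h3 y hy.1) (by positivity)
    linarith
  rw [hI, intervalIntegral.integral_add (i1.const_mul _) (i2.const_mul _),
    intervalIntegral.integral_const_mul, intervalIntegral.integral_const_mul] at hmono
  have hb : 0 ≤ τ L * φ L ^ 2 := mul_nonneg (h2 L hL) (sq_nonneg _)
  have hfin : l / 2 * ∫ y in 0..L, r y * φ y ^ 2 ≤ 2 / l * ∫ y in 0..L, r y * φ' y ^ 2 := by linarith
  have hm := mul_le_mul_of_nonneg_left hfin (by positivity : 0 ≤ 2 / l)
  have e1 : 2 / l * (l / 2 * ∫ y in 0..L, r y * φ y ^ 2) = ∫ y in 0..L, r y * φ y ^ 2 := by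
    field_simp
  rw [e1] at hm
  refine hm.trans_eq ?_
  ring

/-- Weights on the line for which functions vanishing at the origin satisfy a Hardy inequality. -/
structure HardyWeight (r : ℝ → ℝ) (K : ℝ) : Prop where
  cont : Continuous r
  nonneg : ∀ y, 0 ≤ r y
  const_pos : 0 < K
  hardy : ∀ φ φ' : ℝ → ℝ, (∀ y, HasDerivAt φ (φ' y) y) → Continuous φ' → φ 0 = 0 →
    ∫⁻ y, ENNReal.ofReal (r y * φ y ^ 2) ≤ ENNReal.ofReal K * ∫⁻ y, ENNReal.ofReal (r y * φ' y ^ 2)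

/-- Since the weight is even, reflection reduces the negative half line to the positive one;
monotone exhaustion replaces the interval by the line. -/
theorem hardyWeight_of_tail {r τ τ' : ℝ → ℝ} {l : ℝ} (hl : 0 < l) (hr : Continuous r) (hτ' : Continuous τ')
    (dτ : ∀ y, HasDerivAt τ (τ' y) y) (h0 : ∀ y, 0 ≤ r y) (heven : ∀ y, r (-y) = r y)
    (h1 : ∀ y, 0 ≤ y → τ' y ≤ - l * r y) (h2 : ∀ y, 0 ≤ y → 0 ≤ τ y) (h3 : ∀ y, 0 ≤ y → τ y ≤ r y) :
    HardyWeight r (4 / l ^ 2) := by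
  refine ⟨hr, h0, by positivity, fun φ φ' dφ hφ' hφ0 => ?_⟩
  have cφ : Continuous φ := continuous_iff_continuousAt.2 fun y => (dφ y).continuousAt
  have n2 : ∀ y, 0 ≤ r y * φ' y ^ 2 := fun y => mul_nonneg (h0 y) (sq_nonneg _)
  have n1 : ∀ y, 0 ≤ r y * φ y ^ 2 := fun y => mul_nonneg (h0 y) (sq_nonneg _)
  rcases eq_or_ne (∫⁻ y, ENNReal.ofReal (r y * φ' y ^ 2)) ⊤ with hT | hT
  · rw [hT, ENNReal.mul_top]
    · exact le_top
    · rw [ne_eq, ENNReal.ofReal_eq_zero, not_le]; positivity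
  have c2 : Continuous fun y => r y * φ' y ^ 2 := by fun_prop
  have c1 : Continuous fun y => r y * φ y ^ 2 := by fun_prop
  have i2 := integrable_of_lintegral_le c2.aestronglyMeasurable n2 (lt_top_iff_ne_top.2 hT)
  rw [lintegral_ofReal_eq i2 n2, ← ENNReal.ofReal_mul (by positivity)]
  refine lintegral_le_of_exhaustion (χ := fun N => (Icc (-(N : ℝ)) N).indicator fun _ => 1)
    (Filter.Eventually.of_forall n1) (fun N y => indicator_nonneg (fun _ _ => zero_le_one) _) (fun y => ?_)
    (fun N => ?_) (Filter.Eventually.of_forall fun N => ?_)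
  · obtain ⟨N, hN⟩ := exists_nat_ge |y|
    filter_upwards [Filter.eventually_ge_atTop N] with M hM
    have : |y| ≤ M := hN.trans (by exact_mod_cast hM)
    exact indicator_of_mem (show y ∈ Icc (-(M : ℝ)) M from abs_le.1 this) _
  · have e : (fun y => (Icc (-(N : ℝ)) N).indicator (fun _ => (1 : ℝ)) y * (r y * φ y ^ 2)) =
        (Icc (-(N : ℝ)) N).indicator (fun y => r y * φ y ^ 2) := by
      funext y; by_cases hy : y ∈ Icc (-(N : ℝ)) N <;> simp [hy]
    rw [e, integrable_indicator_iff measurableSet_Icc]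
    exact c1.continuousOn.integrableOn_Icc
  · have e : (fun y => (Icc (-(N : ℝ)) N).indicator (fun _ => (1 : ℝ)) y * (r y * φ y ^ 2)) =
        (Icc (-(N : ℝ)) N).indicator (fun y => r y * φ y ^ 2) := by
      funext y; by_cases hy : y ∈ Icc (-(N : ℝ)) N <;> simp [hy]
    have hN0 : (0 : ℝ) ≤ N := Nat.cast_nonneg N
    rw [e, integral_indicator measurableSet_Icc, integral_Icc_eq_integral_Ioc,
      ← intervalIntegral.integral_of_le (by linarith)]
    have g1 := hardy_interval (L := N) hl hN0 hr hφ' hτ' dτ dφ h1 h2 h3 hφ0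
    have dψ : ∀ y, HasDerivAt (fun y => φ (-y)) (- φ' (-y)) y := fun y => by
      exact ((dφ (-y)).comp y (hasDerivAt_neg y)).congr_deriv (by ring)
    have g2 := hardy_interval (L := N) (φ := fun y => φ (-y)) (φ' := fun y => - φ' (-y)) hl hN0 hr (by fun_prop) hτ' dτ dψ h1 h2 h3
      (by simpa using hφ0)
    have e1 : ∫ y in (0 : ℝ)..N, r y * φ (-y) ^ 2 = ∫ y in (-(N : ℝ))..0, r y * φ y ^ 2 := by
      have := intervalIntegral.integral_comp_neg (a := 0) (b := (N : ℝ)) fun y => r y * φ y ^ 2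
      simpa only [heven, neg_zero] using this
    have e2 : ∫ y in (0 : ℝ)..N, r y * (- φ' (-y)) ^ 2 = ∫ y in (-(N : ℝ))..0, r y * φ' y ^ 2 := by
      have := intervalIntegral.integral_comp_neg (a := 0) (b := (N : ℝ)) fun y => r y * φ' y ^ 2
      simpa only [heven, neg_zero, neg_sq] using this
    rw [e1, e2] at g2
    have s1 := intervalIntegral.integral_add_adjacent_intervals (c1.intervalIntegrable (μ := volume) (-(N : ℝ)) 0)
      (c1.intervalIntegrable 0 (N : ℝ))
    have s2 := intervalIntegral.integral_add_adjacent_intervals (c2.intervalIntegrable (μ := volume) (-(N : ℝ)) 0)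
      (c2.intervalIntegrable 0 (N : ℝ))
    have s3 : ∫ y in (-(N : ℝ))..N, r y * φ' y ^ 2 ≤ ∫ y, r y * φ' y ^ 2 := by
      rw [intervalIntegral.integral_of_le (by linarith)]
      exact setIntegral_le_integral i2 (Filter.Eventually.of_forall n2)
    rw [← s1]
    have := mul_le_mul_of_nonneg_left s3 (by positivity : 0 ≤ 4 / l ^ 2)
    rw [← s2, mul_add] at this
    linarith

theorem tanh_nonneg {y : ℝ} (hy : 0 ≤ y) : 0 ≤ Real.tanh y := by
  rw [Real.tanh_eq_sinh_div_cosh]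
  exact div_nonneg (Real.sinh_nonneg_iff.2 hy) (Real.cosh_pos y).le

theorem continuous_tanh : Continuous Real.tanh := contDiff_tanh.continuous

theorem hasDerivAt_tanh_mul (l y : ℝ) :
    HasDerivAt (fun y => Real.tanh (l * y)) (l * (1 - Real.tanh (l * y) ^ 2)) y := by
  have := (hasDerivAt_tanh (l * y)).comp y ((hasDerivAt_id y).const_mul l)
  refine this.congr_deriv ?_
  ring

/-- The exact tail is 1 - tanh, which is at most 1 - tanh² on the positive half line. -/
theorem hardyWeight_sech_sq {l : ℝ} (hl : 0 < l) :
    HardyWeight (fun y => 1 - Real.tanh (l * y) ^ 2) (4 / l ^ 2) := by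
  have hc := continuous_tanh
  refine hardyWeight_of_tail (τ := fun y => 1 - Real.tanh (l * y))
    (τ' := fun y => - (l * (1 - Real.tanh (l * y) ^ 2))) hl (by fun_prop) (by fun_prop)
    (fun y => (hasDerivAt_tanh_mul l y).const_sub 1) (fun y => ?_) (fun y => ?_) (fun y hy => ?_)
    (fun y hy => ?_) fun y hy => ?_
  · linarith [Real.tanh_sq_lt_one (l * y)]
  · rw [mul_neg, Real.tanh_neg, neg_sq]
  · linarith
  · nlinarith [Real.tanh_sq_lt_one (l * y)]
  · have := tanh_nonneg (mul_nonneg hl.le hy)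
    nlinarith [Real.tanh_sq_lt_one (l * y)]

/-- With T = tanh, the tail (1-T²)(1-T) has derivative -l(1-T²)(1-T)(1+3T), and 1+3T ≥ 1+T for T ≥
0. -/
theorem hardyWeight_sech_four {l : ℝ} (hl : 0 < l) :
    HardyWeight (fun y => (1 - Real.tanh (l * y) ^ 2) ^ 2) (4 / l ^ 2) := by
  have hc := continuous_tanh
  refine hardyWeight_of_tail (τ := fun y => (1 - Real.tanh (l * y) ^ 2) * (1 - Real.tanh (l * y)))
    (τ' := fun y => - l * ((1 - Real.tanh (l * y) ^ 2) * (1 - Real.tanh (l * y)) * (1 + 3 * Real.tanh (l * y))))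
    hl (by fun_prop) (by fun_prop)
    (fun y => ?_) (fun y => sq_nonneg _) (fun y => ?_) (fun y hy => ?_)
    (fun y hy => ?_) fun y hy => ?_
  · have h := hasDerivAt_tanh_mul l y
    refine (((h.fun_pow 2).const_sub 1).mul (h.const_sub 1)).congr_deriv ?_
    push_cast; ring
  · rw [mul_neg, Real.tanh_neg, neg_sq]
  all_goals
    have h1 := tanh_nonneg (mul_nonneg hl.le hy)
    have h2 : Real.tanh (l * y) ≤ 1 := by nlinarith [Real.tanh_sq_lt_one (l * y)]
    have h3 : 0 ≤ 1 - Real.tanh (l * y) ^ 2 := by linarith [Real.tanh_sq_lt_one (l * y)]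
  · have : (1 - Real.tanh (l * y) ^ 2) ^ 2 ≤
        (1 - Real.tanh (l * y) ^ 2) * (1 - Real.tanh (l * y)) * (1 + 3 * Real.tanh (l * y)) := by
      rw [pow_two, mul_assoc]
      refine mul_le_mul_of_nonneg_left ?_ h3
      nlinarith [mul_nonneg h1 (sub_nonneg.2 h2)]
    have := mul_le_mul_of_nonneg_left this hl.le
    linarith
  · exact mul_nonneg h3 (by linarith)
  · rw [pow_two (1 - Real.tanh (l * y) ^ 2)]
    refine mul_le_mul_of_nonneg_left ?_ h3
    nlinarith

/-! ### The weighted Poincaré inequality on the strip -/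

/-- The unit vector along the strip. -/
def ez (n : ℕ) : Space n := EuclideanSpace.single (Fin.last n) (1 : ℝ)

/-- The projection to the cross section. -/
def flat (x : Space n) : Space n := x - zCoord x • ez n

theorem zCoord_add (x y : Space n) : zCoord (x + y) = zCoord x + zCoord y := rfl

theorem zCoord_smul (s : ℝ) (x : Space n) : zCoord (s • x) = s * zCoord x := rfl

theorem zCoord_ez : zCoord (ez n) = 1 := by simp [zCoord, ez]

theorem zCoord_flat (x : Space n) : zCoord (flat x) = 0 := by
  have : zCoord (flat x) = zCoord x - zCoord x * zCoord (ez n) := rfl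
  rw [this, zCoord_ez]; ring

theorem flat_add (x y : Space n) : flat (x + y) = flat x + flat y := by
  simp only [flat, zCoord_add, add_smul]; abel

theorem flat_flat (x : Space n) : flat (flat x) = flat x := by
  conv_lhs => rw [flat, zCoord_flat, zero_smul, sub_zero]

theorem zCoord_single (i : Fin n) : zCoord (EuclideanSpace.single i.castSucc (1 : ℝ) : Space n) = 0 := by
  simp [zCoord, (Fin.castSucc_lt_last i).ne']

theorem flat_single (i : Fin n) : flat (EuclideanSpace.single i.castSucc (1 : ℝ) : Space n) =
    EuclideanSpace.single i.castSucc (1 : ℝ) := by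
  rw [flat, zCoord_single, zero_smul, sub_zero]

theorem zCoord_add_single (x : Space n) (i : Fin n) :
    zCoord (x + EuclideanSpace.single i.castSucc (1 : ℝ)) = zCoord x := by
  rw [zCoord_add, zCoord_single, add_zero]

theorem continuous_flat : Continuous (flat : Space n → Space n) :=
  continuous_id.sub (continuous_zCoord.smul continuous_const)

theorem SP.hasDerivAt_line {h : Space n → ℝ} (hh : SP h) (x v : Space n) (y : ℝ) :
    HasDerivAt (fun y : ℝ => h (x + y • v)) (∑ i, v i * CahnHilliard.pd i h (x + y • v)) y := by
  have h1 : HasDerivAt (fun y : ℝ => x + y • v) v y := by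
    simpa using ((hasDerivAt_id y).smul_const v).const_add x
  have h2 := (hh.diff (x + y • v)).hasFDerivAt.comp_hasDerivAt y h1
  refine h2.congr_deriv ?_
  rw [← inner_gradient, real_inner_comm]
  exact (InnerProductSpace.toDual_symm_apply (𝕜 := ℝ)).symm

theorem join_add_ez (s c : ℝ) (p : Fin n → ℝ) : join n (c + s, p) = join n (c, p) + s • ez n := by
  ext i
  refine Fin.lastCases ?_ (fun j => ?_) i
  · simp [join_last, ez]
  · simp [join_castSucc, ez, (Fin.castSucc_lt_last j).ne]

theorem flat_join (z c : ℝ) (p : Fin n → ℝ) : flat (join n (z, p)) + c • ez n = join n (c, p) := by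
  have h1 : join n (z, p) = join n (0, p) + z • ez n := by rw [← join_add_ez, zero_add]
  have h2 : join n (c, p) = join n (0, p) + c • ez n := by rw [← join_add_ez, zero_add]
  rw [flat, zCoord_join, h2]
  simp only [h1]
  abel

/-- The deviation of `h` from its values on the cross section `z = c`. -/
def sliceDev (h : Space n → ℝ) (c : ℝ) (x : Space n) : ℝ := h x - h (flat x + c • ez n)

theorem SP.continuous_sliceDev {h : Space n → ℝ} (hh : SP h) (c : ℝ) : Continuous (sliceDev h c) :=
  hh.continuous.sub (hh.continuous.comp (continuous_flat.add continuous_const))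

theorem SP.sliceDev_periodic {h : Space n → ℝ} (hh : SP h) (c : ℝ) (i : Fin n) (x : Space n) :
    sliceDev h c (x + EuclideanSpace.single i.castSucc (1 : ℝ)) = sliceDev h c x := by
  simp only [sliceDev, flat_add, flat_single]
  rw [hh.periodic, add_right_comm, hh.periodic]

/-- The longitudinal part of the weighted Poincaré inequality. -/
theorem lintegral_sliceDev_le {r : ℝ → ℝ} {K : ℝ} (hr : HardyWeight r K) {h : Space n → ℝ} (hh : SP h) (c : ℝ) :
    ∫⁻ x, ENNReal.ofReal (r (zCoord x - c) * sliceDev h c x ^ 2) ∂(stripMeasure n) ≤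
      ENNReal.ofReal K * ∫⁻ x, ENNReal.ofReal (r (zCoord x - c) * pz h x ^ 2) ∂(stripMeasure n) := by
  have hrc := hr.cont
  have hz := continuous_zCoord (n := n)
  have hk := hh.continuous_sliceDev c
  have hp := hh.pz.continuous
  have m1 : Measurable fun x : Space n => ENNReal.ofReal (r (zCoord x - c) * sliceDev h c x ^ 2) := by fun_prop
  have m2 : Measurable fun x : Space n => ENNReal.ofReal (r (zCoord x - c) * pz h x ^ 2) := by fun_prop
  have mp := measurePreserving_join_strip n
  rw [← mp.lintegral_comp m1, ← mp.lintegral_comp m2]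
  have m1' : Measurable fun a => ENNReal.ofReal (r (zCoord (join n a) - c) * sliceDev h c (join n a) ^ 2) :=
    m1.comp (measurable_join n)
  have m2' : Measurable fun a => ENNReal.ofReal (r (zCoord (join n a) - c) * pz h (join n a) ^ 2) :=
    m2.comp (measurable_join n)
  rw [lintegral_prod_symm' _ m1', lintegral_prod_symm' _ m2',
    ← lintegral_const_mul' _ _ ENNReal.ofReal_ne_top]
  refine lintegral_mono fun p => ?_
  have e1 : ∀ z, sliceDev h c (join n (z, p)) = h (join n (z, p)) - h (join n (c, p)) := fun z => by
    rw [sliceDev, flat_join]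
  simp only [zCoord_join, e1]
  rw [← lintegral_add_left_eq_self _ c, ← lintegral_add_left_eq_self
    (fun z => ENNReal.ofReal (r (z - c) * pz h (join n (z, p)) ^ 2)) c]
  simp only [add_sub_cancel_left]
  refine hr.hardy (fun y => h (join n (c + y, p)) - h (join n (c, p))) (fun y => pz h (join n (c + y, p)))
    (fun y => ?_) ?_ (by simp)
  · have := (hh.hasDerivAt_line (join n (c, p)) (ez n) y).sub_const (h (join n (c, p)))
    simp only [← join_add_ez] at this
    refine this.congr_deriv ?_
    simp [ez, pz]
  · have : Continuous fun y : ℝ => join n (c, p) + y • ez n := by fun_prop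
    simp only [join_add_ez]
    exact hp.comp this

/-- The transversal part of the weighted Poincaré inequality. -/
theorem lintegral_shift_sub_le {r : ℝ → ℝ} (hrc : Continuous r) (hr0 : ∀ y, 0 ≤ r y) {h : Space n → ℝ} (hh : SP h) (c : ℝ)
    {τ : Space n} (hτ : zCoord τ = 0) :
    ∫⁻ x, ENNReal.ofReal (r (zCoord x - c) * (h (x + τ) - h x) ^ 2) ∂(stripMeasure n) ≤
      ENNReal.ofReal (∑ i, τ i ^ 2) *
        ∫⁻ x, ENNReal.ofReal (r (zCoord x - c) * gradSq h x) ∂(stripMeasure n) := by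
  have hz := continuous_zCoord (n := n)
  have hg := hh.gradSq.continuous
  set F : Space n → ℝ≥0∞ := fun x => ENNReal.ofReal (r (zCoord x - c) * gradSq h x) with hF
  have hFper : ∀ (i : Fin n) (x : Space n), F (x + EuclideanSpace.single i.castSucc (1 : ℝ)) = F x := fun i x => by
    simp only [hF]; rw [zCoord_add_single, hh.gradSq.periodic]
  have hpt : ∀ x, ENNReal.ofReal (r (zCoord x - c) * (h (x + τ) - h x) ^ 2) ≤
      ENNReal.ofReal (∑ i, τ i ^ 2) * ∫⁻ θ in Ioc (0 : ℝ) 1, F (x + θ • τ) := by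
    intro x
    have hc : ∀ i, Continuous fun θ : ℝ => pd i h (x + θ • τ) := fun i =>
      (hh.pd i).continuous.comp (by fun_prop)
    have hgl : Continuous fun θ : ℝ => gradSq h (x + θ • τ) := hg.comp (by fun_prop)
    have hcs : Continuous fun θ : ℝ => ∑ i, τ i * pd i h (x + θ • τ) :=
      continuous_finsetSum _ fun i _ => continuous_const.mul (hc i)
    have h1 := intervalIntegral.integral_eq_sub_of_hasDerivAt (a := 0) (b := 1)
      (fun θ _ => hh.hasDerivAt_line x τ θ) (hcs.intervalIntegrable _ _)
    rw [one_smul, zero_smul, add_zero] at h1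
    have h2 := sq_intervalIntegral_le zero_le_one (hcs.continuousOn (s := Icc 0 1))
    rw [h1, sub_zero, one_mul] at h2
    have h3 : ∫ θ in (0 : ℝ)..1, (∑ i, τ i * pd i h (x + θ • τ)) ^ 2 ≤
        (∑ i, τ i ^ 2) * ∫ θ in (0 : ℝ)..1, gradSq h (x + θ • τ) := by
      rw [← intervalIntegral.integral_const_mul]
      refine intervalIntegral.integral_mono_on zero_le_one ((hcs.pow 2).intervalIntegrable _ _)
        ((hgl.const_mul _).intervalIntegrable _ _) fun θ _ => ?_
      exact Finset.sum_mul_sq_le_sq_mul_sq _ _ _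
    have hzx : ∀ θ : ℝ, zCoord (x + θ • τ) = zCoord x := fun θ => by
      rw [zCoord_add, zCoord_smul, hτ, mul_zero, add_zero]
    have h4 : ∫⁻ θ in Ioc (0 : ℝ) 1, F (x + θ • τ) =
        ENNReal.ofReal (r (zCoord x - c) * ∫ θ in (0 : ℝ)..1, gradSq h (x + θ • τ)) := by
      simp only [hF, hzx]
      rw [← intervalIntegral.integral_const_mul, intervalIntegral.integral_of_le zero_le_one]
      exact lintegral_ofReal_eq ((hgl.const_mul _).integrableOn_Icc.mono_set Ioc_subset_Icc_self)
        fun θ => mul_nonneg (hr0 _) (gradSq_nonneg _ _)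
    rw [h4, ← ENNReal.ofReal_mul (Finset.sum_nonneg fun _ _ => sq_nonneg _)]
    refine ENNReal.ofReal_le_ofReal ?_
    have := mul_le_mul_of_nonneg_left (h2.trans h3) (hr0 (zCoord x - c))
    linarith
  refine (lintegral_mono hpt).trans ?_
  rw [lintegral_const_mul' _ _ ENNReal.ofReal_ne_top]
  refine mul_le_mul_right ?_ _
  rw [lintegral_lintegral_swap]
  · simp only [lintegral_strip_shift hFper]
    rw [lintegral_const]
    simp
  · have : Measurable F := by simp only [hF]; fun_prop
    have h2 : Measurable fun p : Space n × ℝ => p.1 + p.2 • τ := by fun_prop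
    exact (this.comp h2).aemeasurable

/-- The uniform probability measure on `[0,1)^d`. -/
def cellUnit (n : ℕ) : Measure (Space n) := (stripMeasure n).restrict {x | zCoord x ∈ Ico (0 : ℝ) 1}

theorem measurableSet_zUnit : MeasurableSet {x : Space n | zCoord x ∈ Ico (0 : ℝ) 1} :=
  continuous_zCoord.measurable measurableSet_Ico

instance : IsProbabilityMeasure (cellUnit n) := by
  refine ⟨?_⟩
  rw [cellUnit, Measure.restrict_apply_univ]
  have := (measurePreserving_zCoord n).measure_preimage (measurableSet_Ico (a := (0 : ℝ)) (b := 1)).nullMeasurableSet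
  have e : {x : Space n | zCoord x ∈ Ico (0 : ℝ) 1} = zCoord ⁻¹' Ico (0 : ℝ) 1 := rfl
  rw [e, this]
  simp

theorem integrable_cellUnit {g : Space n → ℝ} (hg : Continuous g) : Integrable g (cellUnit n) := by
  rw [cellUnit, stripMeasure, Measure.restrict_restrict measurableSet_zUnit]
  refine (hg.continuousOn.integrableOn_compact (isCompact_box n 1)).mono_set fun x hx => mem_box hx.2 ?_
  have := hx.1
  simp only [mem_ofPred_eq, mem_Ico] at this
  rw [abs_le]; constructor <;> linarith [this.1, this.2]

theorem sq_integral_le_of_prob {X : Type*} [MeasurableSpace X] {m : Measure X} [IsProbabilityMeasure m]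
    {g : X → ℝ} (h1 : Integrable g m) (h2 : Integrable (fun x => g x ^ 2) m) :
    (∫ x, g x ∂m) ^ 2 ≤ ∫ x, g x ^ 2 ∂m := by
  set a := ∫ x, g x ∂m with ha
  have h3 : 0 ≤ ∫ x, (g x - a) ^ 2 ∂m := integral_nonneg fun _ => sq_nonneg _
  have e : ∀ x, (g x - a) ^ 2 = g x ^ 2 - 2 * a * g x + a ^ 2 := fun x => by ring
  simp only [e] at h3
  have i3 : Integrable (fun x => g x ^ 2 - 2 * a * g x) m := h2.sub (h1.const_mul _)
  rw [integral_add i3 (integrable_const _), integral_sub h2 (h1.const_mul _), integral_const_mul, ← ha] at h3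
  simp at h3
  linarith

/-- The mean over the cross section `z = c` is invariant under transversal translations. -/
theorem integral_flat_shift {h : Space n → ℝ} (hh : SP h) (c : ℝ) (x : Space n) :
    ∫ y, h (flat y + flat x + c • ez n) ∂(cellUnit n) = ∫ y, h (flat y + c • ez n) ∂(cellUnit n) := by
  have key := integral_strip_shift (F := fun y : Space n => (Ico (0 : ℝ) 1).indicator (fun _ => (1 : ℝ)) (zCoord y) *
    h (flat y + c • ez n)) (fun i y => by
      rw [zCoord_add_single, flat_add, flat_single, add_right_comm, hh.periodic]) (flat x)
  have e : ∀ g : Space n → ℝ, ∫ y, g y ∂(cellUnit n) = ∫ y, (Ico (0 : ℝ) 1).indicator (fun _ => (1 : ℝ)) (zCoord y) *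
      g y ∂(stripMeasure n) := by
    intro g
    rw [cellUnit, ← integral_indicator measurableSet_zUnit]
    refine integral_congr_ae (Filter.Eventually.of_forall fun y => ?_)
    by_cases hy : zCoord y ∈ Ico (0 : ℝ) 1
    · simp only [indicator_of_mem hy, one_mul]
      exact indicator_of_mem (show y ∈ {x : Space n | zCoord x ∈ Ico (0 : ℝ) 1} from hy) _
    · simp only [indicator_of_notMem hy, zero_mul]
      exact indicator_of_notMem (show y ∉ {x : Space n | zCoord x ∈ Ico (0 : ℝ) 1} from hy) _
  rw [e, e, ← key]
  refine integral_congr_ae (Filter.Eventually.of_forall fun y => ?_)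
  simp only [flat_add, flat_flat, zCoord_add, zCoord_flat, add_zero]

theorem sum_flat_sq_le {y : Space n} (hy : y ∈ cell n) : ∑ i, flat y i ^ 2 ≤ n := by
  have h1 : ∀ i, flat y i ^ 2 ≤ if i = Fin.last n then 0 else 1 := by
    intro i
    refine Fin.lastCases ?_ (fun j => ?_) i
    · rw [if_pos rfl]
      have : flat y (Fin.last n) = 0 := zCoord_flat y
      rw [this]; norm_num
    · rw [if_neg (Fin.castSucc_lt_last j).ne]
      have e : flat y j.castSucc = y j.castSucc := by
        simp [flat, ez, (Fin.castSucc_lt_last j).ne]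
      rw [e]
      have := hy j
      nlinarith [this.1, this.2]
  refine (Finset.sum_le_sum fun i _ => h1 i).trans ?_
  rw [Fin.sum_univ_castSucc]
  simp

/-- The weighted Poincaré inequality on the strip. -/
theorem weighted_poincare {r : ℝ → ℝ} {K : ℝ} (hr : HardyWeight r K) {h : Space n → ℝ} (hh : SP h) (c : ℝ) :
    ∃ m : ℝ, ∫⁻ x, ENNReal.ofReal (r (zCoord x - c) * (h x - m) ^ 2) ∂(stripMeasure n) ≤
      ENNReal.ofReal (2 * (n + K)) *
        ∫⁻ x, ENNReal.ofReal (r (zCoord x - c) * gradSq h x) ∂(stripMeasure n) := by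
  have hrc := hr.cont
  have hz := continuous_zCoord (n := n)
  have hfl := continuous_flat (n := n)
  have hhc := hh.continuous
  have hK := hr.const_pos
  set I := ∫⁻ x, ENNReal.ofReal (r (zCoord x - c) * gradSq h x) ∂(stripMeasure n) with hI
  -- The mean of h over the slice z = c. The integral runs over a unit cube of full dimension, but
  -- `flat` discards the last coordinate.
  set m := ∫ y, h (flat y + c • ez n) ∂(cellUnit n) with hm
  refine ⟨m, ?_⟩
  have hpt : ∀ x, ENNReal.ofReal (r (zCoord x - c) * (h x - m) ^ 2) ≤
      ∫⁻ y, ENNReal.ofReal (r (zCoord x - c) * (h x - h (flat y + flat x + c • ez n)) ^ 2) ∂(cellUnit n) := by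
    intro x
    have c1 : Continuous fun y => h x - h (flat y + flat x + c • ez n) := by fun_prop
    have i1 := integrable_cellUnit c1
    have i2 : Integrable (fun y => (h x - h (flat y + flat x + c • ez n)) ^ 2) (cellUnit n) :=
      integrable_cellUnit (c1.pow 2)
    have e1 : h x - m = ∫ y, (h x - h (flat y + flat x + c • ez n)) ∂(cellUnit n) := by
      rw [integral_sub (integrable_const _) (integrable_cellUnit (by fun_prop)), integral_flat_shift hh]
      simp [hm]
    have h1 := sq_integral_le_of_prob i1 i2
    rw [← e1] at h1
    rw [lintegral_ofReal_eq (i2.const_mul _) fun y => mul_nonneg (hr.nonneg _) (sq_nonneg _), integral_const_mul]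
    exact ENNReal.ofReal_le_ofReal (mul_le_mul_of_nonneg_left h1 (hr.nonneg _))
  refine (lintegral_mono hpt).trans ?_
  rw [lintegral_lintegral_swap]
  swap
  · have : Continuous fun p : Space n × Space n =>
      r (zCoord p.1 - c) * (h p.1 - h (flat p.2 + flat p.1 + c • ez n)) ^ 2 := by fun_prop
    exact this.measurable.ennreal_ofReal.aemeasurable
  -- From x move first within the slice by `flat y`, at a cost of |flat y|² ≤ n, and then along the
  -- strip to z = c, at the cost K of the Hardy inequality. Averaging over y reaches the mean, which
  -- by transversal invariance does not depend on x.
  have hy : ∀ y ∈ cell n, ∫⁻ x, ENNReal.ofReal (r (zCoord x - c) *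
      (h x - h (flat y + flat x + c • ez n)) ^ 2) ∂(stripMeasure n) ≤ ENNReal.ofReal (2 * (n + K)) * I := by
    intro y hy
    have c1 : Measurable fun x => ENNReal.ofReal (2 * (r (zCoord x - c) * (h (x + flat y) - h x) ^ 2)) := by
      have : Continuous fun x => 2 * (r (zCoord x - c) * (h (x + flat y) - h x) ^ 2) := by fun_prop
      exact this.measurable.ennreal_ofReal
    have hk := lintegral_sliceDev_le hr hh c
    have hk' : ∫⁻ x, ENNReal.ofReal (r (zCoord x - c) * sliceDev h c x ^ 2) ∂(stripMeasure n) ≤ ENNReal.ofReal K * I := by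
      refine hk.trans (mul_le_mul_right (lintegral_mono fun x => ENNReal.ofReal_le_ofReal ?_) _)
      exact mul_le_mul_of_nonneg_left (pz_sq_le_gradSq _ _) (hr.nonneg _)
    have hs := lintegral_strip_shift (F := fun x => ENNReal.ofReal (r (zCoord x - c) * sliceDev h c x ^ 2))
      (fun i x => by rw [zCoord_add_single, hh.sliceDev_periodic]) (flat y)
    simp only [zCoord_add, zCoord_flat, add_zero] at hs
    have ht := lintegral_shift_sub_le hrc hr.nonneg hh c (zCoord_flat y)
    have ht' : ∫⁻ x, ENNReal.ofReal (r (zCoord x - c) * (h (x + flat y) - h x) ^ 2) ∂(stripMeasure n) ≤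
        ENNReal.ofReal n * I := ht.trans (mul_le_mul_left (ENNReal.ofReal_le_ofReal (sum_flat_sq_le hy)) _)
    calc _ ≤ ∫⁻ x, (ENNReal.ofReal (2 * (r (zCoord x - c) * (h (x + flat y) - h x) ^ 2)) +
            ENNReal.ofReal (2 * (r (zCoord x - c) * sliceDev h c (x + flat y) ^ 2))) ∂(stripMeasure n) := by
          refine lintegral_mono fun x => ?_
          rw [← ENNReal.ofReal_add (mul_nonneg zero_le_two (mul_nonneg (hr.nonneg _) (sq_nonneg _)))
            (mul_nonneg zero_le_two (mul_nonneg (hr.nonneg _) (sq_nonneg _)))]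
          refine ENNReal.ofReal_le_ofReal ?_
          have e : sliceDev h c (x + flat y) = h (x + flat y) - h (flat y + flat x + c • ez n) := by
            rw [sliceDev, flat_add, flat_flat, add_comm (flat x)]
          rw [e]
          have := mul_nonneg (hr.nonneg (zCoord x - c))
            (sq_nonneg ((h (x + flat y) - h x) + (h (x + flat y) - h (flat y + flat x + c • ez n))))
          nlinarith
      _ = 2 * ∫⁻ x, ENNReal.ofReal (r (zCoord x - c) * (h (x + flat y) - h x) ^ 2) ∂(stripMeasure n) +
          2 * ∫⁻ x, ENNReal.ofReal (r (zCoord x - c) * sliceDev h c (x + flat y) ^ 2) ∂(stripMeasure n) := by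
          rw [lintegral_add_left c1]
          simp only [ENNReal.ofReal_mul (zero_le_two (α := ℝ)), ENNReal.ofReal_ofNat]
          rw [lintegral_const_mul' _ _ (by norm_num), lintegral_const_mul' _ _ (by norm_num)]
      _ ≤ 2 * (ENNReal.ofReal n * I) + 2 * (ENNReal.ofReal K * I) := by
          rw [hs]
          exact add_le_add (mul_le_mul_right ht' _) (mul_le_mul_right hk' _)
      _ = _ := by
          rw [ENNReal.ofReal_mul zero_le_two, ENNReal.ofReal_add (Nat.cast_nonneg n) hK.le, ENNReal.ofReal_ofNat]
          ring
  calc _ ≤ ∫⁻ _, ENNReal.ofReal (2 * (n + K)) * I ∂(cellUnit n) := by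
        refine lintegral_mono_ae ?_
        have : ∀ᵐ y ∂(cellUnit n), y ∈ cell n := ae_restrict_of_ae (ae_mem_cell n)
        filter_upwards [this] with y hy' using hy y hy'
    _ = _ := by rw [lintegral_const]; simp

/-! ### Integration by parts for Sobolev functions, and the spectral gap -/

theorem sq_integral_mul_le {X : Type*} [MeasurableSpace X] {m : Measure X} {a b : X → ℝ}
    (ia : Integrable (fun x => a x ^ 2) m) (ib : Integrable (fun x => b x ^ 2) m)
    (iab : Integrable (fun x => a x * b x) m) :
    (∫ x, a x * b x ∂m) ^ 2 ≤ (∫ x, a x ^ 2 ∂m) * ∫ x, b x ^ 2 ∂m := by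
  have h : ∀ s : ℝ, 0 ≤ (∫ x, b x ^ 2 ∂m) * (s * s) + (2 * ∫ x, a x * b x ∂m) * s + ∫ x, a x ^ 2 ∂m := by
    intro s
    have h1 : 0 ≤ ∫ x, (s * b x + a x) ^ 2 ∂m := integral_nonneg fun _ => sq_nonneg _
    have e : ∀ x, (s * b x + a x) ^ 2 = s ^ 2 * b x ^ 2 + 2 * s * (a x * b x) + a x ^ 2 := fun x => by ring
    simp only [e] at h1
    have i3 : Integrable (fun x => s ^ 2 * b x ^ 2 + 2 * s * (a x * b x)) m :=
      (ib.const_mul _).add (iab.const_mul _)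
    rw [integral_add i3 ia, integral_add (ib.const_mul _) (iab.const_mul _), integral_const_mul,
      integral_const_mul] at h1
    linarith
  have := discrim_le_zero h
  rw [discrim] at this
  linarith

theorem integrable_mul_of_sq {X : Type*} [MeasurableSpace X] {m : Measure X} {a b : X → ℝ}
    (ma : AEStronglyMeasurable a m) (mb : AEStronglyMeasurable b m)
    (ia : Integrable (fun x => a x ^ 2) m) (ib : Integrable (fun x => b x ^ 2) m) :
    Integrable (fun x => a x * b x) m := by
  refine (ia.add ib).mono' (ma.mul mb) (Filter.Eventually.of_forall fun x => ?_)
  refine (abs_mul_le_half _ _).trans ?_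
  simp only [Pi.add_apply]
  nlinarith [sq_nonneg (a x), sq_nonneg (b x)]

theorem SP.integrable_mul {a b : Space n → ℝ} (ha : SP a) (hb : SP b)
    (ia : Integrable (fun x => a x ^ 2) (stripMeasure n)) (ib : Integrable (fun x => b x ^ 2) (stripMeasure n)) :
    Integrable (fun x => a x * b x) (stripMeasure n) :=
  integrable_mul_of_sq ha.continuous.aestronglyMeasurable hb.continuous.aestronglyMeasurable ia ib

theorem SP.integrable_pd_sq {a : Space n → ℝ} (ha : SP a) (ia : Integrable (CahnHilliard.gradSq a) (stripMeasure n))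
    (i : Fin (n + 1)) : Integrable (fun x => CahnHilliard.pd i a x ^ 2) (stripMeasure n) := by
  refine ia.mono' ((ha.pd i).pow 2).continuous.aestronglyMeasurable (Filter.Eventually.of_forall fun x => ?_)
  rw [Real.norm_eq_abs, abs_of_nonneg (sq_nonneg _)]
  exact pd_sq_le_gradSq _ _ _

theorem SP.integrable_bdd_mul {a b : Space n → ℝ} (ha : SP a) {M : ℝ} (hM : ∀ x, |a x| ≤ M)
    (ib : Integrable b (stripMeasure n)) : Integrable (fun x => a x * b x) (stripMeasure n) :=
  ib.bdd_mul (c := M) ha.continuous.aestronglyMeasurable (Filter.Eventually.of_forall hM)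

/-- Integrability of B alone removes the cutoff: the boundary term is at most (4K/R)∫|B|. -/
theorem integral_pz_eq_zero {B : Space n → ℝ} (hB : SP B) (i0 : Integrable B (stripMeasure n))
    (i1 : Integrable (pz B) (stripMeasure n)) : ∫ x, pz B x ∂(stripMeasure n) = 0 := by
  have hK := one_le_cutK
  have l1 := (tendsto_integral_wt i1).abs
  have l2 := tendsto_const_div_succ (4 * cutK * ∫ x, |B x| ∂(stripMeasure n))
  refine abs_eq_zero.1 (tendsto_nhds_unique l1 (squeeze_zero (fun _ => abs_nonneg _) (fun N => ?_) l2))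
  have hR : (0 : ℝ) < (N : ℝ) + 1 := by positivity
  have hw := isTestFunction_wt (n := n) hR
  have e := hw.integral_mul_pd hB (Fin.last n)
  change ∫ x, _ * pz B x ∂_ = - ∫ x, pz _ x * B x ∂_ at e
  rw [e, abs_neg]
  have hb : ∀ x, |pz (wt n ((N : ℝ) + 1)) x * B x| ≤ 4 * cutK / ((N : ℝ) + 1) * |B x| := fun x => by
    rw [abs_mul]
    refine mul_le_mul_of_nonneg_right ((abs_pz_wt_le hR x).trans ?_) (abs_nonneg _)
    exact mul_le_of_le_one_right (by positivity) (cut_le_one _ _)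
  have j : Integrable (fun x => pz (wt n ((N : ℝ) + 1)) x * B x) (stripMeasure n) :=
    ((isTestFunction_pz_wt hR).mul hB).integrable
  refine abs_integral_le_integral_abs.trans ?_
  calc _ ≤ ∫ x, 4 * cutK / ((N : ℝ) + 1) * |B x| ∂(stripMeasure n) :=
        integral_mono j.abs (i0.abs.const_mul _) hb
    _ = _ := by rw [integral_const_mul]; ring

theorem integral_inner_eq_neg {A B : Space n → ℝ} (hA : SP A) (hB : SP B)
    (i1 : Integrable (fun x => ∑ i, pd i A x * pd i B x) (stripMeasure n))
    (i2 : Integrable (fun x => A x * lap B x) (stripMeasure n))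
    (i3 : Integrable (fun x => A x * pz B x) (stripMeasure n)) :
    ∫ x, (∑ i, pd i A x * pd i B x) ∂(stripMeasure n) = - ∫ x, A x * lap B x ∂(stripMeasure n) := by
  have hK := one_le_cutK
  have l1 := ((tendsto_integral_wt i1).add (tendsto_integral_wt i2)).abs
  have l2 := tendsto_const_div_succ (4 * cutK * ∫ x, |A x * pz B x| ∂(stripMeasure n))
  have := abs_eq_zero.1 (tendsto_nhds_unique l1 (squeeze_zero (fun _ => abs_nonneg _) (fun N => ?_) l2))
  · linarith
  have hR : (0 : ℝ) < (N : ℝ) + 1 := by positivity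
  have hw := isTestFunction_wt (n := n) hR
  have hw' := isTestFunction_pz_wt (n := n) hR
  have e := integral_divTerm hw hw' (sum_pd_wt_mul _) hA hB
  have j1 := (hw.mul (SP.sum (s := Finset.univ) fun i => (hA.pd i).mul (hB.pd i))).integrable
  have j2 := (hw.mul (hA.mul hB.lap)).integrable
  have j3 := (hw'.mul (hA.mul hB.pz)).integrable
  have j12 : Integrable (fun x => wt n ((N : ℝ) + 1) x * (∑ i, pd i A x * pd i B x) +
    wt n ((N : ℝ) + 1) x * (A x * lap B x)) (stripMeasure n) := j1.add j2
  simp only [divTerm] at e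
  rw [integral_add j12 j3, integral_add j1 j2] at e
  have e2 : ∫ x, wt n ((N : ℝ) + 1) x * (∑ i, pd i A x * pd i B x) ∂(stripMeasure n) +
      ∫ x, wt n ((N : ℝ) + 1) x * (A x * lap B x) ∂(stripMeasure n) =
      - ∫ x, pz (wt n ((N : ℝ) + 1)) x * (A x * pz B x) ∂(stripMeasure n) := by linarith
  rw [e2, abs_neg]
  have hb : ∀ x, |pz (wt n ((N : ℝ) + 1)) x * (A x * pz B x)| ≤ 4 * cutK / ((N : ℝ) + 1) * |A x * pz B x| :=
    fun x => by
      rw [abs_mul]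
      refine mul_le_mul_of_nonneg_right ((abs_pz_wt_le hR x).trans ?_) (abs_nonneg _)
      exact mul_le_of_le_one_right (by positivity) (cut_le_one _ _)
  refine abs_integral_le_integral_abs.trans ?_
  calc _ ≤ ∫ x, 4 * cutK / ((N : ℝ) + 1) * |A x * pz B x| ∂(stripMeasure n) :=
        integral_mono j3.abs (i3.abs.const_mul _) hb
    _ = _ := by rw [integral_const_mul]; ring

theorem integrable_sum_pd_mul {A B : Space n → ℝ} (hA : SP A) (hB : SP B)
    (iA : Integrable (gradSq A) (stripMeasure n)) (iB : Integrable (gradSq B) (stripMeasure n)) :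
    Integrable (fun x => ∑ i, pd i A x * pd i B x) (stripMeasure n) :=
  integrable_finsetSum _ fun i _ => (hA.pd i).integrable_mul (hB.pd i) (hA.integrable_pd_sq iA i)
    (hB.integrable_pd_sq iB i)

/-! #### The slope of the kink -/

/-- The derivative of the kink, as a function on the strip. -/
def slope (n : ℕ) (c : ℝ) (x : Space n) : ℝ := kinkSlope c (zCoord x)

theorem sp_slope (c : ℝ) : SP (slope n c) := SP.zfun (contDiff_kinkSlope c)

theorem slope_pos (c : ℝ) (x : Space n) : 0 < slope n c x := kinkSlope_pos _ _

theorem slope_le_one (c : ℝ) (x : Space n) : slope n c x ≤ 1 := kinkSlope_le_one _ _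

theorem abs_slope_le_one (c : ℝ) (x : Space n) : |slope n c x| ≤ 1 := by
  rw [abs_of_pos (slope_pos c x)]; exact slope_le_one c x

theorem abs_kink_le_one (c : ℝ) (x : Space n) : |kink n c x| ≤ 1 := (abs_kinkProfile_lt_one c _).le

theorem slope_eq (c : ℝ) (x : Space n) : slope n c x = (1 - kink n c x ^ 2) / √2 := rfl

theorem sqrt_two_mul_slope (c : ℝ) (x : Space n) : √2 * slope n c x = 1 - kink n c x ^ 2 := by
  rw [slope_eq]; field_simp

theorem pd_slope (c : ℝ) (i : Fin (n + 1)) :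
    pd i (slope n c) = fun x => if i = Fin.last n then kink n c x ^ 3 - kink n c x else 0 :=
  pd_zfun (hasDerivAt_kinkSlope c) i

theorem kink_cube_sub (c : ℝ) (x : Space n) :
    kink n c x ^ 3 - kink n c x = - (√2 * kink n c x * slope n c x) := by
  have := sqrt_two_mul_slope c x
  linear_combination (kink n c x) * this

theorem pz_slope (c : ℝ) (x : Space n) : pz (slope n c) x = - (√2 * kink n c x * slope n c x) := by
  rw [pz, pd_slope]
  simp only [if_true, kink_cube_sub]

/-- Differentiating v'' = G'(v) shows that the slope lies in the kernel of -Δ + G''(v_c), as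
translation invariance requires. -/
theorem lap_slope (c : ℝ) (x : Space n) : lap (slope n c) x = well2 (kink n c) x * slope n c x := by
  have h : ∀ s, HasDerivAt (fun s => kinkProfile c s ^ 3 - kinkProfile c s)
      ((3 * kinkProfile c s ^ 2 - 1) * kinkSlope c s) s := fun s => by
    have := (hasDerivAt_well (kinkProfile c s)).comp s (hasDerivAt_kinkProfile c s)
    exact this
  have := lap_zfun (n := n) (hasDerivAt_kinkSlope c) h
  exact congrFun this x

theorem integrable_slope (c : ℝ) : Integrable (slope n c) (stripMeasure n) :=
  integrable_zCoord (integrable_kinkSlope c)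

theorem integrable_slope_sq (c : ℝ) : Integrable (fun x => slope n c x ^ 2) (stripMeasure n) :=
  (integrable_gradSq_kink c).congr (Filter.Eventually.of_forall fun x => gradSq_kink c x)

theorem gradSq_slope (c : ℝ) (x : Space n) : gradSq (slope n c) x = pz (slope n c) x ^ 2 := by
  simp [gradSq, pz, pd_slope]

theorem pz_slope_sq_le (c : ℝ) (x : Space n) : pz (slope n c) x ^ 2 ≤ 2 * slope n c x ^ 2 := by
  have h1 : kink n c x ^ 2 ≤ 1 := (kinkProfile_sq_lt_one c _).le
  rw [pz_slope, neg_sq, mul_pow, mul_pow, sqrt_two_sq]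
  nlinarith [sq_nonneg (slope n c x)]

theorem integrable_gradSq_slope (c : ℝ) : Integrable (gradSq (slope n c)) (stripMeasure n) := by
  refine ((integrable_slope_sq (n := n) c).const_mul 2).mono' (sp_slope c).gradSq.continuous.aestronglyMeasurable
    (Filter.Eventually.of_forall fun x => ?_)
  rw [Real.norm_eq_abs, abs_of_nonneg (gradSq_nonneg _ _), gradSq_slope]
  exact pz_slope_sq_le c x

theorem integral_slope (c : ℝ) : ∫ x, slope n c x ∂(stripMeasure n) = 2 := by
  rw [show (fun x : Space n => slope n c x) = fun x => kinkSlope c (zCoord x) from rfl,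
    integral_zCoord (continuous_kinkSlope c).aestronglyMeasurable,
    integral_of_hasDerivAt_of_tendsto (hasDerivAt_kinkProfile c) (integrable_kinkSlope c)
      (tendsto_kinkProfile_atBot c) (tendsto_kinkProfile_atTop c)]
  norm_num

/-- The primitive of `√(2 G)`. -/
def wellPrimitive (s : ℝ) : ℝ := (s - s ^ 3 / 3) / √2

theorem hasDerivAt_wellPrimitive (s : ℝ) : HasDerivAt wellPrimitive ((1 - s ^ 2) / √2) s := by
  have h := (((hasDerivAt_id s).sub ((hasDerivAt_pow 3 s).div_const 3)).div_const √2)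
  refine h.congr_deriv ?_
  push_cast; ring

theorem kinkEnergy_eq : kinkEnergy = 4 / (3 * √2) := by
  have h1 : kinkEnergy = ∫ s in (-1 : ℝ)..1, (1 - s ^ 2) / √2 := by
    refine intervalIntegral.integral_congr fun s hs => ?_
    rw [uIcc_of_le (by norm_num)] at hs
    have h2 : 0 ≤ 1 - s ^ 2 := by nlinarith [hs.1, hs.2]
    simp only [doubleWell]
    rw [show 2 * ((1 - s ^ 2) ^ 2 / 4) = (1 - s ^ 2) ^ 2 / 2 by ring, Real.sqrt_div (sq_nonneg _),
      Real.sqrt_sq h2]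
  rw [h1, intervalIntegral.integral_eq_sub_of_hasDerivAt (fun s _ => hasDerivAt_wellPrimitive s)
    (by apply Continuous.intervalIntegrable; fun_prop)]
  have : √2 ≠ 0 := by positivity
  simp only [wellPrimitive]
  field_simp
  ring

theorem half_le_kinkEnergy : 1 / 2 ≤ kinkEnergy := by
  rw [kinkEnergy_eq, div_le_div_iff₀ (by norm_num) (by positivity)]
  nlinarith [sqrt_two_sq, Real.sqrt_nonneg 2]

/-- Equipartition: along the kink, ψ² dz = √(2G(v)) dv. -/
theorem integral_slope_sq (c : ℝ) : ∫ x, slope n c x ^ 2 ∂(stripMeasure n) = kinkEnergy := by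
  have hc := continuous_kinkSlope c
  have hd : ∀ s, HasDerivAt (fun s => wellPrimitive (kinkProfile c s)) (kinkSlope c s ^ 2) s := fun s => by
    have := (hasDerivAt_wellPrimitive (kinkProfile c s)).comp s (hasDerivAt_kinkProfile c s)
    exact this.congr_deriv (pow_two _).symm
  have hcont : Continuous wellPrimitive :=
    continuous_iff_continuousAt.2 fun s => (hasDerivAt_wellPrimitive s).continuousAt
  have hm : AEStronglyMeasurable (fun s => kinkSlope c s ^ 2) volume := (hc.pow 2).aestronglyMeasurable
  have hi : Integrable (fun s => kinkSlope c s ^ 2) := by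
    refine (integrable_kinkSlope c).mono' hm
      (Filter.Eventually.of_forall fun s => ?_)
    rw [Real.norm_eq_abs, abs_of_nonneg (sq_nonneg _), sq]
    exact mul_le_of_le_one_left (kinkSlope_pos c s).le (kinkSlope_le_one c s)
  rw [show (fun x : Space n => slope n c x ^ 2) = fun x => (fun s => kinkSlope c s ^ 2) (zCoord x) from rfl,
    integral_zCoord hm]
  have := integral_of_hasDerivAt_of_tendsto hd hi
    ((hcont.tendsto _).comp (tendsto_kinkProfile_atBot c)) ((hcont.tendsto _).comp (tendsto_kinkProfile_atTop c))
  refine this.trans ?_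
  rw [kinkEnergy_eq]
  have : √2 ≠ 0 := by positivity
  simp only [wellPrimitive]
  field_simp
  ring

/-! #### The spectral gap -/

/-- The reciprocal of the slope of the kink. -/
def invSlope (c s : ℝ) : ℝ := √2 * Real.cosh ((s - c) / √2) ^ 2

theorem contDiff_invSlope (c : ℝ) : ContDiff ℝ ∞ (invSlope c) :=
  contDiff_const.mul ((Real.contDiff_cosh.comp (by fun_prop)).pow 2)

theorem kinkSlope_mul_invSlope (c s : ℝ) : kinkSlope c s * invSlope c s = 1 := by
  unfold kinkSlope invSlope kinkProfile
  have h := Real.cosh_sq ((s - c) / √2)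
  have h1 := (Real.cosh_pos ((s - c) / √2)).ne'
  rw [Real.tanh_eq_sinh_div_cosh]
  field_simp
  linarith

theorem kinkSlope_sq_eq (c s : ℝ) : (1 - Real.tanh (1 / √2 * (s - c)) ^ 2) ^ 2 = 2 * kinkSlope c s ^ 2 := by
  unfold kinkSlope kinkProfile
  rw [div_pow, sqrt_two_sq, one_div_mul_eq_div]
  ring

/-- The spectral gap of the linearization at a kink. -/
theorem spectral_gap (hn : n ≤ 4) (c : ℝ) {g : Space n → ℝ} (hg : SP g)
    (i0 : Integrable (fun x => g x ^ 2) (stripMeasure n)) (i1 : Integrable (gradSq g) (stripMeasure n)) :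
    ∫ x, g x ^ 2 ∂(stripMeasure n) - (∫ x, g x * slope n c x ∂(stripMeasure n)) ^ 2 / kinkEnergy ≤
      24 * ∫ x, secondDensity (kink n c) g x ∂(stripMeasure n) := by
  have sψ := sp_slope (n := n) c
  have sv := sp_kink (n := n) c
  -- Ground state substitution g = ψh, with the positive kernel element ψ as ground state.
  set h : Space n → ℝ := fun x => g x * invSlope c (zCoord x) with hh
  have sh : SP h := hg.mul (SP.zfun (contDiff_invSlope c))
  have hgh : ∀ x, slope n c x * h x = g x := fun x => by
    have := kinkSlope_mul_invSlope c (zCoord x)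
    simp only [hh, slope]
    linear_combination (g x) * this
  have hgf : g = fun x => slope n c x * h x := funext fun x => (hgh x).symm
  have hgrad : ∀ i x, slope n c x * pd i h x = pd i g x +
      if i = Fin.last n then √2 * kink n c x * g x else 0 := by
    intro i x
    have e : pd i g x = slope n c x * pd i h x + pd i (slope n c) x * h x := by
      conv_lhs => rw [hgf]
      rw [pd_mul _ sψ sh]
    rw [pd_slope] at e
    split_ifs with hi
    · simp only [if_pos hi, kink_cube_sub] at e
      rw [e, ← hgh x]; ring
    · simp only [if_neg hi] at e
      rw [e]; ring
  -- Since ∂_zψ = -√2 v_c ψ, expanding ψ²|∇h|² gives the density of the second variation plus the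
  -- exact z-derivative of √2 v_c g².
  set B : Space n → ℝ := fun x => √2 * kink n c x * g x ^ 2 with hB
  have sB : SP B := (sv.const_mul √2).mul (hg.pow 2)
  have hpB : ∀ x, pz B x = (1 - kink n c x ^ 2) * g x ^ 2 + 2 * (√2 * kink n c x) * (g x * pz g x) := by
    intro x
    simp only [pz, hB]
    rw [pd_mul _ (sv.const_mul √2) (hg.pow 2), pd_const_mul _ sv, pd_pow _ hg]
    have : pd (Fin.last n) (kink n c) x = slope n c x := by
      rw [pd_kink]; simp [slope]
    simp only [this]
    rw [sqrt_two_mul_slope]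
    push_cast
    ring
  have hpt : ∀ x, slope n c x ^ 2 * gradSq h x = secondDensity (kink n c) g x + pz B x := by
    intro x
    have e1 : slope n c x ^ 2 * gradSq h x = ∑ i, (slope n c x * pd i h x) ^ 2 := by
      simp only [gradSq, Finset.mul_sum, mul_pow]
    have e2 : ∑ i, (slope n c x * pd i h x) ^ 2 = gradSq g x + (2 * (√2 * kink n c x) * (g x * pz g x) +
        (√2 * kink n c x * g x) ^ 2) := by
      have : ∀ i, (slope n c x * pd i h x) ^ 2 = pd i g x ^ 2 + if i = Fin.last n then
          (2 * (√2 * kink n c x) * (g x * pz g x) + (√2 * kink n c x * g x) ^ 2) else 0 := by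
        intro i
        rw [hgrad]
        split_ifs with hi
        · rw [hi, pz]; ring
        · ring
      simp only [this, Finset.sum_add_distrib, Finset.sum_ite_eq', Finset.mem_univ, if_true]
      rfl
    rw [e1, e2, hpB, secondDensity, well2, mul_pow, mul_pow, sqrt_two_sq]
    ring
  have bv : ∀ x, |√2 * kink n c x| ≤ √2 := fun x => by
    rw [abs_mul, abs_of_nonneg (Real.sqrt_nonneg 2)]
    exact mul_le_of_le_one_right (Real.sqrt_nonneg 2) (abs_kink_le_one c x)
  have iB : Integrable B (stripMeasure n) := (sv.const_mul √2).integrable_bdd_mul bv i0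
  have igz := hg.integrable_mul hg.pz i0 (hg.integrable_pd_sq i1 (Fin.last n))
  have b2 : ∀ x, |2 * (√2 * kink n c x)| ≤ 2 * √2 := fun x => by
    rw [abs_mul, abs_two]; exact mul_le_mul_of_nonneg_left (bv x) zero_le_two
  have b3 : ∀ x : Space n, |1 - kink n c x ^ 2| ≤ 1 := fun x => by
    have h1 : kink n c x ^ 2 ≤ 1 := (kinkProfile_sq_lt_one c _).le
    rw [abs_le]; constructor <;> nlinarith [sq_nonneg (kink n c x)]
  have ipB : Integrable (pz B) (stripMeasure n) := by
    have := (((SP.const 1).sub (sv.pow 2)).integrable_bdd_mul b3 i0).add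
      (((sv.const_mul √2).const_mul 2).integrable_bdd_mul b2 igz)
    exact this.congr (Filter.Eventually.of_forall fun x => (hpB x).symm)
  have iQ : Integrable (secondDensity (kink n c) g) (stripMeasure n) := by
    have b4 : ∀ x : Space n, |well2 (kink n c) x| ≤ 11 := fun x =>
      abs_well2_le ((abs_kink_le_one c x).trans one_le_two)
    exact i1.add (sv.well2.integrable_bdd_mul b4 i0)
  have iH : Integrable (fun x => slope n c x ^ 2 * gradSq h x) (stripMeasure n) :=
    (iQ.add ipB).congr (Filter.Eventually.of_forall fun x => (hpt x).symm)
  have hQ : ∫ x, slope n c x ^ 2 * gradSq h x ∂(stripMeasure n) =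
      ∫ x, secondDensity (kink n c) g x ∂(stripMeasure n) := by
    simp only [hpt]
    rw [integral_add iQ ipB, integral_pz_eq_zero sB iB ipB, add_zero]
  have hQ0 : 0 ≤ ∫ x, secondDensity (kink n c) g x ∂(stripMeasure n) := by
    rw [← hQ]; exact integral_nonneg fun x => mul_nonneg (sq_nonneg _) (gradSq_nonneg _ _)
  -- The weight ψ² is half of the fourth power of sech at l = 1/√2. Its Hardy constant is 8, and the
  -- Poincaré constant 2(n + 8) is at most 24 for n ≤ 4.
  obtain ⟨m, hm⟩ := weighted_poincare (hardyWeight_sech_four (l := 1 / √2) (by positivity)) sh c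
  have hl : (4 : ℝ) / (1 / √2) ^ 2 = 8 := by rw [div_pow, sqrt_two_sq]; norm_num
  have e1 : ∀ x : Space n, (1 - Real.tanh (1 / √2 * (zCoord x - c)) ^ 2) ^ 2 * (h x - m) ^ 2 =
      2 * (g x - m * slope n c x) ^ 2 := fun x => by
    rw [kinkSlope_sq_eq, ← hgh x, slope]; ring
  have e2 : ∀ x : Space n, (1 - Real.tanh (1 / √2 * (zCoord x - c)) ^ 2) ^ 2 * gradSq h x =
      2 * (slope n c x ^ 2 * gradSq h x) := fun x => by
    rw [kinkSlope_sq_eq, slope]; ring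
  simp only [e1, e2, hl] at hm
  have igs := hg.integrable_mul sψ i0 (integrable_slope_sq c)
  have iS := integrable_slope_sq (n := n) c
  have eG : ∀ x, (g x - m * slope n c x) ^ 2 = g x ^ 2 - 2 * m * (g x * slope n c x) + m ^ 2 * slope n c x ^ 2 :=
    fun x => by ring
  have i3 : Integrable (fun x => g x ^ 2 - 2 * m * (g x * slope n c x)) (stripMeasure n) := i0.sub (igs.const_mul _)
  have iG : Integrable (fun x => (g x - m * slope n c x) ^ 2) (stripMeasure n) := by
    simp only [eG]; exact i3.add (iS.const_mul _)
  rw [lintegral_ofReal_eq (iG.const_mul 2) fun x => mul_nonneg zero_le_two (sq_nonneg _),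
    lintegral_ofReal_eq (iH.const_mul 2) fun x =>
      mul_nonneg zero_le_two (mul_nonneg (sq_nonneg _) (gradSq_nonneg _ _)),
    ← ENNReal.ofReal_mul (by positivity), integral_const_mul, integral_const_mul, hQ] at hm
  have hm2 := (ENNReal.ofReal_le_ofReal_iff (by positivity)).1 hm
  have hG : ∫ x, (g x - m * slope n c x) ^ 2 ∂(stripMeasure n) = ∫ x, g x ^ 2 ∂(stripMeasure n) -
      2 * m * (∫ x, g x * slope n c x ∂(stripMeasure n)) + m ^ 2 * kinkEnergy := by
    simp only [eG]
    rw [integral_add i3 (iS.const_mul _), integral_sub i0 (igs.const_mul _), integral_const_mul,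
      integral_const_mul, integral_slope_sq]
  rw [hG] at hm2
  have hN := half_le_kinkEnergy
  have hN0 : 0 < kinkEnergy := by linarith
  set P := ∫ x, g x * slope n c x ∂(stripMeasure n)
  -- The constant m is merely some constant; completing the square replaces it by the optimal one,
  -- which is the orthogonal projection onto ψ.
  have hsq : 0 ≤ (m * kinkEnergy - P) ^ 2 / kinkEnergy := by positivity
  have hsq2 : (m * kinkEnergy - P) ^ 2 / kinkEnergy = m ^ 2 * kinkEnergy - 2 * m * P + P ^ 2 / kinkEnergy := by
    field_simp
    ring
  have hn' : (n : ℝ) ≤ 4 := by exact_mod_cast hn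
  have hb := mul_le_mul_of_nonneg_right hn' hQ0
  linarith

/-! ### The kinks closest to a function -/

theorem integral_le_of_hasDerivAt_of_bounded {F f : ℝ → ℝ} (hF : ∀ s, HasDerivAt F (f s) s)
    (hf : Continuous f) (h0 : ∀ s, 0 ≤ f s) {K : ℝ} (hK : ∀ s, |F s| ≤ K) : ∫ s, f s ≤ 2 * K := by
  refine le_of_tendsto (intervalIntegral_tendsto_integral (integrable_of_hasDerivAt_of_bounded hF hf h0 hK)
    Filter.tendsto_neg_atTop_atBot Filter.tendsto_id) (Filter.Eventually.of_forall fun i => ?_)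
  rw [intervalIntegral.integral_eq_sub_of_hasDerivAt (fun s _ => hF s) (hf.intervalIntegrable _ _)]
  linarith [(abs_le.1 (hK (id i))).2, (abs_le.1 (hK (-i))).1]

theorem tanh_sub_tanh_sub (y σ : ℝ) : Real.tanh y - Real.tanh (y - σ) =
    Real.tanh σ * (1 - Real.tanh y ^ 2) / (1 - Real.tanh y * Real.tanh σ) := by
  have hy := Real.cosh_pos y
  have hσ := Real.cosh_pos σ
  have hyσ := Real.cosh_pos (y - σ)
  have h1 : 0 < 1 - Real.tanh y * Real.tanh σ := by
    have e : Real.cosh (y - σ) = Real.cosh y * Real.cosh σ * (1 - Real.tanh y * Real.tanh σ) := by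
      rw [Real.cosh_sub, Real.tanh_eq_sinh_div_cosh, Real.tanh_eq_sinh_div_cosh]; field_simp
    rw [e] at hyσ
    exact (mul_pos_iff_of_pos_left (by positivity)).1 hyσ
  rw [eq_div_iff h1.ne']
  have h2 : Real.tanh (y - σ) * (1 - Real.tanh y * Real.tanh σ) = Real.tanh y - Real.tanh σ := by
    rw [Real.tanh_eq_sinh_div_cosh (y - σ)]
    rw [div_mul_eq_mul_div, div_eq_iff hyσ.ne', Real.cosh_sub, Real.sinh_sub, Real.tanh_eq_sinh_div_cosh,
      Real.tanh_eq_sinh_div_cosh]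
    field_simp
  linear_combination -h2

/-- Shifting a kink by a small amount changes it, to first order, by its slope. -/
theorem kink_sub_kink (c : ℝ) {τ : ℝ} (hτ : |τ| ≤ 1 / 2) : ∃ b : ℝ, ∀ x : Space n,
    |kink n c x - kink n b x - √2 * τ * slope n c x| ≤ 4 * τ ^ 2 * slope n c x := by
  have h2 := Real.sqrt_nonneg 2
  have hτ' := abs_le.1 hτ
  -- With the shift parametrized by artanh τ, the addition theorem makes the difference of the kinks
  -- a rational function of τ.
  refine ⟨c + √2 * Real.artanh τ, fun x => ?_⟩
  have hs := slope_pos c x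
  have hv := abs_le.1 (abs_kink_le_one c x)
  have e : kink n (c + √2 * Real.artanh τ) x = Real.tanh ((zCoord x - c) / √2 - Real.artanh τ) := by
    rw [kink]; congr 1; field_simp; ring
  have h := tanh_sub_tanh_sub ((zCoord x - c) / √2) (Real.artanh τ)
  rw [← e, Real.tanh_artanh ⟨by linarith [hτ'.1], by linarith [hτ'.2]⟩] at h
  change kink n c x - _ = τ * (1 - kink n c x ^ 2) / (1 - kink n c x * τ) at h
  have hd : 1 / 2 ≤ 1 - kink n c x * τ := by
    have : |kink n c x * τ| ≤ 1 * (1 / 2) := by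
      rw [abs_mul]; exact mul_le_mul (abs_kink_le_one c x) hτ (abs_nonneg _) zero_le_one
    linarith [(abs_le.1 this).2]
  have hd0 : 0 < 1 - kink n c x * τ := by linarith
  have e2 : kink n c x - kink n (c + √2 * Real.artanh τ) x - √2 * τ * slope n c x =
      √2 * τ ^ 2 * (kink n c x * slope n c x) / (1 - kink n c x * τ) := by
    rw [h, ← sqrt_two_mul_slope, eq_div_iff hd0.ne', sub_mul, div_mul_cancel₀ _ hd0.ne']; ring
  have h3 : √2 ≤ 2 := by nlinarith [sqrt_two_sq]
  rw [e2, abs_div, abs_of_pos hd0, div_le_iff₀ hd0, abs_mul,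
    abs_of_nonneg (by positivity : 0 ≤ √2 * τ ^ 2), abs_mul, abs_of_pos hs]
  have h4 : |kink n c x| * slope n c x ≤ slope n c x := mul_le_of_le_one_left hs.le (abs_kink_le_one c x)
  calc √2 * τ ^ 2 * (|kink n c x| * slope n c x) ≤ 2 * τ ^ 2 * slope n c x := by gcongr
    _ = 4 * τ ^ 2 * slope n c x * (1 / 2) := by ring
    _ ≤ _ := by gcongr

theorem integral_sq_eq_toReal {f : Space n → ℝ} (hf : MemLp f 2 (stripMeasure n)) :
    ∫ x, f x ^ 2 ∂(stripMeasure n) = (eLpNorm f 2 (stripMeasure n)).toReal ^ 2 := by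
  have h0 : ∀ᵐ x ∂(stripMeasure n), 0 ≤ f x ^ 2 := Filter.Eventually.of_forall fun _ => sq_nonneg _
  rw [integral_eq_lintegral_of_nonneg_ae h0 (hf.1.pow 2), ← ENNReal.toReal_pow]
  congr 1
  rw [eLpNorm_eq_lintegral_rpow_enorm_toReal two_ne_zero ENNReal.ofNat_ne_top, ENNReal.toReal_ofNat,
    ← ENNReal.rpow_natCast, ← ENNReal.rpow_mul]
  norm_num
  refine lintegral_congr fun x => ?_
  rw [← ofReal_norm, Real.norm_eq_abs, ← ENNReal.ofReal_pow (abs_nonneg _), sq_abs]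

/-- The difference to the closest kink is orthogonal to the slope of this kink. -/
theorem IsClosestKink.integral_mul_slope {w : Space n → ℝ} {c : ℝ} (h : IsClosestKink w c)
    (hf : SP fun x => w x - kink n c x)
    (i0 : Integrable (fun x => (w x - kink n c x) ^ 2) (stripMeasure n)) :
    ∫ x, (w x - kink n c x) * slope n c x ∂(stripMeasure n) = 0 := by
  set f : Space n → ℝ := fun x => w x - kink n c x with hfd
  have iS := integrable_slope_sq (n := n) c
  have ifs := hf.integrable_mul (sp_slope c) i0 iS
  set α := ∫ x, f x * slope n c x ∂(stripMeasure n)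
  set β := ∫ x, |f x * slope n c x| ∂(stripMeasure n)
  have hs2 := sqrt_two_sq
  have hs0 := Real.sqrt_nonneg 2
  -- Minimality of the L² distance against the shifted kink, expanded to second order in τ.
  have key : ∀ τ : ℝ, |τ| ≤ 1 / 2 → 0 ≤ 2 * √2 * τ * α + τ ^ 2 * (8 * β + 16 * kinkEnergy) := by
    intro τ hτ
    obtain ⟨b, hb⟩ := kink_sub_kink (n := n) c hτ
    set g : Space n → ℝ := fun x => kink n c x - kink n b x with hg
    have sg : SP g := (sp_kink c).sub (sp_kink b)
    have g1 : ∀ x, |g x| ≤ 4 * |τ| * slope n c x := fun x => by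
      have hx := hb x
      have := slope_pos c x
      have e : |√2 * τ * slope n c x| = √2 * |τ| * slope n c x := by
        rw [abs_mul, abs_mul, abs_of_nonneg hs0, abs_of_pos this]
      have h1 : |g x| ≤ 4 * τ ^ 2 * slope n c x + √2 * |τ| * slope n c x := by
        rw [← e]
        calc |g x| = |(g x - √2 * τ * slope n c x) + √2 * τ * slope n c x| := by rw [sub_add_cancel]
          _ ≤ _ := (abs_add_le _ _).trans (add_le_add_left hx _)
      have h3 : √2 ≤ 2 := by nlinarith
      have h4 : 4 * τ ^ 2 + √2 * |τ| ≤ 4 * |τ| := by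
        rw [← sq_abs]; nlinarith [abs_nonneg τ]
      nlinarith
    have g2 : ∀ x, g x ^ 2 ≤ 16 * τ ^ 2 * slope n c x ^ 2 := fun x => by
      have := sq_le_sq' (by linarith [abs_nonneg (g x), g1 x]) (g1 x)
      rw [sq_abs, mul_pow, mul_pow, sq_abs] at this
      linarith
    have ig : Integrable (fun x => g x ^ 2) (stripMeasure n) :=
      (iS.const_mul (16 * τ ^ 2)).mono' (sg.pow 2).continuous.aestronglyMeasurable
        (Filter.Eventually.of_forall fun x => by rw [Real.norm_eq_abs, abs_of_nonneg (sq_nonneg _)]; exact g2 x)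
    have ifg := hf.integrable_mul sg i0 ig
    have e : ∀ x, w x - kink n b x = f x + g x := fun x => by simp only [hfd, hg]; ring
    have mf : MemLp f 2 (stripMeasure n) := (memLp_two_iff_integrable_sq hf.continuous.aestronglyMeasurable).2 i0
    have mg : MemLp g 2 (stripMeasure n) := (memLp_two_iff_integrable_sq sg.continuous.aestronglyMeasurable).2 ig
    have hmin := h b
    simp only [e] at hmin
    have hmin2 := pow_le_pow_left₀ ENNReal.toReal_nonneg (ENNReal.toReal_mono (mf.add mg).2.ne hmin) 2
    change (eLpNorm f 2 _).toReal ^ 2 ≤ (eLpNorm (f + g) 2 _).toReal ^ 2 at hmin2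
    rw [← integral_sq_eq_toReal mf, ← integral_sq_eq_toReal (mf.add mg)] at hmin2
    have e2 : ∀ x, (f + g) x ^ 2 = f x ^ 2 + 2 * (f x * g x) + g x ^ 2 := fun x => by
      simp only [Pi.add_apply]; ring
    simp only [e2] at hmin2
    have i3 : Integrable (fun x => f x ^ 2 + 2 * (f x * g x)) (stripMeasure n) := i0.add (ifg.const_mul 2)
    rw [integral_add i3 ig, integral_add i0 (ifg.const_mul 2), integral_const_mul] at hmin2
    have b1 : ∫ x, g x ^ 2 ∂(stripMeasure n) ≤ 16 * τ ^ 2 * kinkEnergy := by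
      rw [← integral_slope_sq (n := n) c, ← integral_const_mul]
      exact integral_mono ig (iS.const_mul _) g2
    have b2 : ∫ x, f x * g x ∂(stripMeasure n) ≤ √2 * τ * α + 4 * τ ^ 2 * β := by
      rw [← integral_const_mul, ← integral_const_mul, ← integral_add (ifs.const_mul _) (ifs.abs.const_mul _)]
      refine integral_mono ifg ((ifs.const_mul _).add (ifs.abs.const_mul _)) fun x => ?_
      have h1 : f x * (g x - √2 * τ * slope n c x) ≤ |f x| * (4 * τ ^ 2 * slope n c x) :=
        (le_abs_self _).trans (by rw [abs_mul]; exact mul_le_mul_of_nonneg_left (hb x) (abs_nonneg _))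
      have h2 : |f x * slope n c x| = |f x| * slope n c x := by rw [abs_mul, abs_of_pos (slope_pos c x)]
      simp only [h2]
      linarith
    nlinarith
  have hN := half_le_kinkEnergy
  have hβ : 0 ≤ β := integral_nonneg fun _ => abs_nonneg _
  set K := 8 * β + 16 * kinkEnergy
  have hK : 1 ≤ K := by simp only [K]; linarith
  have h1 : 1 ≤ √2 := by nlinarith
  by_contra hα
  have hα0 : 0 < |α| := abs_pos.2 hα
  -- If α were nonzero, a small shift with the sign opposite to α would make the linear term beat
  -- the quadratic one.
  set τ := min (1 / 2) (|α| / K) with hτ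
  have hτ0 : 0 < τ := lt_min (by norm_num) (by positivity)
  have hτK : τ * K ≤ |α| := by rw [← le_div_iff₀ (by linarith)]; exact min_le_right _ _
  have h5 : 2 * √2 * τ * |α| ≤ τ ^ 2 * K := by
    rcases abs_cases α with ⟨e, -⟩ | ⟨e, -⟩
    · have := key (-τ) (by rw [abs_neg, abs_of_pos hτ0]; exact min_le_left _ _)
      rw [e]; nlinarith
    · have := key τ (by rw [abs_of_pos hτ0]; exact min_le_left _ _)
      rw [e]; nlinarith
  nlinarith [mul_pos hτ0 hα0, mul_le_mul_of_nonneg_left hτK hτ0.le, mul_le_mul_of_nonneg_right h1 (mul_pos hτ0 hα0).le]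

/-! ### Differences of kinks -/

/-- A primitive of the profile of a kink. -/
def logCosh (a s : ℝ) : ℝ := √2 * Real.log (Real.cosh ((s - a) / √2))

theorem hasDerivAt_logCosh (a s : ℝ) : HasDerivAt (logCosh a) (kinkProfile a s) s := by
  have h := (((((hasDerivAt_id s).sub_const a).div_const √2).cosh).log (Real.cosh_pos _).ne').const_mul √2
  refine h.congr_deriv ?_
  have : √2 ≠ 0 := by positivity
  simp only [id, kinkProfile]
  rw [Real.tanh_eq_sinh_div_cosh]
  field_simp

theorem contDiff_logCosh (a : ℝ) : ContDiff ℝ ∞ (logCosh a) :=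
  contDiff_const.mul ((Real.contDiff_cosh.comp (by fun_prop)).log fun s => (Real.cosh_pos _).ne')

theorem monotone_kinkProfile (a : ℝ) : Monotone (kinkProfile a) :=
  monotone_of_deriv_nonneg (fun s => (hasDerivAt_kinkProfile a s).differentiableAt) fun s => by
    rw [(hasDerivAt_kinkProfile a s).deriv]; exact (kinkSlope_pos a s).le

/-- Convexity: the graph lies above its tangents because the profile of the kink is increasing. -/
theorem logCosh_tangent (x y : ℝ) : kinkProfile 0 x * (y - x) ≤ logCosh 0 y - logCosh 0 x := by
  have hd : ∀ s, HasDerivAt (fun s => logCosh 0 s - kinkProfile 0 x * s) (kinkProfile 0 s - kinkProfile 0 x) s :=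
    fun s => ((hasDerivAt_logCosh 0 s).sub ((hasDerivAt_id s).const_mul (kinkProfile 0 x))).congr_deriv (by ring)
  have hc : Continuous fun s => logCosh 0 s - kinkProfile 0 x * s :=
    continuous_iff_continuousAt.2 fun s => (hd s).continuousAt
  have hm := monotone_kinkProfile 0
  suffices logCosh 0 x - kinkProfile 0 x * x ≤ logCosh 0 y - kinkProfile 0 x * y by linarith
  rcases le_total x y with h | h
  · exact monotoneOn_of_deriv_nonneg (convex_Ici x) hc.continuousOn
      (fun s _ => (hd s).differentiableAt.differentiableWithinAt) (fun s hs => by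
        rw [(hd s).deriv, sub_nonneg]; exact hm (mem_Ici.1 (interior_subset hs))) (mem_Ici.2 le_rfl) h h
  · exact antitoneOn_of_deriv_nonpos (convex_Iic x) hc.continuousOn
      (fun s _ => (hd s).differentiableAt.differentiableWithinAt) (fun s hs => by
        rw [(hd s).deriv, sub_nonpos]; exact hm (mem_Iic.1 (interior_subset hs))) h (mem_Iic.2 le_rfl) h

/-- Two tangent inequalities at s and s - c. They give at once the sign of c(v_0 - v_c), the bound
|c| for the difference of the primitives, and the decay of `kinkPrimitive`. -/
theorem logCosh_sub_bounds (c s : ℝ) : - c * kinkProfile 0 s ≤ logCosh c s - logCosh 0 s ∧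
    logCosh c s - logCosh 0 s ≤ - c * kinkProfile c s := by
  have e1 : logCosh c s = logCosh 0 (s - c) := by simp [logCosh]
  have e2 : kinkProfile c s = kinkProfile 0 (s - c) := by simp [kinkProfile]
  have h1 := logCosh_tangent s (s - c)
  have h2 := logCosh_tangent (s - c) s
  rw [e1, e2]
  constructor <;> linarith

theorem mul_kinkProfile_sub_nonneg (c s : ℝ) : 0 ≤ c * (kinkProfile 0 s - kinkProfile c s) := by
  have := logCosh_sub_bounds c s; linarith [this.1, this.2]

/-- The integrand is nonnegative with a primitive bounded by c², so its integral is at most the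
oscillation 2c². -/
theorem integrable_kinkProfile_sub (c : ℝ) :
    Integrable (fun s => c * (kinkProfile 0 s - kinkProfile c s)) ∧
      ∫ s, c * (kinkProfile 0 s - kinkProfile c s) ≤ 2 * c ^ 2 := by
  have hF : ∀ s, HasDerivAt (fun s => c * (logCosh 0 s - logCosh c s))
      (c * (kinkProfile 0 s - kinkProfile c s)) s := fun s =>
    ((hasDerivAt_logCosh 0 s).sub (hasDerivAt_logCosh c s)).const_mul c
  have hc : Continuous fun s => c * (kinkProfile 0 s - kinkProfile c s) :=
    continuous_const.mul ((contDiff_kinkProfile 0).continuous.sub (contDiff_kinkProfile c).continuous)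
  have hK : ∀ s, |c * (logCosh 0 s - logCosh c s)| ≤ c ^ 2 := fun s => by
    have h := logCosh_sub_bounds c s
    have hb : |logCosh c s - logCosh 0 s| ≤ |c| := by
      have b : ∀ a, |c * kinkProfile a s| ≤ |c| := fun a => by
        rw [abs_mul]; exact mul_le_of_le_one_right (abs_nonneg _) (abs_kinkProfile_lt_one a s).le
      have b0 := abs_le.1 (b 0)
      have b1 := abs_le.1 (b c)
      rw [abs_le]; constructor <;> linarith [h.1, h.2, b0.2, b1.1]
    rw [abs_mul, abs_sub_comm, ← sq_abs c, sq]
    exact mul_le_mul_of_nonneg_left hb (abs_nonneg _)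
  exact ⟨integrable_of_hasDerivAt_of_bounded hF hc (mul_kinkProfile_sub_nonneg c) hK,
    integral_le_of_hasDerivAt_of_bounded hF hc (mul_kinkProfile_sub_nonneg c) hK⟩

theorem integrable_kink_sub_sq (c : ℝ) :
    Integrable (fun x : Space n => (kink n c x - kink n 0 x) ^ 2) (stripMeasure n) := by
  have sk := ((sp_kink (n := n) c).sub (sp_kink 0)).pow 2
  rcases eq_or_ne c 0 with rfl | hc
  · simp
  have i := (integrable_zCoord (n := n) (integrable_kinkProfile_sub c).1).const_mul (2 * |c|⁻¹)
  refine i.mono' sk.continuous.aestronglyMeasurable (Filter.Eventually.of_forall fun x => ?_)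
  have h1 := abs_le.1 (abs_kink_le_one c x)
  have h2 := abs_le.1 (abs_kink_le_one 0 x)
  have h3 := mul_kinkProfile_sub_nonneg c (zCoord x)
  have e : c * (kinkProfile 0 (zCoord x) - kinkProfile c (zCoord x)) = |c| * |kink n c x - kink n 0 x| := by
    rw [← abs_of_nonneg h3, abs_mul, abs_sub_comm]; rfl
  rw [Real.norm_eq_abs, abs_of_nonneg (sq_nonneg _), e, ← sq_abs, sq]
  have : |kink n c x - kink n 0 x| ≤ 2 := by rw [abs_le]; constructor <;> linarith [h1.1, h1.2, h2.1, h2.2]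
  have hc' := abs_ne_zero.2 hc
  rw [mul_assoc, inv_mul_cancel_left₀ hc']
  exact mul_le_mul_of_nonneg_right this (abs_nonneg _)

/-- The primitive of the difference of the kinks, corrected by a multiple of the kink so as to be
square integrable. -/
def kinkPrimitive (n : ℕ) (c : ℝ) (x : Space n) : ℝ :=
  logCosh c (zCoord x) - logCosh 0 (zCoord x) + c * kinkProfile c (zCoord x)

theorem sp_kinkPrimitive (c : ℝ) : SP (kinkPrimitive n c) :=
  ((SP.zfun (contDiff_logCosh c)).sub (SP.zfun (contDiff_logCosh 0))).add
    ((SP.zfun (contDiff_kinkProfile c)).const_mul c)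

theorem pz_kinkPrimitive (c : ℝ) (x : Space n) :
    pz (kinkPrimitive n c) x = kink n c x - kink n 0 x + c * slope n c x :=
  congrFun (pz_zfun fun s => ((hasDerivAt_logCosh c s).sub (hasDerivAt_logCosh 0 s)).add
    ((hasDerivAt_kinkProfile c s).const_mul c)) x

/-- The primitive is bounded in absolute value by c(v_0 - v_c), which is at most 2|c| and has
integral at most 2c². The cubic growth in |c| is the source of the factor (|c|+1)c² in the estimate
of dH/dt. -/
theorem kinkPrimitive_sq (c : ℝ) : Integrable (fun x => kinkPrimitive n c x ^ 2) (stripMeasure n) ∧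
    ∫ x, kinkPrimitive n c x ^ 2 ∂(stripMeasure n) ≤ 4 * (|c| * c ^ 2) := by
  obtain ⟨i, hi⟩ := integrable_kinkProfile_sub c
  have i' := (integrable_zCoord (n := n) i).const_mul (2 * |c|)
  have hb : ∀ x, kinkPrimitive n c x ^ 2 ≤
      2 * |c| * (c * (kinkProfile 0 (zCoord x) - kinkProfile c (zCoord x))) := fun x => by
    have h := logCosh_sub_bounds c (zCoord x)
    have h3 := mul_kinkProfile_sub_nonneg c (zCoord x)
    have h4 : c * (kinkProfile 0 (zCoord x) - kinkProfile c (zCoord x)) ≤ 2 * |c| := by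
      refine (le_abs_self _).trans ?_
      rw [abs_mul, mul_comm]
      refine mul_le_mul_of_nonneg_right ?_ (abs_nonneg _)
      have h1 := abs_le.1 (abs_kink_le_one c x)
      have h2 := abs_le.1 (abs_kink_le_one 0 x)
      change |kink n 0 x - kink n c x| ≤ 2
      rw [abs_le]; constructor <;> linarith [h1.1, h1.2, h2.1, h2.2]
    have h5 : |kinkPrimitive n c x| ≤ c * (kinkProfile 0 (zCoord x) - kinkProfile c (zCoord x)) := by
      unfold kinkPrimitive
      rw [abs_le]; constructor <;> linarith [h.1, h.2]
    rw [← sq_abs, sq]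
    exact mul_le_mul (h5.trans h4) h5 (abs_nonneg _) (by positivity)
  have iB : Integrable (fun x => kinkPrimitive n c x ^ 2) (stripMeasure n) :=
    i'.mono' ((sp_kinkPrimitive c).pow 2).continuous.aestronglyMeasurable
      (Filter.Eventually.of_forall fun x => by rw [Real.norm_eq_abs, abs_of_nonneg (sq_nonneg _)]; exact hb x)
  refine ⟨iB, (integral_mono iB i' hb).trans ?_⟩
  rw [integral_const_mul, integral_zCoord (φ := fun s => c * (kinkProfile 0 s - kinkProfile c s)) i.aestronglyMeasurable]
  nlinarith [mul_le_mul_of_nonneg_left hi (abs_nonneg c)]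

/-! ### Functions close to a kink -/

/-- The difference of a function and a kink. -/
def offset (w : Space n → ℝ) (c : ℝ) (x : Space n) : ℝ := w x - kink n c x

/-- The part of `G'(w)` of higher order in the difference to the kink. -/
def rest (w : Space n → ℝ) (c : ℝ) (x : Space n) : ℝ := 3 * kink n c x * offset w c x ^ 2 + offset w c x ^ 3

/-- A smooth function on the strip, uniformly close to a kink, with `w - v_c` in `H¹`, orthogonal to
the slope of the kink, and with chemical potential in `H¹`. -/
structure NearKink (w : Space n → ℝ) (c : ℝ) : Prop where
  sp : SP w
  small : ∀ x, |offset w c x| ≤ 1 / 10000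
  sq : Integrable (fun x => offset w c x ^ 2) (stripMeasure n)
  grad : Integrable (gradSq (offset w c)) (stripMeasure n)
  perp : ∫ x, offset w c x * slope n c x ∂(stripMeasure n) = 0
  chem_sq : Integrable (fun x => chem w x ^ 2) (stripMeasure n)
  chem_grad : Integrable (gradSq (chem w)) (stripMeasure n)

theorem Integrable.of_sq_le {a : Space n → ℝ} {b : Space n → ℝ} (ha : SP a)
    (ib : Integrable b (stripMeasure n)) (h : ∀ x, a x ^ 2 ≤ b x) :
    Integrable (fun x => a x ^ 2) (stripMeasure n) :=
  ib.mono' (ha.pow 2).continuous.aestronglyMeasurable (Filter.Eventually.of_forall fun x => by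
    rw [Real.norm_eq_abs, abs_of_nonneg (sq_nonneg _)]; exact h x)

theorem abs_well2_kink_le (c : ℝ) (x : Space n) : |well2 (kink n c) x| ≤ 11 :=
  abs_well2_le ((abs_kink_le_one c x).trans one_le_two)

theorem integrable_gradSq_mul {a f : Space n → ℝ} (ha : SP a) (hf : SP f) (h1 : ∀ x, |a x| ≤ 1)
    (h2 : ∀ x, gradSq a x ≤ 1) (i0 : Integrable (fun x => f x ^ 2) (stripMeasure n))
    (i1 : Integrable (gradSq f) (stripMeasure n)) :
    Integrable (gradSq fun x => a x * f x) (stripMeasure n) := by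
  refine ((i1.const_mul 2).add (i0.const_mul 2)).mono' (ha.mul hf).gradSq.continuous.aestronglyMeasurable
    (Filter.Eventually.of_forall fun x => ?_)
  rw [Real.norm_eq_abs, abs_of_nonneg (gradSq_nonneg _ _)]
  have h : gradSq (fun x => a x * f x) x ≤ 2 * (a x ^ 2 * gradSq f x) + 2 * (gradSq a x * f x ^ 2) := by
    simp only [gradSq, Finset.mul_sum, Finset.sum_mul]
    rw [← Finset.sum_add_distrib]
    refine Finset.sum_le_sum fun i _ => ?_
    rw [pd_mul _ ha hf]
    nlinarith [sq_nonneg (a x * pd i f x - pd i a x * f x)]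
  have h3 : a x ^ 2 ≤ 1 := by rw [← sq_abs]; exact pow_le_one₀ (abs_nonneg _) (h1 x)
  have h4 := mul_le_mul_of_nonneg_right h3 (gradSq_nonneg f x)
  have h5 := mul_le_mul_of_nonneg_right (h2 x) (sq_nonneg (f x))
  simp only [Pi.add_apply]
  linarith

namespace NearKink

variable {w : Space n → ℝ} {c : ℝ} (hw : NearKink w c)
include hw

theorem sp_offset : SP (offset w c) := hw.sp.sub (sp_kink c)

theorem sp_rest : SP (rest w c) :=
  (((sp_kink c).const_mul 3).mul (hw.sp_offset.pow 2)).add (hw.sp_offset.pow 3)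

/-- Exact Taylor expansion of the cubic G' at v_c; the zeroth order terms cancel by the equation of
the kink. So μ is the linearized operator applied to f, plus a remainder quadratic in f. -/
theorem chem_eq (x : Space n) : chem w x =
    - lap (offset w c) x + well2 (kink n c) x * offset w c x + rest w c x := by
  have h : lap (offset w c) x = lap w x - (kink n c x ^ 3 - kink n c x) := by
    unfold offset; rw [lap_sub hw.sp (sp_kink c), lap_kink]
  rw [h, chem, well2, rest]
  have : w x = kink n c x + offset w c x := by simp [offset]
  rw [this]; ring

theorem abs_rest_le (x : Space n) : |rest w c x| ≤ 4 * offset w c x ^ 2 := by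
  have h1 := abs_kink_le_one c x
  have h2 := hw.small x
  have e : rest w c x = (3 * kink n c x + offset w c x) * offset w c x ^ 2 := by rw [rest]; ring
  rw [e, abs_mul, abs_of_nonneg (sq_nonneg (offset w c x))]
  refine mul_le_mul_of_nonneg_right ((abs_add_le _ _).trans ?_) (sq_nonneg _)
  rw [abs_mul, abs_of_pos (by norm_num : (0 : ℝ) < 3)]
  linarith

/-- Here the uniform smallness of f acts: cubic terms become small multiples of f² and disappear
into the spectral gap. -/
theorem abs_offset_mul_rest_le (x : Space n) : |offset w c x * rest w c x| ≤ 4 / 10000 * offset w c x ^ 2 := by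
  rw [abs_mul]
  have := mul_le_mul (hw.small x) (hw.abs_rest_le x) (abs_nonneg _) (by norm_num)
  linarith

theorem rest_sq : Integrable (fun x => rest w c x ^ 2) (stripMeasure n) :=
  Integrable.of_sq_le hw.sp_rest (hw.sq.const_mul 1) fun x => by
    have h1 := hw.abs_rest_le x
    have h2 := hw.small x
    have h3 : |rest w c x| ≤ 1 * |offset w c x| := by
      rw [← sq_abs] at h1; nlinarith [abs_nonneg (offset w c x)]
    simpa using sq_le_of_abs_le h3

theorem well_sq : Integrable (fun x => (well2 (kink n c) x * offset w c x) ^ 2) (stripMeasure n) :=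
  Integrable.of_sq_le ((sp_kink c).well2.mul hw.sp_offset) (hw.sq.const_mul (11 ^ 2)) fun x =>
    sq_le_of_abs_le (by rw [abs_mul]; exact mul_le_mul_of_nonneg_right (abs_well2_kink_le c x) (abs_nonneg _))

theorem lap_sq : Integrable (fun x => lap (offset w c) x ^ 2) (stripMeasure n) :=
  Integrable.of_sq_le hw.sp_offset.lap (((hw.chem_sq.const_mul 3).add (hw.well_sq.const_mul 3)).add
    (hw.rest_sq.const_mul 3)) fun x => by
      have e : lap (offset w c) x = well2 (kink n c) x * offset w c x + rest w c x - chem w x := by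
        rw [hw.chem_eq]; ring
      simp only [Pi.add_apply]
      rw [e]
      set a := well2 (kink n c) x * offset w c x
      nlinarith [sq_nonneg (a - rest w c x), sq_nonneg (a + chem w x), sq_nonneg (rest w c x + chem w x)]

/-- The weak form of the equation for the difference to the kink. -/
theorem integral_mul_chem {A : Space n → ℝ} (hA : SP A) (i0 : Integrable (fun x => A x ^ 2) (stripMeasure n))
    (i1 : Integrable (gradSq A) (stripMeasure n)) :
    ∫ x, A x * chem w x ∂(stripMeasure n) =
      ∫ x, ((∑ i, pd i A x * pd i (offset w c) x) + A x * (well2 (kink n c) x * offset w c x)) ∂(stripMeasure n) +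
        ∫ x, A x * rest w c x ∂(stripMeasure n) := by
  have sf := hw.sp_offset
  have j1 := integrable_sum_pd_mul hA sf i1 hw.grad
  have j2 := hA.integrable_mul sf.lap i0 hw.lap_sq
  have j3 := hA.integrable_mul sf.pz i0 (sf.integrable_pd_sq hw.grad (Fin.last n))
  have j4 := hA.integrable_mul ((sp_kink c).well2.mul sf) i0 hw.well_sq
  have j5 := hA.integrable_mul hw.sp_rest i0 hw.rest_sq
  have e := integral_inner_eq_neg hA sf j1 j2 j3
  have e2 : ∀ x, A x * chem w x = - (A x * lap (offset w c) x) + A x * (well2 (kink n c) x * offset w c x) +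
      A x * rest w c x := fun x => by rw [hw.chem_eq]; ring
  simp only [e2]
  have j24 : Integrable (fun x => - (A x * lap (offset w c) x) + A x * (well2 (kink n c) x * offset w c x))
    (stripMeasure n) := j2.neg.add j4
  have jn : Integrable (fun x => - (A x * lap (offset w c) x)) (stripMeasure n) := j2.neg
  rw [integral_add j24 j5, integral_add jn j4, integral_add j1 j4, e, integral_neg]

/-- The linearized operator is symmetric and annihilates ψ, so only the quadratic remainder of μ is
seen by ψ. -/
theorem integral_slope_mul_chem :
    ∫ x, slope n c x * chem w x ∂(stripMeasure n) = ∫ x, slope n c x * rest w c x ∂(stripMeasure n) := by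
  have sf := hw.sp_offset
  have sψ := sp_slope (n := n) c
  rw [hw.integral_mul_chem sψ (integrable_slope_sq c) (integrable_gradSq_slope c)]
  have j1 := integrable_sum_pd_mul sf sψ hw.grad (integrable_gradSq_slope c)
  have el : lap (slope n c) = fun x => well2 (kink n c) x * slope n c x := funext (lap_slope c)
  have j4 : Integrable (fun x => slope n c x * (well2 (kink n c) x * offset w c x)) (stripMeasure n) :=
    sψ.integrable_mul ((sp_kink c).well2.mul sf) (integrable_slope_sq c) hw.well_sq
  have e3 : ∀ x, offset w c x * lap (slope n c) x = slope n c x * (well2 (kink n c) x * offset w c x) :=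
    fun x => by rw [lap_slope]; ring
  have j2 : Integrable (fun x => offset w c x * lap (slope n c) x) (stripMeasure n) := by simpa only [e3] using j4
  have e := integral_inner_eq_neg sf sψ j1 j2
    (sf.integrable_mul sψ.pz hw.sq (sψ.integrable_pd_sq (integrable_gradSq_slope c) (Fin.last n)))
  simp only [e3, mul_comm (pd _ (offset w c) _)] at e
  simp only [mul_comm (pd _ (offset w c) _)] at j1
  rw [integral_add j1 j4, e]
  ring

/-- Orthogonality of f to ψ removes the kernel term from the spectral gap. -/
theorem integral_secondDensity_nonneg (hn : n ≤ 4) : ∫ x, offset w c x ^ 2 ∂(stripMeasure n) ≤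
    24 * ∫ x, secondDensity (kink n c) (offset w c) x ∂(stripMeasure n) := by
  have h := spectral_gap hn c hw.sp_offset hw.sq hw.grad
  rw [hw.perp] at h
  simpa using h

end NearKink

/-! #### A weight decaying more slowly than the slope of the kink -/

/-- The weight `1 / cosh`, at eight times the scale of the kink. -/
def slowSech (c s : ℝ) : ℝ := (Real.cosh (1 / (8 * √2) * (s - c)))⁻¹

theorem contDiff_slowSech (c : ℝ) : ContDiff ℝ ∞ (slowSech c) :=
  (Real.contDiff_cosh.comp (by fun_prop)).inv fun s => (Real.cosh_pos _).ne'

theorem slowSech_pos (c s : ℝ) : 0 < slowSech c s := inv_pos.2 (Real.cosh_pos _)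

theorem slowSech_le_one (c s : ℝ) : slowSech c s ≤ 1 := inv_le_one_of_one_le₀ (Real.one_le_cosh _)

theorem slowSech_sq (c s : ℝ) : slowSech c s ^ 2 = 1 - Real.tanh (1 / (8 * √2) * (s - c)) ^ 2 := by
  have h := Real.cosh_sq (1 / (8 * √2) * (s - c))
  have h1 := (Real.cosh_pos (1 / (8 * √2) * (s - c))).ne'
  rw [slowSech, Real.tanh_eq_sinh_div_cosh]
  generalize 1 / (8 * √2) * (s - c) = y at *
  field_simp
  linarith

theorem hasDerivAt_slowSech (c s : ℝ) : HasDerivAt (slowSech c)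
    (- (1 / (8 * √2)) * Real.tanh (1 / (8 * √2) * (s - c)) * slowSech c s) s := by
  have h := ((((hasDerivAt_id s).sub_const c).const_mul (1 / (8 * √2))).cosh).fun_inv (Real.cosh_pos _).ne'
  refine h.congr_deriv ?_
  rw [slowSech, Real.tanh_eq_sinh_div_cosh]
  have h1 := (Real.cosh_pos (1 / (8 * √2) * (s - c))).ne'
  simp only [id]
  generalize 1 / (8 * √2) = l at *
  field_simp

/-- Three doublings of the argument, each multiplying cosh - 1 by at least 4. -/
theorem cosh_sub_one_le (t : ℝ) : 64 * (Real.cosh t - 1) ≤ Real.cosh (8 * t) - 1 := by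
  have h : ∀ t, 4 * (Real.cosh t - 1) ≤ Real.cosh (2 * t) - 1 := fun t => by
    rw [Real.cosh_two_mul]
    nlinarith [Real.cosh_sq t, Real.one_le_cosh t]
  have h1 := h t
  have h2 := h (2 * t)
  have h3 := h (2 * (2 * t))
  rw [show 8 * t = 2 * (2 * (2 * t)) by ring]
  linarith

theorem cosh_sq_mul_kinkSlope (c s : ℝ) :
    √2 * Real.cosh (8 * (1 / (8 * √2) * (s - c))) ^ 2 * kinkSlope c s = 1 := by
  have := kinkSlope_mul_invSlope c s
  rw [invSlope] at this
  rw [show 8 * (1 / (8 * √2) * (s - c)) = (s - c) / √2 by field_simp]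
  linarith

/-- The squared slow weight dominates ψ, so bounds with the slow weight imply bounds with ψ. -/
theorem kinkSlope_le_slowSech_sq (c s : ℝ) : kinkSlope c s ≤ slowSech c s ^ 2 := by
  have h := cosh_sq_mul_kinkSlope c s
  have h2 := cosh_sub_one_le (1 / (8 * √2) * (s - c))
  rw [slowSech]
  generalize 1 / (8 * √2) * (s - c) = y at *
  have h1 := Real.one_le_cosh y
  rw [inv_pow, le_inv_comm₀ (kinkSlope_pos c s) (by positivity), inv_eq_of_mul_eq_one_left h]
  have h3 : 1 ≤ √2 := by nlinarith [sqrt_two_sq, Real.sqrt_nonneg 2]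
  have h4 := pow_le_pow_left₀ (by linarith) (by linarith : Real.cosh y ≤ Real.cosh (8 * y)) 2
  nlinarith [sq_nonneg (Real.cosh (8 * y))]

/-- The slow weight differs markedly from one only where ψ is already tiny. Multiplying f by it
therefore almost preserves orthogonality to ψ. -/
theorem inv_slowSech_sub_one_sq_mul (c s : ℝ) : ((slowSech c s)⁻¹ - 1) ^ 2 * kinkSlope c s ≤ 1 / 4096 := by
  have h := cosh_sq_mul_kinkSlope c s
  have h2 := cosh_sub_one_le (1 / (8 * √2) * (s - c))
  rw [slowSech, inv_inv]
  generalize 1 / (8 * √2) * (s - c) = y at *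
  have h1 := Real.one_le_cosh y
  have hs := (kinkSlope_pos c s).le
  have h3 : 1 ≤ √2 := by nlinarith [sqrt_two_sq, Real.sqrt_nonneg 2]
  have h4 : (Real.cosh y - 1) ^ 2 ≤ 1 / 4096 * Real.cosh (8 * y) ^ 2 := by
    have : Real.cosh y - 1 ≤ 1 / 64 * Real.cosh (8 * y) := by linarith
    have := pow_le_pow_left₀ (by linarith) this 2
    linarith
  have h5 := mul_le_mul_of_nonneg_right h4 hs
  have h6 : 0 ≤ Real.cosh (8 * y) ^ 2 * kinkSlope c s := by positivity
  nlinarith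

theorem integrable_slowSech_sq (c : ℝ) : Integrable (fun s => slowSech c s ^ 2) ∧ ∫ s, slowSech c s ^ 2 ≤ 23 := by
  have hF : ∀ s, HasDerivAt (fun s => 8 * √2 * Real.tanh (1 / (8 * √2) * (s - c))) (slowSech c s ^ 2) s := fun s => by
    have h := ((hasDerivAt_tanh_mul (1 / (8 * √2)) (s - c)).comp s ((hasDerivAt_id s).sub_const c)).const_mul (8 * √2)
    refine h.congr_deriv ?_
    rw [slowSech_sq, mul_one, ← mul_assoc, mul_one_div_cancel (by positivity), one_mul]
  have hc := (contDiff_slowSech c).continuous.pow 2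
  have hK : ∀ s, |8 * √2 * Real.tanh (1 / (8 * √2) * (s - c))| ≤ 8 * √2 := fun s => by
    rw [abs_mul, abs_of_nonneg (by positivity : 0 ≤ 8 * √2)]
    exact mul_le_of_le_one_right (by positivity) (Real.abs_tanh_lt_one _).le
  have h2 : √2 ≤ 23 / 16 := by
    rw [show (23 : ℝ) / 16 = √((23 / 16) ^ 2) from (Real.sqrt_sq (by norm_num)).symm]
    exact Real.sqrt_le_sqrt (by norm_num)
  exact ⟨integrable_of_hasDerivAt_of_bounded hF hc (fun _ => sq_nonneg _) hK,
    (integral_le_of_hasDerivAt_of_bounded hF hc (fun _ => sq_nonneg _) hK).trans (by linarith)⟩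

/-! #### Control of the difference to the kink by the dissipation -/

theorem abs_le_of_sq_le_mul {x a b s : ℝ} (ha : 0 ≤ a) (hb : 0 ≤ b) (hs : 0 < s) (h : x ^ 2 ≤ a * b) :
    |x| ≤ s * a + 1 / (4 * s) * b := by
  refine abs_le_of_sq_le_sq (h.trans ?_) (by positivity)
  have e : (s * a + 1 / (4 * s) * b) ^ 2 = a * b + (s * a - 1 / (4 * s) * b) ^ 2 := by field_simp; ring
  rw [e]; linarith [sq_nonneg (s * a - 1 / (4 * s) * b)]

/-- The arithmetic of the weighted estimate, with e the slow weight: P = ∫(ef)², Y = ∫(e(μ-M))², S =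
∫e², Q the second variation at ef, X = ∫e²fμ, t = ⟨ef,ψ⟩², r the pairing of ψ with the remainder,
and x₁, x₂, x₃ the pairings ⟨ef, e(μ-M)⟩, ∫e²f and ⟨ψ, μ-M⟩. The coefficients of P on the right add
up to less than one, so P is absorbed. -/
theorem le_of_weighted_bounds {P Y S Q X x₁ x₂ x₃ M r t : ℝ} (hP : 0 ≤ P) (hY : 0 ≤ Y)
    (hS : S ≤ 23) (gap : P ≤ 24 * Q + 2 * t) (ht : t ≤ P * (2 / 4096))
    (hQ : Q ≤ X + (4 / 10000 + 1 / 128) * P) (hX : X = x₁ + M * x₂) (h1 : x₁ ^ 2 ≤ P * Y)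
    (h2 : x₂ ^ 2 ≤ S * P) (h2' : |x₂| ≤ 1 / 10000 * S) (hM : 2 * M = r - x₃) (h3 : x₃ ^ 2 ≤ 2 * Y)
    (hr : |r| ≤ 4 * P) : P ≤ 10 ^ 5 * Y := by
  have b1 := (abs_le.1 (abs_le_of_sq_le_mul hP hY (s := 1 / 160) (by norm_num) h1)).2
  have b2 : |r * x₂| ≤ 4 * P * (23 / 10000) := by
    rw [abs_mul]; exact mul_le_mul hr (by linarith) (abs_nonneg _) (by linarith)
  have h4 : (x₃ * x₂) ^ 2 ≤ P * (46 * Y) := by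
    rw [mul_pow]
    have : x₂ ^ 2 ≤ 23 * P := h2.trans (mul_le_mul_of_nonneg_right hS hP)
    have := mul_le_mul h3 this (sq_nonneg _) (by linarith)
    linarith
  have b3 := abs_le_of_sq_le_mul hP (by linarith) (s := 1 / 160) (by norm_num) h4
  have e : X = x₁ + (r * x₂ - x₃ * x₂) / 2 := by rw [hX]; linear_combination (x₂ / 2) * hM
  have b2' := (abs_le.1 b2).2
  have b3' := (abs_le.1 b3).1
  norm_num at b1 b3'
  linarith

/-- The weight `slowSech` on the strip. -/
def slowWeight (n : ℕ) (c : ℝ) (x : Space n) : ℝ := slowSech c (zCoord x)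

theorem sp_slowWeight (c : ℝ) : SP (slowWeight n c) := SP.zfun (contDiff_slowSech c)

theorem gradSq_slowWeight_le (c : ℝ) (x : Space n) : gradSq (slowWeight n c) x ≤ 1 / 128 * slowWeight n c x ^ 2 := by
  have e : gradSq (slowWeight n c) x = (- (1 / (8 * √2)) * Real.tanh (1 / (8 * √2) * (zCoord x - c)) *
      slowWeight n c x) ^ 2 := by
    have h : ∀ i, pd i (slowWeight n c) x = _ := fun i => congrFun (pd_zfun (hasDerivAt_slowSech c) i) x
    simp [gradSq, h, slowWeight]
  rw [e, mul_pow, mul_pow, neg_sq, div_pow, mul_pow, sqrt_two_sq]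
  have := Real.tanh_sq_lt_one (1 / (8 * √2) * (zCoord x - c))
  refine mul_le_mul_of_nonneg_right ?_ (sq_nonneg _)
  linarith

/-- Localization formula for the second variation. -/
theorem secondDensity_mul {e f : Space n → ℝ} (he : SP e) (hf : SP f) (v : Space n → ℝ) (x : Space n) :
    (∑ i, pd i (fun x => e x * (e x * f x)) x * pd i f x) + e x * (e x * f x) * (well2 v x * f x) =
      secondDensity v (fun x => e x * f x) x - gradSq e x * f x ^ 2 := by
  have h : ∀ i, pd i (fun x => e x * (e x * f x)) x * pd i f x =
      pd i (fun x => e x * f x) x ^ 2 - pd i e x ^ 2 * f x ^ 2 := fun i => by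
    rw [pd_mul _ he (he.mul hf), pd_mul _ he hf]; ring
  simp only [h, Finset.sum_sub_distrib, ← Finset.sum_mul, secondDensity, gradSq]
  ring

namespace NearKink

variable {w : Space n → ℝ} {c : ℝ} (hw : NearKink w c)
include hw

/-- On the unbounded strip ∇μ does not control μ, nor f in L²; a decaying weight restores control.
Test the equation for f with e²f, where e decays so slowly that |∇e|² ≤ e²/128 is harmless. The
spectral gap for ef bounds P = ∫(ef)² by ∫e²fμ. Weighted Poincaré gives μ up to a constant M, and
pairing with ψ shows that M is quadratic in f up to √D. The product of M with ∫e²f is small because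
f is uniformly small, and P is absorbed. Finally ψ ≤ e². -/
theorem integral_slope_mul_sq_le (hn : n ≤ 4) : ∫ x, slope n c x * offset w c x ^ 2 ∂(stripMeasure n) ≤
    10 ^ 9 * ∫ x, gradSq (chem w) x ∂(stripMeasure n) := by
  have sf := hw.sp_offset
  have sμ := hw.sp.chem
  have sψ := sp_slope (n := n) c
  have se := sp_slowWeight (n := n) c
  have iψ2 := integrable_slope_sq (n := n) c
  set f := offset w c
  set e := slowWeight n c with he
  set μ := chem w
  have e0 : ∀ x, 0 < e x := fun x => slowSech_pos _ _
  have e1 : ∀ x, |e x| ≤ 1 := fun x => by rw [abs_of_pos (e0 x)]; exact slowSech_le_one _ _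
  have ee : ∀ x, e x ^ 2 ≤ 1 := fun x => pow_le_one₀ (e0 x).le (slowSech_le_one _ _)
  have eψ : ∀ x, slope n c x ≤ e x ^ 2 := fun x => kinkSlope_le_slowSech_sq _ _
  have sp := se.mul sf
  have ge : ∀ x, gradSq e x ≤ 1 / 128 * e x ^ 2 := gradSq_slowWeight_le c
  have ge1 : ∀ x, gradSq e x ≤ 1 := fun x => by linarith [ge x, ee x]
  have ip : Integrable (fun x => (e x * f x) ^ 2) (stripMeasure n) :=
    Integrable.of_sq_le sp (hw.sq.const_mul 1) fun x => by
      rw [mul_pow]; exact mul_le_mul_of_nonneg_right (ee x) (sq_nonneg _)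
  have ipg := integrable_gradSq_mul se sf e1 ge1 hw.sq hw.grad
  have iep : Integrable (fun x => (e x * (e x * f x)) ^ 2) (stripMeasure n) :=
    Integrable.of_sq_le (se.mul sp) (ip.const_mul 1) fun x => by
      rw [mul_pow]; exact mul_le_mul_of_nonneg_right (ee x) (sq_nonneg _)
  have iepg := integrable_gradSq_mul se sp e1 ge1 ip ipg
  obtain ⟨is1, is2⟩ := integrable_slowSech_sq c
  have ie : Integrable (fun x => e x ^ 2) (stripMeasure n) := integrable_zCoord (n := n) is1
  have hS : ∫ x, e x ^ 2 ∂(stripMeasure n) ≤ 23 := by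
    rw [show (fun x => e x ^ 2) = fun x => (fun s => slowSech c s ^ 2) (zCoord x) from rfl,
      integral_zCoord is1.aestronglyMeasurable]
    exact is2
  set P := ∫ x, (e x * f x) ^ 2 ∂(stripMeasure n) with hPd
  have hP : 0 ≤ P := integral_nonneg fun _ => sq_nonneg _
  -- weighted Poincaré inequality for the chemical potential
  obtain ⟨M, hM⟩ := weighted_poincare (hardyWeight_sech_sq (l := 1 / (8 * √2)) (by positivity)) sμ c
  have hl : (4 : ℝ) / (1 / (8 * √2)) ^ 2 = 512 := by rw [div_pow, mul_pow, sqrt_two_sq]; norm_num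
  have eT : ∀ x : Space n, 1 - Real.tanh (1 / (8 * √2) * (zCoord x - c)) ^ 2 = e x ^ 2 := fun x => (slowSech_sq _ _).symm
  simp only [eT, hl] at hM
  have sμM : SP fun x => e x * (μ x - M) := se.mul (sμ.sub (SP.const M))
  have hD0 : 0 ≤ ∫ x, gradSq μ x ∂(stripMeasure n) := integral_nonneg fun x => gradSq_nonneg _ _
  have hn' : (n : ℝ) ≤ 4 := by exact_mod_cast hn
  -- The constant is 1032 = 2(4 + 512), with n ≤ 4 and the Hardy constant 4/l² = 512.
  have hM2 : ∫⁻ x, ENNReal.ofReal ((e x * (μ x - M)) ^ 2) ∂(stripMeasure n) ≤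
      ENNReal.ofReal (1032 * ∫ x, gradSq μ x ∂(stripMeasure n)) := by
    simp only [mul_pow]
    refine hM.trans ?_
    rw [ENNReal.ofReal_mul (by norm_num : (0 : ℝ) ≤ 1032), ← lintegral_ofReal_eq hw.chem_grad (gradSq_nonneg _)]
    refine mul_le_mul' (ENNReal.ofReal_le_ofReal (by linarith)) (lintegral_mono fun x => ENNReal.ofReal_le_ofReal ?_)
    exact mul_le_of_le_one_left (gradSq_nonneg _ _) (ee x)
  have iY : Integrable (fun x => (e x * (μ x - M)) ^ 2) (stripMeasure n) :=
    integrable_of_lintegral_le (sμM.pow 2).continuous.aestronglyMeasurable (fun x => sq_nonneg _)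
      (hM2.trans_lt ENNReal.ofReal_lt_top)
  set Y := ∫ x, (e x * (μ x - M)) ^ 2 ∂(stripMeasure n) with hYd
  have hY0 : 0 ≤ Y := integral_nonneg fun _ => sq_nonneg _
  have hYD : Y ≤ 1032 * ∫ x, gradSq μ x ∂(stripMeasure n) := by
    rw [lintegral_ofReal_eq iY fun x => sq_nonneg _] at hM2
    exact (ENNReal.ofReal_le_ofReal_iff (by positivity)).1 hM2
  -- the second variation at the localized function
  have gap := spectral_gap hn c sp ip ipg
  set Q := ∫ x, secondDensity (kink n c) (fun x => e x * f x) x ∂(stripMeasure n) with hQd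
  set X := ∫ x, e x * (e x * f x) * μ x ∂(stripMeasure n) with hXd
  have igf : Integrable (fun x => gradSq e x * f x ^ 2) (stripMeasure n) :=
    se.gradSq.integrable_bdd_mul (fun x => by rw [abs_of_nonneg (gradSq_nonneg _ _)]; exact ge1 x) hw.sq
  have iQ : Integrable (secondDensity (kink n c) fun x => e x * f x) (stripMeasure n) :=
    ipg.add ((sp_kink c).well2.integrable_bdd_mul (abs_well2_kink_le c) ip)
  have ier := (se.mul sp).integrable_mul hw.sp_rest iep hw.rest_sq
  have hXQ : X = ∫ x, (secondDensity (kink n c) (fun x => e x * f x) x - gradSq e x * f x ^ 2) ∂(stripMeasure n) +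
      ∫ x, e x * (e x * f x) * rest w c x ∂(stripMeasure n) := by
    rw [hXd, hw.integral_mul_chem (se.mul sp) iep iepg]
    congr 1
    exact integral_congr_ae (Filter.Eventually.of_forall fun x => secondDensity_mul se sf (kink n c) x)
  rw [integral_sub iQ igf] at hXQ
  have hg : ∫ x, gradSq e x * f x ^ 2 ∂(stripMeasure n) ≤ 1 / 128 * P := by
    rw [hPd, ← integral_const_mul]
    refine integral_mono igf (ip.const_mul _) fun x => ?_
    have := mul_le_mul_of_nonneg_right (ge x) (sq_nonneg (f x))
    simp only [mul_pow]; linarith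
  have hr : - (4 / 10000 * P) ≤ ∫ x, e x * (e x * f x) * rest w c x ∂(stripMeasure n) := by
    rw [hPd, ← integral_const_mul, ← integral_neg]
    refine integral_mono (ip.const_mul _).neg ier fun x => ?_
    have h := mul_le_mul_of_nonneg_left (abs_le.1 (hw.abs_offset_mul_rest_le x)).1 (sq_nonneg (e x))
    simp only [mul_pow]
    calc _ = e x ^ 2 * -(4 / 10000 * f x ^ 2) := by ring
      _ ≤ _ := h
      _ = _ := by ring
  have hQ : Q ≤ X + (4 / 10000 + 1 / 128) * P := by linarith
  -- the component along the slope
  set φ : Space n → ℝ := fun x => ((e x)⁻¹ - 1) * slope n c x with hφ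
  have sei : SP fun x => (e x)⁻¹ := SP.zfun ((contDiff_slowSech c).inv fun s => (slowSech_pos c s).ne')
  have sφ : SP φ := (sei.sub (SP.const 1)).mul sψ
  have hφ2 : ∀ x, φ x ^ 2 ≤ 1 / 4096 * slope n c x := fun x => by
    have := mul_le_mul_of_nonneg_right (inv_slowSech_sub_one_sq_mul c (zCoord x)) (slope_pos c x).le
    calc φ x ^ 2 = ((slowSech c (zCoord x))⁻¹ - 1) ^ 2 * kinkSlope c (zCoord x) * slope n c x := by
          simp only [hφ, he, slowWeight, slope]; ring
      _ ≤ _ := this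
  have iψ := integrable_slope (n := n) c
  have iφ : Integrable (fun x => φ x ^ 2) (stripMeasure n) := Integrable.of_sq_le sφ (iψ.const_mul _) hφ2
  have hφI : ∫ x, φ x ^ 2 ∂(stripMeasure n) ≤ 2 / 4096 := by
    have := integral_mono iφ (iψ.const_mul (1 / 4096)) hφ2
    rw [integral_const_mul, integral_slope] at this
    linarith
  have ipφ := sp.integrable_mul sφ ip iφ
  -- As f ⊥ ψ, the pairing ⟨ef,ψ⟩ equals -⟨ef,φ⟩ with φ = (1/e - 1)ψ, and φ is small in L².
  have ht : (∫ x, e x * f x * slope n c x ∂(stripMeasure n)) ^ 2 ≤ P * (2 / 4096) := by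
    have h1 : ∀ x, e x * f x * slope n c x = f x * slope n c x - e x * f x * φ x := fun x => by
      have := (e0 x).ne'
      simp only [hφ]; field_simp; ring
    simp only [h1]
    rw [integral_sub (sf.integrable_mul sψ hw.sq iψ2) ipφ, hw.perp, zero_sub, neg_sq]
    exact (sq_integral_mul_le ip iφ ipφ).trans (mul_le_mul_of_nonneg_left hφI hP)
  -- splitting off the mean of the chemical potential
  have i1 := sp.integrable_mul sμM ip iY
  have i2 := se.integrable_mul sp ie ip
  have hX : X = ∫ x, e x * f x * (e x * (μ x - M)) ∂(stripMeasure n) + M * ∫ x, e x * (e x * f x) ∂(stripMeasure n) := by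
    rw [hXd, ← integral_const_mul, ← integral_add i1 (i2.const_mul M)]
    exact integral_congr_ae (Filter.Eventually.of_forall fun x => by ring)
  have h2' : |∫ x, e x * (e x * f x) ∂(stripMeasure n)| ≤ 1 / 10000 * ∫ x, e x ^ 2 ∂(stripMeasure n) := by
    rw [← integral_const_mul]
    refine abs_integral_le_integral_abs.trans (integral_mono i2.abs (ie.const_mul _) fun x => ?_)
    have := mul_le_mul_of_nonneg_left (hw.small x) (sq_nonneg (e x))
    calc |e x * (e x * f x)| = e x ^ 2 * |f x| := by rw [abs_mul, abs_mul, abs_of_pos (e0 x)]; ring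
      _ ≤ _ := this
      _ = _ := by ring
  set a : Space n → ℝ := fun x => slope n c x * (e x)⁻¹ with ha
  have sa : SP a := sψ.mul sei
  have ha2 : ∀ x, a x ^ 2 ≤ slope n c x := fun x => by
    simp only [ha]
    rw [← div_eq_mul_inv, div_pow, div_le_iff₀ (by have := e0 x; positivity), pow_two]
    exact mul_le_mul_of_nonneg_left (eψ x) (slope_pos c x).le
  have ia : Integrable (fun x => a x ^ 2) (stripMeasure n) := Integrable.of_sq_le sa iψ ha2
  have iaY := sa.integrable_mul sμM ia iY
  have h3 : (∫ x, a x * (e x * (μ x - M)) ∂(stripMeasure n)) ^ 2 ≤ 2 * Y := by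
    refine (sq_integral_mul_le ia iY iaY).trans (mul_le_mul_of_nonneg_right ?_ hY0)
    rw [← integral_slope (n := n) c]; exact integral_mono ia iψ ha2
  have iψμ := sψ.integrable_mul sμ iψ2 hw.chem_sq
  -- Pair μ with ψ: ∫ψ = 2 and ∫ψμ equals the integral of ψ against the remainder. Dividing ψ by e
  -- is affordable because ψ ≤ e².
  have hMr : 2 * M = ∫ x, slope n c x * rest w c x ∂(stripMeasure n) -
      ∫ x, a x * (e x * (μ x - M)) ∂(stripMeasure n) := by
    have : ∀ x, a x * (e x * (μ x - M)) = slope n c x * μ x - M * slope n c x := fun x => by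
      have := (e0 x).ne'
      simp only [ha]; field_simp
    simp only [this]
    rw [integral_sub iψμ (iψ.const_mul M), integral_const_mul, integral_slope, hw.integral_slope_mul_chem]
    ring
  have iψf : Integrable (fun x => slope n c x * f x ^ 2) (stripMeasure n) :=
    sψ.integrable_bdd_mul (abs_slope_le_one c) hw.sq
  have hψf : ∫ x, slope n c x * f x ^ 2 ∂(stripMeasure n) ≤ P :=
    integral_mono iψf ip fun x => by
      simp only [mul_pow]; exact mul_le_mul_of_nonneg_right (eψ x) (sq_nonneg _)
  have hrr : |∫ x, slope n c x * rest w c x ∂(stripMeasure n)| ≤ 4 * P := by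
    have : |∫ x, slope n c x * rest w c x ∂(stripMeasure n)| ≤
        ∫ x, 4 * (slope n c x * f x ^ 2) ∂(stripMeasure n) := by
      refine abs_integral_le_integral_abs.trans (integral_mono
        (sψ.integrable_mul hw.sp_rest iψ2 hw.rest_sq).abs (iψf.const_mul _) fun x => ?_)
      have := mul_le_mul_of_nonneg_left (hw.abs_rest_le x) (slope_pos c x).le
      simp only [abs_mul, abs_of_pos (slope_pos c x)]
      linarith
    rw [integral_const_mul] at this
    linarith
  have hN := half_le_kinkEnergy
  have hgap : P ≤ 24 * Q + 2 * (∫ x, e x * f x * slope n c x ∂(stripMeasure n)) ^ 2 := by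
    have : (∫ x, e x * f x * slope n c x ∂(stripMeasure n)) ^ 2 / kinkEnergy ≤
        2 * (∫ x, e x * f x * slope n c x ∂(stripMeasure n)) ^ 2 := by
      rw [div_le_iff₀ (by linarith)]
      nlinarith [sq_nonneg (∫ x, e x * f x * slope n c x ∂(stripMeasure n))]
    linarith
  have := le_of_weighted_bounds hP hY0 hS hgap ht hQ hX (sq_integral_mul_le ip iY i1)
    (sq_integral_mul_le ie ip i2) h2' hMr h3 hrr
  linarith

end NearKink

/-! ### Bounds on the energy gap and on the derivatives of the distance and the dissipation -/

namespace NearKink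

variable {w : Space n → ℝ} {c : ℝ} (hw : NearKink w c)
include hw

theorem integrable_secondDensity : Integrable (secondDensity (kink n c) (offset w c)) (stripMeasure n) :=
  hw.grad.add ((sp_kink c).well2.integrable_bdd_mul (abs_well2_kink_le c) hw.sq)

theorem integrable_slope_mul_sq : Integrable (fun x => slope n c x * offset w c x ^ 2) (stripMeasure n) :=
  (sp_slope c).integrable_bdd_mul (abs_slope_le_one c) hw.sq

/-- Exact expansion of the energy at the kink: the first term integrates to the energy of the kink,
the linear term is a z-derivative because the kink is critical, and the remainder beyond the second
variation is f² times a small factor. -/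
theorem energyDensity_eq (x : Space n) : energyDensity w x = slope n c x ^ 2 +
    pz (fun x => slope n c x * offset w c x) x + 1 / 2 * secondDensity (kink n c) (offset w c) x +
    (kink n c x + 1 / 4 * offset w c x) * offset w c x * offset w c x ^ 2 := by
  have sf := hw.sp_offset
  have hwe : w = fun x => kink n c x + offset w c x := funext fun x => by simp [offset]
  have hpd : ∀ i, pd i w x = (if i = Fin.last n then slope n c x else 0) + pd i (offset w c) x := fun i => by
    conv_lhs => rw [hwe, pd_add _ (sp_kink c) sf]
    simp only [pd_kink, slope]
  have hg : gradSq w x = gradSq (offset w c) x + (slope n c x ^ 2 + 2 * slope n c x * pz (offset w c) x) := by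
    have : ∀ i, pd i w x ^ 2 = pd i (offset w c) x ^ 2 + if i = Fin.last n then
        slope n c x ^ 2 + 2 * slope n c x * pz (offset w c) x else 0 := fun i => by
      rw [hpd]
      split_ifs with hi
      · rw [hi, pz]; ring
      · ring
    simp only [gradSq, this, Finset.sum_add_distrib, Finset.sum_ite_eq', Finset.mem_univ, if_true]
  have hp : pz (fun x => slope n c x * offset w c x) x =
      (kink n c x ^ 3 - kink n c x) * offset w c x + slope n c x * pz (offset w c) x := by
    have h := pz_slope c x
    rw [← kink_cube_sub] at h
    rw [pz, pd_mul _ (sp_slope c) sf]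
    change slope n c x * pz (offset w c) x + pz (slope n c) x * offset w c x = _
    rw [h, add_comm]
  have hs : slope n c x ^ 2 = (1 - kink n c x ^ 2) ^ 2 / 2 := by rw [slope_eq, div_pow, sqrt_two_sq]
  have hwx : w x = kink n c x + offset w c x := congrFun hwe x
  rw [energyDensity, hg, hp, hs, secondDensity, well2, doubleWell, hwx]
  ring

/-- By the spectral gap the second variation dominates the small multiple of ∫f² left by the cubic
and quartic terms, so the energy gap is nonnegative. -/
theorem integrable_energyDensity_and_le (hn : n ≤ 4) : Integrable (energyDensity w) (stripMeasure n) ∧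
    kinkEnergy ≤ ∫ x, energyDensity w x ∂(stripMeasure n) := by
  have sf := hw.sp_offset
  have sψ := sp_slope (n := n) c
  have iS := integrable_slope_sq (n := n) c
  have ipz : Integrable (pz fun x => slope n c x * offset w c x) (stripMeasure n) := by
    rw [pz, pd_mul _ sψ sf]
    exact (sψ.integrable_mul sf.pz iS (sf.integrable_pd_sq hw.grad (Fin.last n))).add
      (sψ.pz.integrable_mul sf (sψ.integrable_pd_sq (integrable_gradSq_slope c) (Fin.last n)) hw.sq)
  have iQ := hw.integrable_secondDensity
  have hb : ∀ x, |(kink n c x + 1 / 4 * offset w c x) * offset w c x| ≤ 2 / 10000 := fun x => by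
    have h1 := hw.small x
    rw [abs_mul]
    have : |kink n c x + 1 / 4 * offset w c x| ≤ 2 := by
      refine (abs_add_le _ _).trans ?_
      rw [abs_mul, abs_of_pos (by norm_num : (0 : ℝ) < 1 / 4)]
      linarith [abs_kink_le_one c x]
    have := mul_le_mul this h1 (abs_nonneg _) zero_le_two
    linarith
  have iR : Integrable (fun x => (kink n c x + 1 / 4 * offset w c x) * offset w c x * offset w c x ^ 2)
      (stripMeasure n) :=
    (((sp_kink c).add (sf.const_mul (1 / 4))).mul sf).integrable_bdd_mul hb hw.sq
  have j1 : Integrable (fun x => slope n c x ^ 2 + pz (fun x => slope n c x * offset w c x) x) (stripMeasure n) :=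
    iS.add ipz
  have j2 : Integrable (fun x => slope n c x ^ 2 + pz (fun x => slope n c x * offset w c x) x +
    1 / 2 * secondDensity (kink n c) (offset w c) x) (stripMeasure n) := j1.add (iQ.const_mul _)
  have e := hw.energyDensity_eq
  refine ⟨(j2.add iR).congr (Filter.Eventually.of_forall fun x => (e x).symm), ?_⟩
  simp only [e]
  rw [integral_add j2 iR, integral_add j1 (iQ.const_mul _), integral_add iS ipz, integral_const_mul,
    integral_slope_sq, integral_pz_eq_zero (sψ.mul sf) (sψ.integrable_mul sf iS hw.sq) ipz]
  have h1 := hw.integral_secondDensity_nonneg hn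
  have h2 : - (2 / 10000 * ∫ x, offset w c x ^ 2 ∂(stripMeasure n)) ≤
      ∫ x, (kink n c x + 1 / 4 * offset w c x) * offset w c x * offset w c x ^ 2 ∂(stripMeasure n) := by
    rw [← integral_const_mul, ← integral_neg]
    refine integral_mono (hw.sq.const_mul _).neg iR fun x => ?_
    have := mul_le_mul_of_nonneg_right (abs_le.1 (hb x)).1 (sq_nonneg (offset w c x))
    simp only; linarith
  have h3 : 0 ≤ ∫ x, offset w c x ^ 2 ∂(stripMeasure n) := integral_nonneg fun _ => sq_nonneg _
  linarith

theorem abs_integral_slope_mul_rest_le : |∫ x, slope n c x * rest w c x ∂(stripMeasure n)| ≤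
    4 * ∫ x, slope n c x * offset w c x ^ 2 ∂(stripMeasure n) := by
  rw [← integral_const_mul]
  refine abs_integral_le_integral_abs.trans (integral_mono ((sp_slope c).integrable_mul hw.sp_rest
    (integrable_slope_sq c) hw.rest_sq).abs (hw.integrable_slope_mul_sq.const_mul _) fun x => ?_)
  have := mul_le_mul_of_nonneg_left (hw.abs_rest_le x) (slope_pos c x).le
  simp only [abs_mul, abs_of_pos (slope_pos c x)]
  linarith

/-- Split u - v_0 = f + (v_c - v_0). The pairing of f with μ is the second variation up to cubic
terms and is nonnegative. For the other part, adding cψ gives v_c - v_0 a square integrable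
primitive, and integration by parts leaves ∂_zμ, controlled by √D. The correction c∫ψμ is quadratic
in f. -/
theorem neg_pairing_le (hn : n ≤ 4) :
    -2 * ∫ x, (w x - kink n 0 x) * chem w x ∂(stripMeasure n) ≤
      10 ^ 6 * √((|c| + 1) * c ^ 2 * ∫ x, gradSq (chem w) x ∂(stripMeasure n)) := by
  have sf := hw.sp_offset
  have sμ := hw.sp.chem
  have sψ := sp_slope (n := n) c
  have sB := sp_kinkPrimitive (n := n) c
  have sk := (sp_kink (n := n) c).sub (sp_kink 0)
  obtain ⟨iB, hB⟩ := kinkPrimitive_sq (n := n) c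
  have iμz := sμ.integrable_pd_sq hw.chem_grad (Fin.last n)
  set D := ∫ x, gradSq (chem w) x ∂(stripMeasure n)
  have hD : 0 ≤ D := integral_nonneg fun x => gradSq_nonneg _ _
  set Z := (|c| + 1) * c ^ 2 * D with hZ
  have hc := abs_nonneg c
  have hZ0 : 0 ≤ Z := by positivity
  have ifμ := sf.integrable_mul sμ hw.sq hw.chem_sq
  have ikμ := sk.integrable_mul sμ (integrable_kink_sub_sq c) hw.chem_sq
  have iψμ := sψ.integrable_mul sμ (integrable_slope_sq c) hw.chem_sq
  have iBμ := sB.integrable_mul sμ iB hw.chem_sq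
  have iBμz := sB.integrable_mul sμ.pz iB iμz
  -- the part along the difference to the kink
  have h1 : 0 ≤ ∫ x, offset w c x * chem w x ∂(stripMeasure n) := by
    have e : ∫ x, offset w c x * chem w x ∂(stripMeasure n) =
        ∫ x, secondDensity (kink n c) (offset w c) x ∂(stripMeasure n) +
          ∫ x, offset w c x * rest w c x ∂(stripMeasure n) := by
      rw [hw.integral_mul_chem sf hw.sq hw.grad]
      congr 1
      refine integral_congr_ae (Filter.Eventually.of_forall fun x => ?_)
      simp only [secondDensity, gradSq, pow_two]; ring
    have h2 : - (4 / 10000 * ∫ x, offset w c x ^ 2 ∂(stripMeasure n)) ≤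
        ∫ x, offset w c x * rest w c x ∂(stripMeasure n) := by
      rw [← integral_const_mul, ← integral_neg]
      exact integral_mono (hw.sq.const_mul _).neg (sf.integrable_mul hw.sp_rest hw.sq hw.rest_sq)
        fun x => (abs_le.1 (hw.abs_offset_mul_rest_le x)).1
    have h3 : 0 ≤ ∫ x, offset w c x ^ 2 ∂(stripMeasure n) := integral_nonneg fun _ => sq_nonneg _
    linarith [hw.integral_secondDensity_nonneg hn]
  -- the part along the difference of the kinks
  have h2 : ∫ x, (kink n c x - kink n 0 x) * chem w x ∂(stripMeasure n) =
      - ∫ x, kinkPrimitive n c x * pz (chem w) x ∂(stripMeasure n) -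
        c * ∫ x, slope n c x * rest w c x ∂(stripMeasure n) := by
    have e : ∀ x, pz (fun x => kinkPrimitive n c x * chem w x) x = (kink n c x - kink n 0 x) * chem w x +
        c * (slope n c x * chem w x) + kinkPrimitive n c x * pz (chem w) x := fun x => by
      rw [pz, pd_mul _ sB sμ]
      change kinkPrimitive n c x * pz (chem w) x + pz (kinkPrimitive n c) x * chem w x = _
      rw [pz_kinkPrimitive]; ring
    have i12 : Integrable (fun x => (kink n c x - kink n 0 x) * chem w x + c * (slope n c x * chem w x))
      (stripMeasure n) := ikμ.add (iψμ.const_mul c)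
    have h0 := integral_pz_eq_zero (sB.mul sμ) iBμ
      ((i12.add iBμz).congr (Filter.Eventually.of_forall fun x => (e x).symm))
    simp only [e] at h0
    rw [integral_add i12 iBμz, integral_add ikμ (iψμ.const_mul c), integral_const_mul,
      hw.integral_slope_mul_chem] at h0
    linarith
  have h3 : |∫ x, kinkPrimitive n c x * pz (chem w) x ∂(stripMeasure n)| ≤ 2 * √Z := by
    refine abs_le_of_sq_le_sq ?_ (by positivity)
    rw [mul_pow, Real.sq_sqrt hZ0]
    have hz : ∫ x, pz (chem w) x ^ 2 ∂(stripMeasure n) ≤ D :=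
      integral_mono iμz hw.chem_grad fun x => pz_sq_le_gradSq _ x
    refine (sq_integral_mul_le iB iμz iBμz).trans ((mul_le_mul hB hz (integral_nonneg fun _ => sq_nonneg _)
      (by positivity)).trans ?_)
    rw [hZ]
    nlinarith [mul_nonneg (sq_nonneg c) hD]
  set W := ∫ x, slope n c x * offset w c x ^ 2 ∂(stripMeasure n) with hW
  have hW0 : 0 ≤ W := integral_nonneg fun x => mul_nonneg (slope_pos c x).le (sq_nonneg _)
  -- Both W ≤ 1 and W ≤ 10⁹D are used: their product bounds W² linearly in D, which is the scaling
  -- required for a bound by √D.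
  have hW1 : W ≤ 1 := by
    have : W ≤ ∫ x, 1 / 2 * slope n c x ∂(stripMeasure n) := by
      refine integral_mono hw.integrable_slope_mul_sq ((integrable_slope c).const_mul _) fun x => ?_
      have h : offset w c x ^ 2 ≤ 1 / 2 := by
        rw [← sq_abs]
        nlinarith [hw.small x, abs_nonneg (offset w c x)]
      simp only
      nlinarith [slope_pos c x]
    rw [integral_const_mul, integral_slope] at this
    linarith
  have hWD : W ≤ 10 ^ 9 * D := hw.integral_slope_mul_sq_le hn
  have h4 : |c| * W ≤ 40000 * √Z := by
    refine (le_abs_self _).trans (abs_le_of_sq_le_sq ?_ (by positivity))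
    rw [mul_pow, mul_pow, Real.sq_sqrt hZ0, sq_abs]
    have : W ^ 2 ≤ 10 ^ 9 * D := by nlinarith
    have h5 := mul_le_mul_of_nonneg_left this (sq_nonneg c)
    have h6 : c ^ 2 * D ≤ Z := by rw [hZ]; nlinarith [mul_nonneg (mul_nonneg hc (sq_nonneg c)) hD]
    linarith
  have h5 : |c * ∫ x, slope n c x * rest w c x ∂(stripMeasure n)| ≤ 4 * (|c| * W) := by
    rw [abs_mul]
    linarith [mul_le_mul_of_nonneg_left hw.abs_integral_slope_mul_rest_le hc]
  have hs : ∫ x, (w x - kink n 0 x) * chem w x ∂(stripMeasure n) =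
      ∫ x, offset w c x * chem w x ∂(stripMeasure n) +
        ∫ x, (kink n c x - kink n 0 x) * chem w x ∂(stripMeasure n) := by
    rw [← integral_add ifμ ikμ]
    exact integral_congr_ae (Filter.Eventually.of_forall fun x => by simp only [offset]; ring)
  rw [hs, h2]
  have hz := Real.sqrt_nonneg Z
  linarith [(abs_le.1 h3).2, (abs_le.1 h5).2]

/-- Write q = Δμ = αψ + g with g ⊥ ψ. At the kink the second variation of q is bounded below by
∫g²/24. Replacing v_c by u costs a multiple of ∫|f|q²; its g part is absorbed. The ψ part is
α²∫|f|ψ², at most a constant times D√D by Cauchy–Schwarz, ψ ≤ 1 and the weighted bound for ∫ψf². -/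
theorem neg_secondDensity_le (hn : n ≤ 4) (iq : Integrable (fun x => lap (chem w) x ^ 2) (stripMeasure n))
    (iqg : Integrable (gradSq (lap (chem w))) (stripMeasure n)) :
    -2 * ∫ x, secondDensity w (lap (chem w)) x ∂(stripMeasure n) ≤
      10 ^ 7 * ((∫ x, gradSq (chem w) x ∂(stripMeasure n)) *
        √(∫ x, gradSq (chem w) x ∂(stripMeasure n))) := by
  have sf := hw.sp_offset
  have sμ := hw.sp.chem
  have sq' := sμ.lap
  have sψ := sp_slope (n := n) c
  have iS := integrable_slope_sq (n := n) c
  have iμz := sμ.integrable_pd_sq hw.chem_grad (Fin.last n)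
  have iψz := sψ.integrable_pd_sq (integrable_gradSq_slope c) (Fin.last n)
  set D := ∫ x, gradSq (chem w) x ∂(stripMeasure n)
  set q := lap (chem w)
  have hD : 0 ≤ D := integral_nonneg fun x => gradSq_nonneg _ _
  have iqψ := sq'.integrable_mul sψ iq iS
  set α := (∫ x, q x * slope n c x ∂(stripMeasure n)) / kinkEnergy with hα
  have hN := half_le_kinkEnergy
  have hN0 : 0 < kinkEnergy := by linarith
  -- the component of `q` along the slope
  have hα2 : α ^ 2 ≤ 4 * D := by
    have e : ∀ x, ∑ i, pd i (slope n c) x * pd i (chem w) x = pz (slope n c) x * pz (chem w) x := fun x => by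
      refine (Finset.sum_eq_single (Fin.last n) (fun i _ hi => ?_) (by simp)).trans rfl
      rw [pd_slope]; simp [hi]
    -- One integration by parts turns ⟨Δμ,ψ⟩ into -∫∂_zμ ∂_zψ, so α is controlled by √D even though
    -- q itself is not.
    have h := integral_inner_eq_neg sψ sμ
      (integrable_sum_pd_mul sψ sμ (integrable_gradSq_slope c) hw.chem_grad)
      (sψ.integrable_mul sq' iS iq) (sψ.integrable_mul sμ.pz iS iμz)
    simp only [e, mul_comm (slope n c _) (lap (chem w) _)] at h
    have h1 := sq_integral_mul_le iψz iμz (sψ.pz.integrable_mul sμ.pz iψz iμz)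
    have h2 : ∫ x, pz (slope n c) x ^ 2 ∂(stripMeasure n) ≤ 2 * kinkEnergy := by
      rw [← integral_slope_sq (n := n) c, ← integral_const_mul]
      exact integral_mono iψz (iS.const_mul 2) fun x => pz_slope_sq_le c x
    have h3 : ∫ x, pz (chem w) x ^ 2 ∂(stripMeasure n) ≤ D :=
      integral_mono iμz hw.chem_grad fun x => pz_sq_le_gradSq _ x
    have h4 := h1.trans (mul_le_mul h2 h3 (integral_nonneg fun _ => sq_nonneg _) (by positivity))
    change (∫ x, pz (slope n c) x * pz (chem w) x ∂(stripMeasure n)) ^ 2 ≤ _ at h4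
    rw [h, neg_sq] at h4
    rw [hα, div_pow, div_le_iff₀ (by positivity)]
    nlinarith [mul_nonneg hD hN0.le]
  set g : Space n → ℝ := fun x => q x - α * slope n c x with hg
  have hgsq : ∀ x, g x ^ 2 = q x ^ 2 - 2 * α * (q x * slope n c x) + α ^ 2 * slope n c x ^ 2 := fun x => by
    simp only [hg]; ring
  have i12 : Integrable (fun x => q x ^ 2 - 2 * α * (q x * slope n c x)) (stripMeasure n) :=
    iq.sub (iqψ.const_mul _)
  have ig : Integrable (fun x => g x ^ 2) (stripMeasure n) := by
    simp only [hgsq]; exact i12.add (iS.const_mul _)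
  have hgap : ∫ x, g x ^ 2 ∂(stripMeasure n) ≤ 24 * ∫ x, secondDensity (kink n c) q x ∂(stripMeasure n) := by
    refine le_trans (le_of_eq ?_) (spectral_gap hn c sq' iq iqg)
    simp only [hgsq]
    rw [integral_add i12 (iS.const_mul _), integral_sub iq (iqψ.const_mul _), integral_const_mul,
      integral_const_mul, integral_slope_sq, hα]
    field_simp
    ring
  -- the change of the second variation
  have iQ : Integrable (secondDensity (kink n c) q) (stripMeasure n) :=
    iqg.add ((sp_kink c).well2.integrable_bdd_mul (abs_well2_kink_le c) iq)
  set V : Space n → ℝ := fun x => |offset w c x| * slope n c x ^ 2 with hV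
  have iV : Integrable V (stripMeasure n) :=
    iS.bdd_mul (c := 1) sf.continuous.abs.aestronglyMeasurable
      (Filter.Eventually.of_forall fun x => by
        rw [Real.norm_eq_abs, abs_abs]; linarith [hw.small x])
  -- By |G''(u) - G''(v_c)| ≤ 9|f| and q² ≤ 2α²ψ² + 2g². The coefficient 18/10000 of g² is below the
  -- gap 1/24.
  have hpt : ∀ x, secondDensity (kink n c) q x - (18 * α ^ 2 * V x + 18 / 10000 * g x ^ 2) ≤ secondDensity w q x := by
    intro x
    have e : well2 w x - well2 (kink n c) x = 3 * (2 * kink n c x + offset w c x) * offset w c x := by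
      simp only [well2, offset]; ring
    have h1 : |well2 w x - well2 (kink n c) x| ≤ 9 * |offset w c x| := by
      rw [e, abs_mul, abs_mul, abs_of_pos (by norm_num : (0 : ℝ) < 3)]
      refine mul_le_mul_of_nonneg_right ?_ (abs_nonneg _)
      have := abs_add_le (2 * kink n c x) (offset w c x)
      rw [abs_mul, abs_two] at this
      linarith [abs_kink_le_one c x, hw.small x]
    have h2 : q x ^ 2 ≤ 2 * (α ^ 2 * slope n c x ^ 2) + 2 * g x ^ 2 := by
      have : q x = α * slope n c x + g x := by simp only [hg]; ring
      rw [this]; nlinarith [sq_nonneg (α * slope n c x - g x)]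
    have h3 := mul_le_mul_of_nonneg_right (abs_le.1 h1).1 (sq_nonneg (q x))
    have h4 := mul_le_mul_of_nonneg_left h2 (abs_nonneg (offset w c x))
    have h5 := mul_le_mul_of_nonneg_right (hw.small x) (sq_nonneg (g x))
    simp only [secondDensity, hV]
    nlinarith
  have iw : Integrable (secondDensity w q) (stripMeasure n) := by
    refine iqg.add (hw.sp.well2.integrable_bdd_mul (fun x => abs_well2_le ?_) iq)
    have : w x = kink n c x + offset w c x := by simp [offset]
    rw [this]
    exact (abs_add_le _ _).trans (by linarith [abs_kink_le_one c x, hw.small x])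
  have iE : Integrable (fun x => 18 * α ^ 2 * V x + 18 / 10000 * g x ^ 2) (stripMeasure n) :=
    (iV.const_mul _).add (ig.const_mul _)
  have h1 := integral_mono (iQ.sub iE) iw hpt
  simp only [Pi.sub_apply] at h1
  rw [integral_sub iQ iE, integral_add (iV.const_mul _) (ig.const_mul _), integral_const_mul,
    integral_const_mul] at h1
  have hg0 : 0 ≤ ∫ x, g x ^ 2 ∂(stripMeasure n) := integral_nonneg fun _ => sq_nonneg _
  -- the interaction of the difference to the kink and the slope
  have hVD : ∫ x, V x ∂(stripMeasure n) ≤ 40000 * √D := by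
    refine (le_abs_self _).trans (abs_le_of_sq_le_sq ?_ (by positivity))
    rw [mul_pow, Real.sq_sqrt hD]
    have e : ∀ x, V x = (|offset w c x| * slope n c x) * slope n c x := fun x => by simp only [hV]; ring
    have ha : ∀ x, (|offset w c x| * slope n c x) ^ 2 ≤ slope n c x * offset w c x ^ 2 := fun x => by
      rw [mul_pow, sq_abs, mul_comm]
      refine mul_le_mul_of_nonneg_right ?_ (sq_nonneg _)
      rw [pow_two]; exact mul_le_of_le_one_left (slope_pos c x).le (slope_le_one c x)
    have ma : AEStronglyMeasurable (fun x => |offset w c x| * slope n c x) (stripMeasure n) :=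
      (sf.continuous.abs.mul sψ.continuous).aestronglyMeasurable
    have ia : Integrable (fun x => (|offset w c x| * slope n c x) ^ 2) (stripMeasure n) :=
      hw.integrable_slope_mul_sq.mono' (ma.pow 2) (Filter.Eventually.of_forall fun x => by
        rw [Real.norm_eq_abs, abs_of_nonneg (sq_nonneg _)]; exact ha x)
    simp only [e]
    have h2 := integral_mono ia hw.integrable_slope_mul_sq ha
    have h3 := h2.trans (hw.integral_slope_mul_sq_le hn)
    have hk : kinkEnergy ≤ 1 := by
      rw [kinkEnergy_eq, div_le_one (by positivity)]; nlinarith [sqrt_two_sq, Real.sqrt_nonneg 2]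
    have h4 := sq_integral_mul_le ia iS ((iV).congr (Filter.Eventually.of_forall e))
    rw [integral_slope_sq] at h4
    have h5 := mul_le_mul h3 hk hN0.le (by positivity)
    linarith
  have h6 : α ^ 2 * ∫ x, V x ∂(stripMeasure n) ≤ 4 * D * (40000 * √D) :=
    mul_le_mul hα2 hVD (integral_nonneg fun x => mul_nonneg (abs_nonneg _) (sq_nonneg _)) (by positivity)
  have h7 : 0 ≤ D * √D := by positivity
  linarith

end NearKink

/-! ### Smooth solutions close to kinks -/

theorem integrable_sq_of_memLp_iteratedFDeriv {f g : Space n → ℝ} (hg : Continuous g) {k : ℕ} {K : ℝ}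
    (h : MemLp (iteratedFDeriv ℝ k f) 2 (stripMeasure n)) (hb : ∀ x, ‖g x‖ ≤ K * ‖iteratedFDeriv ℝ k f x‖) :
    Integrable (fun x => g x ^ 2) (stripMeasure n) :=
  (memLp_two_iff_integrable_sq hg.aestronglyMeasurable).1
    (h.of_le_mul hg.aestronglyMeasurable (Filter.Eventually.of_forall hb))

theorem SmoothMemSobolev.integrable_sq {f : Space n → ℝ} {k : ℕ} (h : SmoothMemSobolev k f) (hf : SP f) :
    Integrable (fun x => f x ^ 2) (stripMeasure n) :=
  integrable_sq_of_memLp_iteratedFDeriv (K := 1) hf.continuous (h 0 (Nat.zero_le _)) fun x => by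
    rw [norm_iteratedFDeriv_zero, one_mul]

theorem SmoothMemSobolev.integrable_lap_sq {f : Space n → ℝ} {k : ℕ} (h : SmoothMemSobolev k f) (hk : 2 ≤ k)
    (hf : SP f) : Integrable (fun x => lap f x ^ 2) (stripMeasure n) :=
  integrable_sq_of_memLp_iteratedFDeriv (K := n + 1) hf.lap.continuous (h 2 hk) fun x => by
    rw [← laplacian_eq_lap hf.smooth, InnerProductSpace.laplacian_eq_iteratedFDeriv_orthonormalBasis f
      (EuclideanSpace.basisFun (Fin (n + 1)) ℝ)]
    refine (norm_sum_le_of_le (f := fun i => _) Finset.univ (n := fun _ => ‖iteratedFDeriv ℝ 2 f x‖)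
      fun i _ => ?_).trans (by simp)
    refine ((iteratedFDeriv ℝ 2 f x).le_opNorm _).trans (le_of_eq ?_)
    simp [Fin.prod_univ_two]

theorem deriv_doubleWell (s : ℝ) : deriv doubleWell s = s ^ 3 - s := (hasDerivAt_doubleWell s).deriv

theorem deriv_doubleWell_sub_laplacian {w : Space n → ℝ} (hw : SP w) :
    (fun y => deriv doubleWell (w y) - (Δ w) y) = chem w := by
  rw [laplacian_eq_lap hw.smooth]
  exact funext fun y => by rw [deriv_doubleWell]; rfl

theorem energy_eq (w : Space n → ℝ) : energy w = ∫⁻ x, ENNReal.ofReal (energyDensity w x) ∂(stripMeasure n) := by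
  simp only [energy, norm_gradient_sq, energyDensity]

theorem dissipation_eq {w : Space n → ℝ} (hw : SP w) :
    dissipation w = ∫⁻ x, ENNReal.ofReal (gradSq (chem w) x) ∂(stripMeasure n) := by
  have e : (fun y => (Δ w) y - deriv doubleWell (w y)) = fun y => - chem w y := by
    rw [← deriv_doubleWell_sub_laplacian hw]; exact funext fun y => by ring
  simp only [dissipation, e]
  refine lintegral_congr fun x => ?_
  rw [← ofReal_norm, ← ENNReal.ofReal_pow (norm_nonneg _), norm_gradient_sq]
  simp only [gradSq, pd_neg, neg_sq]

/-- A continuous periodic function obeys an almost everywhere bound on the cell at every point of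
space. -/
theorem abs_le_of_eLpNorm_top_le {f : Space n → ℝ} (hf : SP f) {δ : ℝ} (hδ : 0 ≤ δ)
    (h : eLpNorm f ⊤ (stripMeasure n) ≤ ENNReal.ofReal δ) (x : Space n) : |f x| ≤ δ := by
  refine forall_of_ae_strip (g := fun x => |f x|) hf.continuous.abs (fun i y => by simp only [hf.periodic i y]) ?_ x
  rw [eLpNorm_exponent_top] at h
  filter_upwards [ae_le_eLpNormEssSup (f := f) (μ := stripMeasure n)] with y hy
  have := hy.trans h
  rwa [Real.enorm_eq_ofReal_abs, ENNReal.ofReal_le_ofReal_iff hδ] at this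

theorem IsSmoothSolution.st {T : ℝ} {u : ℝ → Space n → ℝ} (h : IsSmoothSolution T u) : ST T u :=
  ⟨h.smooth, h.periodic⟩

/-- By the equation of the kink, μ = a·f - Δf with a bounded coefficient a, so the H² bound on f
suffices. -/
theorem integrable_chem_sq {w : Space n → ℝ} {c : ℝ} (hw : SP w) (hs : ∀ x, |offset w c x| ≤ 1 / 10000)
    (h0 : Integrable (fun x => offset w c x ^ 2) (stripMeasure n))
    (h2 : Integrable (fun x => lap (offset w c) x ^ 2) (stripMeasure n)) :
    Integrable (fun x => chem w x ^ 2) (stripMeasure n) := by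
  refine Integrable.of_sq_le hw.chem ((h0.const_mul (2 * 20 ^ 2)).add (h2.const_mul 2)) fun x => ?_
  have hl : lap (offset w c) x = lap w x - (kink n c x ^ 3 - kink n c x) := by
    unfold offset; rw [lap_sub hw (sp_kink c), lap_kink]
  set a := well2 (kink n c) x + 3 * kink n c x * offset w c x + offset w c x ^ 2
  have e : chem w x = a * offset w c x - lap (offset w c) x := by
    rw [hl, chem]
    simp only [a, well2, offset]; ring
  have ha : |a| ≤ 20 := by
    have h1 := hs x
    have h3 : |3 * kink n c x * offset w c x| ≤ 3 * 1 * (1 / 10000) := by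
      rw [abs_mul, abs_mul, abs_of_pos (by norm_num : (0 : ℝ) < 3)]
      exact mul_le_mul (by linarith [abs_kink_le_one c x]) h1 (abs_nonneg _) (by norm_num)
    have h4 : |offset w c x ^ 2| ≤ 1 := by
      rw [abs_pow]; exact pow_le_one₀ (abs_nonneg _) (by linarith)
    exact (abs_add_three _ _ _).trans (by linarith [abs_well2_kink_le c x])
  have h5 := sq_le_of_abs_le (a := a * offset w c x) (b := offset w c x) (M := 20)
    (by rw [abs_mul]; exact mul_le_mul_of_nonneg_right ha (abs_nonneg _))
  rw [e]
  simp only [Pi.add_apply]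
  linarith [sq_sub_le (a * offset w c x) (lap (offset w c) x)]

/-- A smooth solution whose slices are uniformly close to kinks is a flow, and its slices are close to
kinks in the stronger sense of `NearKink`. -/
theorem IsSmoothSolution.flow_and_nearKink {T : ℝ} {u : ℝ → Space n → ℝ} {c : ℝ → ℝ} (hu : IsSmoothSolution T u)
    (hc : ∀ t ∈ Ioo 0 T, IsClosestKink (u t) (c t))
    (hS : ∀ t ∈ Ioo 0 T, SmoothMemSobolev 3 (offset (u t) (c t)))
    (hδ : ∀ t ∈ Ioo 0 T, eLpNorm (offset (u t) (c t)) ⊤ (stripMeasure n) ≤ ENNReal.ofReal (1 / 10000)) :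
    Flow T u ∧ ∀ t ∈ Ioo 0 T, NearKink (u t) (c t) := by
  have hst := hu.st
  have sf : ∀ t ∈ Ioo 0 T, SP (offset (u t) (c t)) := fun t ht => (hst.sp ht).sub (sp_kink _)
  have i0 : ∀ t ∈ Ioo 0 T, Integrable (fun x => offset (u t) (c t) x ^ 2) (stripMeasure n) :=
    fun t ht => (hS t ht).integrable_sq (sf t ht)
  have i2 : ∀ t ∈ Ioo 0 T, Integrable (fun x => lap (offset (u t) (c t)) x ^ 2) (stripMeasure n) :=
    fun t ht => (hS t ht).integrable_lap_sq (by norm_num) (sf t ht)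
  have hs : ∀ t ∈ Ioo 0 T, ∀ x, |offset (u t) (c t) x| ≤ 1 / 10000 := fun t ht =>
    abs_le_of_eLpNorm_top_le (sf t ht) (by norm_num) (hδ t ht)
  have iμ : ∀ t ∈ Ioo 0 T, Integrable (fun x => chem (u t) x ^ 2) (stripMeasure n) := fun t ht =>
    integrable_chem_sq (hst.sp ht) (hs t ht) (i0 t ht) (i2 t ht)
  have hf : Flow T u := by
    refine ⟨hst, fun t ht x => ?_, fun t ht x => ?_, fun t ht => ?_, iμ⟩
    · have h := hu.equation t ht x
      rw [deriv_doubleWell_sub_laplacian (hst.sp ht), laplacian_eq_lap (hst.sp ht).chem.smooth] at h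
      exact sub_eq_zero.1 h
    · have : u t x = kink n (c t) x + offset (u t) (c t) x := by simp [offset]
      rw [this]
      exact (abs_add_le _ _).trans (by linarith [abs_kink_le_one (c t) x, hs t ht x])
    · refine Integrable.of_sq_le ((hst.sp ht).sub (sp_kink 0))
        (((i0 t ht).const_mul 2).add ((integrable_kink_sub_sq (c t)).const_mul 2)) fun x => ?_
      have e : u t x - kink n 0 x = offset (u t) (c t) x + (kink n (c t) x - kink n 0 x) := by simp [offset]
      simp only [Pi.add_apply]
      rw [e]
      nlinarith [sq_nonneg (offset (u t) (c t) x - (kink n (c t) x - kink n 0 x))]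
  refine ⟨hf, fun t ht => ⟨hst.sp ht, hs t ht, i0 t ht, integrable_gradSq_of_sq (sf t ht) (i0 t ht) (i2 t ht),
    (hc t ht).integral_mul_slope (sf t ht) (i0 t ht), iμ t ht, hf.integrable_gradSq_chem_slice ht⟩⟩

end CahnHilliard

end

open CahnHilliard in
/-- Differential relations for the energy, the squared distance and the dissipation. -/
theorem lemma4p4 :
    ∃ δ : ℝ, 0 < δ ∧ ∃ C : ℝ, 0 < C ∧
      -- the dimension is `d = n + 1`, with `1 ≤ d ≤ 5`, and `d' = max (3, d)`
      ∀ (n : ℕ) (_ : n + 1 ≤ 5) (d' : ℝ) (_ : d' = max 3 ((n : ℝ) + 1))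
        (T : ℝ) (_ : 0 < T) (u : ℝ → CahnHilliard.Space n → ℝ) (c : ℝ → ℝ),
        CahnHilliard.IsSmoothSolution T u →
        (∀ t ∈ Set.Ioo 0 T, CahnHilliard.sqDist (u t) < ⊤) →
        (∀ t ∈ Set.Ioo 0 T, CahnHilliard.energy (u t) < ⊤) →
        (∀ t ∈ Set.Ioo 0 T, CahnHilliard.IsClosestKink (u t) (c t)) →
        (∀ t ∈ Set.Ioo 0 T, CahnHilliard.SmoothMemSobolev 3
          (fun x => u t x - CahnHilliard.kink n (c t) x)) →
        (∀ t ∈ Set.Ioo 0 T, MeasureTheory.eLpNorm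
          (fun x => u t x - CahnHilliard.kink n (c t) x) ⊤ (CahnHilliard.stripMeasure n)
            ≤ ENNReal.ofReal δ) →
        ∀ t ∈ Set.Ioo 0 T, ∀ (ℰ D : ℝ), ℰ = CahnHilliard.energyGap (u t) →
          D = (CahnHilliard.dissipation (u t)).toReal →
          CahnHilliard.dissipation (u t) < ⊤ ∧
          HasDerivAt (fun s => CahnHilliard.energyGap (u s)) (-D) t ∧
          (∃ H' : ℝ, HasDerivAt (fun s => (CahnHilliard.sqDist (u s)).toReal) H' t ∧
            H' ≤ C * (((|c t| + 1) * c t ^ 2 * D) ^ (1 / 2 : ℝ)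
              + ℰ ^ (3 / 2 - d' / 12) * D ^ (d' / 12))) ∧
          (∃ D' : ℝ, HasDerivAt (fun s => (CahnHilliard.dissipation (u s)).toReal) D' t ∧
            D' ≤ C * (D ^ (3 / 2 : ℝ) + ℰ ^ (1 - d' / 6) * D ^ (1 + d' / 6))) := by
  -- The radius is the smallness required in `NearKink`; the constant is the larger of 10⁶ from the
  -- distance and 10⁷ from the dissipation.
  refine ⟨1 / 10000, by norm_num, 10 ^ 7, by norm_num, ?_⟩
  intro n hn5 d' _ T _ u c hu hH _ hc hS hδ t ht ℰ D hℰ hD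
  have hn : n ≤ 4 := by omega
  obtain ⟨hf, hk⟩ := hu.flow_and_nearKink hc hS hδ
  have hE := fun s hs => ((hk s hs).integrable_energyDensity_and_le hn).1
  have hE0 : ∀ w : Space n → ℝ, ∀ x, 0 ≤ energyDensity w x := fun w x =>
    add_nonneg (mul_nonneg (by norm_num) (gradSq_nonneg _ _)) (div_nonneg (sq_nonneg _) (by norm_num))
  have dE : ∀ s ∈ Set.Ioo 0 T, energyGap (u s) = ∫ x, energyDensity (u s) x ∂(stripMeasure n) - kinkEnergy :=
    fun s hs => by
      rw [energyGap, energy_eq, lintegral_ofReal_eq (hE s hs) (hE0 _),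
        ENNReal.toReal_ofReal (MeasureTheory.integral_nonneg (hE0 _))]
  have dD : ∀ s ∈ Set.Ioo 0 T, dissipation (u s) =
      ENNReal.ofReal (∫ x, gradSq (chem (u s)) x ∂(stripMeasure n)) := fun s hs => by
    rw [dissipation_eq (hk s hs).sp, lintegral_ofReal_eq (hk s hs).chem_grad (gradSq_nonneg _)]
  have dD' : ∀ s ∈ Set.Ioo 0 T, (dissipation (u s)).toReal = ∫ x, gradSq (chem (u s)) x ∂(stripMeasure n) :=
    fun s hs => by
      rw [dD s hs, ENNReal.toReal_ofReal (MeasureTheory.integral_nonneg (gradSq_nonneg _))]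
  have hnhds : Set.Ioo 0 T ∈ nhds t := Ioo_mem_nhds ht.1 ht.2
  have hDt := hD.trans (dD' t ht)
  have hD0 : 0 ≤ D := hD ▸ ENNReal.toReal_nonneg
  have hℰ0 : 0 ≤ ℰ := by
    rw [hℰ, dE t ht]; linarith [((hk t ht).integrable_energyDensity_and_le hn).2]
  -- The mixed terms in ℰ and D are only added to bounds that already hold without them, so
  -- nonnegativity for arbitrary exponents is enough.
  have hr : ∀ a b : ℝ, 0 ≤ ℰ ^ a * D ^ b := fun a b =>
    mul_nonneg (Real.rpow_nonneg hℰ0 _) (Real.rpow_nonneg hD0 _)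
  refine ⟨by rw [dD t ht]; exact ENNReal.ofReal_lt_top, ?_, ⟨_, hf.hasDerivAt_sqDist hn hH ht, ?_⟩, ⟨_,
    (hf.hasDerivAt_dissipation hn ht).congr_of_eventuallyEq (Filter.mem_of_superset hnhds dD'), ?_⟩⟩
  · rw [hDt]
    exact ((hf.hasDerivAt_energy hn hE ht).sub_const kinkEnergy).congr_of_eventuallyEq
      (Filter.mem_of_superset hnhds dE)
  · have h := (hk t ht).neg_pairing_le hn
    rw [← hDt, Real.sqrt_eq_rpow] at h
    have h2 : 0 ≤ ((|c t| + 1) * c t ^ 2 * D) ^ (1 / 2 : ℝ) := Real.rpow_nonneg (by positivity) _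
    refine h.trans ?_
    linarith [hr (3 / 2 - d' / 12) (d' / 12)]
  · have h := (hk t ht).neg_secondDensity_le hn (by rw [hf.lap_chem_eq ht]; exact hf.integrable_td_slice ht)
      (by rw [hf.lap_chem_eq ht]; exact hf.integrable_gradSq_td_slice hn ht)
    rw [hf.lap_chem_eq ht, ← hDt, Real.sqrt_eq_rpow] at h
    have e : D ^ (3 / 2 : ℝ) = D * D ^ (1 / 2 : ℝ) := by
      rw [show (3 / 2 : ℝ) = 1 + 1 / 2 by norm_num, Real.rpow_add' hD0 (by norm_num), Real.rpow_one]
    rw [e]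
    refine h.trans ?_
    linarith [hr (1 - d' / 6) (1 + d' / 6)]
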